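/- Setting. A relational signature $\sigma$ is a finite set of relation symbols of positive arities; $\|\sigma\|$ is the sum of the arities. All $\sigma$-structures are finite and non-empty. A structure is $d$-bounded if every node of its Gaifman graph (distinct elements are adjacent iff they occur in a common tuple of a relation) has at most $d$ neighbours. An $r$-type with $n\ge 1$ centres is a structure with $n$ distinguished elements (centres) such that every element has Gaifman distance at most $r$ from some centre. The $r$-sphere of $\bar a\in A^n$ in $\mathcal A$ is the substructure induced on the elements at distance at most $r$ from $\bar a$, with centres $\bar a$. A sphere-formula $\mathrm{sph}_\tau(\bar x)$ of radius $r$, for an $r$-type $\tau$ and a tuple $\bar x$ of distinct variables, is an $\mathrm{FO}[\sigma]$-formula with free variables among $\bar x$ such that $\mathcal A\models\mathrm{sph}_\tau[\bar a]$ iff the $r$-sphere of $\bar a$ in $\mathcal A$ is isomorphic to $\tau$. Let $\mathbf P$ be a unary numerical predicate collection: a countable set of names $P$, each with a semantics $[\![P]\!]\subseteq\mathbb Z$. The formulas of $\mathrm{FO}(\mathbf P)[\sigma]$ are built from $x=y$ and $R(\bar x)$ ($R\in\sigma$) by $\neg$, $\vee$, $\exists y$, and $P(\#(y).\varphi-k)$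 with $P\in\mathbf P$, $k\in\mathbb Z$; the latter says that the number of $y$ satisfying $\varphi$, minus $k$, lies in $[\![P]\!]$. Let $P_\exists$ be a name with $[\![P_\exists]\!]=\mathbb N_{\ge1}$. The binding rank $\mathrm{br}(\varphi)$ is the maximal nesting depth of the constructs $\exists y$ and $\#(y)$; the binding width $\mathrm{bw}(\varphi)$ is $1$ if $\varphi$ contains such a construct and $0$ otherwise. $\|\varphi\|$ is the length of $\varphi$ as a word in which every symbol, including each variable, predicate name and integer, is one letter, and $\|\varphi\|_{\mathrm{bin}}$ is the size of the syntax tree of $\varphi$ in which variables, relation symbols, predicate names and integers are written in binary (predicate names via a fixed injection into $\mathbb N$). Formulas $\varphi,\psi$ are $d$-equivalent if they agree in every $d$-bounded $\sigma$-structure under every assignment. Put $\exp_0(n)=n$ and $\exp_{k+1}(n)=2^{\exp_k(n)}$; in the bounds below, $\log\log d$ stands for $\lfloor\log_2\lfloor\log_2 d\rfloor\rfloor$, and for $0$ if $d\le 1$. A formula is in weak Hanf normal form for $\mathrm{FO}(\mathbf P)[\sigma]$ if it is a Boolean combination of sphere-formulas and of sentences $$P\Bigl(\#(y).\bigvee_{\tau\in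 T}\mathrm{sph}_\tau(y)-k\Bigr),\qquad(*)$$ where $P\in\mathbf P\cup\{P_\exists\}$, $k\in\mathbb Z$, and $T$ is a finite (possibly empty) set of pairwise non-isomorphic types with one centre, all of the same radius. Its locality radius is the maximum of the radii of its sphere-formulas and sentences $(*)$. Theorem. For every unary numerical predicate collection $\mathbf P$ there is a polynomial $p$ such that the following hold. (a) For every relational signature $\sigma$, every $d\in\mathbb N$ and every $\varphi\in\mathrm{FO}(\mathbf P)[\sigma]$ there is a $d$-equivalent formula $\psi$ in weak Hanf normal form for $\mathrm{FO}(\mathbf P)[\sigma]$ of locality radius less than $(2\,\mathrm{bw}(\varphi)+1)^{\mathrm{br}(\varphi)}$, with $\mathrm{free}(\psi)=\mathrm{free}(\varphi)$, and with at most $\exp_4\bigl(p(\|\varphi\|+\|\sigma\|)+\log\log d\bigr)$ distinct sentences of the form $(*)$. (b) There is an algorithm that, on input $d\ge2$, $\sigma$ and $\varphi\in\mathrm{FO}(\mathbf P)[\sigma]$, constructs such a formula $\psi$ in time at most $\exp_5\bigl(p(\|\varphi\|_{\mathrm{bin}}+\|\sigma\|)+\log\log d\bigr)$. (Algorithms are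 while-programs on binary trees, where each elementary operation is charged with the size of the tree it produces.) -/

import Mathlib

namespace Hanf

/-! ## Signatures, structures, Gaifman graph -/

/-- A finite relational signature: the list of the (positive) arities of its relation symbols.
The relation symbols are the positions in this list. -/
structure Signature where
  arities : List ℕ
  arity_pos : ∀ a ∈ arities, 0 < a

namespace Signature

/-- The relation symbols of `σ`. -/
abbrev Sym (σ : Signature) : Type := Fin σ.arities.length

/-- The arity of a relation symbol. -/
def ar (σ : Signature) (R : σ.Sym) : ℕ := σ.arities.get R

/-- The size of a relational signature: the sum of the arities of its symbols. -/
def size (σ : Signature) : ℕ := σ.arities.sum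

end Signature

/-- The interpretation of the symbols of `σ` in a universe `A`. Universes are required to be
finite and non-empty wherever structures are quantified over. -/
structure Struc (σ : Signature) (A : Type) where
  rel : (R : σ.Sym) → Set (Fin (σ.ar R) → A)

namespace Struc

variable {σ : Signature} {A : Type}

/-- The Gaifman graph: distinct elements are adjacent iff they occur in a common tuple of some
relation. -/
def gaifman (S : Struc σ A) : SimpleGraph A where
  Adj a b := a ≠ b ∧ ∃ (R : σ.Sym) (t : Fin (σ.ar R) → A),
    t ∈ S.rel R ∧ a ∈ Set.range t ∧ b ∈ Set.range t
  symm := ⟨fun _ _ ⟨h, R, t, ht, ha, hb⟩ => ⟨h.symm, R, t, ht, hb, ha⟩⟩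
  loopless := ⟨fun _ h => h.1 rfl⟩

/-- A (finite) structure is `d`-bounded if each node of its Gaifman graph has at most `d`
neighbours. -/
def Bounded (S : Struc σ A) (d : ℕ) : Prop :=
  ∀ a : A, (S.gaifman.neighborSet a).ncard ≤ d

/-- The `r`-neighbourhood of a tuple. -/
def nbhd (S : Struc σ A) (r : ℕ) {n : ℕ} (a : Fin n → A) : Set A :=
  {b | ∃ i, S.gaifman.edist (a i) b ≤ (r : ℕ∞)}

/-- The induced substructure on a set of elements. -/
def induce (S : Struc σ A) (B : Set A) : Struc σ B where
  rel R := {t | (fun i => (t i : A)) ∈ S.rel R}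

theorem centre_mem_nbhd (S : Struc σ A) (r : ℕ) {n : ℕ} (a : Fin n → A) (i : Fin n) :
    a i ∈ S.nbhd r a := ⟨i, by simp⟩

end Struc

/-! ## Types and spheres -/

/-- A finite `σ`-structure together with a tuple of `n` distinguished elements (its centres). -/
structure Pointed (σ : Signature) (n : ℕ) where
  carrier : Type
  finite : Finite carrier
  str : Struc σ carrier
  centre : Fin n → carrier

/-- Isomorphism of structures with distinguished elements. -/
def Pointed.Iso {σ : Signature} {n : ℕ} (τ ρ : Pointed σ n) : Prop :=
  ∃ e : τ.carrier ≃ ρ.carrier,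
    (∀ (R : σ.Sym) (t : Fin (σ.ar R) → τ.carrier), t ∈ τ.str.rel R ↔ e ∘ t ∈ ρ.str.rel R) ∧
    ∀ i, e (τ.centre i) = ρ.centre i

/-- `τ` is an `r`-type with `n ≥ 1` centres: each element has distance at most `r` from some
centre. -/
def Pointed.IsType {σ : Signature} {n : ℕ} (τ : Pointed σ n) (r : ℕ) : Prop :=
  1 ≤ n ∧ ∀ b, b ∈ τ.str.nbhd r τ.centre

/-- The `r`-sphere of the tuple `a` in `S`. -/
def Struc.sphere {σ : Signature} {A : Type} [Finite A] (S : Struc σ A) (r : ℕ) {n : ℕ}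
    (a : Fin n → A) : Pointed σ n where
  carrier := S.nbhd r a
  finite := inferInstance
  str := S.induce (S.nbhd r a)
  centre := fun i => ⟨a i, S.centre_mem_nbhd r a i⟩

/-! ## The logic -/

/-- Formulas over the signature `σ` and a set `N` of names of unary numerical predicates. The
structure variables are the natural numbers. The last constructor is `P(#(y).φ - k)`; since all
predicates are unary, it covers all applications of a predicate to a counting term. -/
inductive Formula (σ : Signature) (N : Type) : Type
  | eq (x y : ℕ) : Formula σ N
  | rel (R : σ.Sym) (x : Fin (σ.ar R) → ℕ) : Formula σ N
  | neg (φ : Formula σ N) : Formula σ N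
  | or (φ ψ : Formula σ N) : Formula σ N
  | ex (y : ℕ) (φ : Formula σ N) : Formula σ N
  | num (P : N) (y : ℕ) (φ : Formula σ N) (k : ℤ) : Formula σ N

namespace Formula

variable {σ : Signature} {N : Type}

/-- Satisfaction in the structure `S` under the assignment `β`, where `sem` is the semantics of
the numerical predicates. -/
def Sat (sem : N → Set ℤ) {A : Type} (S : Struc σ A) : (ℕ → A) → Formula σ N → Prop
  | β, eq x y => β x = β y
  | β, rel R x => (fun i => β (x i)) ∈ S.rel R
  | β, neg φ => ¬ Sat sem S β φ
  | β, or φ ψ => Sat sem S β φ ∨ Sat sem S β ψ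
  | β, ex y φ => ∃ a : A, Sat sem S (Function.update β y a) φ
  | β, num P y φ k => (({a : A | Sat sem S (Function.update β y a) φ}.ncard : ℤ) - k) ∈ sem P

/-- The free variables. -/
def free : Formula σ N → Finset ℕ
  | eq x y => {x, y}
  | rel _ x => Finset.univ.image x
  | neg φ => φ.free
  | or φ ψ => φ.free ∪ ψ.free
  | ex y φ => φ.free.erase y
  | num _ y φ _ => φ.free.erase y

/-- The plain first-order formulas (no numerical predicates). -/
def IsFO : Formula σ N → Prop
  | eq _ _ => True
  | rel _ _ => True
  | neg φ => φ.IsFO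
  | or φ ψ => φ.IsFO ∧ ψ.IsFO
  | ex _ φ => φ.IsFO
  | num _ _ _ _ => False

/-- The length as a word: every variable, relation symbol, predicate name, integer, bracket,
comma, connective counts as one letter, and the suffix `- k` is omitted for `k = 0`. -/
def size : Formula σ N → ℕ
  | eq _ _ => 3
  | rel R _ => 2 * σ.ar R + 2
  | neg φ => φ.size + 1
  | or φ ψ => φ.size + ψ.size + 3
  | ex _ φ => φ.size + 2
  | num _ _ φ k => φ.size + 8 + (if k = 0 then 0 else 2)

/-- The binding rank: the nesting depth of the constructs `∃ y` and `#(y)`. -/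
def br : Formula σ N → ℕ
  | eq _ _ => 0
  | rel _ _ => 0
  | neg φ => φ.br
  | or φ ψ => max φ.br ψ.br
  | ex _ φ => φ.br + 1
  | num _ _ φ _ => φ.br + 1

/-- The binding width: the maximal number of variables bound by one construct. -/
def bw : Formula σ N → ℕ
  | eq _ _ => 0
  | rel _ _ => 0
  | neg φ => φ.bw
  | or φ ψ => max φ.bw ψ.bw
  | ex _ φ => max φ.bw 1
  | num _ _ φ _ => max 1 φ.bw

/-- Disjunction of a list of formulas; the empty disjunction is the false formula `¬ y = y`. -/
def bigOr (y : ℕ) : List (Formula σ N) → Formula σ N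
  | [] => neg (eq y y)
  | [φ] => φ
  | φ :: ψ :: l => or φ (bigOr y (ψ :: l))

/-- The Boolean combinations of the formulas in `C`. -/
inductive BoolComb (C : Set (Formula σ N)) : Formula σ N → Prop
  | base {φ : Formula σ N} (h : φ ∈ C) : BoolComb C φ
  | neg {φ : Formula σ N} (h : BoolComb C φ) : BoolComb C (neg φ)
  | or {φ ψ : Formula σ N} (h : BoolComb C φ) (h' : BoolComb C ψ) : BoolComb C (or φ ψ)

/-- `θ` is a sphere-formula `sph_τ(x)` for the `r`-type `τ` and the tuple `x` of pairwise distinct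
variables: a first-order formula with free variables from `x` that holds for precisely those
tuples whose `r`-sphere is isomorphic to `τ`. -/
def IsSph (sem : N → Set ℤ) (r : ℕ) {n : ℕ} (τ : Pointed σ n) (x : Fin n → ℕ)
    (θ : Formula σ N) : Prop :=
  τ.IsType r ∧ Function.Injective x ∧ θ.IsFO ∧ (∀ v ∈ θ.free, v ∈ Set.range x) ∧
  ∀ (A : Type) [Finite A] [Nonempty A] (S : Struc σ A) (β : ℕ → A),
    θ.Sat sem S β ↔ (S.sphere r (β ∘ x)).Iso τ

/-- `θ` is a sphere-formula of radius `r`. -/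
def IsSphereFormula (sem : N → Set ℤ) (r : ℕ) (θ : Formula σ N) : Prop :=
  ∃ (n : ℕ) (τ : Pointed σ n) (x : Fin n → ℕ), IsSph sem r τ x θ

/-- `χ` is a sentence `P(#(y).⋁_{τ ∈ T} sph_τ(y) - k)` where `T` is a finite, possibly empty, set
of pairwise non-isomorphic `r`-types with one centre and `k` is an integer. -/
def IsWeakCondition (sem : N → Set ℤ) (r : ℕ) (χ : Formula σ N) : Prop :=
  ∃ (P : N) (y : ℕ) (k : ℤ) (m : ℕ) (τ : Fin m → Pointed σ 1) (θ : Fin m → Formula σ N),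
    (∀ i j, i ≠ j → ¬ (τ i).Iso (τ j)) ∧
    (∀ i, IsSph sem r (τ i) (fun _ => y) (θ i)) ∧
    χ = num P y (bigOr y (List.ofFn θ)) k

/-- `ψ` is in weak Hanf normal form, with locality radius less than `R` and with at most `s`
distinct numerical conditions: it is a Boolean combination of sphere-formulas of radius less than
`R` and of at most `s` sentences `P(#(y).⋁_{τ ∈ T} sph_τ(y) - k)` of radius less than `R`. -/
def IsWHNF (sem : N → Set ℤ) (R s : ℕ) (ψ : Formula σ N) : Prop :=
  ∃ C : Finset (Formula σ N),
    C.card ≤ s ∧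
    (∀ χ ∈ C, ∃ r < R, IsWeakCondition sem r χ) ∧
    BoolComb {θ | θ ∈ C ∨ ∃ r < R, IsSphereFormula sem r θ} ψ

end Formula

/-- The semantics of the predicate names `N` together with the additional name `none` for the
predicate `P_∃`, whose semantics is the set of positive integers. -/
def withExists {N : Type} (sem : N → Set ℤ) : Option N → Set ℤ
  | none => {z | 1 ≤ z}
  | some P => sem P

/-- `d`-equivalence of a formula over `N` and a formula over `N'`. -/
def DEquiv {σ : Signature} {N N' : Type} (sem : N → Set ℤ) (sem' : N' → Set ℤ) (d : ℕ)
    (φ : Formula σ N) (ψ : Formula σ N') : Prop :=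
  ∀ (A : Type) [Finite A] [Nonempty A] (S : Struc σ A), S.Bounded d →
    ∀ β : ℕ → A, φ.Sat sem S β ↔ ψ.Sat sem' S β

/-- The `k`-fold exponential function to the base `2`. -/
def expTower : ℕ → ℕ → ℕ
  | 0, n => n
  | k + 1, n => 2 ^ expTower k n

/-! ## Algorithms: while-programs on binary trees, with their running time -/

/-- The data of while-programs: binary trees. -/
inductive Data : Type
  | nil : Data
  | cons (a b : Data) : Data

namespace Data

/-- The number of nodes. -/
def size : Data → ℕ
  | nil => 1
  | cons a b => a.size + b.size + 1

def head : Data → Data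
  | nil => nil
  | cons a _ => a

def tail : Data → Data
  | nil => nil
  | cons _ b => b

def ofList : List Data → Data
  | [] => nil
  | a :: l => cons a (ofList l)

def ofBool : Bool → Data
  | false => nil
  | true => cons nil nil

/-- Natural numbers are encoded in binary. -/
def ofNat (n : ℕ) : Data := ofList (n.bits.map ofBool)

/-- Integers are encoded by sign and binary absolute value. -/
def ofInt (k : ℤ) : Data := cons (ofBool (decide (k < 0))) (ofNat k.natAbs)

end Data

/-- While-programs. A program transforms a tree into a tree. -/
inductive Prog : Type
  | id : Prog
  | nil : Prog
  | head : Prog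
  | tail : Prog
  | pair (p q : Prog) : Prog
  | seq (p q : Prog) : Prog
  | cond (c p q : Prog) : Prog
  | loop (c p : Prog) : Prog

/-- `Run p x y t`: the program `p`, started on the tree `x`, halts with result `y` after time `t`.
Elementary operations are charged with the size of the tree that they produce, and control
operations with one time unit. A tree different from `nil` counts as "true". -/
inductive Run : Prog → Data → Data → ℕ → Prop
  | id (x : Data) : Run Prog.id x x x.size
  | nil (x : Data) : Run Prog.nil x Data.nil 1
  | head (x : Data) : Run Prog.head x x.head x.head.size
  | tail (x : Data) : Run Prog.tail x x.tail x.tail.size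
  | pair {p q : Prog} {x y z : Data} {s t : ℕ} (hp : Run p x y s) (hq : Run q x z t) :
      Run (Prog.pair p q) x (Data.cons y z) (s + t + (Data.cons y z).size)
  | seq {p q : Prog} {x y z : Data} {s t : ℕ} (hp : Run p x y s) (hq : Run q y z t) :
      Run (Prog.seq p q) x z (s + t + 1)
  | condTrue {c p q : Prog} {x b y : Data} {s t : ℕ} (hc : Run c x b s) (hb : b ≠ Data.nil)
      (hp : Run p x y t) : Run (Prog.cond c p q) x y (s + t + 1)
  | condFalse {c p q : Prog} {x y : Data} {s t : ℕ} (hc : Run c x Data.nil s)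
      (hq : Run q x y t) : Run (Prog.cond c p q) x y (s + t + 1)
  | loopDone {c p : Prog} {x : Data} {s : ℕ} (hc : Run c x Data.nil s) :
      Run (Prog.loop c p) x x (s + 1)
  | loopStep {c p : Prog} {x b y z : Data} {s t u : ℕ} (hc : Run c x b s) (hb : b ≠ Data.nil)
      (hp : Run p x y t) (hl : Run (Prog.loop c p) y z u) :
      Run (Prog.loop c p) x z (s + t + u + 1)

/-- The encoding of a signature. -/
def Signature.encode (σ : Signature) : Data := Data.ofList (σ.arities.map Data.ofNat)

/-- The encoding of a formula as a tree, namely its syntax tree with variables, relation symbols,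
predicate names and integers in binary. -/
def Formula.encode {σ : Signature} {N : Type} [Encodable N] : Formula σ N → Data
  | .eq x y => Data.ofList [Data.ofNat 0, Data.ofNat x, Data.ofNat y]
  | .rel R x => Data.ofList [Data.ofNat 1, Data.ofNat R.val,
      Data.ofList ((List.ofFn x).map Data.ofNat)]
  | .neg φ => Data.ofList [Data.ofNat 2, φ.encode]
  | .or φ ψ => Data.ofList [Data.ofNat 3, φ.encode, ψ.encode]
  | .ex y φ => Data.ofList [Data.ofNat 4, Data.ofNat y, φ.encode]
  | .num P y φ k => Data.ofList [Data.ofNat 5, Data.ofNat (Encodable.encode P), Data.ofNat y,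
      φ.encode, Data.ofInt k]

/-- The encoding of an input consisting of a degree bound, a signature and a formula. -/
def encodeInput {N : Type} [Encodable N] (d : ℕ) (σ : Signature) (φ : Formula σ N) : Data :=
  Data.ofList [Data.ofNat d, σ.encode, φ.encode]

end Hanf

/-!
# Hanf normal forms for first-order logic with unary counting

*Existence.* Let `φ` have binding rank `k` and let `rad j = (3 ^ j - 1) / 2`. Whether `φ` holds of
a tuple in a `d`-bounded structure depends on two things only: on the isomorphism type of the
`rad k`-sphere of the tuple, and on the truth values of numerical conditions on the numbers of
elements with given `rad j`-spheres, `j < k`. The number of letters is chosen so large that all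
spheres that occur are isomorphic to spheres in structures whose elements are letters. The disjoint
union of many copies of each of these structures is the universal structure `univStr`: it contains
every sphere, even far away from any short list of elements. So instead of elements of a given
structure, the procedure `eval` assigns elements `b` of the universal structure to the variables of
`φ`, and it returns a Boolean combination of numerical conditions, without free variables, that is
equivalent to `φ` for every assignment with isomorphic spheres (`holds_eval`).

The essential case is `P(#(y).ψ - c)` (`holds_quantifier`). By induction there are sentences that
are equivalent to `ψ`, one for each value `b` of `y`. Suppose that their truth values are known.
Elements of distance at most `2 * rad j + 1` from the assignment, where `j = k - 1`, lie in its
`rad k`-sphere, so that the universal structure tells their number. For the other elements `b` the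
`rad j`-spheres of `b` and of the assignment are disjoint and no tuple meets both; hence only the
type of the sphere of `b` matters (`Match.glue`). Their number is the number of all elements with
types from a certain set `T`, minus the number of those near to the assignment. Therefore the
formula is equivalent to `P(#(y).⋁ sph_τ(y) - c')`, with `τ` ranging over `T` and with a corrected
integer `c'`. The result is the disjunction over all possible truth values.

The normal form (`normalForm`) is the disjunction, over all structures on the letters and all
assignments of letters to the free variables, of the sphere-formula (`sphereFormula`) together with
the result of `eval`. A sphere-formula says that the letters can be interpreted by distinct
elements with the same atomic statements, in such a way that no tuple leads out of the sphere from
its inner part; by `Match.of_closed` the elements then form the whole sphere.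

*Number of conditions.* With `rad j < 3 ^ k` and `d.size` at most exponential in `log log d`, the
number of letters is doubly exponential, the number of structures on them and the size of the
universal structure are triply exponential, and the number of its subsets, which are the possible
sets of truth values, is one exponential more. At most polynomially many of these factors are
multiplied (`towerBd_length_normalFormConds`).

*Running time.* The functions used by the algorithm are shown to be computable in time
`s ^ (C ^ (h + 1))`, where `s` is the size of the input and `h` is the height of the recursions and
the length of the loops that may increase their state by a polynomial in each iteration (`Fast`).
This class is closed under composition, loops (`Fast.foldl`, `Fast.foldl'`) and recursion
(`Fast.treeRec`), so that no program needs to be written down. For `normalForm` the number `h` is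
bounded by the size of the universal structure, which is triply exponential; this yields five
exponentials for the time (`towerBd_time`).
-/

namespace Hanf

set_option linter.unusedSectionVars false

/-! ### Growth of running times -/

/-- Types whose elements are represented by trees. -/
class Enc (α : Type) where
  enc : α → Data

open Enc

instance : Enc Data := ⟨fun x => x⟩
instance : Enc Unit := ⟨fun _ => Data.nil⟩
instance : Enc Bool := ⟨Data.ofBool⟩
instance : Enc ℕ := ⟨Data.ofNat⟩
instance : Enc ℤ := ⟨Data.ofInt⟩
instance {α β : Type} [Enc α] [Enc β] : Enc (α × β) := ⟨fun x => Data.cons (enc x.1) (enc x.2)⟩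
instance {α : Type} [Enc α] (p : α → Prop) : Enc {x // p x} := ⟨fun x => enc x.1⟩
instance {α : Type} [Enc α] : Enc (List α) := ⟨fun l => Data.ofList (l.map enc)⟩

section Growth

variable {α β γ δ : Type} [Enc α] [Enc β] [Enc γ] [Enc δ]

/-- The size of the tree that represents `x`, plus two. The summand makes `sz x` a useful base
of powers. -/
def sz (x : α) : ℕ := (enc x).size + 2

theorem Data.size_pos (x : Data) : 0 < x.size := by cases x <;> simp [Data.size]

theorem three_le_sz (x : α) : 3 ≤ sz x := by
  have := Data.size_pos (enc x); simp only [sz]; omega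

theorem sz_pair (x : α) (y : β) : sz (x, y) + 1 = sz x + sz y := by
  simp only [sz, enc, Data.size]; omega

theorem sz_nil : sz ([] : List α) = 3 := rfl

theorem sz_cons (x : α) (l : List α) : sz (x :: l) + 1 = sz x + sz l := by
  simp only [sz, enc, Data.size, List.map, Data.ofList]; omega

theorem sz_fst_le (x : α × β) : sz x.1 ≤ sz x := by
  have := sz_pair x.1 x.2; have := three_le_sz x.2; simp at *; omega

theorem sz_snd_le (x : α × β) : sz x.2 ≤ sz x := by
  have := sz_pair x.1 x.2; have := three_le_sz x.1; simp at *; omega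

theorem sz_le_of_mem {x : α} {l : List α} (h : x ∈ l) : sz x ≤ sz l := by
  induction l with
  | nil => simp at h
  | cons a l ih =>
    have := sz_cons a l
    have := three_le_sz a
    have := three_le_sz l
    rcases List.mem_cons.1 h with rfl | h
    · omega
    · have := ih h; omega

theorem length_le_sz (l : List α) : l.length ≤ sz l := by
  induction l with
  | nil => simp
  | cons a l ih =>
    have := sz_cons a l; have := three_le_sz a; simp; omega

theorem sz_append (l l' : List α) : sz (l ++ l') + 3 = sz l + sz l' := by
  induction l with
  | nil => simp [sz_nil, add_comm]
  | cons a l ih =>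
    have := sz_cons a l; have := sz_cons a (l ++ l'); simp at *; omega

theorem sz_reverse (l : List α) : sz l.reverse = sz l := by
  induction l with
  | nil => rfl
  | cons a l ih =>
    have := sz_cons a l; have := sz_append l.reverse [a]; have := sz_cons a []
    have := sz_nil (α := α)
    simp at *; omega

theorem sz_le_of_forall {l : List α} {b : ℕ} (h : ∀ x ∈ l, sz x ≤ b) :
    sz l ≤ l.length * b + 3 := by
  induction l with
  | nil => simp [sz_nil]
  | cons a l ih =>
    have h1 := sz_cons a l
    have h2 := ih (fun x hx => h x (List.mem_cons_of_mem _ hx))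
    have h3 := h a (List.mem_cons_self)
    simp only [List.length_cons, Nat.add_mul, one_mul]; omega

theorem sz_le_of_sublist {l l' : List α} (h : l.Sublist l') : sz l ≤ sz l' := by
  induction h with
  | slnil => exact le_rfl
  | cons a _ ih => rename_i l1 l2 _; have := sz_cons a l2; have := three_le_sz a; omega
  | cons_cons a _ ih => rename_i l1 l2 _; have := sz_cons a l1; have := sz_cons a l2; omega

/-- `T` is bounded by a power of the input size, whose exponent is a constant to the power
`h + 1`. For constant `h` these are the polynomial bounds; in general the bounds are those that
arise from polynomial ones by `h`-fold iteration. -/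
def Bd (h T : α → ℕ) : Prop := ∃ C, ∀ x, T x ≤ sz x ^ (C ^ (h x + 1))

theorem Bd.mono {h h' T T' : α → ℕ} (H : Bd h T) (hT : ∀ x, T' x ≤ T x)
    (hh : ∀ x, h x ≤ h' x) : Bd h' T' := by
  obtain ⟨C, hC⟩ := H
  refine ⟨C + 1, fun x => (hT x).trans ((hC x).trans ?_)⟩
  have := three_le_sz x
  apply Nat.pow_le_pow_right (by omega)
  calc C ^ (h x + 1) ≤ (C + 1) ^ (h x + 1) := Nat.pow_le_pow_left (by omega) _
    _ ≤ _ := Nat.pow_le_pow_right (by omega) (by have := hh x; omega)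

theorem Bd.of_le {h T T' : α → ℕ} (H : Bd h T) (hT : ∀ x, T' x ≤ T x) : Bd h T' :=
  H.mono hT fun _ => le_rfl

theorem Bd.size (h : α → ℕ) : Bd h (fun x => sz x) := ⟨1, fun x => by simp⟩

theorem le_pow_pow {s k h : ℕ} (hs : 3 ≤ s) : k ≤ s ^ (k ^ (h + 1)) := by
  rcases Nat.eq_zero_or_pos k with rfl | hk
  · simp
  calc k ≤ 2 ^ k := Nat.lt_two_pow_self.le
    _ ≤ s ^ k := Nat.pow_le_pow_left (by omega) _
    _ ≤ _ := Nat.pow_le_pow_right (by omega) (Nat.le_self_pow (by omega) k)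

theorem Bd.const (h : α → ℕ) (k : ℕ) : Bd h (fun _ => k) :=
  ⟨k, fun x => le_pow_pow (three_le_sz x)⟩

theorem Bd.mul {h T T' : α → ℕ} (H : Bd h T) (H' : Bd h T') : Bd h (fun x => T x * T' x) := by
  obtain ⟨C, hC⟩ := H
  obtain ⟨C', hC'⟩ := H'
  refine ⟨C + C', fun x => (Nat.mul_le_mul (hC x) (hC' x)).trans ?_⟩
  have := three_le_sz x
  rw [← pow_add]
  exact Nat.pow_le_pow_right (by omega) (pow_add_pow_le (by omega) (by omega) (by omega))

theorem Bd.add {h T T' : α → ℕ} (H : Bd h T) (H' : Bd h T') : Bd h (fun x => T x + T' x) := by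
  obtain ⟨C, hC⟩ := H
  obtain ⟨C', hC'⟩ := H'
  refine ⟨C + C' + 1, fun x => (Nat.add_le_add (hC x) (hC' x)).trans ?_⟩
  have h3 := three_le_sz x
  have e1 : C ^ (h x + 1) + C' ^ (h x + 1) + 1 ^ (h x + 1) ≤ (C + C' + 1) ^ (h x + 1) :=
    (Nat.add_le_add_right (pow_add_pow_le (by omega) (by omega) (by omega)) _).trans
      (pow_add_pow_le (by omega) (by omega) (by omega))
  refine le_trans ?_ (Nat.pow_le_pow_right (by omega) e1)
  have a1 : 1 ≤ sz x ^ (C ^ (h x + 1)) := Nat.one_le_pow _ _ (by omega)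
  have a2 : 1 ≤ sz x ^ (C' ^ (h x + 1)) := Nat.one_le_pow _ _ (by omega)
  generalize C ^ (h x + 1) = a at *
  generalize C' ^ (h x + 1) = b at *
  rw [one_pow, pow_succ, pow_add]
  nlinarith [Nat.mul_le_mul a1 a2]

theorem Bd.pow {h T : α → ℕ} (H : Bd h T) (K : ℕ) :
    Bd h (fun x => T x ^ (K ^ (h x + 1))) := by
  obtain ⟨C, hC⟩ := H
  refine ⟨C * K, fun x => (Nat.pow_le_pow_left (hC x) _).trans ?_⟩
  rw [← pow_mul, mul_pow]

/-- Uniform version of composition: a bound in terms of `f x` becomes one in terms of `x`. -/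
theorem Bd.comp {h : α → ℕ} {h' T : β → ℕ} {f : α → β} (H : Bd h' T)
    (Hf : Bd h (fun x => sz (f x))) (hh : ∀ x, h' (f x) ≤ h x) : Bd h (fun x => T (f x)) := by
  obtain ⟨C, hC⟩ := H
  refine (Hf.pow (C + 1)).of_le fun x => (hC _).trans ?_
  have := three_le_sz (f x)
  apply Nat.pow_le_pow_right (by omega)
  calc C ^ (h' (f x) + 1) ≤ (C + 1) ^ (h' (f x) + 1) := Nat.pow_le_pow_left (by omega) _
    _ ≤ _ := Nat.pow_le_pow_right (by omega) (by have := hh x; omega)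

/-! ### Computable functions and their running times -/

/-- Since every operation is charged with the size of its result, a time bound is also a bound on the
increase of the size; the input counts since a loop may return it without any step. -/
theorem Run.size_le {p : Prog} {x y : Data} {t : ℕ} (h : Run p x y t) :
    y.size ≤ x.size + t := by
  induction h with
  | id x => omega
  | nil x => simp [Data.size]
  | head x => omega
  | tail x => omega
  | pair => omega
  | seq => omega
  | condTrue => omega
  | condFalse => omega
  | loopDone => omega
  | loopStep => omega

/-- The program `p` computes `f` on the representations of its arguments, in time `T`. -/
def Comp (p : Prog) (f : α → β) (T : α → ℕ) : Prop :=
  ∀ x, ∃ t ≤ T x, Run p (enc x) (enc (f x)) t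

/-- `f` is computable within a time bound of the kind described in `Bd`. -/
def Fast (h : α → ℕ) (f : α → β) : Prop := ∃ p T, Comp p f T ∧ Bd h T

theorem Fast.size {h : α → ℕ} {f : α → β} (H : Fast h f) : Bd h (fun x => sz (f x)) := by
  obtain ⟨p, T, hp, hT⟩ := H
  refine ((Bd.size h).add hT).of_le fun x => ?_
  obtain ⟨t, ht, hr⟩ := hp x
  have := hr.size_le
  simp only [sz]; omega

theorem Fast.mono {h h' : α → ℕ} {f : α → β} (H : Fast h f) (hh : ∀ x, h x ≤ h' x) :
    Fast h' f := by
  obtain ⟨p, T, hp, hT⟩ := H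
  exact ⟨p, T, hp, hT.mono (fun _ => le_rfl) hh⟩

theorem Fast.of_eq {h : α → ℕ} {f g : α → β} (H : Fast h f) (e : ∀ x, f x = g x) : Fast h g := by
  have : f = g := funext e
  rwa [← this]

/-- Two representations of one and the same tree are interchangeable at no cost. -/
theorem Fast.cast {h : α → ℕ} {f : α → β} {g : α → γ} (H : Fast h f)
    (e : ∀ x, enc (f x) = enc (g x)) : Fast h g := by
  obtain ⟨p, T, hp, hT⟩ := H
  exact ⟨p, T, fun x => by rw [← e]; exact hp x, hT⟩

/-- Changing the type of the argument without changing its representation. -/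
theorem Fast.castArg {h : α → ℕ} {h' : γ → ℕ} {f : α → β} {g : γ → β} (H : Fast h f)
    (i : γ → α) (hi : ∀ x, enc (i x) = enc x) (hh : ∀ x, h (i x) ≤ h' x)
    (e : ∀ x, enc (f (i x)) = enc (g x)) : Fast h' g := by
  obtain ⟨p, T, hp, C, hC⟩ := H
  refine ⟨p, fun x => T (i x), fun x => by rw [← e, ← hi]; exact hp _, ?_⟩
  have : Bd (fun x => h (i x)) (fun x => T (i x)) :=
    ⟨C, fun x => by have := hC (i x); simp only [sz, hi] at this ⊢; exact this⟩
  exact this.mono (fun _ => le_rfl) hh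

theorem Fast.id (h : α → ℕ) : Fast h (fun x : α => x) :=
  ⟨Prog.id, fun x => sz x, fun x => ⟨_, by simp [sz], Run.id _⟩, Bd.size h⟩

/-- The exponents of the two bounds multiply, so that a bound of the same kind results, as long as
both functions have the same height. -/
theorem Fast.comp {h : α → ℕ} {h' : β → ℕ} {f : α → β} {g : β → γ} (hg : Fast h' g)
    (hf : Fast h f) (hh : ∀ x, h' (f x) ≤ h x) : Fast h (fun x => g (f x)) := by
  have hs := hf.size
  obtain ⟨p, T, hp, hT⟩ := hf
  obtain ⟨q, S, hq, hS⟩ := hg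
  refine ⟨Prog.seq p q, fun x => T x + S (f x) + 1, fun x => ?_,
    (hT.add (hS.comp hs hh)).add (Bd.const _ 1)⟩
  obtain ⟨t, ht, hr⟩ := hp x
  obtain ⟨s, hs, hr'⟩ := hq (f x)
  exact ⟨_, by dsimp only; omega, Run.seq hr hr'⟩

/-- Composition with a polynomial time function. -/
theorem Fast.comp₀ {h : α → ℕ} {f : α → β} {g : β → γ} (hg : Fast (fun _ => 0) g)
    (hf : Fast h f) : Fast h (fun x => g (f x)) := hg.comp hf fun _ => Nat.zero_le _

theorem Fast.pair {h : α → ℕ} {f : α → β} {g : α → γ} (hf : Fast h f) (hg : Fast h g) :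
    Fast h (fun x => (f x, g x)) := by
  have hs := hf.size.add hg.size
  obtain ⟨p, T, hp, hT⟩ := hf
  obtain ⟨q, S, hq, hS⟩ := hg
  refine ⟨Prog.pair p q, fun x => T x + S x + (sz (f x) + sz (g x)), fun x => ?_,
    (hT.add hS).add hs⟩
  obtain ⟨t, ht, hr⟩ := hp x
  obtain ⟨s, hs, hr'⟩ := hq x
  exact ⟨_, by simp only [Data.size, sz]; omega, Run.pair hr hr'⟩

theorem Fast.fst {h : α → ℕ} {f : α → β × γ} (hf : Fast h f) : Fast h (fun x => (f x).1) := by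
  refine Fast.comp₀ (g := fun x : β × γ => x.1) ?_ hf
  refine ⟨Prog.head, fun x => sz x.1, fun x => ⟨(enc x.1).size, Nat.le_add_right _ _, Run.head _⟩,
    (Bd.size _).of_le sz_fst_le⟩

theorem Fast.snd {h : α → ℕ} {f : α → β × γ} (hf : Fast h f) : Fast h (fun x => (f x).2) := by
  refine Fast.comp₀ (g := fun x : β × γ => x.2) ?_ hf
  refine ⟨Prog.tail, fun x => sz x.2, fun x => ⟨(enc x.2).size, Nat.le_add_right _ _, Run.tail _⟩,
    (Bd.size _).of_le sz_snd_le⟩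

theorem exists_run_const (y : Data) : ∃ p t, ∀ x, Run p x y t := by
  induction y with
  | nil => exact ⟨Prog.nil, 1, fun x => Run.nil x⟩
  | cons a b iha ihb =>
    obtain ⟨p, t, hp⟩ := iha
    obtain ⟨q, s, hq⟩ := ihb
    exact ⟨Prog.pair p q, _, fun x => Run.pair (hp x) (hq x)⟩

/-- Each tree can be built by a program that ignores its input. -/
theorem Fast.const (h : α → ℕ) (y : β) : Fast h (fun _ : α => y) := by
  obtain ⟨p, t, hp⟩ := exists_run_const (enc y)
  exact ⟨p, fun _ => t, fun x => ⟨t, le_rfl, hp _⟩, Bd.const h t⟩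

/-- A function remains fast on a part of its domain. -/
theorem Fast.restrict {h : α → ℕ} {f : α → β} (hf : Fast h f) (p : α → Prop) :
    Fast (fun x : {x // p x} => h x.1) (fun x => f x.1) :=
  hf.castArg (fun x => x.1) (fun _ => rfl) (fun _ => le_rfl) fun _ => rfl

/-- Case distinction, where each branch needs to be computable only where it is chosen. -/
theorem Fast.dite {h : α → ℕ} {c : α → Bool} {f : {x // c x = true} → β}
    {g : {x // ¬ c x = true} → β} (hc : Fast h c) (hf : Fast (fun x => h x.1) f)
    (hg : Fast (fun x => h x.1) g) :
    Fast h (fun x => if e : c x = true then f ⟨x, e⟩ else g ⟨x, e⟩) := by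
  obtain ⟨r, U, hr, hU⟩ := hc
  obtain ⟨p, T, hp, CT, hT⟩ := hf
  obtain ⟨q, S, hq, CS, hS⟩ := hg
  have hB : ∀ C, Bd h (fun x => sz x ^ (C ^ (h x + 1))) := fun C => ⟨C, fun _ => le_rfl⟩
  refine ⟨Prog.cond r p q,
    fun x => U x + (sz x ^ (CT ^ (h x + 1)) + sz x ^ (CS ^ (h x + 1))) + 1, fun x => ?_,
    (hU.add ((hB CT).add (hB CS))).add (Bd.const _ 1)⟩
  obtain ⟨u, hu, h3⟩ := hr x
  by_cases e : c x = true
  · obtain ⟨t, ht, h1⟩ := hp ⟨x, e⟩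
    have := ht.trans (hT _)
    simp only [sz, enc] at this
    rw [e] at h3
    refine ⟨u + t + 1, by simp only [sz]; omega,
      Run.condTrue h3 (by simp [enc, Data.ofBool]) ?_⟩
    beta_reduce
    rw [dif_pos e]
    exact h1
  · obtain ⟨t, ht, h1⟩ := hq ⟨x, e⟩
    have := ht.trans (hS _)
    simp only [sz, enc] at this
    rw [Bool.eq_false_of_not_eq_true e] at h3
    refine ⟨u + t + 1, by simp only [sz]; omega, Run.condFalse h3 ?_⟩
    beta_reduce
    rw [dif_neg e]
    exact h1

theorem Fast.ite {h : α → ℕ} {c : α → Bool} {f g : α → β} (hc : Fast h c) (hf : Fast h f)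
    (hg : Fast h g) : Fast h (fun x => if c x then f x else g x) :=
  (Fast.dite hc (hf.restrict _) (hg.restrict _)).of_eq fun x => by simp

/-- Whether a tree is a leaf. -/
def Data.isNil : Data → Bool
  | .nil => true
  | .cons _ _ => false

theorem Fast.isNil {h : α → ℕ} {f : α → β} (hf : Fast h f) :
    Fast h (fun x => (enc (f x)).isNil) := by
  refine Fast.comp₀ (g := fun y : β => (enc y).isNil) ?_ hf
  refine ⟨Prog.cond Prog.id Prog.nil (Prog.pair Prog.nil Prog.nil),
    fun x => sz x + (1 + 1 + 3) + 1, fun x => ?_,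
    ((Bd.size _).add (Bd.const _ 5)).add (Bd.const _ 1)⟩
  have h1 := Run.id (enc x)
  cases e : enc x with
  | nil =>
    rw [e] at h1
    have h2 := Run.condFalse (p := Prog.nil) h1
      (Run.pair (Run.nil Data.nil) (Run.nil Data.nil))
    refine ⟨Data.nil.size + (1 + 1 + (Data.nil.cons Data.nil).size) + 1, ?_, ?_⟩
    · simp [sz, e, Data.size]
    · simpa [e, Data.isNil, enc, Data.ofBool] using h2
  | cons a b =>
    rw [e] at h1
    have h2 := Run.condTrue (q := Prog.pair Prog.nil Prog.nil) h1 (by simp) (Run.nil _)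
    refine ⟨(a.cons b).size + 1 + 1, ?_, ?_⟩
    · simp only [sz, e]; omega
    · simpa [e, Data.isNil, enc, Data.ofBool] using h2

end Growth

/-! ### Loops -/

section Loops

variable {α β γ δ : Type} [Enc α] [Enc β] [Enc γ] [Enc δ]

/-- Iterating `step` `k` times leads from `s` to `s'`, passing only through states of size at
most `B` that satisfy the loop condition `c`. -/
def Reach (c : δ → Bool) (step : δ → δ) (B k : ℕ) (s s' : δ) : Prop :=
  step^[k] s = s' ∧ ∀ j < k, c (step^[j] s) = true ∧ sz (step^[j] s) ≤ B

theorem Reach.refl {c : δ → Bool} {step : δ → δ} {B : ℕ} (s : δ) : Reach c step B 0 s s :=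
  ⟨rfl, fun _ h => absurd h (Nat.not_lt_zero _)⟩

theorem Reach.trans {c : δ → Bool} {step : δ → δ} {B k l : ℕ} {s s' s'' : δ}
    (h : Reach c step B k s s') (h' : Reach c step B l s' s'') :
    Reach c step B (k + l) s s'' := by
  obtain ⟨rfl, h2⟩ := h
  obtain ⟨rfl, h3⟩ := h'
  refine ⟨by rw [add_comm, Function.iterate_add_apply], fun j hj => ?_⟩
  by_cases hjk : j < k
  · exact h2 j hjk
  · have := h3 (j - k) (by omega)
    rwa [← Function.iterate_add_apply, Nat.sub_add_cancel (by omega)] at this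

theorem Reach.step {c : δ → Bool} {step : δ → δ} {B : ℕ} {s : δ} (h : c s = true)
    (hB : sz s ≤ B) : Reach c step B 1 s (step s) :=
  ⟨rfl, fun j hj => by
    obtain rfl : j = 0 := by omega
    exact ⟨h, hB⟩⟩

theorem Reach.mono {c : δ → Bool} {step : δ → δ} {B B' k : ℕ} {s s' : δ}
    (h : Reach c step B k s s') (hB : B ≤ B') : Reach c step B' k s s' :=
  ⟨h.1, fun j hj => ⟨(h.2 j hj).1, (h.2 j hj).2.trans hB⟩⟩

theorem Reach.run {c : δ → Bool} {step : δ → δ} {B D k : ℕ} {s s' : δ} {p q : Prog}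
    {T S : δ → ℕ} (h : Reach c step B k s s') (hp : Comp p c T) (hq : Comp q step S)
    (hD : ∀ j < k, T (step^[j] s) + S (step^[j] s) + 1 ≤ D) (hs' : c s' = false) :
    ∃ t ≤ k * D + (T s' + 1), Run (Prog.loop p q) (enc s) (enc s') t := by
  induction k generalizing s with
  | zero =>
    obtain ⟨rfl, -⟩ := h
    obtain ⟨t, ht, hr⟩ := hp s
    simp only [Function.iterate_zero, id_eq] at hs' ⊢
    rw [hs'] at hr
    exact ⟨_, by omega, Run.loopDone hr⟩
  | succ k ih =>
    have h1 := (h.2 0 (by omega)).1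
    have h2 := hD 0 (by omega)
    simp only [Function.iterate_zero, id_eq] at h1 h2
    have hr : Reach c step B k (step s) s' :=
      ⟨h.1, fun j hj => h.2 (j + 1) (by omega)⟩
    obtain ⟨u, hu, hl⟩ := ih hr fun j hj => hD (j + 1) (by omega)
    obtain ⟨t, ht, hrt⟩ := hp s
    obtain ⟨v, hv, hrv⟩ := hq s
    rw [h1] at hrt
    refine ⟨t + v + u + 1, ?_, Run.loopStep hrt (by simp [enc, Data.ofBool]) hrv hl⟩
    rw [Nat.add_mul]; omega

/-- A while loop is fast if the number of its iterations and the sizes of the states are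
bounded. -/
theorem Fast.while {h : α → ℕ} {hd : δ → ℕ} {s s' : α → δ} {c : δ → Bool} {step : δ → δ}
    {B k : α → ℕ} (hc : Fast hd c) (hst : Fast hd step) (hs : Fast h s) (hB : Bd h B)
    (hk : Bd h k) (hs' : Bd h (fun x => sz (s' x)))
    (hr : ∀ x, Reach c step (B x) (k x) (s x) (s' x)) (he : ∀ x, c (s' x) = false)
    (hh : ∀ x, ∀ j < k x, hd (step^[j] (s x)) ≤ h x) (hh' : ∀ x, hd (s' x) ≤ h x) :
    Fast h s' := by
  obtain ⟨p, T, hp, CT, hT⟩ := hc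
  obtain ⟨q, S, hq, CS, hS⟩ := hst
  obtain ⟨r, U, hr', hU⟩ := hs
  set K := CT + CS + 1 with hK
  refine ⟨Prog.seq r (Prog.loop p q),
    fun x => U x + (k x * ((B x ^ (K ^ (h x + 1)) + B x ^ (K ^ (h x + 1)) + 1)) +
      (sz (s' x) ^ (K ^ (h x + 1)) + 1)) + 1, fun x => ?_, ?_⟩
  · obtain ⟨t, ht, hrt⟩ := hr' x
    have key : ∀ y : δ, hd y ≤ h x → ∀ b, sz y ≤ b →
        T y ≤ b ^ (K ^ (h x + 1)) ∧ S y ≤ b ^ (K ^ (h x + 1)) := by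
      intro y hy b hb
      have h3 := three_le_sz y
      have aux : ∀ C ≤ K, sz y ^ (C ^ (hd y + 1)) ≤ b ^ (K ^ (h x + 1)) := fun C hC =>
        (Nat.pow_le_pow_left hb _).trans (Nat.pow_le_pow_right (by omega)
          ((Nat.pow_le_pow_left hC _).trans (Nat.pow_le_pow_right (by omega) (by omega))))
      exact ⟨(hT y).trans (aux _ (by omega)), (hS y).trans (aux _ (by omega))⟩
    obtain ⟨u, hu, hl⟩ := (hr x).run hp hq
      (D := B x ^ (K ^ (h x + 1)) + B x ^ (K ^ (h x + 1)) + 1)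
      (fun j hj => by
        have := key _ (hh x j hj) _ ((hr x).2 j hj).2
        omega) (he x)
    have := (key _ (hh' x) _ le_rfl).1
    exact ⟨_, by dsimp only; omega, Run.seq hrt hl⟩
  · exact ((hU.add ((hk.mul (((hB.pow K).add (hB.pow K)).add (Bd.const _ 1))).add
      ((hs'.pow K).add (Bd.const _ 1)))).add (Bd.const _ 1))

theorem Fast.not {h : α → ℕ} {f : α → Bool} (hf : Fast h f) : Fast h (fun x => !f x) :=
  (Fast.ite hf (Fast.const _ false) (Fast.const _ true)).of_eq fun x => by cases f x <;> rfl

theorem Fast.and {h : α → ℕ} {f g : α → Bool} (hf : Fast h f) (hg : Fast h g) :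
    Fast h (fun x => f x && g x) :=
  (Fast.ite hf hg (Fast.const _ false)).of_eq fun x => by cases f x <;> rfl

theorem Fast.or {h : α → ℕ} {f g : α → Bool} (hf : Fast h f) (hg : Fast h g) :
    Fast h (fun x => f x || g x) :=
  (Fast.ite hf (Fast.const _ true) hg).of_eq fun x => by cases f x <;> rfl

theorem Fast.cons {h : α → ℕ} {f : α → β} {l : α → List β} (hf : Fast h f) (hl : Fast h l) :
    Fast h (fun x => f x :: l x) := (hf.pair hl).cast fun _ => rfl

theorem Fast.nil (h : α → ℕ) : Fast h (fun _ => ([] : List β)) := Fast.const _ _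

theorem Fast.isEmpty {h : α → ℕ} {l : α → List β} (hl : Fast h l) :
    Fast h (fun x => (l x).isEmpty) :=
  hl.isNil.of_eq fun x => by cases l x <;> rfl

/-- The raw first component of a tree, at a type chosen freely. -/
theorem Fast.rawHead {h : α → ℕ} {f : α → β} (hf : Fast h f) :
    Fast h (fun x => (enc (f x)).head) := by
  refine Fast.comp₀ (g := fun y : β => (enc y).head) ?_ hf
  refine ⟨Prog.head, fun x => sz x, fun x => ⟨_, ?_, Run.head _⟩, Bd.size _⟩
  simp only [sz]
  cases enc x <;> simp [Data.head, Data.size]; omega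

theorem Fast.rawTail {h : α → ℕ} {f : α → β} (hf : Fast h f) :
    Fast h (fun x => (enc (f x)).tail) := by
  refine Fast.comp₀ (g := fun y : β => (enc y).tail) ?_ hf
  refine ⟨Prog.tail, fun x => sz x, fun x => ⟨_, ?_, Run.tail _⟩, Bd.size _⟩
  simp only [sz]
  cases enc x <;> simp [Data.tail, Data.size]; omega

theorem Fast.listTail {h : α → ℕ} {l : α → List β} (hl : Fast h l) :
    Fast h (fun x => (l x).tail) :=
  hl.rawTail.cast fun x => by cases l x <;> rfl

theorem Fast.headD {h : α → ℕ} {l : α → List β} {d : α → β} (hl : Fast h l) (hd : Fast h d) :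
    Fast h (fun x => (l x).headD (d x)) :=
  (Fast.ite hl.isEmpty (hd.cast (g := fun x => enc (d x)) fun _ => rfl) hl.rawHead).cast
    fun x => by cases l x <;> rfl

/-- Case distinction on the shape of a list. -/
theorem Fast.listCases {h : α → ℕ} {l : α → List β} {f : α → γ} {g : α × β × List β → γ}
    (hl : Fast h l) (hf : Fast h f) (hg : Fast (fun p => h p.1) g) :
    Fast h (fun x => match l x with | [] => f x | a :: t => g (x, a, t)) := by
  have hg' : Fast (fun x : {x // ¬ (l x).isEmpty = true} => h x.1)
      (fun x => g (x.1, (l x.1).head (by simpa using x.2), (l x.1).tail)) := by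
    refine Fast.comp (h' := fun p => h p.1)
      (f := fun x : {x // ¬ (l x).isEmpty = true} =>
        (x.1, (l x.1).head (by simpa using x.2), (l x.1).tail)) hg ?_ fun _ => le_rfl
    refine (((Fast.id h).pair hl).restrict _).cast fun x => ?_
    obtain ⟨x, hx⟩ := x
    change Data.cons (enc x) (enc (l x)) =
      Data.cons (enc x) (enc ((l x).head (by simpa using hx) :: (l x).tail))
    rw [List.cons_head_tail]
  refine (Fast.dite hl.isEmpty (hf.restrict _) hg').of_eq fun x => ?_
  split
  · rename_i hE
    simp [List.isEmpty_iff.1 hE]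
  · rename_i hE
    obtain ⟨a, t, e⟩ := List.exists_cons_of_ne_nil (l := l x) (by simpa using hE)
    simp [e]

/-- A loop over a list is fast if the intermediate results are known to be small. -/
theorem Fast.foldl {h : α → ℕ} {l : α → List β} {init : α → γ} {f : α → γ → β → γ}
    (hl : Fast h l) (hi : Fast h init)
    (hf : Fast (fun p : α × γ × β => h p.1) (fun p => f p.1 p.2.1 p.2.2)) {B : α → ℕ}
    (hB : Bd h B) (hb : ∀ x l₁ l₂, l x = l₁ ++ l₂ → sz (l₁.foldl (f x) (init x)) ≤ B x) :
    Fast h (fun x => (l x).foldl (f x) (init x)) := by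
  -- The state consists of the rest of the list, the context and the accumulator.
  let step : List β × α × γ → List β × α × γ := fun s =>
    match s.1 with
    | [] => s
    | b :: l => (l, s.2.1, f s.2.1 s.2.2 b)
  let c : List β × α × γ → Bool := fun s => !s.1.isEmpty
  let hd : List β × α × γ → ℕ := fun s => h s.2.1
  have hc : Fast hd c := (Fast.id _).fst.isEmpty.not
  have hst : Fast hd step := by
    refine Fast.listCases (g := fun p => (p.2.2, p.1.2.1, f p.1.2.1 p.1.2.2 p.2.1))
      (Fast.id _).fst (Fast.id _) ?_
    refine (Fast.id _).snd.snd.pair ((Fast.id _).fst.snd.fst.pair ?_)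
    exact Fast.comp (f := fun p : (List β × α × γ) × β × List β => (p.1.2.1, p.1.2.2, p.2.1)) hf
      ((Fast.id _).fst.snd.fst.pair ((Fast.id _).fst.snd.snd.pair (Fast.id _).snd.fst))
      fun _ => le_rfl
  have key : ∀ x l₂ l₁, l x = l₁ ++ l₂ →
      Reach c step (sz (l x) + sz x + B x) l₂.length (l₂, x, l₁.foldl (f x) (init x))
        ([], x, (l x).foldl (f x) (init x)) := by
    intro x l₂
    induction l₂ with
    | nil => intro l₁ e; simpa [e] using Reach.refl _
    | cons b l₂ ih =>
      intro l₁ e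
      have h2 := ih (l₁ ++ [b]) (by simp [e])
      rw [List.foldl_append] at h2
      rw [List.length_cons, Nat.add_comm l₂.length]
      refine Reach.trans (Reach.step (s := (b :: l₂, x, l₁.foldl (f x) (init x))) rfl ?_) h2
      have e1 := sz_pair (b :: l₂) (x, l₁.foldl (f x) (init x))
      have e2 := sz_pair x (l₁.foldl (f x) (init x))
      have e3 := hb x l₁ _ e
      have e4 := sz_append l₁ (b :: l₂)
      have e5 := three_le_sz l₁
      rw [← e] at e4
      omega
  have hx : Fast h (fun x => (l x, x, init x)) := hl.pair ((Fast.id h).pair hi)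
  have hbd : Bd h (fun x => sz (l x) + sz x + B x) := (hl.size.add (Bd.size h)).add hB
  have hfin : Fast h (fun x => (([] : List β), x, (l x).foldl (f x) (init x))) := by
    refine Fast.while (hd := hd) (k := fun x => (l x).length) hc hst hx hbd
      (hl.size.of_le fun x => length_le_sz _) ?_ (fun x => key x (l x) [] rfl) (fun _ => rfl) ?_
      (fun _ => le_rfl)
    · refine (((Bd.const h 3).add (Bd.size h)).add hB).of_le fun x => ?_
      have e1 := sz_pair ([] : List β) (x, (l x).foldl (f x) (init x))
      have e2 := sz_pair x ((l x).foldl (f x) (init x))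
      have e3 := hb x (l x) [] (by simp)
      have e4 := sz_nil (α := β)
      omega
    · intro x j _
      have : ∀ j s, hd (step^[j] s) = hd s := by
        intro j
        induction j with
        | zero => intro s; rfl
        | succ j ih =>
          intro s
          rw [Function.iterate_succ_apply, ih]
          obtain ⟨_ | ⟨b, t⟩, s⟩ := s <;> rfl
      rw [this]
  exact hfin.snd.snd

/-- A loop over a list whose body is computable in polynomial time. Nothing is required of the
intermediate results, but the length of the list goes into the exponent of the running time. -/
theorem Fast.foldl' {h : α → ℕ} {l : α → List β} {init : α → γ} {f : α → γ → β → γ}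
    (hl : Fast h l) (hi : Fast h init)
    (hf : Fast (fun _ => 0) (fun p : α × γ × β => f p.1 p.2.1 p.2.2))
    (hn : ∀ x, (l x).length ≤ h x) :
    Fast h (fun x => (l x).foldl (f x) (init x)) := by
  obtain ⟨C, hC⟩ := hf.size
  set K := 2 * C + 1 with hK
  have hbd := ((hl.size.add (Bd.size h)).add hi.size).pow K
  refine Fast.foldl hl hi (hf.mono fun _ => Nat.zero_le _) hbd ?_
  intro x l₁ l₂ e
  set b := sz (l x) + sz x + sz (init x) with hb
  have h3 := three_le_sz (l x)
  -- Each iteration multiplies the exponent by the constant `K` at most.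
  have key : ∀ l₃ l₄, l₁ = l₃ ++ l₄ → sz (l₃.foldl (f x) (init x)) ≤ b ^ (K ^ l₃.length) := by
    intro l₃
    induction l₃ using List.reverseRecOn with
    | nil => intro _ _; simp [hb]
    | append_singleton l₃ a ih =>
      intro l₄ e'
      have h1 := ih ([a] ++ l₄) (by simp [e'])
      have h2 := hC (x, l₃.foldl (f x) (init x), a)
      simp only [List.foldl_append, List.foldl_cons, List.foldl_nil, List.length_append,
        List.length_singleton] at h2 ⊢
      refine h2.trans ?_
      have h4 := sz_pair x (l₃.foldl (f x) (init x), a)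
      have h5 := sz_pair (l₃.foldl (f x) (init x)) a
      have h6 : sz a ≤ sz (l x) := sz_le_of_mem (by simp [e, e'])
      have h7 : 1 ≤ b ^ (K ^ l₃.length) := Nat.one_le_pow _ _ (by omega)
      have h8 : sz (x, l₃.foldl (f x) (init x), a) ≤ b * b ^ (K ^ l₃.length) := by
        nlinarith
      refine (Nat.pow_le_pow_left h8 _).trans ?_
      rw [← pow_succ', ← pow_mul]
      apply Nat.pow_le_pow_right (by omega)
      have h9 : 1 ≤ K ^ l₃.length := Nat.one_le_pow _ _ (by omega)
      simp only [zero_add, pow_one]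
      rw [pow_succ]
      nlinarith
  refine (key l₁ [] (by simp)).trans (Nat.pow_le_pow_right (by omega) ?_)
  apply Nat.pow_le_pow_right (by omega)
  have := hn x
  rw [e, List.length_append] at this
  omega

end Loops

section Lists

variable {α β γ δ : Type} [Enc α] [Enc β] [Enc γ] [Enc δ]

/-! ### Lists -/

theorem foldl_cons_eq (l acc : List β) : l.foldl (fun acc a => a :: acc) acc = l.reverse ++ acc := by
  induction l generalizing acc with
  | nil => rfl
  | cons a l ih => simp [ih]

theorem Fast.reverse {h : α → ℕ} {l : α → List β} (hl : Fast h l) :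
    Fast h (fun x => (l x).reverse) := by
  refine Fast.comp₀ (g := fun l : List β => l.reverse) ?_ hl
  refine (Fast.foldl (f := fun _ acc a => a :: acc) (Fast.id _) (Fast.nil _)
    ((Fast.id _).snd.snd.cons (Fast.id _).snd.fst) (Bd.size _) ?_).of_eq
      fun l => by simp
  intro l l₁ l₂ e
  rw [foldl_cons_eq, List.append_nil, sz_reverse, e]
  exact sz_le_of_sublist (List.sublist_append_left _ _)

theorem Fast.append {h : α → ℕ} {l l' : α → List β} (hl : Fast h l) (hl' : Fast h l') :
    Fast h (fun x => l x ++ l' x) := by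
  refine Fast.comp₀ (g := fun p : List β × List β => p.1 ++ p.2) ?_ (hl.pair hl')
  refine (Fast.foldl (f := fun _ acc a => a :: acc) (Fast.id _).fst.reverse (Fast.id _).snd
    ((Fast.id _).snd.snd.cons (Fast.id _).snd.fst) ((Bd.size _).add (Bd.size _)) ?_).of_eq
      fun l => by simp
  intro l l₁ l₂ e
  have h1 := sz_append l₁.reverse l.2
  rw [foldl_cons_eq]
  rw [sz_reverse] at h1
  have h2 : sz l₁ ≤ sz l.1.reverse := by
    rw [e]; exact sz_le_of_sublist (List.sublist_append_left _ _)
  rw [sz_reverse] at h2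
  have := sz_fst_le l
  have := sz_snd_le l
  omega

theorem foldl_append_eq (f : β → List γ) (l : List β) (acc : List γ) :
    l.foldl (fun acc a => acc ++ f a) acc = acc ++ l.flatMap f := by
  induction l generalizing acc with
  | nil => simp
  | cons a l ih => simp [ih]

/-- Loops that collect the results of their iterations. The result of an iteration does not enter the
next one, and therefore the number of iterations does not matter for the height. -/
theorem Fast.flatMap {h : α → ℕ} {l : α → List β} {f : α → β → List γ} (hl : Fast h l)
    (hf : Fast (fun p : α × β => h p.1) (fun p => f p.1 p.2)) :
    Fast h (fun x => (l x).flatMap (f x)) := by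
  obtain ⟨C, hC⟩ := hf.size
  refine (Fast.foldl (f := fun x acc a => acc ++ f x a) hl (Fast.nil h)
    ((Fast.id _).snd.fst.append (Fast.comp (f := fun p : α × List γ × β => (p.1, p.2.2)) hf
      ((Fast.id _).fst.pair (Fast.id _).snd.snd) fun _ => le_rfl))
    (B := fun x => sz (l x) * (sz x + sz (l x)) ^ (C ^ (h x + 1)) + 3)
    ((hl.size.mul (((Bd.size h).add hl.size).pow C)).add (Bd.const h 3)) ?_).of_eq
      fun x => by rw [foldl_append_eq]; rfl
  intro x l₁ l₂ e
  rw [foldl_append_eq, List.nil_append]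
  have key : ∀ l₃ : List β, (∀ b ∈ l₃, b ∈ l x) → sz (l₃.flatMap (f x)) ≤
      l₃.length * (sz x + sz (l x)) ^ (C ^ (h x + 1)) + 3 := by
    intro l₃ h₃
    induction l₃ with
    | nil => simp [sz_nil]
    | cons b l₃ ih =>
      have h4 := ih fun b hb => h₃ b (List.mem_cons_of_mem _ hb)
      have h5 := sz_append (f x b) (l₃.flatMap (f x))
      have h6 := hC (x, b)
      have h7 := sz_pair x b
      have h8 := sz_le_of_mem (h₃ b List.mem_cons_self)
      have h9 := h6.trans (Nat.pow_le_pow_left (show sz (x, b) ≤ sz x + sz (l x) by omega) _)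
      simp only [List.flatMap_cons, List.length_cons, Nat.add_mul, one_mul]
      dsimp only at h9
      omega
  refine (key l₁ fun b hb => by rw [e]; exact List.mem_append_left _ hb).trans ?_
  have : l₁.length ≤ sz (l x) := by
    have := length_le_sz (l x)
    rw [e, List.length_append] at this
    rw [e]; omega
  exact Nat.add_le_add_right (Nat.mul_le_mul_right _ this) _

theorem Fast.map {h : α → ℕ} {l : α → List β} {f : α → β → γ} (hl : Fast h l)
    (hf : Fast (fun p : α × β => h p.1) (fun p => f p.1 p.2)) :
    Fast h (fun x => (l x).map (f x)) :=
  (Fast.flatMap (f := fun x b => [f x b]) hl (hf.cons (Fast.nil _))).of_eq fun _ =>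
    List.map_eq_flatMap.symm

theorem flatMap_ite_eq_filter (p : β → Bool) (l : List β) :
    l.flatMap (fun b => if p b then [b] else []) = l.filter p := by
  induction l with
  | nil => rfl
  | cons a l ih => by_cases h : p a <;> simp [h, ih]

theorem Fast.filter {h : α → ℕ} {l : α → List β} {f : α → β → Bool} (hl : Fast h l)
    (hf : Fast (fun p : α × β => h p.1) (fun p => f p.1 p.2)) :
    Fast h (fun x => (l x).filter (f x)) :=
  (Fast.flatMap (f := fun x b => if f x b then [b] else []) hl
    (Fast.ite hf ((Fast.id _).snd.cons (Fast.nil _)) (Fast.nil _))).of_eq fun _ =>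
      flatMap_ite_eq_filter _ _

theorem Fast.any {h : α → ℕ} {l : α → List β} {f : α → β → Bool} (hl : Fast h l)
    (hf : Fast (fun p : α × β => h p.1) (fun p => f p.1 p.2)) :
    Fast h (fun x => (l x).any (f x)) :=
  (Fast.filter hl hf).isEmpty.not.of_eq fun x => by
    rw [Bool.eq_iff_iff]; simp

theorem Fast.all {h : α → ℕ} {l : α → List β} {f : α → β → Bool} (hl : Fast h l)
    (hf : Fast (fun p : α × β => h p.1) (fun p => f p.1 p.2)) :
    Fast h (fun x => (l x).all (f x)) :=
  (Fast.any (f := fun x b => !f x b) hl hf.not).not.of_eq fun x => by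
    rw [Bool.eq_iff_iff]; simp

theorem Fast.zip {h : α → ℕ} {l : α → List β} {l' : α → List γ} (hl : Fast h l)
    (hl' : Fast h l') : Fast h (fun x => (l x).zip (l' x)) := by
  refine Fast.comp₀ (g := fun p : List β × List γ => p.1.zip p.2) ?_ (hl.pair hl')
  let step : List γ × List (β × γ) → β → List γ × List (β × γ) := fun s b =>
    match s.1 with
    | [] => ([], s.2)
    | c :: r => (r, (b, c) :: s.2)
  have key : ∀ (l : List β) (r : List γ) acc,
      l.foldl step (r, acc) = (r.drop l.length, (l.zip r).reverse ++ acc) := by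
    intro l
    induction l with
    | nil => simp
    | cons b l ih =>
      intro r acc
      cases r with
      | nil => simp [step, ih]
      | cons c r => simp [step, ih]
  have hst : Fast (fun _ => 0) (fun p : (List β × List γ) × (List γ × List (β × γ)) × β =>
      step p.2.1 p.2.2) :=
    Fast.listCases (l := fun p : (List β × List γ) × (List γ × List (β × γ)) × β => p.2.1.1)
      (f := fun p => ([], p.2.1.2))
      (g := fun q => (q.2.2, (q.1.2.2, q.2.1) :: q.1.2.1.2)) (Fast.id _).snd.fst.fst
      ((Fast.nil _).pair (Fast.id _).snd.fst.snd)
      ((Fast.id _).snd.snd.pair (((Fast.id _).fst.snd.snd.pair (Fast.id _).snd.fst).cons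
        (Fast.id _).fst.snd.fst.snd))
  refine (Fast.foldl (f := fun _ => step) (B := fun x => sz x + (sz x * (sz x + sz x) + 3))
    (Fast.id _).fst ((Fast.id _).snd.pair (Fast.nil _)) hst
    ((Bd.size _).add (((Bd.size _).mul ((Bd.size _).add (Bd.size _))).add (Bd.const _ 3)))
    ?_).snd.reverse.of_eq fun x => by simp [key]
  intro x l₁ l₂ e
  rw [key, List.append_nil]
  have h1 := sz_pair (x.2.drop l₁.length) (l₁.zip x.2).reverse
  rw [sz_reverse] at h1
  have h2 : sz (x.2.drop l₁.length) ≤ sz x :=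
    (sz_le_of_sublist (List.drop_sublist _ _)).trans (sz_snd_le x)
  have h3 : sz (l₁.zip x.2) ≤ (l₁.zip x.2).length * (sz x + sz x) + 3 := by
    refine sz_le_of_forall fun p hp => ?_
    obtain ⟨b, c⟩ := p
    have hb := sz_le_of_mem (show b ∈ x.1 by
      rw [e]; exact List.mem_append_left _ (List.of_mem_zip hp).1)
    have hc := sz_le_of_mem (List.of_mem_zip hp).2
    have := sz_pair b c
    have := sz_fst_le x
    have := sz_snd_le x
    omega
  have h4 : (l₁.zip x.2).length ≤ sz x := by
    have := length_le_sz x.2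
    have := sz_snd_le x
    rw [List.length_zip]; omega
  have h5 := Nat.mul_le_mul_right (sz x + sz x) h4
  omega

/-! ### Equality -/

/-- One step of the comparison of two trees: the pairs of trees on the stack are still to be
compared. -/
def eqStep (s : Bool × List (Data × Data)) : Bool × List (Data × Data) :=
  match s.2 with
  | [] => s
  | (Data.nil, Data.nil) :: r => (s.1, r)
  | (Data.cons a b, Data.cons c d) :: r => (s.1, (a, c) :: (b, d) :: r)
  | _ => (false, [])

/-- One step of the comparison of two trees takes polynomial time. -/
theorem Fast.eqStep : Fast (fun _ => 0) eqStep := by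
  let P := (Bool × List (Data × Data)) × (Data × Data) × List (Data × Data)
  have i : Fast (fun _ => 0) (fun p : P => p) := Fast.id _
  have h1 : Fast (fun _ => 0) (fun p : P => (enc p.2.1.1).isNil) := i.snd.fst.fst.isNil
  have h2 : Fast (fun _ => 0) (fun p : P => (enc p.2.1.2).isNil) := i.snd.fst.snd.isNil
  have h3 : Fast (fun _ => 0) (fun p : P =>
      if (enc p.2.1.1).isNil then
        if (enc p.2.1.2).isNil then (p.1.1, p.2.2) else (false, [])
      else if (enc p.2.1.2).isNil then (false, [])
      else (p.1.1, ((enc p.2.1.1).head, (enc p.2.1.2).head) ::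
        ((enc p.2.1.1).tail, (enc p.2.1.2).tail) :: p.2.2)) := by
    refine Fast.ite h1 (Fast.ite h2 (i.fst.fst.pair i.snd.snd) (Fast.const _ _))
      (Fast.ite h2 (Fast.const _ _) (i.fst.fst.pair ?_))
    exact (i.snd.fst.fst.rawHead.pair i.snd.fst.snd.rawHead).cons
      ((i.snd.fst.fst.rawTail.pair i.snd.fst.snd.rawTail).cons i.snd.snd)
  refine (Fast.listCases (Fast.id _).snd (Fast.id _) h3).of_eq fun s => ?_
  obtain ⟨b, _ | ⟨⟨_ | ⟨a, b⟩, _ | ⟨c, d⟩⟩, r⟩⟩ := s <;> rfl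

noncomputable instance : DecidableEq Data := Classical.decEq _

theorem reach_eqStep (n : ℕ) : ∀ (r : List (Data × Data)) (B : ℕ),
    (r.map fun p => p.1.size).sum ≤ n → sz (true, r) ≤ B →
    ∃ k ≤ n, Reach (fun s : Bool × List (Data × Data) => !s.2.isEmpty) Hanf.eqStep B k (true, r)
      (r.all fun p => decide (p.1 = p.2), []) := by
  induction n with
  | zero =>
    intro r B hn hB
    cases r with
    | nil => exact ⟨0, le_rfl, Reach.refl _⟩
    | cons p r =>
      have := Data.size_pos p.1
      simp at hn; omega
  | succ n ih =>
    intro r B hn hB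
    rcases r with _ | ⟨⟨a, b⟩, r⟩
    · exact ⟨0, by omega, Reach.refl _⟩
    have h1 : Reach (fun s : Bool × List (Data × Data) => !s.2.isEmpty) Hanf.eqStep B 1
        (true, (a, b) :: r) (Hanf.eqStep (true, (a, b) :: r)) := Reach.step rfl hB
    have e1 := sz_pair true ((a, b) :: r)
    have e2 := sz_cons (a, b) r
    have e3 := sz_pair a b
    have e4 := three_le_sz a
    have e5 := three_le_sz b
    have e6 := sz_pair true r
    rcases a with _ | ⟨a, a'⟩ <;> rcases b with _ | ⟨b, b'⟩
    · obtain ⟨k, hk, hr⟩ := ih r B (by simp [Data.size] at hn; omega) (by omega)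
      refine ⟨1 + k, by omega, h1.trans ?_⟩
      simpa [Hanf.eqStep] using hr
    · exact ⟨1, by omega, by simpa [Hanf.eqStep] using h1⟩
    · exact ⟨1, by omega, by simpa [Hanf.eqStep] using h1⟩
    · have f1 := sz_pair true ((a, b) :: (a', b') :: r)
      have f2 := sz_cons (a, b) ((a', b') :: r)
      have f3 := sz_cons (a', b') r
      have f4 := sz_pair a b
      have f5 := sz_pair a' b'
      have f6 : sz (a.cons a') + 1 = sz a + sz a' := sz_pair a a'
      have f7 : sz (b.cons b') + 1 = sz b + sz b' := sz_pair b b'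
      obtain ⟨k, hk, hr⟩ := ih ((a, b) :: (a', b') :: r) B
        (by simp [Data.size] at hn ⊢; omega) (by omega)
      refine ⟨1 + k, by omega, h1.trans ?_⟩
      simpa [Hanf.eqStep, Bool.and_assoc] using hr

theorem Fast.dataEq : Fast (fun _ => 0) (fun p : Data × Data => decide (p.1 = p.2)) := by
  have key : ∀ p : Data × Data, ∃ k ≤ sz p,
      Reach (fun s : Bool × List (Data × Data) => !s.2.isEmpty) Hanf.eqStep (sz (true, [p])) k
        (true, [p]) (decide (p.1 = p.2), []) := by
    intro p
    obtain ⟨k, hk, hr⟩ := reach_eqStep p.1.size [p] _ (by simp) le_rfl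
    refine ⟨k, hk.trans ?_, by simpa using hr⟩
    have := sz_fst_le p
    simp only [sz, enc] at this ⊢
    omega
  choose k hk hr using key
  have h1 : Fast (fun _ => 0) (fun p : Data × Data => (true, [p])) :=
    (Fast.const _ true).pair ((Fast.id _).cons (Fast.nil _))
  refine Fast.fst (f := fun p : Data × Data => (decide (p.1 = p.2), ([] : List (Data × Data))))
    (Fast.while (Fast.id _).snd.isEmpty.not Fast.eqStep h1 h1.size ((Bd.size _).of_le hk)
      ((Bd.const _ 20).of_le fun x => ?_) hr (fun _ => rfl) (fun _ _ _ => le_rfl)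
      fun _ => le_rfl)
  cases decide (x.1 = x.2) <;> simp [sz, enc, Data.ofList, Data.ofBool, Data.size]

/-- Types whose elements are determined by the trees that represent them. -/
class EncInj (α : Type) [Enc α] : Prop where
  inj : Function.Injective (enc : α → Data)

instance : EncInj Bool := ⟨fun a b h => by
  cases a <;> cases b <;> simp_all [enc, Data.ofBool]⟩

instance [EncInj α] [EncInj β] : EncInj (α × β) := ⟨fun a b h => by
  simp only [enc, Data.cons.injEq] at h
  exact Prod.ext (EncInj.inj h.1) (EncInj.inj h.2)⟩

instance [EncInj α] : EncInj (List α) := ⟨fun a b h => by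
  induction a generalizing b with
  | nil => cases b <;> simp_all [enc, Data.ofList]
  | cons x a ih =>
    cases b with
    | nil => simp_all [enc, Data.ofList]
    | cons y b =>
      simp only [enc, Data.ofList, List.map_cons, Data.cons.injEq] at h
      rw [EncInj.inj h.1, ih b h.2]⟩

theorem enc_nat (n : ℕ) : enc n = enc n.bits := rfl

instance : EncInj ℕ := ⟨fun a b h => by
  rw [enc_nat, enc_nat] at h
  have := EncInj.inj h
  apply Nat.eq_of_testBit_eq
  intro i
  rw [Nat.testBit_eq_inth, Nat.testBit_eq_inth, this]⟩

theorem Fast.eq [DecidableEq β] [EncInj β] {h : α → ℕ} {f g : α → β} (hf : Fast h f)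
    (hg : Fast h g) : Fast h (fun x => decide (f x = g x)) :=
  (Fast.comp₀ Fast.dataEq ((hf.cast (g := fun x => enc (f x)) fun _ => rfl).pair
    (hg.cast (g := fun x => enc (g x)) fun _ => rfl))).of_eq fun x => by
      simp [EncInj.inj.eq_iff]

theorem Fast.mem [DecidableEq β] [EncInj β] {h : α → ℕ} {f : α → β} {l : α → List β}
    (hf : Fast h f) (hl : Fast h l) : Fast h (fun x => decide (f x ∈ l x)) := by
  refine (Fast.any (f := fun x b => decide (f x = b)) hl (Fast.eq
    (hf.comp (Fast.id _).fst fun _ => le_rfl) (Fast.id _).snd)).of_eq fun x => ?_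
  rw [Bool.eq_iff_iff]; simp

/-- Replacing the context by an earlier one. -/
theorem Fast.weaken {h : α → ℕ} {f : α → γ} (hf : Fast h f) :
    Fast (fun p : α × β => h p.1) (fun p => f p.1) :=
  hf.comp (Fast.id _).fst fun _ => le_rfl

end Lists

section Recursion

variable {α β γ δ : Type} [Enc α] [Enc β] [Enc γ] [Enc δ]

/-! ### Recursion -/

/-- Collecting the values of the children of a node from the stack. -/
def popStep (s : List β × List β) : List β × List β :=
  match s.2 with
  | [] => (s.1, [])
  | b :: r => (b :: s.1, r)

/-- One step of the stack machine that evaluates a recursively defined function. The first stack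
contains the tasks: either an argument at which the function is to be evaluated (flag `true`), or
an argument such that the values at its children are already on the second stack. -/
def recStep (children : α → List α) (comb : α × List β → β)
    (s : List (Bool × α) × List β) : List (Bool × α) × List β :=
  match s.1 with
  | [] => s
  | t :: ts =>
    if t.1 then ((children t.2).map (fun y => (true, y)) ++ (false, t.2) :: ts, s.2)
    else
      let p := (children t.2).foldl (fun s _ => popStep s) ([], s.2)
      (ts, comb (t.2, p.1) :: p.2)

theorem Fast.popStep : Fast (fun _ => 0) (popStep : List β × List β → _) :=
  (Fast.listCases (g := fun q => (q.2.1 :: q.1.1, q.2.2)) (Fast.id _).snd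
    ((Fast.id _).fst.pair (Fast.nil _))
    (((Fast.id _).snd.fst.cons (Fast.id _).fst.fst).pair (Fast.id _).snd.snd)).of_eq fun s => by
      obtain ⟨g, _ | ⟨b, r⟩⟩ := s <;> rfl

/-- One step of the stack machine takes polynomial time. -/
theorem Fast.recStep {children : α → List α} {comb : α × List β → β}
    (hch : Fast (fun _ => 0) children) (hc : Fast (fun _ => 0) comb) :
    Fast (fun _ => 0) (recStep children comb) := by
  have h1 : Fast (fun _ => 0) (fun p : α × List β =>
      (children p.1).foldl (fun s _ => Hanf.popStep s) (([] : List β), p.2)) := by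
    refine Fast.foldl (f := fun _ s _ => Hanf.popStep s) (B := fun p => 3 + sz p)
      (hch.comp₀ (Fast.id _).fst) ((Fast.nil _).pair (Fast.id _).snd)
      (Fast.popStep.comp₀ (Fast.id _).snd.fst) ((Bd.const _ 3).add (Bd.size _)) ?_
    intro x l₁ _ _
    have key : ∀ (l : List α) (s : List β × List β),
        sz (l.foldl (fun s _ => Hanf.popStep s) s) = sz s := by
      intro l
      induction l with
      | nil => intro s; rfl
      | cons a l ih =>
        intro s
        rw [List.foldl_cons, ih]
        obtain ⟨g, _ | ⟨b, r⟩⟩ := s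
        · rfl
        · have := sz_cons b r
          have := sz_cons b g
          have := sz_pair g (b :: r)
          have := sz_pair (b :: g) r
          simp only [Hanf.popStep]
          omega
    rw [key]
    have := sz_pair ([] : List β) x.2
    have := sz_nil (α := β)
    have := sz_snd_le x
    omega
  have i : Fast (fun _ => 0) (fun p : (List (Bool × α) × List β) × (Bool × α) ×
    List (Bool × α) => p) := Fast.id _
  have h2 := h1.comp₀ (i.snd.fst.snd.pair i.fst.snd)
  refine (Fast.listCases (Fast.id _).fst (Fast.id _) (Fast.ite i.snd.fst.fst
    (((Fast.map (f := fun _ y => (true, y)) (hch.comp₀ i.snd.fst.snd)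
      ((Fast.const _ true).pair (Fast.id _).snd)).append
        (((Fast.const _ false).pair i.snd.fst.snd).cons i.snd.snd)).pair i.fst.snd)
    (i.snd.snd.pair ((hc.comp₀ (i.snd.fst.snd.pair h2.fst)).cons h2.snd)))).of_eq fun s => ?_
  obtain ⟨_ | ⟨⟨_ | _, a⟩, ts⟩, vs⟩ := s <;> rfl

theorem foldl_popStep (l : List α) (vs ws g : List β) (h : l.length = vs.length) :
    l.foldl (fun s _ => popStep s) (g, vs ++ ws) = (vs.reverse ++ g, ws) := by
  induction l generalizing vs g with
  | nil =>
    obtain rfl : vs = [] := List.length_eq_zero_iff.1 h.symm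
    rfl
  | cons a l ih =>
    cases vs with
    | nil => simp at h
    | cons v vs =>
      simp only [List.length_cons, Nat.add_right_cancel_iff] at h
      have := ih vs (v :: g) h
      simpa [popStep] using this

variable {F : α → β} {children : α → List α} {comb : α × List β → β}

/-- The stack machine evaluates a list of arguments if it evaluates each of them. -/
theorem reach_children {g : ℕ} (ys : List α)
    (hy : ∀ y ∈ ys, sz (F y) ≤ g ∧ ∀ ts vs, ∃ k ≤ g,
      Reach (fun s : List (Bool × α) × List β => !s.1.isEmpty) (recStep children comb)
        (sz ts + sz vs + g) k ((true, y) :: ts, vs) (ts, F y :: vs)) :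
    ∀ ts vs, ∃ k ≤ ys.length * g,
      Reach (fun s : List (Bool × α) × List β => !s.1.isEmpty) (recStep children comb)
        (sz (ys.map (fun y => (true, y)) ++ ts) + sz vs + (ys.length * g + g)) k
        (ys.map (fun y => (true, y)) ++ ts, vs) (ts, (ys.map F).reverse ++ vs) := by
  induction ys with
  | nil => intro ts vs; exact ⟨0, by simp, Reach.refl _⟩
  | cons y ys ih =>
    intro ts vs
    obtain ⟨h1, h2⟩ := hy y List.mem_cons_self
    obtain ⟨k, hk, hr⟩ := h2 (ys.map (fun y => (true, y)) ++ ts) vs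
    obtain ⟨k', hk', hr'⟩ := ih (fun y h => hy y (List.mem_cons_of_mem _ h)) ts (F y :: vs)
    have e1 := sz_cons (F y) vs
    have e2 := sz_cons (true, y) (ys.map (fun y => (true, y)) ++ ts)
    have e3 := three_le_sz (true, y)
    simp only [List.length_cons, Nat.add_mul, one_mul, List.map_cons, List.cons_append,
      List.reverse_cons, List.append_assoc, List.nil_append]
    refine ⟨k + k', by omega, Reach.trans (hr.mono ?_) (hr'.mono ?_)⟩ <;> omega

/-- The arithmetic behind `Fast.treeRec`: the quantities that occur at a node of height `H` are
bounded by a power of the size `s` of the node with exponent `K ^ (H + 1)`, if at its children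
they are bounded by `g`. -/
theorem treeRec_arith {s c K H n : ℕ} (hs : 3 ≤ s) (hc : 1 ≤ c)
    (hK : K = (2 * c + 2) * c + 3 * c + 8) (hn : n ≤ s ^ c) :
    let g := (s ^ c) ^ (K ^ H)
    (s + (n * g + 3)) ^ c ≤ s ^ (K ^ (H + 1)) ∧
    n * g + 2 ≤ s ^ (K ^ (H + 1)) ∧
    n * (s ^ c + 5) + s + (n * g + g) + 30 ≤ s ^ (K ^ (H + 1)) := by
  intro g
  have hKH : 1 ≤ K ^ H := Nat.one_le_pow _ _ (by omega)
  have hP : s ≤ s ^ c := Nat.le_self_pow (by omega) s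
  have hg : s ^ c ≤ g := Nat.le_self_pow (by omega) _
  have e1 : s ^ c * g = s ^ (c + c * K ^ H) := by
    simp only [g]; rw [← pow_mul, ← pow_add]
  have e2 : n * g ≤ s ^ c * g := Nat.mul_le_mul_right _ hn
  have e3 : K ^ (H + 1) = K ^ H * K := pow_succ _ _
  set P := s ^ c
  have e4 : s ^ 4 * (P * g) = s ^ (c + c * K ^ H + 4) := by
    rw [e1, pow_add s (c + c * K ^ H) 4, mul_comm]
  have e5 : 81 ≤ s ^ 4 := Nat.pow_le_pow_left hs 4
  have e6 : 81 * (P * g) ≤ s ^ (c + c * K ^ H + 4) := by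
    rw [← e4]; exact Nat.mul_le_mul_right _ e5
  have k1 : (2 * c + 4) * c ≤ K := by rw [hK]; nlinarith
  have k2 : 2 * c + 4 ≤ K := by rw [hK]; nlinarith
  have k3 : c + c * K ^ H + 4 ≤ (2 * c + 4) * K ^ H := by nlinarith
  have e7 : c + c * K ^ H + 4 ≤ K ^ (H + 1) := by
    rw [e3, mul_comm _ K]; exact k3.trans (Nat.mul_le_mul_right _ k2)
  have e8 : s ^ (c + c * K ^ H + 4) ≤ s ^ (K ^ (H + 1)) := Nat.pow_le_pow_right (by omega) e7
  have e9 : n * P ≤ P * g := Nat.mul_le_mul hn hg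
  have e10 : P ≤ P * g := Nat.le_mul_of_pos_right _ (by omega)
  have e11 : g ≤ P * g := Nat.le_mul_of_pos_left _ (by omega)
  refine ⟨?_, by omega, ?_⟩
  · have f1 : s + (n * g + 3) ≤ s ^ (c + c * K ^ H + 4) := by omega
    refine (Nat.pow_le_pow_left f1 _).trans ?_
    rw [← pow_mul]
    apply Nat.pow_le_pow_right (by omega)
    rw [e3, mul_comm _ K]
    calc (c + c * K ^ H + 4) * c ≤ ((2 * c + 4) * K ^ H) * c := Nat.mul_le_mul_right _ k3
      _ = ((2 * c + 4) * c) * K ^ H := by ring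
      _ ≤ _ := Nat.mul_le_mul_right _ k1
  · rw [Nat.mul_add]; omega

/-- A recursively defined function is fast: if the children of a node and the value at a node in
terms of the values at its children can be computed in polynomial time, then only the height of
the recursion goes into the exponent of the running time. -/
theorem Fast.treeRec {ht : α → ℕ} (hch : Fast (fun _ => 0) children)
    (hc : Fast (fun _ => 0) comb) (hF : ∀ x, F x = comb (x, (children x).map F))
    (hht : ∀ x, ∀ y ∈ children x, ht y < ht x) : Fast ht F := by
  obtain ⟨c₁, hc₁⟩ := hch.size
  obtain ⟨c₂, hc₂⟩ := hc.size
  simp only [zero_add, pow_one] at hc₁ hc₂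
  obtain ⟨c, hc1, h1, h2⟩ : ∃ c, 1 ≤ c ∧ (∀ x, sz (children x) ≤ sz x ^ c) ∧
      ∀ x, sz (comb x) ≤ sz x ^ c := by
    refine ⟨c₁ + c₂ + 1, by omega, fun x => (hc₁ x).trans ?_, fun x => (hc₂ x).trans ?_⟩ <;>
    · have := three_le_sz x
      exact Nat.pow_le_pow_right (by omega) (by omega)
  obtain ⟨K, hK⟩ : ∃ K, K = (2 * c + 2) * c + 3 * c + 8 := ⟨_, rfl⟩
  let G : α → ℕ := fun x => sz x ^ (K ^ (ht x + 1))
  have key : ∀ n, ∀ x, ht x = n → sz (F x) ≤ G x ∧ ∀ ts vs, ∃ k ≤ G x,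
      Reach (fun s : List (Bool × α) × List β => !s.1.isEmpty) (Hanf.recStep children comb)
        (sz ts + sz vs + G x) k ((true, x) :: ts, vs) (ts, F x :: vs) := by
    intro n
    induction n using Nat.strong_induction_on with
    | _ n ih =>
    intro x hx
    have h3 := three_le_sz x
    obtain ⟨g, hg⟩ : ∃ g, g = (sz x ^ c) ^ (K ^ ht x) := ⟨_, rfl⟩
    have hys : ∀ y ∈ children x, G y ≤ g := by
      intro y hy
      have h4 := hht x y hy
      have h5 := three_le_sz y
      rw [hg]
      refine (Nat.pow_le_pow_left ((sz_le_of_mem hy).trans (h1 x)) _).trans ?_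
      exact Nat.pow_le_pow_right (by positivity) (Nat.pow_le_pow_right (by omega) (by omega))
    have hn : (children x).length ≤ sz x ^ c := (length_le_sz _).trans (h1 x)
    obtain ⟨a1, a2, a3⟩ := treeRec_arith (H := ht x) h3 hc1 hK hn
    rw [← hg] at a1 a2 a3
    have hval : sz ((children x).map F) ≤ (children x).length * g + 3 := by
      refine (sz_le_of_forall (b := g) fun z hz => ?_).trans (by simp)
      obtain ⟨y, hy, rfl⟩ := List.mem_map.1 hz
      exact ((ih (ht y) (hx ▸ hht x y hy) y rfl).1).trans (hys y hy)
    refine ⟨?_, fun ts vs => ?_⟩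
    · rw [hF]
      refine (h2 _).trans (le_trans (Nat.pow_le_pow_left ?_ c) a1)
      have := sz_pair x ((children x).map F)
      omega
    · obtain ⟨k, hk, hr⟩ := reach_children (F := F) (children := children)
        (comb := comb) (g := g) (children x) (fun y hy => by
          obtain ⟨b1, b2⟩ := ih (ht y) (hx ▸ hht x y hy) y rfl
          refine ⟨b1.trans (hys y hy), fun ts vs => ?_⟩
          obtain ⟨k, hk, hr⟩ := b2 ts vs
          have := hys y hy
          exact ⟨k, hk.trans this, hr.mono (Nat.add_le_add_left this _)⟩) ((false, x) :: ts) vs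
      have e1 := sz_cons (false, x) ts
      have e2 := sz_pair false x
      have e3 := sz_cons (true, x) ts
      have e4 := sz_pair true x
      have e5 : sz false = 3 := rfl
      have e6 : sz true = 5 := rfl
      have e7 := sz_pair ((true, x) :: ts) vs
      have e8 := sz_append ((children x).map fun y => (true, y)) ((false, x) :: ts)
      have e9 : sz ((children x).map fun y => (true, y)) ≤
          (children x).length * (sz x ^ c + 5) + 3 := by
        refine (sz_le_of_forall (b := sz x ^ c + 5) fun z hz => ?_).trans (by simp)
        obtain ⟨y, hy, rfl⟩ := List.mem_map.1 hz
        have := sz_pair true y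
        have := (sz_le_of_mem hy).trans (h1 x)
        omega
      have e10 := sz_pair ((false, x) :: ts) (((children x).map F).reverse ++ vs)
      have e11 := sz_append ((children x).map F).reverse vs
      rw [sz_reverse] at e11
      have s1 : Hanf.recStep children comb ((true, x) :: ts, vs) =
          ((children x).map (fun y => (true, y)) ++ (false, x) :: ts, vs) := rfl
      have s2 : Hanf.recStep children comb ((false, x) :: ts, ((children x).map F).reverse ++ vs) =
          (ts, F x :: vs) := by
        simp only [Hanf.recStep, Bool.false_eq_true, if_false]
        rw [foldl_popStep _ _ _ _ (by simp), hF x]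
        simp
      have r1 := Reach.step (c := fun s : List (Bool × α) × List β => !s.1.isEmpty)
        (step := Hanf.recStep children comb) (B := sz ts + sz vs + G x) (s := ((true, x) :: ts, vs))
        rfl (by simp only [G]; omega)
      have r3 := Reach.step (c := fun s : List (Bool × α) × List β => !s.1.isEmpty)
        (step := Hanf.recStep children comb) (B := sz ts + sz vs + G x)
        (s := ((false, x) :: ts, ((children x).map F).reverse ++ vs))
        rfl (by simp only [G]; omega)
      rw [s1] at r1
      rw [s2] at r3
      refine ⟨1 + k + 1, by simp only [G]; omega,
        (r1.trans (hr.mono ?_)).trans r3⟩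
      simp only [G]; omega
  choose k hk hr using fun x => (key _ x rfl).2 [] []
  have hG : Bd ht G := ⟨K, fun x => le_rfl⟩
  have hsF : Bd ht (fun x => sz (F x)) := hG.of_le fun x => (key _ x rfl).1
  have hi : Fast ht (fun x : α => ([(true, x)], ([] : List β))) :=
    (((Fast.const _ true).pair (Fast.id _)).cons (Fast.nil _)).pair (Fast.nil _)
  have hfin : Fast ht (fun x : α => (([] : List (Bool × α)), [F x])) :=
    Fast.while (hd := fun _ => 0) (Fast.id _).fst.isEmpty.not (Fast.recStep hch hc) hi
      ((Bd.const _ 6).add hG) (hG.of_le hk)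
      ((hsF.add (Bd.const _ 6)).of_le fun x => by
        have := sz_pair ([] : List (Bool × α)) [F x]
        have := sz_cons (F x) []
        have : sz ([] : List (Bool × α)) = 3 := rfl
        have : sz ([] : List β) = 3 := rfl
        omega)
      (fun x => (hr x).mono le_rfl) (fun _ => rfl) (fun _ _ _ => Nat.zero_le _)
      fun _ => Nat.zero_le _
  refine (hfin.snd.rawHead).cast fun x => rfl

end Recursion

section Numbers

variable {α β γ δ : Type} [Enc α] [Enc β] [Enc γ] [Enc δ]

/-! ### Arithmetic in binary -/

/-- Functions defined by recursion on a list, with access to the tail of the list. -/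
theorem Fast.listRec {h : α → ℕ} {l : α → List β} {F : List β → γ} {g : β → List β → γ → γ}
    (hl : Fast h l) (hg : Fast (fun _ => 0) (fun p : β × List β × γ => g p.1 p.2.1 p.2.2))
    (hF : ∀ b l, F (b :: l) = g b l (F l)) {C : ℕ} (hC : ∀ l, sz (F l) ≤ C * sz l) :
    Fast h (fun x => F (l x)) := by
  refine Fast.comp₀ (g := F) ?_ hl
  have key : ∀ l₁ : List β, l₁.foldl (fun (s : List β × γ) b => (b :: s.1, g b s.1 s.2))
      ([], F []) = (l₁.reverse, F l₁.reverse) := by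
    intro l₁
    induction l₁ using List.reverseRecOn with
    | nil => rfl
    | append_singleton l₁ b ih => simp [ih, hF]
  refine (Fast.foldl (f := fun _ (s : List β × γ) b => (b :: s.1, g b s.1 s.2))
    (Fast.id _).reverse (Fast.const _ ([], F [])) ?_ (B := fun x => sz x + C * sz x)
    ((Bd.size _).add ((Bd.const _ C).mul (Bd.size _))) ?_).snd.of_eq fun x => ?_
  · exact ((Fast.id _).snd.snd.cons (Fast.id _).snd.fst.fst).pair
      (hg.comp₀ ((Fast.id _).snd.snd.pair (Fast.id _).snd.fst))
  · intro x l₁ l₂ e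
    rw [key]
    have h1 := sz_pair l₁.reverse (F l₁.reverse)
    have h2 := hC l₁.reverse
    have h3 : sz l₁.reverse ≤ sz x := by
      rw [sz_reverse, ← sz_reverse x, e]
      exact sz_le_of_sublist (List.sublist_append_left _ _)
    have h4 := Nat.mul_le_mul_left C h3
    omega
  · rw [key, List.reverse_reverse]

/-- Incrementing a number given by its bits. -/
def incBits : List Bool → List Bool
  | [] => [true]
  | false :: l => true :: l
  | true :: l => false :: incBits l

/-- Decrementing a positive number given by its bits. -/
def decBits : List Bool → List Bool
  | [] => []
  | false :: l => true :: decBits l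
  | true :: l => if l.isEmpty then [] else false :: l

theorem bits_double (n : ℕ) : (2 * n).bits = if n.bits.isEmpty then [] else false :: n.bits := by
  rcases Nat.eq_zero_or_pos n with rfl | hn
  · rfl
  · rw [Nat.bit0_bits n (by omega)]
    cases e : n.bits with
    | nil =>
      have := congrArg List.length e
      rw [Nat.size_eq_bits_len] at this
      have := Nat.size_pos.2 hn
      simp at *; omega
    | cons a l => simp

theorem bits_succ (n : ℕ) : (n + 1).bits = incBits n.bits := by
  induction n using Nat.strong_induction_on with
  | _ n ih =>
  rcases Nat.even_or_odd' n with ⟨m, rfl | rfl⟩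
  · rw [Nat.bit1_bits, bits_double]
    cases e : m.bits <;> simp [incBits]
  · rw [Nat.bit1_bits, show 2 * m + 1 + 1 = 2 * (m + 1) by ring, Nat.bit0_bits _ (by omega),
      ih m (by omega), incBits]

theorem bits_pred (n : ℕ) : (n - 1).bits = decBits n.bits := by
  induction n using Nat.strong_induction_on with
  | _ n ih =>
  rcases Nat.even_or_odd' n with ⟨m, rfl | rfl⟩
  · rcases Nat.eq_zero_or_pos m with rfl | hm
    · rfl
    · rw [Nat.bit0_bits m (by omega), show 2 * m - 1 = 2 * (m - 1) + 1 by omega, Nat.bit1_bits,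
        ih m (by omega), decBits]
  · rw [Nat.bit1_bits, Nat.add_sub_cancel, bits_double, decBits]

theorem Fast.bits {h : α → ℕ} {f : α → ℕ} (hf : Fast h f) : Fast h (fun x => (f x).bits) :=
  hf.cast fun _ => rfl

theorem Fast.double {h : α → ℕ} {f : α → ℕ} (hf : Fast h f) : Fast h (fun x => 2 * f x) :=
  (Fast.ite hf.bits.isEmpty (Fast.nil _) ((Fast.const _ false).cons hf.bits)).cast fun x => by
    rw [enc_nat (2 * f x), bits_double]

theorem Fast.doubleSucc {h : α → ℕ} {f : α → ℕ} (hf : Fast h f) :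
    Fast h (fun x => 2 * f x + 1) :=
  ((Fast.const _ true).cons hf.bits).cast fun x => by
    rw [enc_nat (2 * f x + 1), Nat.bit1_bits]

theorem Fast.succ {h : α → ℕ} {f : α → ℕ} (hf : Fast h f) : Fast h (fun x => f x + 1) := by
  refine (Fast.listRec (F := incBits) (C := 3)
    (g := fun b l r => if b then false :: r else true :: l) hf.bits
    (Fast.ite (Fast.id _).fst ((Fast.const _ false).cons (Fast.id _).snd.snd)
      ((Fast.const _ true).cons (Fast.id _).snd.fst)) ?_ ?_).cast fun x => ?_
  · intro b l; cases b <;> rfl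
  · intro l
    have key : sz (incBits l) ≤ sz l + 4 := by
      induction l with
      | nil => simp [incBits, sz, enc, Data.ofList, Data.ofBool, Data.size]
      | cons b l ih =>
        have e5 : sz false = 3 := rfl
        have e6 : sz true = 5 := rfl
        have := sz_cons b l
        cases b
        · have := sz_cons true l
          simp only [incBits]; omega
        · have := sz_cons false (incBits l)
          simp only [incBits]; omega
    have := three_le_sz l
    omega
  · rw [enc_nat (f x + 1), bits_succ]

theorem Fast.pred {h : α → ℕ} {f : α → ℕ} (hf : Fast h f) : Fast h (fun x => f x - 1) := by
  refine (Fast.listRec (F := decBits) (C := 2)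
    (g := fun b l r => if b then (if l.isEmpty then [] else false :: l) else true :: r) hf.bits
    (Fast.ite (Fast.id _).fst (Fast.ite (Fast.id _).snd.fst.isEmpty (Fast.nil _)
      ((Fast.const _ false).cons (Fast.id _).snd.fst))
      ((Fast.const _ true).cons (Fast.id _).snd.snd)) ?_ ?_).cast fun x => ?_
  · intro b l; cases b <;> simp [decBits]
  · intro l
    have e5 : sz false = 3 := rfl
    have e6 : sz true = 5 := rfl
    induction l with
    | nil => simp [decBits, sz_nil]
    | cons b l ih =>
      have := sz_cons b l
      have := three_le_sz l
      cases b
      · have := sz_cons true (decBits l)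
        simp only [decBits]; omega
      · have := sz_cons false l
        simp only [decBits]
        split
        · rw [sz_nil]; omega
        · omega
  · rw [enc_nat (f x - 1), bits_pred]

theorem enc_int (k : ℤ) : enc k = enc (decide (k < 0), k.natAbs) := rfl

theorem Fast.intSucc {h : α → ℕ} {f : α → ℤ} (hf : Fast h f) : Fast h (fun x => f x + 1) := by
  have h1 : Fast h (fun x => (decide (f x < 0), (f x).natAbs)) := hf.cast fun _ => rfl
  refine (Fast.ite h1.fst ((Fast.eq h1.snd.pred (Fast.const _ 0)).not.pair h1.snd.pred)
    ((Fast.const _ false).pair h1.snd.succ)).cast fun x => ?_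
  rw [enc_int (f x + 1)]
  congr 1
  by_cases hx : f x < 0
  · simp only [hx, decide_true, if_true, Prod.mk.injEq]
    refine ⟨?_, by omega⟩
    rw [Bool.eq_iff_iff]; simp; omega
  · simp only [hx, decide_false, Bool.false_eq_true, if_false, Prod.mk.injEq]
    refine ⟨?_, by omega⟩
    rw [Bool.eq_iff_iff]; simp; omega

theorem Fast.intPred {h : α → ℕ} {f : α → ℤ} (hf : Fast h f) : Fast h (fun x => f x - 1) := by
  have h1 : Fast h (fun x => (decide (f x < 0), (f x).natAbs)) := hf.cast fun _ => rfl
  refine (Fast.ite (h1.fst.or (Fast.eq h1.snd (Fast.const _ 0)))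
    ((Fast.const _ true).pair h1.snd.succ) ((Fast.const _ false).pair h1.snd.pred)).cast
      fun x => ?_
  rw [enc_int (f x - 1)]
  congr 1
  by_cases hx : f x < 0 ∨ (f x).natAbs = 0
  · have hx' : (decide (f x < 0) || decide ((f x).natAbs = 0)) = true := by simpa using hx
    simp only [hx', if_true, Prod.mk.injEq]
    refine ⟨?_, by omega⟩
    rw [Bool.eq_iff_iff]; simp; omega
  · have hx' : (decide (f x < 0) || decide ((f x).natAbs = 0)) = false := by simpa using hx
    simp only [hx', Bool.false_eq_true, if_false, Prod.mk.injEq]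
    refine ⟨?_, by omega⟩
    rw [Bool.eq_iff_iff]; simp; omega

theorem length_bits_le_sz (n : ℕ) : n.bits.length ≤ sz n := length_le_sz n.bits

theorem sz_nat_le (n : ℕ) : sz n ≤ 5 * n.bits.length + 3 := by
  have : sz n = sz n.bits := rfl
  rw [this, mul_comm]
  refine sz_le_of_forall fun b _ => ?_
  cases b <;> decide

theorem length_bits_add_le (m j : ℕ) : (m + j).bits.length ≤ m.bits.length + j := by
  rw [Nat.size_eq_bits_len, Nat.size_eq_bits_len, Nat.size_le]
  have h1 := Nat.lt_size_self m
  have h2 : j < 2 ^ j := Nat.lt_two_pow_self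
  have h3 : 1 ≤ 2 ^ m.size := Nat.one_le_two_pow
  rw [pow_add]
  nlinarith

theorem sz_int_le {k k' : ℤ} {j : ℕ} (h : k'.natAbs ≤ k.natAbs + j) :
    sz k' ≤ 5 * (sz k + j) + 10 := by
  have h1 : sz k' + 1 = sz (decide (k' < 0)) + sz k'.natAbs :=
    sz_pair (decide (k' < 0)) k'.natAbs
  have h2 : sz k + 1 = sz (decide (k < 0)) + sz k.natAbs :=
    sz_pair (decide (k < 0)) k.natAbs
  have h3 := three_le_sz (decide (k < 0))
  have h4 : sz (decide (k' < 0)) ≤ 5 := by cases decide (k' < 0) <;> decide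
  have h5 := sz_nat_le k'.natAbs
  have h6 := length_bits_add_le k.natAbs j
  have h7 := length_bits_le_sz k.natAbs
  have h8 : k'.natAbs.bits.length ≤ (k.natAbs + j).bits.length := by
    rw [Nat.size_eq_bits_len, Nat.size_eq_bits_len]
    exact Nat.size_le_size h
  omega

theorem Fast.intSub {h : α → ℕ} {f : α → ℤ} {l : α → List β} (hf : Fast h f) (hl : Fast h l) :
    Fast h (fun x => f x - (l x).length) := by
  have key : ∀ (l : List β) (k : ℤ), l.foldl (fun k _ => k - 1) k = k - l.length := by
    intro l
    induction l with
    | nil => simp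
    | cons a l ih => intro k; simp [ih]; ring
  refine (Fast.foldl (f := fun _ k _ => k - 1) hl hf (Fast.id _).snd.fst.intPred
    (B := fun x => 5 * (sz (f x) + sz (l x)) + 10)
    (((Bd.const _ 5).mul (hf.size.add hl.size)).add (Bd.const _ 10)) ?_).of_eq fun x => key _ _
  intro x l₁ l₂ e
  rw [key]
  refine (sz_int_le (k := f x) (j := l₁.length) (by omega)).trans ?_
  have := length_le_sz (l x)
  have e' := congrArg List.length e
  rw [List.length_append] at e'
  omega

theorem Fast.intAdd {h : α → ℕ} {f : α → ℤ} {l : α → List β} (hf : Fast h f) (hl : Fast h l) :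
    Fast h (fun x => f x + (l x).length) := by
  have key : ∀ (l : List β) (k : ℤ), l.foldl (fun k _ => k + 1) k = k + l.length := by
    intro l
    induction l with
    | nil => simp
    | cons a l ih => intro k; simp [ih]; ring
  refine (Fast.foldl (f := fun _ k _ => k + 1) hl hf (Fast.id _).snd.fst.intSucc
    (B := fun x => 5 * (sz (f x) + sz (l x)) + 10)
    (((Bd.const _ 5).mul (hf.size.add hl.size)).add (Bd.const _ 10)) ?_).of_eq fun x => key _ _
  intro x l₁ l₂ e
  rw [key]
  refine (sz_int_le (k := f x) (j := l₁.length) (by omega)).trans ?_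
  have := length_le_sz (l x)
  have e' := congrArg List.length e
  rw [List.length_append] at e'
  omega

end Numbers

/-! ### Formulas as untyped syntax trees -/

/-- Formulas without reference to a signature or a set of predicate names: relation symbols and
predicate names are given by numbers. Programs work on these. -/
inductive Raw : Type
  | eq (x y : ℕ) : Raw
  | rel (R : ℕ) (x : List ℕ) : Raw
  | neg (φ : Raw) : Raw
  | or (φ ψ : Raw) : Raw
  | ex (y : ℕ) (φ : Raw) : Raw
  | num (P : ℕ) (y : ℕ) (φ : Raw) (k : ℤ) : Raw

namespace Raw

/-- The representation as a tree, which agrees with the representation of formulas with a signature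
(`Formula.enc_erase`). -/
def encode : Raw → Data
  | eq x y => enc ((0 : ℕ), x, y, ())
  | rel R x => enc ((1 : ℕ), R, x, ())
  | neg φ => Data.cons (enc (2 : ℕ)) (Data.cons φ.encode Data.nil)
  | or φ ψ => Data.cons (enc (3 : ℕ)) (Data.cons φ.encode (Data.cons ψ.encode Data.nil))
  | ex y φ => Data.cons (enc (4 : ℕ)) (Data.cons (enc y) (Data.cons φ.encode Data.nil))
  | num P y φ k => Data.cons (enc (5 : ℕ)) (Data.cons (enc P) (Data.cons (enc y)
      (Data.cons φ.encode (Data.cons (enc k) Data.nil))))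

instance : Enc Raw := ⟨encode⟩

/-- The constructor of a formula. -/
def tag : Raw → ℕ
  | eq _ _ => 0
  | rel _ _ => 1
  | neg _ => 2
  | or _ _ => 3
  | ex _ _ => 4
  | num _ _ _ _ => 5

/-- The first number in a formula: a variable, a relation symbol or a predicate name. -/
def fst : Raw → ℕ
  | eq x _ => x
  | rel R _ => R
  | ex y _ => y
  | num P _ _ _ => P
  | _ => 0

/-- The second number in a formula, which is a variable. -/
def snd : Raw → ℕ
  | eq _ y => y
  | num _ y _ _ => y
  | _ => 0

/-- The arguments of an atomic formula with a relation symbol. -/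
def args : Raw → List ℕ
  | rel _ l => l
  | _ => []

/-- The first immediate subformula, or a default. -/
def sub : Raw → Raw
  | neg φ => φ
  | or φ _ => φ
  | ex _ φ => φ
  | num _ _ φ _ => φ
  | _ => eq 0 0

/-- The second immediate subformula, or a default. -/
def sub' : Raw → Raw
  | or _ ψ => ψ
  | _ => eq 0 0

/-- The integer that is subtracted in a numerical condition, or zero. -/
def int : Raw → ℤ
  | num _ _ _ k => k
  | _ => 0

end Raw

section RawFast

variable {α : Type} [Enc α] {h : α → ℕ} {r s : α → Raw} {x y P : α → ℕ} {l : α → List ℕ}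
  {k : α → ℤ}

theorem Fast.rawEq (hx : Fast h x) (hy : Fast h y) : Fast h (fun a => Raw.eq (x a) (y a)) :=
  ((Fast.const _ (0 : ℕ)).pair (hx.pair (hy.pair (Fast.const _ ())))).cast fun _ => rfl

theorem Fast.rawRel (hx : Fast h x) (hl : Fast h l) : Fast h (fun a => Raw.rel (x a) (l a)) :=
  ((Fast.const _ (1 : ℕ)).pair (hx.pair (hl.pair (Fast.const _ ())))).cast fun _ => rfl

theorem Fast.rawNeg (hr : Fast h r) : Fast h (fun a => Raw.neg (r a)) :=
  ((Fast.const _ (2 : ℕ)).pair (hr.pair (Fast.const _ ()))).cast fun _ => rfl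

theorem Fast.rawOr (hr : Fast h r) (hs : Fast h s) : Fast h (fun a => Raw.or (r a) (s a)) :=
  ((Fast.const _ (3 : ℕ)).pair (hr.pair (hs.pair (Fast.const _ ())))).cast fun _ => rfl

theorem Fast.rawEx (hx : Fast h x) (hr : Fast h r) : Fast h (fun a => Raw.ex (x a) (r a)) :=
  ((Fast.const _ (4 : ℕ)).pair (hx.pair (hr.pair (Fast.const _ ())))).cast fun _ => rfl

theorem Fast.rawNum (hP : Fast h P) (hx : Fast h x) (hr : Fast h r) (hk : Fast h k) :
    Fast h (fun a => Raw.num (P a) (x a) (r a) (k a)) :=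
  ((Fast.const _ (5 : ℕ)).pair (hP.pair (hx.pair (hr.pair (hk.pair (Fast.const _ ())))))).cast
    fun _ => rfl

theorem Fast.tag (hr : Fast h r) : Fast h (fun a => (r a).tag) :=
  hr.rawHead.cast fun a => by cases r a <;> rfl

theorem Fast.tagEq (hr : Fast h r) (i : ℕ) : Fast h (fun a => decide ((r a).tag = i)) :=
  Fast.eq hr.tag (Fast.const _ i)

/-- A component of formulas that occurs under some of the constructors only. -/
theorem Fast.component {γ : Type} [Enc γ] (f : Raw → γ) (c : ℕ → Bool) (d : γ)
    {D : Raw → Data} (hc : Fast h (fun a => c (r a).tag))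
    (hD : Fast h (fun a => D (r a))) (h1 : ∀ r, c r.tag = true → enc (f r) = D r)
    (h2 : ∀ r, ¬ c r.tag = true → f r = d) : Fast h (fun a => f (r a)) := by
  refine (Fast.dite (f := fun a => f (r a.1)) (g := fun _ => d) hc
    ((hD.restrict _).cast fun a => (h1 _ a.2).symm) (Fast.const _ d)).of_eq fun a => ?_
  by_cases e : c (r a).tag = true
  · simp [e]
  · simp [e, h2 _ e]

theorem Fast.rawFst (hr : Fast h r) : Fast h (fun a => (r a).fst) :=
  Fast.component (D := fun r => (enc r).tail.head) Raw.fst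
    (fun i => !(decide (i = 2) || decide (i = 3))) 0
    ((hr.tagEq 2).or (hr.tagEq 3)).not hr.rawTail.rawHead
    (fun r e => by cases r <;> first | rfl | simp [Raw.tag] at e)
    (fun r e => by cases r <;> first | rfl | simp [Raw.tag] at e)

theorem Fast.rawSnd (hr : Fast h r) : Fast h (fun a => (r a).snd) :=
  Fast.component (D := fun r => (enc r).tail.tail.head) Raw.snd
    (fun i => decide (i = 0) || decide (i = 5)) 0
    ((hr.tagEq 0).or (hr.tagEq 5)) hr.rawTail.rawTail.rawHead
    (fun r e => by cases r <;> first | rfl | simp [Raw.tag] at e)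
    (fun r e => by cases r <;> first | rfl | simp [Raw.tag] at e)

theorem Fast.rawArgs (hr : Fast h r) : Fast h (fun a => (r a).args) :=
  Fast.component (D := fun r => (enc r).tail.tail.head) Raw.args
    (fun i => decide (i = 1)) []
    (hr.tagEq 1) hr.rawTail.rawTail.rawHead
    (fun r e => by cases r <;> first | rfl | simp [Raw.tag] at e)
    (fun r e => by cases r <;> first | rfl | simp [Raw.tag] at e)

theorem Fast.rawInt (hr : Fast h r) : Fast h (fun a => (r a).int) :=
  Fast.component (D := fun r => (enc r).tail.tail.tail.tail.head) Raw.int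
    (fun i => decide (i = 5)) 0
    (hr.tagEq 5) hr.rawTail.rawTail.rawTail.rawTail.rawHead
    (fun r e => by cases r <;> first | rfl | simp [Raw.tag] at e)
    (fun r e => by cases r <;> first | rfl | simp [Raw.tag] at e)

theorem Fast.rawSub' (hr : Fast h r) : Fast h (fun a => (r a).sub') :=
  Fast.component (D := fun r => (enc r).tail.tail.head) Raw.sub'
    (fun i => decide (i = 3)) (Raw.eq 0 0)
    (hr.tagEq 3) hr.rawTail.rawTail.rawHead
    (fun r e => by cases r <;> first | rfl | simp [Raw.tag] at e)
    (fun r e => by cases r <;> first | rfl | simp [Raw.tag] at e)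

theorem Fast.rawSub (hr : Fast h r) : Fast h (fun a => (r a).sub) :=
  Fast.component Raw.sub (fun i => !(decide (i = 0) || decide (i = 1))) (Raw.eq 0 0)
    (D := fun r => if decide (r.tag = 5) then (enc r).tail.tail.tail.head else
      if decide (r.tag = 4) then (enc r).tail.tail.head else (enc r).tail.head)
    ((hr.tagEq 0).or (hr.tagEq 1)).not
    (Fast.ite (hr.tagEq 5) hr.rawTail.rawTail.rawTail.rawHead
      (Fast.ite (hr.tagEq 4) hr.rawTail.rawTail.rawHead hr.rawTail.rawHead))
    (fun r e => by cases r <;> first | rfl | simp [Raw.tag] at e)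
    (fun r e => by cases r <;> first | rfl | simp [Raw.tag] at e)

end RawFast

/-! ### The algorithm -/

/-- The elements of `l` are added to `l'`, unless they are in there already. -/
def addNew (l' l : List ℕ) : List ℕ := l.foldl (fun acc x => acc.insert x) l'

namespace Raw

/-- Disjunction of a list, of the same shape as `Formula.bigOr`. -/
def bigOr (y : ℕ) : List Raw → Raw
  | [] => neg (eq y y)
  | [φ] => φ
  | φ :: ψ :: l => or φ (bigOr y (ψ :: l))

/-- Conjunction of a list. -/
def bigAnd (y : ℕ) (l : List Raw) : Raw := neg (bigOr y (l.map neg))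

/-- A false sentence of the form admitted in weak Hanf normal forms: the number of elements of a
type from the empty set is positive. The number `0` is the code of `P_∃`. -/
def bot : Raw := num 0 0 (bigOr 0 []) 0

/-- Existential quantification of a list of variables. -/
def exs (vs : List ℕ) (φ : Raw) : Raw := vs.foldr ex φ

/-- The binding rank, in unary. -/
def br : Raw → List Unit
  | eq _ _ => []
  | rel _ _ => []
  | neg φ => φ.br
  | or φ ψ => φ.br ++ ψ.br.drop φ.br.length
  | ex _ φ => () :: φ.br
  | num _ _ φ _ => () :: φ.br

/-- The free variables, without repetitions. -/
def free : Raw → List ℕ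
  | eq x y => addNew [x] [y]
  | rel _ l => addNew [] l
  | neg φ => φ.free
  | or φ ψ => addNew φ.free ψ.free
  | ex y φ => φ.free.filter (fun x => !decide (x = y))
  | num _ y φ _ => φ.free.filter (fun x => !decide (x = y))

/-- All variables. -/
def vars : Raw → List ℕ
  | eq x y => [x, y]
  | rel _ l => l
  | neg φ => φ.vars
  | or φ ψ => φ.vars ++ ψ.vars
  | ex y φ => y :: φ.vars
  | num _ y φ _ => y :: φ.vars

/-- The height of the syntax tree. -/
def height : Raw → ℕ
  | eq _ _ => 0
  | rel _ _ => 0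
  | neg φ => φ.height + 1
  | or φ ψ => max φ.height ψ.height + 1
  | ex _ φ => φ.height + 1
  | num _ _ φ _ => φ.height + 1

end Raw

/-- A relation symbol together with a tuple of letters. Letters are the elements of the small
structures that are enumerated by the algorithm; they also serve as variables. -/
abbrev Tup := ℕ × List ℕ

/-- A structure on the set of letters, given by the truth values of all atomic statements. -/
abbrev Diag := List (Tup × Bool)

/-- The elements of the universal structure: letters, together with the name of a copy and a
structure on the letters. -/
abbrev Elem := ℕ × ℕ × Diag

/-- Partial assignments of elements of the universal structure. -/
abbrev Env := List (ℕ × Elem)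

/-- The lists that the translation of a formula makes use of. -/
structure Params where
  /-- the letters -/
  letters : List ℕ
  /-- the atomic statements about letters -/
  tups : List Tup
  /-- the relation symbols, each with a tuple of variables that are used nowhere else -/
  rels : List (ℕ × List ℕ)
  /-- the functions from letters to letters -/
  maps : List (List (ℕ × ℕ))
  /-- the elements of the universal structure -/
  U : List Elem
  /-- the subsets of the universal structure -/
  W : List (List (Elem × Bool))

instance : Enc Params := ⟨fun p => enc (p.letters, p.tups, p.rels, p.maps, p.U, p.W)⟩

/-- The atomic statement `t` is true in `D`. -/
def Diag.holds (D : Diag) (t : Tup) : Bool := decide ((t, true) ∈ D)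

/-- The letters of distance at most one from `N`. -/
def nbStep (ls : List ℕ) (D : Diag) (N : List ℕ) : List ℕ :=
  ls.filter fun m => decide (m ∈ N) ||
    D.any fun t => t.2 && (decide (m ∈ t.1.2) && t.1.2.any fun j => decide (j ∈ N))

/-- The letters of distance at most `r` from `cs`. -/
def ballList (ls : List ℕ) (D : Diag) (cs : List ℕ) (r : List Unit) : List ℕ :=
  r.foldl (fun N _ => nbStep ls D N) (ls.filter fun m => decide (m ∈ cs))

/-- No tuple of the relation `R` contains an element of `N'` and an element outside `N`. -/
def closedFormula (y : ℕ) (N' N : List ℕ) (R : ℕ × List ℕ) : Raw :=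
  Raw.neg (Raw.exs R.2 (Raw.bigAnd y [Raw.rel R.1 R.2,
    Raw.bigOr y (R.2.flatMap fun j => N'.map fun i => Raw.eq j i),
    Raw.bigOr y (R.2.map fun j => Raw.bigAnd y (N.map fun i => Raw.neg (Raw.eq j i)))]))

/-- The sphere-formula for the `r`-sphere of a tuple of letters in the structure `D`. The list
`xs` consists of the variables and the letters that correspond to them. The formula says that the
letters of the sphere, used as variables, can be assigned pairwise distinct elements that satisfy
the same atomic statements, such that the elements assigned to the inner letters of the sphere
occur in no tuple with elements outside the sphere. -/
def sphereFormula (p : Params) (D : Diag) (r : List Unit) (xs : List (ℕ × ℕ)) : Raw :=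
  let cs := xs.map Prod.snd
  let N := ballList p.letters D cs r
  let N' := if r.isEmpty then [] else ballList p.letters D cs r.tail
  let y := N.headD 0
  Raw.exs N (Raw.bigAnd y (
    xs.map (fun q => Raw.eq q.1 q.2) ++
    (N.flatMap (fun i => (N.filter fun j => !decide (i = j)).map fun j =>
      Raw.neg (Raw.eq i j)) ++
    ((p.tups.filter fun t => t.2.all fun i => decide (i ∈ N)).map (fun t =>
      if D.holds t then Raw.rel t.1 t.2 else Raw.neg (Raw.rel t.1 t.2)) ++
    p.rels.map (closedFormula y N' N)))))

/-- The value of an assignment at `x`; the first entry counts. -/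
def Env.lookup (e : Env) (x : ℕ) : Elem :=
  ((e.filter fun q => decide (q.1 = x)).map Prod.snd).headD (0, 0, [])

/-- Application of a function given as a list of pairs. -/
def apply (π : List (ℕ × ℕ)) (x : ℕ) : ℕ :=
  ((π.filter fun q => decide (q.1 = x)).map Prod.snd).headD 0

/-- `π` is an isomorphism between the `r`-spheres of `b` and `b'` in the universal structure. -/
def isoVia (p : Params) (r : List Unit) (b b' : Elem) (π : List (ℕ × ℕ)) : Bool :=
  let N := ballList p.letters b.2.2 [b.1] r
  let N' := ballList p.letters b'.2.2 [b'.1] r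
  decide (apply π b.1 = b'.1) &&
  ((N.all fun i => N.all fun j => decide (i = j) || !decide (apply π i = apply π j)) &&
  ((p.tups.all fun t => !(t.2.all fun i => decide (i ∈ N)) ||
    decide (b.2.2.holds t = b'.2.2.holds (t.1, t.2.map (apply π)))) &&
  ((N.all fun i => decide (apply π i ∈ N')) &&
  (N'.all fun m => N.any fun i => decide (apply π i = m)))))

/-- The `r`-spheres of `b` and `b'` in the universal structure are isomorphic, by exhaustive search. -/
def isoTest (p : Params) (r : List Unit) (b b' : Elem) : Bool := p.maps.any (isoVia p r b b')

/-- A maximal sublist of elements with pairwise non-isomorphic `r`-spheres. -/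
def reps (p : Params) (r : List Unit) (l : List Elem) : List Elem :=
  l.foldl (fun T b => if T.any (fun b' => isoTest p r b b') then T else b :: T) []

/-- The element `b` of the universal structure has distance at most `r` from the values of the
assignment `e`. -/
def isNear (p : Params) (e : Env) (r : List Unit) (b : Elem) : Bool :=
  decide (b.1 ∈ ballList p.letters b.2.2
    ((e.filter fun q => decide (q.2.2 = b.2)).map fun q => q.2.1) r)

/-- The sentence `P(#(y).⋁ sph_τ(y) - k')` that stands for `P(#(y).φ - k)`, if the elements of
the universal structure that satisfy `φ` under the assignment `e` are given by `w`, and if `φ`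
speaks about spheres of radius `r`. The types `τ` are those of elements of `w` that are not near
to the values of the assignment, and `k'` is `k` corrected by the number of near elements in `w`
and by the number of near elements with one of the types `τ`. -/
def condition (p : Params) (e : Env) (r : List Unit) (P y : ℕ) (k : ℤ)
    (w : List (Elem × Bool)) : Raw :=
  let R := r ++ (r ++ [()])
  let T := reps p r ((w.filter fun q => q.2 && !isNear p e R q.1).map Prod.fst)
  Raw.num P y (Raw.bigOr y (T.map fun b => sphereFormula p b.2.2 r [(y, b.1)]))
    (k - (w.filter fun q => q.2 && isNear p e R q.1).length +
      (p.U.filter fun b => isNear p e R b && T.any fun b' => isoTest p r b b').length)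

/-- The sentence that says that precisely those of the sentences `vals` hold that are indicated
by `w`, and moreover `χ`. -/
def ofTruthValues (vals : List Raw) (w : List (Elem × Bool)) (χ : Raw) : Raw :=
  Raw.neg (Raw.bigOr 0 ((w.zip vals).map (fun q => if q.1.2 then Raw.neg q.2 else q.2) ++
    [Raw.neg χ]))

/-- The sentence that stands for `P(#(y).φ - k)`, where the sentences `vals` stand for `φ`, with
`y` interpreted by the elements of the universal structure. -/
def quantifier (p : Params) (e : Env) (r : List Unit) (P y : ℕ) (k : ℤ) (vals : List Raw) : Raw :=
  Raw.bigOr 0 (p.W.map fun w => ofTruthValues vals w (condition p e r P y k w))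

/-- The atomic formula with relation symbol `R` holds of elements `us` of the universal
structure. -/
def relHolds (R : ℕ) (us : List Elem) : Bool :=
  (us.all fun u => us.all fun v => decide (u.2 = v.2)) &&
    (us.any fun u => u.2.2.holds (R, us.map Prod.fst))

/-- A sentence with the given truth value, built from the false sentence `Raw.bot`. -/
def ofBool (b : Bool) : Raw := if b then Raw.neg Raw.bot else Raw.bot

/-- A sentence that is equivalent to `φ` in all structures with elements whose spheres are
isomorphic to those of the values of the assignment `e` in the universal structure. The list `ρ`
starts with the radius that is relevant for `φ`, followed by the radii for the scopes of nested
quantifiers. -/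
def eval (p : Params) : Raw → Env → List (List Unit) → Raw
  | .eq x y, e, _ => ofBool (decide (e.lookup x = e.lookup y))
  | .rel R l, e, _ => ofBool (relHolds R (l.map e.lookup))
  | .neg φ, e, ρ => .neg (eval p φ e ρ)
  | .or φ ψ, e, ρ => .or (eval p φ e ρ) (eval p ψ e ρ)
  | .ex y φ, e, ρ => quantifier p e (ρ.tail.headD []) 0 y 0
      (p.U.map fun b => eval p φ ((y, b) :: e) ρ.tail)
  | .num P y φ k, e, ρ => quantifier p e (ρ.tail.headD []) (P + 1) y k
      (p.U.map fun b => eval p φ ((y, b) :: e) ρ.tail)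

/-- All ways to mark the elements of a list as true or false. -/
def signs {α : Type} (l : List α) : List (List (α × Bool)) :=
  (l.map fun a => [(a, true), (a, false)]).sections

/-- The list of the radii `(3 ^ j - 1) / 2`, in unary and in decreasing order. -/
def radii (k : List Unit) : List (List Unit) :=
  k.foldl (fun ρ _ => if ρ.isEmpty then [[]]
    else (ρ.headD [] ++ (ρ.headD [] ++ (ρ.headD [] ++ [()]))) :: ρ) []

/-- A number in unary. -/
def unary (n : ℕ) : List Unit :=
  n.bits.reverse.foldl (fun l b => l ++ (l ++ if b then [()] else [])) []

/-- A positive number that is larger than all numbers in a list. -/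
def above (l : List ℕ) : ℕ := (l.flatMap Nat.bits).foldl (fun v _ => 2 * v) 1

/-- The binary logarithm of the number of letters. It has to be so large that every sphere of the
radius that is relevant for `φ` in a `d`-bounded structure can be named by letters. -/
def logLetters (d : ℕ) (φ : Raw) : List Unit :=
  (φ.free.map fun _ => ()) ++ (φ.br ++
    ((radii (() :: φ.br)).headD []).flatMap fun _ => d.bits.map fun _ => ())

/-- The letters: an interval of numbers larger than all variables of `φ`. -/
def lettersOf (d : ℕ) (φ : Raw) : List ℕ :=
  (logLetters d φ).foldl (fun ls _ => ls.flatMap fun v => [2 * v, 2 * v + 1]) [above φ.vars]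

/-- A tuple of `a` variables larger than all letters, if `v` is the first letter. -/
def auxVars (v a : ℕ) : List ℕ := (unary a).foldl (fun vs _ => (2 * vs.headD v) :: vs) []

/-- The list with its elements numbered, starting with zero. -/
def number {α : Type} (l : List α) : List (ℕ × α) :=
  (l.foldl (fun (s : ℕ × List (ℕ × α)) a => (s.1 + 1, s.2 ++ [(s.1, a)])) (0, [])).2

/-- The relation symbols of the signature with arities `σ`, each with a tuple of auxiliary variables. -/
def relsOf (ls : List ℕ) (σ : List ℕ) : List (ℕ × List ℕ) :=
  number (σ.map (auxVars (ls.headD 0)))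

/-- All atomic statements about letters. -/
def tupsOf (ls : List ℕ) (rels : List (ℕ × List ℕ)) : List Tup :=
  rels.flatMap fun R => (R.2.map fun _ => ls).sections.map fun t => (R.1, t)

/-- The universe of the universal structure: all letters of all copies of the structures `Ds`, with one
copy for each letter. -/
def elems (ls : List ℕ) (Ds : List Diag) : List Elem :=
  ls.flatMap fun i => ls.flatMap fun c => Ds.map fun D => (i, c, D)

/-- All functions from letters to letters, as lists of pairs. -/
def functions (ls : List ℕ) : List (List (ℕ × ℕ)) :=
  (ls.map fun i => ls.map fun j => (i, j)).sections

/-- The lists for given letters `ls` and a given list `σ` of arities. -/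
def paramsOf (ls : List ℕ) (σ : List ℕ) : Params where
  letters := ls
  tups := tupsOf ls (relsOf ls σ)
  rels := relsOf ls σ
  maps := functions ls
  U := elems ls (signs (tupsOf ls (relsOf ls σ)))
  W := signs (elems ls (signs (tupsOf ls (relsOf ls σ))))

/-- The part of the normal form that belongs to a structure `D` on the letters and to the
assignment `xs` of letters to the free variables. -/
def disjunct (p : Params) (φ : Raw) (ρ : List (List Unit)) (D : Diag) (xs : List (ℕ × ℕ)) : Raw :=
  Raw.bigAnd 0 [sphereFormula p D (ρ.headD []) xs,
    eval p φ (xs.map fun q => (q.1, q.2, p.letters.headD 0, D)) ρ]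

/-- The normal form in terms of the parameters. -/
def normalFormWith (p : Params) (φ : Raw) (ρ : List (List Unit)) : Raw :=
  if φ.free.isEmpty then eval p φ [] ρ
  else Raw.bigOr 0 (((signs p.tups).flatMap fun D =>
    (φ.free.map fun x => p.letters.map fun i => (x, i)).sections.map fun xs =>
      disjunct p φ ρ D xs) ++ [Raw.bot])

/-- The weak Hanf normal form of the formula `φ` over the signature with arities `σ`, for
`d`-bounded structures. -/
def normalForm (d : ℕ) (σ : List ℕ) (φ : Raw) : Raw :=
  normalFormWith (paramsOf (lettersOf d φ) σ) φ (radii (() :: φ.br))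

section AlgorithmFast

variable {α β γ δ : Type} [Enc α] [Enc β] [Enc γ] [Enc δ] {h : α → ℕ}

/-! ### The running time of the algorithm -/

theorem Fast.weaken₂ {f : α → γ} (hf : Fast h f) :
    Fast (fun p : (α × β) × δ => h p.1.1) (fun p => f p.1.1) := hf.weaken.weaken

theorem bigOr_eq_foldl (y : ℕ) (l : List Raw) (φ : Raw) :
    Raw.bigOr y (l ++ [φ]) = l.reverse.foldl (fun acc ψ => Raw.or ψ acc) φ := by
  induction l with
  | nil => rfl
  | cons ψ l ih =>
    rw [List.reverse_cons, List.foldl_append, ← ih]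
    cases l <;> rfl

theorem sz_or (φ ψ : Raw) : sz (Raw.or φ ψ) ≤ sz φ + sz ψ + 20 := by
  change (Data.cons (enc (3 : ℕ)) (Data.cons (enc φ) (Data.cons (enc ψ) Data.nil))).size + 2 ≤ _
  have : (enc (3 : ℕ)).size = 9 := by decide
  simp only [sz, Data.size, this]; omega

theorem Fast.bigOr {y : α → ℕ} {l : α → List Raw} (hy : Fast h y) (hl : Fast h l) :
    Fast h (fun x => Raw.bigOr (y x) (l x)) := by
  refine Fast.comp₀ (g := fun p : ℕ × List Raw => Raw.bigOr p.1 p.2) ?_ (hy.pair hl)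
  have i : Fast (fun _ => 0) (fun p : ℕ × List Raw => p) := Fast.id _
  have j : Fast (fun _ => 0) (fun p : (ℕ × List Raw) × Raw × List Raw => p) := Fast.id _
  refine (Fast.listCases (l := fun p : ℕ × List Raw => p.2.reverse)
    (g := fun q => q.2.2.foldl (fun acc ψ => Raw.or ψ acc) q.2.1) i.snd.reverse
    (i.fst.rawEq i.fst).rawNeg ?_).of_eq fun p => ?_
  · refine Fast.foldl (f := fun _ acc ψ => Raw.or ψ acc) j.snd.snd j.snd.fst
      ((Fast.id _).snd.snd.rawOr (Fast.id _).snd.fst) (B := fun q => 30 * sz q.2)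
      ((Bd.const _ 30).mul j.snd.size) ?_
    intro q l₁ l₂ e
    have key : ∀ l₁ : List Raw, sz (l₁.foldl (fun acc ψ => Raw.or ψ acc) q.2.1) ≤
        sz q.2.1 + 20 * sz l₁ := by
      intro l₁
      induction l₁ using List.reverseRecOn with
      | nil => simp
      | append_singleton l₁ a ih =>
        rw [List.foldl_append, List.foldl_cons, List.foldl_nil]
        have h1 := sz_or a (l₁.foldl (fun acc ψ => Raw.or ψ acc) q.2.1)
        have h2 := sz_append l₁ [a]
        have h3 := sz_cons a []
        have h4 := sz_nil (α := Raw)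
        have h5 := three_le_sz a
        omega
    have h1 := key l₁
    have h2 : sz l₁ ≤ sz q.2.2 := by
      rw [e]; exact sz_le_of_sublist (List.sublist_append_left _ _)
    have h3 := sz_pair q.2.1 q.2.2
    have h4 := three_le_sz q.2.1
    have h5 := three_le_sz q.2.2
    have h6 : sz q.2 + 1 = sz q.2.1 + sz q.2.2 := h3
    omega
  · obtain ⟨y, l⟩ := p
    cases l using List.reverseRecOn with
    | nil => rfl
    | append_singleton l φ => simp [bigOr_eq_foldl]

theorem Fast.bigAnd {y : α → ℕ} {l : α → List Raw} (hy : Fast h y) (hl : Fast h l) :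
    Fast h (fun x => Raw.bigAnd (y x) (l x)) :=
  (Fast.bigOr hy (Fast.map (f := fun _ r => Raw.neg r) hl (Fast.id _).snd.rawNeg)).rawNeg

theorem sz_ex (v : ℕ) (φ : Raw) : sz (Raw.ex v φ) ≤ sz v + sz φ + 20 := by
  change (Data.cons (enc (4 : ℕ)) (Data.cons (enc v) (Data.cons (enc φ) Data.nil))).size + 2 ≤ _
  have : (enc (4 : ℕ)).size = 9 := by decide
  simp only [sz, Data.size, this]; omega

theorem Fast.exs {v : α → List ℕ} {r : α → Raw} (hv : Fast h v) (hr : Fast h r) :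
    Fast h (fun x => Raw.exs (v x) (r x)) := by
  refine Fast.comp₀ (g := fun p : List ℕ × Raw => Raw.exs p.1 p.2) ?_ (hv.pair hr)
  refine (Fast.foldl (f := fun _ φ v => Raw.ex v φ) (Fast.id _).fst.reverse (Fast.id _).snd
    ((Fast.id _).snd.snd.rawEx (Fast.id _).snd.fst) (B := fun q => 30 * sz q)
      ((Bd.const _ 30).mul (Bd.size _)) ?_).of_eq fun p => ?_
  · intro q l₁ l₂ e
    have key : ∀ l₁ : List ℕ, sz (l₁.foldl (fun φ v => Raw.ex v φ) q.2) ≤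
        sz q.2 + 20 * sz l₁ := by
      intro l₁
      induction l₁ using List.reverseRecOn with
      | nil => simp
      | append_singleton l₁ a ih =>
        rw [List.foldl_append, List.foldl_cons, List.foldl_nil]
        have h1 := sz_ex a (l₁.foldl (fun φ v => Raw.ex v φ) q.2)
        have h2 := sz_append l₁ [a]
        have h3 := sz_cons a []
        have h4 := sz_nil (α := ℕ)
        have h5 := three_le_sz a
        omega
    have h1 := key l₁
    have h2 : sz l₁ ≤ sz q.1.reverse := by
      rw [e]; exact sz_le_of_sublist (List.sublist_append_left _ _)
    rw [sz_reverse] at h2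
    have h3 : sz q + 1 = sz q.1 + sz q.2 := sz_pair q.1 q.2
    have h4 := three_le_sz q.1
    have h5 := three_le_sz q.2
    omega
  · rw [Raw.exs, List.foldl_reverse]

variable {p : α → Params}

theorem Fast.params (hp : Fast h p) :
    Fast h (fun x => ((p x).letters, (p x).tups, (p x).rels, (p x).maps, (p x).U, (p x).W)) :=
  hp.cast fun _ => rfl

theorem Fast.letters (hp : Fast h p) : Fast h (fun x => (p x).letters) := hp.params.fst

theorem Fast.tups (hp : Fast h p) : Fast h (fun x => (p x).tups) := hp.params.snd.fst

theorem Fast.rels (hp : Fast h p) : Fast h (fun x => (p x).rels) := hp.params.snd.snd.fst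

theorem Fast.maps (hp : Fast h p) : Fast h (fun x => (p x).maps) := hp.params.snd.snd.snd.fst

theorem Fast.universe (hp : Fast h p) : Fast h (fun x => (p x).U) :=
  hp.params.snd.snd.snd.snd.fst

theorem Fast.subsets (hp : Fast h p) : Fast h (fun x => (p x).W) :=
  hp.params.snd.snd.snd.snd.snd

theorem Fast.holds {D : α → Diag} {t : α → Tup} (hD : Fast h D) (ht : Fast h t) :
    Fast h (fun x => (D x).holds (t x)) :=
  (Fast.mem (ht.pair (Fast.const _ true)) hD).of_eq fun x => by simp [Diag.holds]

theorem Fast.ballList {ls : α → List ℕ} {D : α → Diag} {cs : α → List ℕ} {r : α → List Unit}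
    (hls : Fast h ls) (hD : Fast h D) (hcs : Fast h cs) (hr : Fast h r) :
    Fast h (fun x => ballList (ls x) (D x) (cs x) (r x)) := by
  have hstep : Fast (fun _ => 0) (fun q : List ℕ × Diag × List ℕ => nbStep q.1 q.2.1 q.2.2) := by
    have i : Fast (fun _ => 0) (fun q : List ℕ × Diag × List ℕ => q) := Fast.id _
    have j : Fast (fun _ => 0) (fun q : ((List ℕ × Diag × List ℕ) × ℕ) × Tup × Bool => q) :=
      Fast.id _
    refine Fast.filter (f := fun q m => decide (m ∈ q.2.2) || q.2.1.any fun t =>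
        t.2 && (decide (m ∈ t.1.2) && t.1.2.any fun j => decide (j ∈ q.2.2))) i.fst
      ((Fast.mem (Fast.id _).snd i.snd.snd.weaken).or
        (Fast.any (f := fun p t => t.2 && (decide (p.2 ∈ t.1.2) &&
          t.1.2.any fun j => decide (j ∈ p.1.2.2))) i.snd.fst.weaken
          (j.snd.snd.and ((Fast.mem j.fst.snd j.snd.fst.snd).and
            (Fast.any (f := fun p j => decide (j ∈ p.1.1.2.2)) j.snd.fst.snd
              (Fast.mem (Fast.id _).snd i.snd.snd.weaken₂.weaken))))))
  have i : Fast (fun _ => 0) (fun q : List ℕ × Diag × List ℕ × List Unit => q) := Fast.id _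
  refine Fast.comp₀ (g := fun q : List ℕ × Diag × List ℕ × List Unit =>
    Hanf.ballList q.1 q.2.1 q.2.2.1 q.2.2.2) ?_ (hls.pair (hD.pair (hcs.pair hr)))
  refine Fast.foldl (f := fun q N _ => nbStep q.1 q.2.1 N) (B := fun q => sz q.1) i.snd.snd.snd
    (Fast.filter (f := fun q m => decide (m ∈ q.2.2.1)) i.fst
      (Fast.mem (Fast.id _).snd i.snd.snd.fst.weaken))
    (hstep.comp₀ ((Fast.id _).fst.fst.pair ((Fast.id _).fst.snd.fst.pair (Fast.id _).snd.fst)))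
    i.fst.size ?_
  intro q l₁ _ _
  induction l₁ using List.reverseRecOn with
  | nil => exact sz_le_of_sublist List.filter_sublist
  | append_singleton l₁ a _ =>
    rw [List.foldl_append, List.foldl_cons, List.foldl_nil]
    exact sz_le_of_sublist List.filter_sublist

theorem Fast.closedFormula {y : α → ℕ} {N' N : α → List ℕ} {R : α → ℕ × List ℕ} (hy : Fast h y)
    (hN' : Fast h N') (hN : Fast h N) (hR : Fast h R) :
    Fast h (fun x => closedFormula (y x) (N' x) (N x) (R x)) := by
  have h1 : Fast h (fun x => (R x).2.flatMap fun j => (N' x).map fun i => Raw.eq j i) :=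
    Fast.flatMap (f := fun x j => (N' x).map fun i => Raw.eq j i) hR.snd
      (Fast.map (f := fun p i => Raw.eq p.2 i) hN'.weaken
        ((Fast.id _).fst.snd.rawEq (Fast.id _).snd))
  have h2 : Fast h (fun x => (R x).2.map fun j =>
      Raw.bigAnd (y x) ((N x).map fun i => Raw.neg (Raw.eq j i))) :=
    Fast.map (f := fun x j => Raw.bigAnd (y x) ((N x).map fun i => Raw.neg (Raw.eq j i))) hR.snd
      (Fast.bigAnd hy.weaken (Fast.map (f := fun p i => Raw.neg (Raw.eq p.2 i)) hN.weaken
        ((Fast.id _).fst.snd.rawEq (Fast.id _).snd).rawNeg))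
  exact (Fast.exs hR.snd (Fast.bigAnd hy ((hR.fst.rawRel hR.snd).cons
    ((Fast.bigOr hy h1).cons ((Fast.bigOr hy h2).cons (Fast.nil _)))))).rawNeg

theorem Fast.sphereFormula {D : α → Diag} {r : α → List Unit} {xs : α → List (ℕ × ℕ)}
    (hp : Fast h p) (hD : Fast h D) (hr : Fast h r) (hxs : Fast h xs) :
    Fast h (fun x => sphereFormula (p x) (D x) (r x) (xs x)) := by
  have hcs : Fast h (fun x => (xs x).map Prod.snd) :=
    Fast.map (f := fun _ q => q.2) hxs (Fast.id _).snd.snd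
  have hN := Fast.ballList hp.letters hD hcs hr
  have hN' := Fast.ite hr.isEmpty (Fast.nil _) (Fast.ballList hp.letters hD hcs hr.listTail)
  have hy := hN.headD (Fast.const _ 0)
  refine Fast.exs hN (Fast.bigAnd hy (Fast.append ?_ (Fast.append ?_ (Fast.append ?_ ?_))))
  · exact Fast.map (f := fun _ q => Raw.eq q.1 q.2) hxs
      ((Fast.id _).snd.fst.rawEq (Fast.id _).snd.snd)
  · refine Fast.flatMap (f := fun x i => ((Hanf.ballList (p x).letters (D x)
        ((xs x).map Prod.snd) (r x)).filter fun j => !decide (i = j)).map fun j =>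
          Raw.neg (Raw.eq i j)) hN
      (Fast.map (f := fun q j => Raw.neg (Raw.eq q.2 j))
        (Fast.filter (f := fun q j => !decide (q.2 = j)) hN.weaken
          (Fast.eq (Fast.id _).fst.snd (Fast.id _).snd).not)
        ((Fast.id _).fst.snd.rawEq (Fast.id _).snd).rawNeg)
  · refine Fast.map (f := fun x t => if (D x).holds t then Raw.rel t.1 t.2 else
        Raw.neg (Raw.rel t.1 t.2))
      (Fast.filter (f := fun x t => t.2.all fun i => decide (i ∈ Hanf.ballList (p x).letters (D x)
        ((xs x).map Prod.snd) (r x))) hp.tups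
        (Fast.all (f := fun q i => decide (i ∈ Hanf.ballList (p q.1).letters (D q.1)
          ((xs q.1).map Prod.snd) (r q.1))) (Fast.id _).snd.snd
          (Fast.mem (Fast.id _).snd hN.weaken₂)))
      (Fast.ite (Fast.holds hD.weaken (Fast.id _).snd)
        ((Fast.id _).snd.fst.rawRel (Fast.id _).snd.snd)
        ((Fast.id _).snd.fst.rawRel (Fast.id _).snd.snd).rawNeg)
  · exact Fast.map (f := fun x R => Hanf.closedFormula ((Hanf.ballList (p x).letters (D x)
        ((xs x).map Prod.snd) (r x)).headD 0)
          (if (r x).isEmpty then [] else Hanf.ballList (p x).letters (D x)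
            ((xs x).map Prod.snd) (r x).tail) (Hanf.ballList (p x).letters (D x)
        ((xs x).map Prod.snd) (r x)) R) hp.rels
      (Fast.closedFormula hy.weaken hN'.weaken hN.weaken (Fast.id _).snd)

theorem Fast.lookup {e : α → Env} {x : α → ℕ} (he : Fast h e) (hx : Fast h x) :
    Fast h (fun a => (e a).lookup (x a)) :=
  ((Fast.map (f := fun _ q => q.2) (Fast.filter (f := fun a q => decide (q.1 = x a)) he
    (Fast.eq (Fast.id _).snd.fst hx.weaken)) (Fast.id _).snd.snd).headD
      (Fast.const _ ((0, 0, []) : Elem))).of_eq fun _ => rfl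

theorem Fast.apply {π : α → List (ℕ × ℕ)} {x : α → ℕ} (hπ : Fast h π) (hx : Fast h x) :
    Fast h (fun a => apply (π a) (x a)) :=
  ((Fast.map (f := fun _ q => q.2) (Fast.filter (f := fun a q => decide (q.1 = x a)) hπ
    (Fast.eq (Fast.id _).snd.fst hx.weaken)) (Fast.id _).snd.snd).headD
      (Fast.const _ 0)).of_eq fun _ => rfl

theorem Fast.isoVia {r : α → List Unit} {b b' : α → Elem} {π : α → List (ℕ × ℕ)}
    (hp : Fast h p) (hr : Fast h r) (hb : Fast h b) (hb' : Fast h b') (hπ : Fast h π) :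
    Fast h (fun x => isoVia (p x) (r x) (b x) (b' x) (π x)) := by
  have hN := Fast.ballList hp.letters hb.snd.snd (hb.fst.cons (Fast.nil _)) hr
  have hN' := Fast.ballList hp.letters hb'.snd.snd (hb'.fst.cons (Fast.nil _)) hr
  set N := fun x => Hanf.ballList (p x).letters (b x).2.2 [(b x).1] (r x)
  set N' := fun x => Hanf.ballList (p x).letters (b' x).2.2 [(b' x).1] (r x)
  refine (Fast.eq (Fast.apply hπ hb.fst) hb'.fst).and (Fast.and ?_ (Fast.and ?_ (Fast.and ?_ ?_)))
  · exact Fast.all (f := fun x i => (N x).all fun j => decide (i = j) ||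
        !decide (Hanf.apply (π x) i = Hanf.apply (π x) j)) hN
      (Fast.all (f := fun q j => decide (q.2 = j) ||
        !decide (Hanf.apply (π q.1) q.2 = Hanf.apply (π q.1) j)) hN.weaken
        ((Fast.eq (Fast.id _).fst.snd (Fast.id _).snd).or
          (Fast.eq (Fast.apply hπ.weaken₂ (Fast.id _).fst.snd)
            (Fast.apply hπ.weaken₂ (Fast.id _).snd)).not))
  · refine Fast.all (f := fun x t => !(t.2.all fun i => decide (i ∈ N x)) ||
        decide ((b x).2.2.holds t = (b' x).2.2.holds (t.1, t.2.map (Hanf.apply (π x))))) hp.tups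
      ((Fast.all (f := fun q i => decide (i ∈ N q.1)) (Fast.id _).snd.snd
        (Fast.mem (Fast.id _).snd hN.weaken₂)).not.or
        (Fast.eq (Fast.holds hb.weaken.snd.snd (Fast.id _).snd)
          (Fast.holds hb'.weaken.snd.snd ((Fast.id _).snd.fst.pair
            (Fast.map (f := fun q i => Hanf.apply (π q.1) i) (Fast.id _).snd.snd
              (Fast.apply hπ.weaken₂ (Fast.id _).snd))))))
  · exact Fast.all (f := fun x i => decide (Hanf.apply (π x) i ∈ N' x)) hN
      (Fast.mem (Fast.apply hπ.weaken (Fast.id _).snd) hN'.weaken)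
  · exact Fast.all (f := fun x m => (N x).any fun i => decide (Hanf.apply (π x) i = m)) hN'
      (Fast.any (f := fun q i => decide (Hanf.apply (π q.1) i = q.2)) hN.weaken
        (Fast.eq (Fast.apply hπ.weaken₂ (Fast.id _).snd) (Fast.id _).fst.snd))

theorem Fast.isoTest {r : α → List Unit} {b b' : α → Elem}
    (hp : Fast h p) (hr : Fast h r) (hb : Fast h b) (hb' : Fast h b') :
    Fast h (fun x => isoTest (p x) (r x) (b x) (b' x)) :=
  Fast.any (f := fun x π => Hanf.isoVia (p x) (r x) (b x) (b' x) π) hp.maps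
    (Fast.isoVia hp.weaken hr.weaken hb.weaken hb'.weaken (Fast.id _).snd)

theorem Fast.reps {r : α → List Unit} {l : α → List Elem} (hp : Fast h p) (hr : Fast h r)
    (hl : Fast h l) : Fast h (fun x => reps (p x) (r x) (l x)) := by
  have i : Fast (fun q : α × List Elem × Elem => h q.1) (fun q => q) := Fast.id _
  refine Fast.foldl (f := fun x T b => if T.any (fun b' => Hanf.isoTest (p x) (r x) b b') then T
    else b :: T) hl (Fast.nil _) (Fast.ite (Fast.any (f := fun q b' =>
      Hanf.isoTest (p q.1) (r q.1) q.2.2 b') i.snd.fst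
      (Fast.isoTest hp.weaken.weaken hr.weaken.weaken i.snd.snd.weaken (Fast.id _).snd))
      i.snd.fst (i.snd.snd.cons i.snd.fst)) hl.size ?_
  intro x l₁ l₂ e
  have key : ∀ (l₁ : List Elem), sz (l₁.foldl (fun T b => if T.any (fun b' =>
      Hanf.isoTest (p x) (r x) b b') then T else b :: T) []) ≤ sz l₁ := by
    intro l₁
    induction l₁ using List.reverseRecOn with
    | nil => exact le_rfl
    | append_singleton l₁ a ih =>
      rw [List.foldl_append, List.foldl_cons, List.foldl_nil]
      have h2 := sz_append l₁ [a]
      have h3 := sz_cons a []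
      have h4 := sz_nil (α := Elem)
      have h5 := three_le_sz a
      split
      · omega
      · rw [← Nat.add_le_add_iff_right (n := 1), sz_cons]; omega
  refine (key l₁).trans ?_
  rw [e]
  exact sz_le_of_sublist (List.sublist_append_left _ _)

theorem Fast.isNear {e : α → Env} {r : α → List Unit} {b : α → Elem} (hp : Fast h p)
    (he : Fast h e) (hr : Fast h r) (hb : Fast h b) :
    Fast h (fun x => isNear (p x) (e x) (r x) (b x)) :=
  Fast.mem hb.fst (Fast.ballList hp.letters hb.snd.snd
    (Fast.map (f := fun _ q => q.2.1) (Fast.filter (f := fun x q => decide (q.2.2 = (b x).2)) he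
      (Fast.eq (Fast.id _).snd.snd.snd hb.weaken.snd)) (Fast.id _).snd.snd.fst) hr)

theorem Fast.condition {e : α → Env} {r : α → List Unit} {P y : α → ℕ} {k : α → ℤ}
    {w : α → List (Elem × Bool)} (hp : Fast h p) (he : Fast h e) (hr : Fast h r) (hP : Fast h P)
    (hy : Fast h y) (hk : Fast h k) (hw : Fast h w) :
    Fast h (fun x => condition (p x) (e x) (r x) (P x) (y x) (k x) (w x)) := by
  have hR : Fast h (fun x => r x ++ (r x ++ [()])) :=
    hr.append (hr.append (Fast.const _ [()]))
  set R := fun x => r x ++ (r x ++ [()])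
  have hT : Fast h (fun x => Hanf.reps (p x) (r x) (((w x).filter fun q => q.2 &&
      !Hanf.isNear (p x) (e x) (R x) q.1).map Prod.fst)) :=
    Fast.reps hp hr (Fast.map (f := fun _ q => q.1) (Fast.filter (f := fun x q => q.2 &&
      !Hanf.isNear (p x) (e x) (R x) q.1) hw ((Fast.id _).snd.snd.and
        (Fast.isNear hp.weaken he.weaken hR.weaken (Fast.id _).snd.fst).not)) (Fast.id _).snd.fst)
  set T := fun x => Hanf.reps (p x) (r x) (((w x).filter fun q => q.2 &&
      !Hanf.isNear (p x) (e x) (R x) q.1).map Prod.fst) with hTdef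
  refine Fast.rawNum hP hy (Fast.bigOr hy (Fast.map (f := fun x b =>
    Hanf.sphereFormula (p x) b.2.2 (r x) [(y x, b.1)]) hT (Fast.sphereFormula hp.weaken
      (Fast.id _).snd.snd.snd hr.weaken ((hy.weaken.pair (Fast.id _).snd.fst).cons
        (Fast.nil _))))) ((hk.intSub ?_).intAdd ?_)
  · exact Fast.filter (f := fun x q => q.2 && Hanf.isNear (p x) (e x) (R x) q.1) hw
      ((Fast.id _).snd.snd.and (Fast.isNear hp.weaken he.weaken hR.weaken (Fast.id _).snd.fst))
  · exact Fast.filter (f := fun x b => Hanf.isNear (p x) (e x) (R x) b &&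
        (T x).any fun b' => Hanf.isoTest (p x) (r x) b b') hp.universe
      ((Fast.isNear hp.weaken he.weaken hR.weaken (Fast.id _).snd).and
        (Fast.any (f := fun q b' => Hanf.isoTest (p q.1) (r q.1) q.2 b') hT.weaken
          (Fast.isoTest hp.weaken₂ hr.weaken₂ (Fast.id _).fst.snd (Fast.id _).snd)))

theorem Fast.ofTruthValues {vals : α → List Raw} {w : α → List (Elem × Bool)} {χ : α → Raw}
    (hv : Fast h vals) (hw : Fast h w) (hχ : Fast h χ) :
    Fast h (fun x => ofTruthValues (vals x) (w x) (χ x)) :=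
  (Fast.bigOr (Fast.const _ 0) ((Fast.map
    (f := fun _ (q : (Elem × Bool) × Raw) => if q.1.2 then Raw.neg q.2 else q.2)
    (hw.zip hv) (Fast.ite (Fast.id _).snd.fst.snd (Fast.id _).snd.snd.rawNeg
      (Fast.id _).snd.snd)).append (hχ.rawNeg.cons (Fast.nil _)))).rawNeg

theorem Fast.quantifier {e : α → Env} {r : α → List Unit} {P y : α → ℕ} {k : α → ℤ}
    {vals : α → List Raw} (hp : Fast h p) (he : Fast h e) (hr : Fast h r) (hP : Fast h P)
    (hy : Fast h y) (hk : Fast h k) (hv : Fast h vals) :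
    Fast h (fun x => quantifier (p x) (e x) (r x) (P x) (y x) (k x) (vals x)) :=
  Fast.bigOr (Fast.const _ 0) (Fast.map (f := fun x w => Hanf.ofTruthValues (vals x) w
    (Hanf.condition (p x) (e x) (r x) (P x) (y x) (k x) w)) hp.subsets
    (Fast.ofTruthValues hv.weaken (Fast.id _).snd (Fast.condition hp.weaken he.weaken hr.weaken
      hP.weaken hy.weaken hk.weaken (Fast.id _).snd)))

theorem Fast.ofBool {c : α → Bool} (hc : Fast h c) : Fast h (fun x => ofBool (c x)) :=
  Fast.ite hc (Fast.const _ (Raw.neg Raw.bot)) (Fast.const _ Raw.bot)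

theorem Fast.relHolds {R : α → ℕ} {us : α → List Elem} (hR : Fast h R) (hus : Fast h us) :
    Fast h (fun x => relHolds (R x) (us x)) :=
  (Fast.all (f := fun x (u : Elem) => (us x).all fun v => decide (u.2 = v.2)) hus
    (Fast.all (f := fun (q : α × Elem) v => decide (q.2.2 = v.2)) hus.weaken
      (Fast.eq (Fast.id _).fst.snd.snd (Fast.id _).snd.snd))).and
  (Fast.any (f := fun x (u : Elem) => u.2.2.holds (R x, (us x).map Prod.fst)) hus
    (Fast.holds (Fast.id _).snd.snd.snd (hR.weaken.pair
      (Fast.map (f := fun _ (u : Elem) => u.1) hus.weaken (Fast.id _).snd.fst))))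

end AlgorithmFast

section RecursionFast

variable {α β γ δ : Type} [Enc α] [Enc β] [Enc γ] [Enc δ] {h : α → ℕ}

/-- The immediate subformulas. -/
def Raw.subs (r : Raw) : List Raw :=
  if decide (r.tag = 0) || decide (r.tag = 1) then []
  else if decide (r.tag = 3) then [r.sub, r.sub'] else [r.sub]

theorem Fast.subs : Fast (fun _ => 0) Raw.subs :=
  Fast.ite (((Fast.id _).tagEq 0).or ((Fast.id _).tagEq 1)) (Fast.nil _)
    (Fast.ite ((Fast.id _).tagEq 3) ((Fast.id _).rawSub.cons ((Fast.id _).rawSub'.cons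
      (Fast.nil _))) ((Fast.id _).rawSub.cons (Fast.nil _)))

theorem height_lt_of_mem_subs (r s : Raw) (hs : s ∈ r.subs) : s.height < r.height := by
  cases r <;> simp [Raw.subs, Raw.tag, Raw.sub, Raw.sub'] at hs <;>
    (try rcases hs with rfl | rfl) <;> simp_all [Raw.height]

theorem Fast.brAux : Fast Raw.height Raw.br := by
  have i : Fast (fun _ => 0) (fun p : Raw × List (List Unit) => p) := Fast.id _
  have hd : Fast (fun _ => 0) (fun p : List Unit × List Unit => p.2.drop p.1.length) := by
    have key : ∀ a b : List Unit, a.foldl (fun b _ => b.tail) b = b.drop a.length := by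
      intro a
      induction a with
      | nil => simp
      | cons u a ih => intro b; cases b <;> simp [ih]
    refine (Fast.foldl (f := fun _ b _ => b.tail) (Fast.id _).fst (Fast.id _).snd
      (Fast.id _).snd.fst.listTail (Bd.size _) ?_).of_eq fun p => key _ _
    intro x l₁ _ _
    rw [key]
    exact (sz_le_of_sublist (List.drop_sublist _ _)).trans (sz_snd_le x)
  have v0 : Fast (fun _ => 0) (fun p : Raw × List (List Unit) => p.2.headD []) :=
    i.snd.headD (Fast.nil _)
  have v1 : Fast (fun _ => 0) (fun p : Raw × List (List Unit) => p.2.tail.headD []) :=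
    i.snd.listTail.headD (Fast.nil _)
  refine Fast.treeRec (children := Raw.subs) (comb := fun p =>
    if decide (p.1.tag = 0) || decide (p.1.tag = 1) then []
    else if decide (p.1.tag = 2) then p.2.headD []
    else if decide (p.1.tag = 3) then p.2.headD [] ++ (p.2.tail.headD []).drop (p.2.headD []).length
    else () :: p.2.headD []) Fast.subs ?_ ?_ height_lt_of_mem_subs
  · exact Fast.ite ((i.fst.tagEq 0).or (i.fst.tagEq 1)) (Fast.nil _)
      (Fast.ite (i.fst.tagEq 2) v0 (Fast.ite (i.fst.tagEq 3) (v0.append (hd.comp₀ (v0.pair v1)))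
        ((Fast.const _ ()).cons v0)))
  · intro r
    cases r <;> rfl

theorem Fast.addNew {l l' : α → List ℕ} (hl : Fast h l) (hl' : Fast h l') :
    Fast h (fun x => addNew (l x) (l' x)) := by
  refine Fast.foldl (f := fun _ acc x => acc.insert x) hl' hl
    ((Fast.ite (Fast.mem (Fast.id _).snd.snd (Fast.id _).snd.fst) (Fast.id _).snd.fst
      ((Fast.id _).snd.snd.cons (Fast.id _).snd.fst)).of_eq fun p => by
        simp [List.insert]) (hl.size.add hl'.size) ?_
  intro x l₁ l₂ e
  have key : ∀ l₁ : List ℕ, sz (l₁.foldl (fun acc x => acc.insert x) (l x)) ≤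
      sz (l x) + sz l₁ := by
    intro l₁
    induction l₁ using List.reverseRecOn with
    | nil => simp
    | append_singleton l₁ a ih =>
      rw [List.foldl_append, List.foldl_cons, List.foldl_nil]
      have h2 := sz_append l₁ [a]
      have h3 := sz_cons a []
      have h4 := sz_nil (α := ℕ)
      have h5 := three_le_sz a
      by_cases hm : a ∈ l₁.foldl (fun acc x => acc.insert x) (l x)
      · rw [List.insert_of_mem hm]; omega
      · rw [List.insert_of_not_mem hm, ← Nat.add_le_add_iff_right (n := 1), sz_cons]; omega
  refine (key l₁).trans (Nat.add_le_add_left ?_ _)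
  rw [e]
  exact sz_le_of_sublist (List.sublist_append_left _ _)

theorem Fast.freeAux : Fast Raw.height Raw.free := by
  have i : Fast (fun _ => 0) (fun p : Raw × List (List ℕ) => p) := Fast.id _
  have v0 : Fast (fun _ => 0) (fun p : Raw × List (List ℕ) => p.2.headD []) :=
    i.snd.headD (Fast.nil _)
  have v1 : Fast (fun _ => 0) (fun p : Raw × List (List ℕ) => p.2.tail.headD []) :=
    i.snd.listTail.headD (Fast.nil _)
  refine Fast.treeRec (children := Raw.subs) (comb := fun p =>
    if decide (p.1.tag = 0) then Hanf.addNew [p.1.fst] [p.1.snd]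
    else if decide (p.1.tag = 1) then Hanf.addNew [] p.1.args
    else if decide (p.1.tag = 2) then p.2.headD []
    else if decide (p.1.tag = 3) then Hanf.addNew (p.2.headD []) (p.2.tail.headD [])
    else if decide (p.1.tag = 4) then (p.2.headD []).filter (fun x => !decide (x = p.1.fst))
    else (p.2.headD []).filter (fun x => !decide (x = p.1.snd)))
    Fast.subs ?_ ?_ height_lt_of_mem_subs
  · exact Fast.ite (i.fst.tagEq 0) (Fast.addNew (i.fst.rawFst.cons (Fast.nil _))
        (i.fst.rawSnd.cons (Fast.nil _)))
      (Fast.ite (i.fst.tagEq 1) (Fast.addNew (Fast.nil _) i.fst.rawArgs)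
      (Fast.ite (i.fst.tagEq 2) v0 (Fast.ite (i.fst.tagEq 3) (Fast.addNew v0 v1)
      (Fast.ite (i.fst.tagEq 4)
        (Fast.filter (f := fun p x => !decide (x = p.1.fst)) v0
          (Fast.eq (Fast.id _).snd i.fst.rawFst.weaken).not)
        (Fast.filter (f := fun p x => !decide (x = p.1.snd)) v0
          (Fast.eq (Fast.id _).snd i.fst.rawSnd.weaken).not)))))
  · intro r
    cases r <;> rfl

theorem Fast.varsAux : Fast Raw.height Raw.vars := by
  have i : Fast (fun _ => 0) (fun p : Raw × List (List ℕ) => p) := Fast.id _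
  have v0 : Fast (fun _ => 0) (fun p : Raw × List (List ℕ) => p.2.headD []) :=
    i.snd.headD (Fast.nil _)
  have v1 : Fast (fun _ => 0) (fun p : Raw × List (List ℕ) => p.2.tail.headD []) :=
    i.snd.listTail.headD (Fast.nil _)
  refine Fast.treeRec (children := Raw.subs) (comb := fun p =>
    if decide (p.1.tag = 0) then [p.1.fst, p.1.snd]
    else if decide (p.1.tag = 1) then p.1.args
    else if decide (p.1.tag = 2) then p.2.headD []
    else if decide (p.1.tag = 3) then p.2.headD [] ++ p.2.tail.headD []
    else if decide (p.1.tag = 4) then p.1.fst :: p.2.headD []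
    else p.1.snd :: p.2.headD [])
    Fast.subs ?_ ?_ height_lt_of_mem_subs
  · exact Fast.ite (i.fst.tagEq 0) (i.fst.rawFst.cons (i.fst.rawSnd.cons (Fast.nil _)))
      (Fast.ite (i.fst.tagEq 1) i.fst.rawArgs
      (Fast.ite (i.fst.tagEq 2) v0 (Fast.ite (i.fst.tagEq 3) (v0.append v1)
      (Fast.ite (i.fst.tagEq 4) (i.fst.rawFst.cons v0) (i.fst.rawSnd.cons v0)))))
  · intro r
    cases r <;> rfl

instance : DecidableEq Elem :=
  @instDecidableEqProd _ _ _ (@instDecidableEqProd _ _ _ instDecidableEqList)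

/-- The calls that the evaluation of a formula gives rise to. -/
def evalChildren (a : Params × Raw × Env × List (List Unit)) :
    List (Params × Raw × Env × List (List Unit)) :=
  if decide (a.2.1.tag = 4) || decide (a.2.1.tag = 5) then
    a.1.U.map fun b => (a.1, a.2.1.sub,
      ((if decide (a.2.1.tag = 4) then a.2.1.fst else a.2.1.snd), b) :: a.2.2.1, a.2.2.2.tail)
  else a.2.1.subs.map fun r => (a.1, r, a.2.2)

/-- The value of a formula in terms of the results of these calls. -/
def evalComb (q : (Params × Raw × Env × List (List Unit)) × List Raw) : Raw :=
  if decide (q.1.2.1.tag = 0) then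
    ofBool (decide (q.1.2.2.1.lookup q.1.2.1.fst = q.1.2.2.1.lookup q.1.2.1.snd))
  else if decide (q.1.2.1.tag = 1) then
    ofBool (relHolds q.1.2.1.fst (q.1.2.1.args.map fun x => q.1.2.2.1.lookup x))
  else if decide (q.1.2.1.tag = 2) then .neg (q.2.headD .bot)
  else if decide (q.1.2.1.tag = 3) then .or (q.2.headD .bot) (q.2.tail.headD .bot)
  else if decide (q.1.2.1.tag = 4) then
    quantifier q.1.1 q.1.2.2.1 (q.1.2.2.2.tail.headD []) 0 q.1.2.1.fst 0 q.2
  else quantifier q.1.1 q.1.2.2.1 (q.1.2.2.2.tail.headD []) (q.1.2.1.fst + 1) q.1.2.1.snd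
    q.1.2.1.int q.2

theorem Fast.evalChildren : Fast (fun _ => 0) evalChildren := by
  have i : Fast (fun _ => 0) (fun a : Params × Raw × Env × List (List Unit) => a) := Fast.id _
  exact Fast.ite ((i.snd.fst.tagEq 4).or (i.snd.fst.tagEq 5))
    (Fast.map (f := fun (a : Params × Raw × Env × List (List Unit)) b => (a.1, a.2.1.sub,
      ((if decide (a.2.1.tag = 4) then a.2.1.fst else a.2.1.snd), b) :: a.2.2.1,
        a.2.2.2.tail)) i.fst.universe
      (i.fst.weaken.pair (i.snd.fst.rawSub.weaken.pair
        (((((Fast.ite (i.snd.fst.tagEq 4) i.snd.fst.rawFst i.snd.fst.rawSnd).weaken).pair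
          (Fast.id _).snd).cons i.snd.snd.fst.weaken).pair i.snd.snd.snd.listTail.weaken))))
    (Fast.map (f := fun (a : Params × Raw × Env × List (List Unit)) r => (a.1, r, a.2.2))
      (Fast.subs.comp₀ i.snd.fst)
      (i.fst.weaken.pair ((Fast.id _).snd.pair i.snd.snd.weaken)))

theorem Fast.evalComb : Fast (fun _ => 0) evalComb := by
  have i : Fast (fun _ => 0)
    (fun a : (Params × Raw × Env × List (List Unit)) × List Raw => a) := Fast.id _
  have hr := i.fst.snd.fst
  have he := i.fst.snd.snd.fst
  have hρ := i.fst.snd.snd.snd.listTail.headD (Fast.nil _)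
  have v0 := i.snd.headD (Fast.const _ Raw.bot)
  have v1 := i.snd.listTail.headD (Fast.const _ Raw.bot)
  exact Fast.ite (hr.tagEq 0) (Fast.ofBool (Fast.eq (Fast.lookup he hr.rawFst)
      (Fast.lookup he hr.rawSnd)))
    (Fast.ite (hr.tagEq 1) (Fast.ofBool (Fast.relHolds hr.rawFst
      (Fast.map (f := fun (q : (Params × Raw × Env × List (List Unit)) × List Raw) x =>
        q.1.2.2.1.lookup x) hr.rawArgs (Fast.lookup he.weaken (Fast.id _).snd))))
    (Fast.ite (hr.tagEq 2) v0.rawNeg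
    (Fast.ite (hr.tagEq 3) (v0.rawOr v1)
    (Fast.ite (hr.tagEq 4) (Fast.quantifier i.fst.fst he hρ (Fast.const _ 0) hr.rawFst
        (Fast.const _ 0) i.snd)
      (Fast.quantifier i.fst.fst he hρ hr.rawFst.succ hr.rawSnd hr.rawInt i.snd)))))

/-- The height of the formula bounds the depth of the recursion; the number of calls at each node, one
for each element of the universal structure, is polynomial in the size of the parameters. -/
theorem Fast.evalAux : Fast (fun a : Params × Raw × Env × List (List Unit) => a.2.1.height)
    (fun a => eval a.1 a.2.1 a.2.2.1 a.2.2.2) := by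
  refine Fast.treeRec Fast.evalChildren Fast.evalComb ?_ ?_
  · rintro ⟨p, r, e, ρ⟩
    cases r with
    | eq x y => rfl
    | rel R l => rfl
    | neg φ => rfl
    | or φ ψ => rfl
    | ex y φ =>
      simp [eval, Hanf.evalComb, Hanf.evalChildren, Raw.tag, Raw.fst, Raw.sub,
        Function.comp_def]
    | num P y φ k =>
      simp [eval, Hanf.evalComb, Hanf.evalChildren, Raw.tag, Raw.fst, Raw.snd, Raw.sub, Raw.int,
        Function.comp_def]
  · rintro ⟨p, r, e, ρ⟩ b hb
    simp only [Hanf.evalChildren] at hb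
    split at hb
    · obtain ⟨u, -, rfl⟩ := List.mem_map.1 hb
      cases r <;> simp_all [Raw.tag, Raw.height, Raw.sub]
    · obtain ⟨s, hs, rfl⟩ := List.mem_map.1 hb
      exact height_lt_of_mem_subs _ _ hs

theorem Fast.eval {p : α → Params} {r : α → Raw} {e : α → Env} {ρ : α → List (List Unit)}
    (hp : Fast h p) (hr : Fast h r) (he : Fast h e) (hρ : Fast h ρ)
    (hh : ∀ x, (r x).height ≤ h x) : Fast h (fun x => eval (p x) (r x) (e x) (ρ x)) :=
  Fast.comp (f := fun x => (p x, r x, e x, ρ x)) Fast.evalAux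
    (hp.pair (hr.pair (he.pair hρ))) hh

/-! ### The running time of the preparations -/

/-- The number of lists enters the height, since their product can be exponentially large. -/
theorem Fast.sections {L : α → List (List β)} (hL : Fast h L) (hh : ∀ x, (L x).length ≤ h x) :
    Fast h (fun x => (L x).sections) := by
  have key : ∀ L : List (List β), L.sections =
      L.reverse.foldl (fun acc l => acc.flatMap fun s => l.map fun a => a :: s) [[]] := by
    intro L
    induction L with
    | nil => rfl
    | cons l L ih => rw [List.reverse_cons, List.foldl_append, ← ih]; rfl
  refine (Fast.foldl' (f := fun _ acc l => acc.flatMap fun s => l.map fun a => a :: s)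
    hL.reverse (Fast.const _ [[]]) ?_ (fun x => by simpa using hh x)).of_eq fun x => (key _).symm
  exact Fast.flatMap (f := fun (q : α × List (List β) × List β) s => q.2.2.map fun a => a :: s)
    (Fast.id _).snd.fst
    (Fast.map (f := fun (q : (α × List (List β) × List β) × List β) a => a :: q.2) (Fast.id _).fst.snd.snd
      ((Fast.id _).snd.cons (Fast.id _).fst.snd))

/-- A loop over a list whose body needs to be fast on the elements of the list only. -/
theorem Fast.flatMapMem [DecidableEq β] [EncInj β] {l : α → List β} {f : α → β → List γ}
    (hl : Fast h l) (hf : Fast (fun q : {q : α × β // q.2 ∈ l q.1} => h q.1.1)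
      (fun q => f q.1.1 q.1.2)) : Fast h (fun x => (l x).flatMap (f x)) := by
  have hc : Fast (fun q : α × β => h q.1) (fun q => decide (q.2 ∈ l q.1)) :=
    Fast.mem (Fast.id _).snd hl.weaken
  have hf' : Fast (fun q : {q : α × β // decide (q.2 ∈ l q.1) = true} => h q.1.1)
      (fun q => f q.1.1 q.1.2) :=
    hf.castArg (fun q => ⟨q.1, of_decide_eq_true q.2⟩) (fun _ => rfl) (fun _ => le_rfl)
      fun _ => rfl
  refine (Fast.flatMap (f := fun x b => if decide (b ∈ l x) then f x b else []) hl
    ((Fast.dite (f := fun q => f q.1.1 q.1.2) (g := fun _ => []) hc hf'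
      (Fast.nil _)).of_eq fun q => by simp)).of_eq fun x => ?_
  have : ∀ l' : List β, (∀ b ∈ l', b ∈ l x) →
      l'.flatMap (fun b => if decide (b ∈ l x) then f x b else []) = l'.flatMap (f x) := by
    intro l' hl'
    induction l' with
    | nil => rfl
    | cons b l' ih =>
      simp only [List.flatMap_cons]
      rw [ih fun c hc => hl' c (List.mem_cons_of_mem _ hc)]
      simp [hl' b List.mem_cons_self]
  exact this _ fun _ hb => hb

theorem Fast.mapMem [DecidableEq β] [EncInj β] {l : α → List β} {f : α → β → γ}
    (hl : Fast h l) (hf : Fast (fun q : {q : α × β // q.2 ∈ l q.1} => h q.1.1)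
      (fun q => f q.1.1 q.1.2)) : Fast h (fun x => (l x).map (f x)) :=
  (Fast.flatMapMem (f := fun x b => [f x b]) hl (hf.cons (Fast.nil _))).of_eq fun _ =>
    List.map_eq_flatMap.symm

theorem Fast.signs {l : α → List β} (hl : Fast h l) (hh : ∀ x, (l x).length ≤ h x) :
    Fast h (fun x => signs (l x)) :=
  Fast.sections (Fast.map (f := fun _ a => [(a, true), (a, false)]) hl
    (((Fast.id _).snd.pair (Fast.const _ true)).cons
      (((Fast.id _).snd.pair (Fast.const _ false)).cons (Fast.nil _))))
    fun x => by simpa using hh x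

theorem Fast.radii {k : α → List Unit} (hk : Fast h k) (hh : ∀ x, (k x).length ≤ h x) :
    Fast h (fun x => radii (k x)) := by
  refine Fast.foldl' hk (Fast.nil _) ?_ hh
  have i : Fast (fun _ => 0) (fun q : α × List (List Unit) × Unit => q) := Fast.id _
  have hr := i.snd.fst.headD (Fast.nil _)
  exact Fast.ite i.snd.fst.isEmpty (Fast.const _ [[]])
    ((hr.append (hr.append (hr.append (Fast.const _ [()])))).cons i.snd.fst)

theorem Fast.unary {n : α → ℕ} (hn : Fast h n) (hh : ∀ x, n x ≤ h x) :
    Fast h (fun x => unary (n x)) := by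
  refine Fast.foldl' hn.bits.reverse (Fast.nil _) ?_ fun x => ?_
  · have i : Fast (fun _ => 0) (fun q : α × List Unit × Bool => q) := Fast.id _
    exact i.snd.fst.append (i.snd.fst.append (Fast.ite i.snd.snd (Fast.const _ [()])
      (Fast.nil _)))
  · rw [List.length_reverse, Nat.size_eq_bits_len]
    exact (Nat.size_le.2 Nat.lt_two_pow_self).trans (hh x)

theorem Fast.above {l : α → List ℕ} (hl : Fast h l) : Fast h (fun x => above (l x)) := by
  have key : ∀ (l : List Bool) (v : ℕ), l.foldl (fun v _ => 2 * v) v = 2 ^ l.length * v := by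
    intro l
    induction l with
    | nil => simp
    | cons b l ih => intro v; simp [ih, pow_succ]; ring
  have hb : Fast h (fun x => (l x).flatMap Nat.bits) :=
    Fast.flatMap (f := fun _ n => n.bits) hl (Fast.id _).snd.bits
  refine Fast.foldl (f := fun _ v _ => 2 * v) hb (Fast.const _ 1) (Fast.id _).snd.fst.double
    (B := fun x => 5 * (sz ((l x).flatMap Nat.bits) + 1) + 3)
    (((Bd.const _ 5).mul (hb.size.add (Bd.const _ 1))).add (Bd.const _ 3)) ?_
  intro x l₁ l₂ e
  rw [key, mul_one]
  refine (sz_nat_le _).trans ?_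
  rw [Nat.size_eq_bits_len, Nat.size_pow]
  have := length_le_sz ((l x).flatMap Nat.bits)
  rw [e, List.length_append] at this
  rw [e]; omega

theorem Fast.number {l : α → List β} (hl : Fast h l) (hh : ∀ x, (l x).length ≤ h x) :
    Fast h (fun x => number (l x)) := by
  have i : Fast (fun _ => 0) (fun q : α × (ℕ × List (ℕ × β)) × β => q) := Fast.id _
  exact (Fast.foldl' (f := fun _ (s : ℕ × List (ℕ × β)) a => (s.1 + 1, s.2 ++ [(s.1, a)])) hl
    (Fast.const _ (0, [])) (i.snd.fst.fst.succ.pair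
      (i.snd.fst.snd.append ((i.snd.fst.fst.pair i.snd.snd).cons (Fast.nil _)))) hh).snd

theorem length_unary (n : ℕ) : (unary n).length = n := by
  have key : ∀ (l : List Bool), ∀ n : ℕ, n.bits = l →
      (l.reverse.foldl (fun (l : List Unit) b => l ++ (l ++ if b then [()] else [])) []).length
        = n := by
    intro l
    induction l with
    | nil =>
      intro n hn
      have := congrArg List.length hn
      rw [Nat.size_eq_bits_len] at this
      have : n = 0 := by
        by_contra h0
        have := Nat.size_pos.2 (Nat.pos_of_ne_zero h0)
        simp at *; omega
      simp [this]
    | cons b l ih =>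
      intro n hn
      have h1 : n.div2.bits = l := by rw [Nat.div2_bits_eq_tail, hn]; rfl
      have h2 := ih _ h1
      have h3 : n.bodd = b := by rw [Nat.bodd_eq_bits_head, hn]; rfl
      have h4 := Nat.bodd_add_div2 n
      rw [List.reverse_cons, List.foldl_append]
      simp only [List.foldl_cons, List.foldl_nil, List.length_append, h2]
      rw [h3] at h4
      cases b <;> simp at h4 ⊢ <;> omega
  exact key _ n rfl

theorem Fast.auxVars {v a : α → ℕ} (hv : Fast h v) (ha : Fast h a) (hh : ∀ x, a x ≤ h x) :
    Fast h (fun x => auxVars (v x) (a x)) := by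
  have i : Fast (fun _ => 0) (fun q : (α × ℕ) × List ℕ × Unit => q) := Fast.id _
  have : Fast h (fun x => (Hanf.unary (a x), v x)) := (Fast.unary ha hh).pair hv
  refine Fast.comp (h' := fun q : List Unit × ℕ => q.1.length)
    (g := fun q : List Unit × ℕ => q.1.foldl (fun vs _ => (2 * vs.headD q.2) :: vs) [])
    (Fast.foldl' (f := fun (q : List Unit × ℕ) (vs : List ℕ) _ => (2 * vs.headD q.2) :: vs)
      (Fast.id _).fst (Fast.nil _)
    (((Fast.id _).snd.fst.headD (Fast.id _).fst.snd).double.cons (Fast.id _).snd.fst)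
      fun _ => le_rfl) this fun x => ?_
  simpa [length_unary] using hh x

end RecursionFast

theorem number_eq {α : Type} (l : List α) : number l = (List.range l.length).zip l := by
  have key : ∀ l : List α, l.foldl (fun (s : ℕ × List (ℕ × α)) a => (s.1 + 1, s.2 ++ [(s.1, a)]))
      (0, []) = (l.length, (List.range l.length).zip l) := by
    intro l
    induction l using List.reverseRecOn with
    | nil => rfl
    | append_singleton l a ih =>
      rw [List.foldl_append, ih, List.foldl_cons, List.foldl_nil, List.length_append,
        List.length_singleton, List.range_succ, List.zip_append (by simp)]
      rfl
  rw [number, key]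

theorem mem_number {α : Type} {l : List α} {q : ℕ × α} : q ∈ number l ↔ l[q.1]? = some q.2 := by
  obtain ⟨i, a⟩ := q
  rw [number_eq, List.mem_iff_getElem?]
  simp only [List.getElem?_zip_eq_some]
  constructor
  · rintro ⟨j, h1, h2⟩
    have hj := (List.getElem?_eq_some_iff.1 h1)
    obtain ⟨hj, e⟩ := hj
    simp at e
    subst e
    exact h2
  · intro e
    have : i < l.length := by
      by_contra hh
      rw [List.getElem?_eq_none (by omega)] at e
      cases e
    exact ⟨i, by simp [this], e⟩

theorem length_auxVars (v a : ℕ) : (auxVars v a).length = a := by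
  have key : ∀ l : List Unit,
      (l.foldl (fun vs _ => (2 * vs.headD v) :: vs) ([] : List ℕ)).length = l.length := by
    intro l
    induction l using List.reverseRecOn with
    | nil => rfl
    | append_singleton l a ih => rw [List.foldl_append, List.length_append]; simpa using ih
  rw [auxVars, key, length_unary]

theorem mem_relsOf {ls σ : List ℕ} {R : ℕ × List ℕ} (hR : R ∈ relsOf ls σ) :
    ∃ a, σ[R.1]? = some a ∧ R.2 = auxVars (ls.headD 0) a := by
  have := mem_number.1 hR
  rw [List.getElem?_map, Option.map_eq_some_iff] at this
  obtain ⟨a, h1, h2⟩ := this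
  exact ⟨a, h1, h2.symm⟩

theorem length_of_mem_relsOf {ls σ : List ℕ} {R : ℕ × List ℕ} (hR : R ∈ relsOf ls σ) :
    R.2.length ≤ σ.sum := by
  obtain ⟨a, h1, h2⟩ := mem_relsOf hR
  rw [h2, length_auxVars]
  exact List.single_le_sum (fun _ _ => Nat.zero_le _) _ (List.mem_of_getElem? h1)

section

variable {α β γ δ : Type} [Enc α] [Enc β] [Enc γ] [Enc δ] {h : α → ℕ} {ls σ : α → List ℕ}

theorem Fast.relsOf (hls : Fast h ls) (hσ : Fast h σ) (h1 : ∀ x, (σ x).length ≤ h x)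
    (h2 : ∀ x, (σ x).sum ≤ h x) : Fast h (fun x => relsOf (ls x) (σ x)) := by
  refine Fast.number (Fast.mapMem (f := fun x a => Hanf.auxVars ((ls x).headD 0) a) hσ ?_)
    fun x => by simpa using h1 x
  refine Fast.auxVars (((hls.headD (Fast.const _ 0)).weaken (β := ℕ)).restrict _)
    ((Fast.id (fun q : α × ℕ => h q.1)).snd.restrict _) fun x => ?_
  exact (List.single_le_sum (fun _ _ => Nat.zero_le _) _ x.2).trans (h2 _)

theorem Fast.tupsOf (hls : Fast h ls) (hσ : Fast h σ) (h1 : ∀ x, (σ x).length ≤ h x)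
    (h2 : ∀ x, (σ x).sum ≤ h x) :
    Fast h (fun x => tupsOf (ls x) (Hanf.relsOf (ls x) (σ x))) := by
  refine Fast.flatMapMem (f := fun x (R : ℕ × List ℕ) =>
    (R.2.map fun _ => ls x).sections.map fun t => (R.1, t)) (Fast.relsOf hls hσ h1 h2) ?_
  have hR := (Fast.id (fun q : α × ℕ × List ℕ => h q.1)).snd
  have := Fast.map (f := fun (q : α × ℕ × List ℕ) _ => ls q.1) hR.snd hls.weaken.weaken
  refine Fast.map (Fast.sections (this.restrict _) fun x => ?_)
    ((hR.fst.restrict _).weaken.pair (Fast.id _).snd)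
  simpa using (length_of_mem_relsOf x.2).trans (h2 _)

theorem Fast.elems {Ds : α → List Diag} (hls : Fast h ls) (hDs : Fast h Ds) :
    Fast h (fun x => elems (ls x) (Ds x)) :=
  Fast.flatMap (f := fun x i => (ls x).flatMap fun c => (Ds x).map fun D => (i, c, D)) hls
    (Fast.flatMap (f := fun (q : α × ℕ) c => (Ds q.1).map fun D => (q.2, c, D)) hls.weaken
      (Fast.map (f := fun (q : (α × ℕ) × ℕ) D => (q.1.2, q.2, D)) hDs.weaken₂
        ((Fast.id _).fst.fst.snd.pair ((Fast.id _).fst.snd.pair (Fast.id _).snd))))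

theorem Fast.functions (hls : Fast h ls) (h1 : ∀ x, (ls x).length ≤ h x) :
    Fast h (fun x => functions (ls x)) :=
  Fast.sections (Fast.map (f := fun x i => (ls x).map fun j => (i, j)) hls
    (Fast.map (f := fun (q : α × ℕ) j => (q.2, j)) hls.weaken
      ((Fast.id _).fst.snd.pair (Fast.id _).snd))) fun x => by simpa using h1 x

theorem Fast.paramsOf (hls : Fast h ls) (hσ : Fast h σ) (h1 : ∀ x, (σ x).length ≤ h x)
    (h2 : ∀ x, (σ x).sum ≤ h x) (h3 : ∀ x, (ls x).length ≤ h x)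
    (h4 : ∀ x, (paramsOf (ls x) (σ x)).tups.length ≤ h x)
    (h5 : ∀ x, (paramsOf (ls x) (σ x)).U.length ≤ h x) :
    Fast h (fun x => paramsOf (ls x) (σ x)) := by
  have ht := Fast.tupsOf hls hσ h1 h2
  have hU := Fast.elems hls (Fast.signs ht h4)
  exact (hls.pair (ht.pair ((Fast.relsOf hls hσ h1 h2).pair ((Fast.functions hls h3).pair
    (hU.pair (Fast.signs hU h5)))))).cast fun _ => rfl

theorem Fast.disjunct {p : α → Params} {φ : α → Raw} {ρ : α → List (List Unit)} {D : α → Diag}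
    {xs : α → List (ℕ × ℕ)} (hp : Fast h p) (hφ : Fast h φ) (hρ : Fast h ρ) (hD : Fast h D)
    (hxs : Fast h xs) (hh : ∀ x, (φ x).height ≤ h x) :
    Fast h (fun x => disjunct (p x) (φ x) (ρ x) (D x) (xs x)) := by
  have he := Fast.map (f := fun x (q : ℕ × ℕ) => (q.1, (q.2, ((p x).letters.headD 0, D x)))) hxs
    ((Fast.id _).snd.fst.pair ((Fast.id _).snd.snd.pair
      ((hp.letters.headD (Fast.const _ 0)).weaken.pair hD.weaken)))
  exact Fast.bigAnd (Fast.const _ 0) ((Fast.sphereFormula hp hD (hρ.headD (Fast.nil _)) hxs).cons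
    ((Fast.eval hp hφ he hρ hh).cons (Fast.nil _)))

theorem Fast.normalFormWith {p : α → Params} {φ : α → Raw} {ρ : α → List (List Unit)}
    (hp : Fast h p) (hφ : Fast h φ) (hρ : Fast h ρ) (hh : ∀ x, (φ x).height ≤ h x)
    (hf : ∀ x, (φ x).free.length ≤ h x) (ht : ∀ x, (p x).tups.length ≤ h x) :
    Fast h (fun x => normalFormWith (p x) (φ x) (ρ x)) := by
  have hfree : Fast h (fun x => (φ x).free) := Fast.freeAux.comp hφ hh
  have hs : Fast h (fun x => ((φ x).free.map fun v => (p x).letters.map fun i => (v, i)).sections) :=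
    Fast.sections (Fast.map (f := fun x v => (p x).letters.map fun i => (v, i)) hfree
      (Fast.map (f := fun (q : α × ℕ) i => (q.2, i)) hp.letters.weaken
        ((Fast.id _).fst.snd.pair (Fast.id _).snd))) fun x => by simpa using hf x
  refine Fast.ite hfree.isEmpty (Fast.eval hp hφ (Fast.nil _) hρ hh)
    (Fast.bigOr (Fast.const _ 0) (Fast.append (Fast.flatMap
      (f := fun x D => ((φ x).free.map fun v => (p x).letters.map fun i => (v, i)).sections.map
        fun xs => Hanf.disjunct (p x) (φ x) (ρ x) D xs) (Fast.signs hp.tups ht)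
      (Fast.map (f := fun (q : α × Diag) xs => Hanf.disjunct (p q.1) (φ q.1) (ρ q.1) q.2 xs)
        hs.weaken ?_)) ((Fast.const _ Raw.bot).cons (Fast.nil _))))
  exact Fast.disjunct hp.weaken₂ hφ.weaken₂ hρ.weaken₂ (Fast.id _).fst.snd (Fast.id _).snd
    fun x => hh _

/-- A bound for the depths of the recursions and for the lengths of those loops in the computation
of the normal form whose states may grow in each iteration. The loops over the subsets of the
universal structure are not among them. -/
def normalFormHeight (x : ℕ × List ℕ × Raw) : ℕ :=
  let p := paramsOf (lettersOf x.1 x.2.2) x.2.1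
  x.2.2.height + (x.2.2.br.length + 1) + x.2.2.free.length + x.2.1.length + x.2.1.sum +
    (logLetters x.1 x.2.2).length + p.letters.length + p.tups.length + p.U.length

theorem Fast.normalForm :
    Fast normalFormHeight (fun x : ℕ × List ℕ × Raw => normalForm x.1 x.2.1 x.2.2) := by
  have i : Fast normalFormHeight (fun x => x) := Fast.id _
  have hh : ∀ x, x.2.2.height ≤ normalFormHeight x := fun x => by
    simp only [normalFormHeight]; omega
  have hbr : Fast normalFormHeight (fun x : ℕ × List ℕ × Raw => x.2.2.br) :=
    Fast.brAux.comp i.snd.snd hh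
  have hfree : Fast normalFormHeight (fun x : ℕ × List ℕ × Raw => x.2.2.free) :=
    Fast.freeAux.comp i.snd.snd hh
  have hvars : Fast normalFormHeight (fun x : ℕ × List ℕ × Raw => x.2.2.vars) :=
    Fast.varsAux.comp i.snd.snd hh
  have hrad : Fast normalFormHeight (fun x : ℕ × List ℕ × Raw => Hanf.radii (() :: x.2.2.br)) :=
    Fast.radii ((Fast.const _ ()).cons hbr) fun x => by
      simp only [normalFormHeight, List.length_cons]; omega
  have hlog : Fast normalFormHeight (fun x : ℕ × List ℕ × Raw => logLetters x.1 x.2.2) :=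
    Fast.append (Fast.map (f := fun _ _ => ()) hfree (Fast.const _ ()))
      (hbr.append (Fast.flatMap (f := fun x _ => x.1.bits.map fun _ => ())
        (hrad.headD (Fast.nil _)) (Fast.map (f := fun _ _ => ()) i.fst.bits.weaken
          (Fast.const _ ()))))
  have hls : Fast normalFormHeight (fun x : ℕ × List ℕ × Raw => lettersOf x.1 x.2.2) := by
    refine Fast.foldl' (f := fun _ (ls : List ℕ) _ => ls.flatMap fun v => [2 * v, 2 * v + 1]) hlog
      ((Fast.above hvars).cons (Fast.nil _)) ?_ fun x => by
        simp only [normalFormHeight]; omega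
    exact Fast.flatMap (f := fun _ v => [2 * v, 2 * v + 1]) (Fast.id _).snd.fst
      ((Fast.id _).snd.double.cons ((Fast.id _).snd.doubleSucc.cons (Fast.nil _)))
  refine Fast.normalFormWith (Fast.paramsOf hls i.snd.fst ?_ ?_ ?_ ?_ ?_) i.snd.snd hrad hh ?_ ?_
  all_goals
    intro x
    simp only [normalFormHeight]
    first
    | omega
    | (have : (lettersOf x.1 x.2.2).length =
        (Hanf.paramsOf (lettersOf x.1 x.2.2) x.2.1).letters.length := rfl
       omega)

end

/-! ### Formulas with and without a signature -/

section Erasure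

variable {σ : Signature} {N : Type}

/-- The formula without its dependence on the signature, with codes instead of names of
predicates. -/
def Formula.erase [Encodable N] : Formula σ N → Raw
  | .eq x y => .eq x y
  | .rel R x => .rel R.val (List.ofFn x)
  | .neg φ => .neg φ.erase
  | .or φ ψ => .or φ.erase ψ.erase
  | .ex y φ => .ex y φ.erase
  | .num P y φ k => .num (Encodable.encode P) y φ.erase k

/-- A formula is represented by the same tree as its syntax tree without signature. -/
theorem Formula.enc_erase [Encodable N] (φ : Formula σ N) : enc φ.erase = φ.encode := by
  induction φ with
  | eq x y => rfl
  | rel R x => rfl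
  | neg φ ih => rw [Formula.encode, ← ih]; rfl
  | or φ ψ ih ih' => rw [Formula.encode, ← ih, ← ih']; rfl
  | ex y φ ih => rw [Formula.encode, ← ih]; rfl
  | num P y φ k ih => rw [Formula.encode, ← ih]; rfl

namespace Raw

variable (σ N) in
/-- The formula over the signature `σ` that is given by a raw formula. Meaningless atoms and codes
of predicates are replaced by a false formula. -/
def lift [Encodable N] : Raw → Formula σ (Option N)
  | eq x y => .eq x y
  | rel R l => if h : ∃ hR : R < σ.arities.length, l.length = σ.ar ⟨R, hR⟩ then
      .rel ⟨R, h.1⟩ fun i => l.get (Fin.cast h.2.symm i) else .neg (.eq 0 0)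
  | neg φ => .neg φ.lift
  | or φ ψ => .or φ.lift ψ.lift
  | ex y φ => .ex y φ.lift
  | num P y φ k => match (Encodable.decode P : Option (Option N)) with
    | some Q => .num Q y φ.lift k
    | none => .neg (.eq 0 0)

variable (σ N) in
/-- The raw formula is meaningful over the signature `σ` and the names `N`. -/
def WF [Encodable N] : Raw → Prop
  | eq _ _ => True
  | rel R l => ∃ hR : R < σ.arities.length, l.length = σ.ar ⟨R, hR⟩
  | neg φ => φ.WF
  | or φ ψ => φ.WF ∧ ψ.WF
  | ex _ φ => φ.WF
  | num P _ φ _ => (∃ Q : Option N, Encodable.encode Q = P) ∧ φ.WF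

variable [Encodable N]

/-- The output of a program, as a tree, represents the formula that it stands for. -/
theorem encode_lift {r : Raw} (h : r.WF σ N) : (r.lift σ N).encode = enc r := by
  induction r with
  | eq x y => rfl
  | rel R l =>
    rw [WF] at h
    rw [lift, dif_pos h]
    obtain ⟨h1, h2⟩ := h
    have : List.ofFn (fun i => l.get (Fin.cast h2.symm i)) = l := by
      apply List.ext_get
      · simp [h2]
      · intro n _ _; simp
    simp only [Formula.encode, this]
    rfl
  | neg φ ih => rw [lift, Formula.encode, ih h]; rfl
  | or φ ψ ih ih' => rw [lift, Formula.encode, ih h.1, ih' h.2]; rfl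
  | ex y φ ih => rw [lift, Formula.encode, ih h]; rfl
  | num P y φ k ih =>
    obtain ⟨⟨Q, rfl⟩, h⟩ := h
    rw [lift, Encodable.encodek]
    simp only [Formula.encode, ih h]
    rfl

theorem lift_num {Q : Option N} {P y : ℕ} {φ : Raw} {k : ℤ} (hP : Encodable.encode Q = P) :
    (num P y φ k).lift σ N = .num Q y (φ.lift σ N) k := by
  subst hP
  rw [lift, Encodable.encodek]

theorem lift_bigOr (y : ℕ) (l : List Raw) :
    (bigOr y l).lift σ N = Formula.bigOr y (l.map (lift σ N)) := by
  induction l with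
  | nil => rfl
  | cons φ l ih =>
    cases l with
    | nil => rfl
    | cons ψ l => rw [bigOr, lift, ih]; rfl

theorem wf_bigOr {y : ℕ} {l : List Raw} (h : ∀ r ∈ l, r.WF σ N) : (bigOr y l).WF σ N := by
  induction l with
  | nil => trivial
  | cons φ l ih =>
    cases l with
    | nil => exact h φ List.mem_cons_self
    | cons ψ l =>
      exact ⟨h φ List.mem_cons_self, ih fun r hr => h r (List.mem_cons_of_mem _ hr)⟩

theorem wf_bigAnd {y : ℕ} {l : List Raw} (h : ∀ r ∈ l, r.WF σ N) : (bigAnd y l).WF σ N :=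
  wf_bigOr (fun r hr => by obtain ⟨s, hs, rfl⟩ := List.mem_map.1 hr; exact h s hs)

theorem wf_exs {vs : List ℕ} {r : Raw} (h : r.WF σ N) : (exs vs r).WF σ N := by
  induction vs with
  | nil => exact h
  | cons v vs ih => exact ih

theorem wf_bot : bot.WF σ N := ⟨⟨none, rfl⟩, trivial⟩

/-! ### Free variables -/

theorem free_bigOr_subset {y : ℕ} {l : List Raw} {v : ℕ}
    (h : v ∈ ((bigOr y l).lift σ N).free) :
    (l = [] ∧ v = y) ∨ ∃ r ∈ l, v ∈ (r.lift σ N).free := by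
  induction l with
  | nil => simpa [bigOr, lift, Formula.free] using h
  | cons φ l ih =>
    right
    cases l with
    | nil => exact ⟨φ, List.mem_cons_self, h⟩
    | cons ψ l =>
      rcases Finset.mem_union.1 h with h | h
      · exact ⟨φ, List.mem_cons_self, h⟩
      · obtain ⟨h, -⟩ | ⟨r, hr, hv⟩ := ih h
        · cases h
        · exact ⟨r, List.mem_cons_of_mem _ hr, hv⟩

theorem mem_free_bigOr {y : ℕ} {l : List Raw} {v : ℕ} {r : Raw} (hr : r ∈ l)
    (hv : v ∈ (r.lift σ N).free) : v ∈ ((bigOr y l).lift σ N).free := by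
  induction l with
  | nil => cases hr
  | cons φ l ih =>
    cases l with
    | nil => rwa [List.mem_singleton.1 hr] at hv
    | cons ψ l =>
      rcases List.mem_cons.1 hr with rfl | hr
      · exact Finset.mem_union_left _ hv
      · exact Finset.mem_union_right _ (ih hr)

theorem free_bigAnd_subset {y : ℕ} {l : List Raw} {v : ℕ}
    (h : v ∈ ((bigAnd y l).lift σ N).free) :
    (l = [] ∧ v = y) ∨ ∃ r ∈ l, v ∈ (r.lift σ N).free := by
  obtain ⟨e, rfl⟩ | ⟨r, hr, hv⟩ := free_bigOr_subset (σ := σ) (N := N) h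
  · exact Or.inl ⟨List.map_eq_nil_iff.1 e, rfl⟩
  · obtain ⟨s, hs, rfl⟩ := List.mem_map.1 hr
    exact Or.inr ⟨s, hs, hv⟩

theorem mem_free_bigAnd {y : ℕ} {l : List Raw} {v : ℕ} {r : Raw} (hr : r ∈ l)
    (hv : v ∈ (r.lift σ N).free) : v ∈ ((bigAnd y l).lift σ N).free :=
  mem_free_bigOr (r := neg r) (List.mem_map_of_mem hr) hv

theorem mem_free_exs {vs : List ℕ} {r : Raw} {v : ℕ} :
    v ∈ ((exs vs r).lift σ N).free ↔ v ∈ (r.lift σ N).free ∧ v ∉ vs := by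
  induction vs with
  | nil => simp [exs]
  | cons u vs ih =>
    change v ∈ ((exs vs r).lift σ N).free.erase u ↔ _
    rw [Finset.mem_erase, ih]
    simp only [List.mem_cons, not_or]
    tauto

theorem free_lift_rel {R : ℕ} {l : List ℕ} {v : ℕ} (h : (rel R l).WF σ N)
    (hv : v ∈ ((rel R l).lift σ N).free) : v ∈ l := by
  rw [WF] at h
  rw [lift, dif_pos h] at hv
  simp only [Formula.free, Finset.mem_image, Finset.mem_univ, true_and] at hv
  obtain ⟨i, rfl⟩ := hv
  exact List.get_mem _ _

/-! ### Formulas without counting -/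

theorem isFO_bigOr {y : ℕ} {l : List Raw} (h : ∀ r ∈ l, (r.lift σ N).IsFO) :
    ((bigOr y l).lift σ N).IsFO := by
  induction l with
  | nil => trivial
  | cons φ l ih =>
    cases l with
    | nil => exact h φ List.mem_cons_self
    | cons ψ l =>
      exact ⟨h φ List.mem_cons_self, ih fun r hr => h r (List.mem_cons_of_mem _ hr)⟩

theorem isFO_bigAnd {y : ℕ} {l : List Raw} (h : ∀ r ∈ l, (r.lift σ N).IsFO) :
    ((bigAnd y l).lift σ N).IsFO :=
  isFO_bigOr (y := y) (fun r hr => by obtain ⟨s, hs, rfl⟩ := List.mem_map.1 hr; exact h s hs)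

theorem isFO_exs {vs : List ℕ} {r : Raw} (h : (r.lift σ N).IsFO) :
    ((exs vs r).lift σ N).IsFO := by
  induction vs with
  | nil => exact h
  | cons v vs ih => exact ih

theorem isFO_rel (R : ℕ) (l : List ℕ) : ((rel R l).lift σ N).IsFO := by
  rw [lift]; split <;> trivial

end Raw

/-! ### Satisfaction -/

variable {A : Type}

/-- The tuple given by a list of elements belongs to the relation with the given index. -/
def Struc.relList (S : Struc σ A) (R : ℕ) (l : List A) : Prop :=
  ∃ (hR : R < σ.arities.length) (hl : l.length = σ.ar ⟨R, hR⟩),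
    (fun i => l.get (Fin.cast hl.symm i)) ∈ S.rel ⟨R, hR⟩

theorem Struc.relList_ofFn (S : Struc σ A) (R : σ.Sym) (t : Fin (σ.ar R) → A) :
    S.relList R.val (List.ofFn t) ↔ t ∈ S.rel R := by
  constructor
  · rintro ⟨h1, h2, h3⟩
    convert h3
    simp
  · intro h
    refine ⟨R.2, by simp, ?_⟩
    convert h
    simp

theorem Struc.relList_map {B : Type} (S : Struc σ A) (R : ℕ) (l : List B) (f : B → A)
    (hR : R < σ.arities.length) (hl : l.length = σ.ar ⟨R, hR⟩) :
    S.relList R (l.map f) ↔ (fun i => f (l.get (Fin.cast hl.symm i))) ∈ S.rel ⟨R, hR⟩ := by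
  constructor
  · rintro ⟨h1, h2, h3⟩
    convert h3
    simp
  · intro h
    refine ⟨hR, by simpa using hl, ?_⟩
    convert h
    simp

variable [Encodable N]

/-- Satisfaction of a raw formula. -/
def Raw.Holds (sem : N → Set ℤ) (S : Struc σ A) (β : ℕ → A) (r : Raw) : Prop :=
  (r.lift σ N).Sat (withExists sem) S β

namespace Raw

variable {sem : N → Set ℤ} {S : Struc σ A} {β : ℕ → A}

theorem holds_eq {x y : ℕ} : (eq x y).Holds sem S β ↔ β x = β y := Iff.rfl

theorem holds_neg {r : Raw} : (neg r).Holds sem S β ↔ ¬ r.Holds sem S β := Iff.rfl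

theorem holds_or {r s : Raw} : (or r s).Holds sem S β ↔ r.Holds sem S β ∨ s.Holds sem S β :=
  Iff.rfl

theorem holds_ex {y : ℕ} {r : Raw} :
    (ex y r).Holds sem S β ↔ ∃ a, r.Holds sem S (Function.update β y a) := Iff.rfl

theorem holds_rel {R : ℕ} {l : List ℕ} :
    (rel R l).Holds sem S β ↔ S.relList R (l.map β) := by
  rw [Holds, lift]
  split
  · next h => rw [Struc.relList_map _ _ _ _ h.1 h.2]; rfl
  · next h =>
    simp only [Formula.Sat, not_true_eq_false, false_iff]
    rintro ⟨h1, h2, -⟩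
    exact h ⟨h1, by simpa using h2⟩

theorem holds_bigOr {y : ℕ} {l : List Raw} :
    (bigOr y l).Holds sem S β ↔ ∃ r ∈ l, r.Holds sem S β := by
  induction l with
  | nil => simp [bigOr, holds_neg, holds_eq]
  | cons φ l ih =>
    cases l with
    | nil => simp [bigOr]
    | cons ψ l => rw [bigOr, holds_or, ih]; simp

theorem holds_bigAnd {y : ℕ} {l : List Raw} :
    (bigAnd y l).Holds sem S β ↔ ∀ r ∈ l, r.Holds sem S β := by
  rw [bigAnd, holds_neg, holds_bigOr]
  simp [holds_neg]

theorem holds_exs {vs : List ℕ} {r : Raw} : (exs vs r).Holds sem S β ↔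
    ∃ g : ℕ → A, r.Holds sem S (fun v => if v ∈ vs then g v else β v) := by
  induction vs generalizing β with
  | nil => simpa [exs] using fun _ => ⟨β 0⟩
  | cons v vs ih =>
    change (ex v (exs vs r)).Holds sem S β ↔ _
    rw [holds_ex]
    simp only [ih]
    constructor
    · rintro ⟨a, g, h⟩
      refine ⟨fun u => if u ∈ vs then g u else a, ?_⟩
      convert h using 2 with u
      by_cases h1 : u ∈ vs
      · simp [h1]
      · by_cases h2 : u = v
        · subst h2; simp [h1]
        · simp [h1, h2]
    · rintro ⟨g, h⟩
      refine ⟨g v, g, ?_⟩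
      convert h using 2 with u
      by_cases h1 : u ∈ vs
      · simp [h1]
      · by_cases h2 : u = v
        · subst h2; simp [h1]
        · simp [h1, h2]

theorem holds_bot : ¬ bot.Holds sem S β := by
  have : bot.lift σ N = .num none 0 (.neg (.eq 0 0)) 0 := lift_num rfl
  rw [Holds, this]
  simp [Formula.Sat, withExists]

end Raw

end Erasure

/-! ### Neighbourhoods -/

section Neighbourhoods

variable {σ : Signature} {A B C : Type}

namespace Struc

/-- The elements of distance at most one from `Y`. -/
def nb (S : Struc σ A) (Y : Set A) : Set A :=
  {b | b ∈ Y ∨ ∃ R l, S.relList R l ∧ b ∈ l ∧ ∃ a ∈ l, a ∈ Y}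

/-- The elements of distance at most `r` from `X`. -/
def ball (S : Struc σ A) : ℕ → Set A → Set A
  | 0, X => X
  | r + 1, X => S.nb (S.ball r X)

variable (S : Struc σ A)

theorem subset_nb (Y : Set A) : Y ⊆ S.nb Y := fun _ h => Or.inl h

theorem nb_mono {Y Z : Set A} (h : Y ⊆ Z) : S.nb Y ⊆ S.nb Z := by
  rintro b (hb | ⟨R, l, h1, h2, a, h3, h4⟩)
  · exact Or.inl (h hb)
  · exact Or.inr ⟨R, l, h1, h2, a, h3, h h4⟩

theorem nb_union (Y Z : Set A) : S.nb (Y ∪ Z) = S.nb Y ∪ S.nb Z := by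
  ext b
  constructor
  · rintro ((hb | hb) | ⟨R, l, h1, h2, a, h3, h4 | h4⟩)
    · exact Or.inl (Or.inl hb)
    · exact Or.inr (Or.inl hb)
    · exact Or.inl (Or.inr ⟨R, l, h1, h2, a, h3, h4⟩)
    · exact Or.inr (Or.inr ⟨R, l, h1, h2, a, h3, h4⟩)
  · rintro (h | h)
    · exact S.nb_mono Set.subset_union_left h
    · exact S.nb_mono Set.subset_union_right h

theorem ball_mono {X Y : Set A} (h : X ⊆ Y) (r : ℕ) : S.ball r X ⊆ S.ball r Y := by
  induction r with
  | zero => exact h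
  | succ r ih => exact S.nb_mono ih

theorem ball_union (r : ℕ) (X Y : Set A) : S.ball r (X ∪ Y) = S.ball r X ∪ S.ball r Y := by
  induction r with
  | zero => rfl
  | succ r ih => rw [ball, ih, nb_union]; rfl

theorem ball_add (r s : ℕ) (X : Set A) : S.ball (r + s) X = S.ball s (S.ball r X) := by
  induction s with
  | zero => rfl
  | succ s ih => rw [← add_assoc, ball, ih]; rfl

theorem subset_ball (r : ℕ) (X : Set A) : X ⊆ S.ball r X := by
  induction r with
  | zero => exact subset_rfl
  | succ r ih => exact ih.trans (S.subset_nb _)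

theorem ball_mono_radius {r s : ℕ} (h : r ≤ s) (X : Set A) : S.ball r X ⊆ S.ball s X := by
  obtain ⟨k, rfl⟩ := Nat.exists_eq_add_of_le h
  rw [ball_add]
  exact S.subset_ball _ _

theorem ball_subset_ball {r s k : ℕ} {X Y : Set A} (hY : Y ⊆ S.ball s X) (h : s + k ≤ r) :
    S.ball k Y ⊆ S.ball r X := by
  refine (S.ball_mono hY k).trans ?_
  rw [← ball_add]
  exact S.ball_mono_radius h X

theorem mem_ball_singleton {r : ℕ} {X : Set A} {b : A} :
    b ∈ S.ball r X ↔ ∃ a ∈ X, b ∈ S.ball r {a} := by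
  induction r generalizing b with
  | zero => simp [ball]
  | succ r ih =>
    constructor
    · rintro (h | ⟨R, l, h1, h2, c, h3, h4⟩)
      · obtain ⟨a, ha, h⟩ := ih.1 h
        exact ⟨a, ha, Or.inl h⟩
      · obtain ⟨a, ha, h⟩ := ih.1 h4
        exact ⟨a, ha, Or.inr ⟨R, l, h1, h2, c, h3, h⟩⟩
    · rintro ⟨a, ha, h⟩
      exact S.ball_mono (Set.singleton_subset_iff.2 ha) _ h

theorem nb_symm {a b : A} (h : b ∈ S.nb {a}) : a ∈ S.nb {b} := by
  obtain h | ⟨R, l, h1, h2, c, h3, rfl⟩ := h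
  · exact Or.inl h.symm
  · exact Or.inr ⟨R, l, h1, h3, b, h2, rfl⟩

theorem ball_symm {r : ℕ} {a b : A} (h : b ∈ S.ball r {a}) : a ∈ S.ball r {b} := by
  induction r generalizing b with
  | zero => exact h.symm
  | succ r ih =>
    obtain ⟨c, hc, h⟩ := S.mem_ball_singleton.1 (show b ∈ S.ball 1 (S.ball r {a}) from h)
    have h1 : c ∈ S.ball 1 {b} := S.nb_symm h
    rw [add_comm, ball_add]
    exact S.ball_mono (Set.singleton_subset_iff.2 h1) _ (ih hc)

theorem mem_nb_iff {Y : Set A} {b : A} :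
    b ∈ S.nb Y ↔ ∃ a ∈ Y, a = b ∨ S.gaifman.Adj a b := by
  constructor
  · rintro (h | ⟨R, l, ⟨h1, h2, h3⟩, hb, a, ha, hY⟩)
    · exact ⟨b, h, Or.inl rfl⟩
    · refine ⟨a, hY, ?_⟩
      by_cases e : a = b
      · exact Or.inl e
      · refine Or.inr ⟨e, _, _, h3, ?_, ?_⟩
        · obtain ⟨i, rfl⟩ := List.mem_iff_get.1 ha
          exact ⟨Fin.cast h2 i, rfl⟩
        · obtain ⟨i, rfl⟩ := List.mem_iff_get.1 hb
          exact ⟨Fin.cast h2 i, rfl⟩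
  · rintro ⟨a, ha, rfl | ⟨-, R, t, ht, h1, h2⟩⟩
    · exact Or.inl ha
    · exact Or.inr ⟨R, _, (S.relList_ofFn R t).2 ht, List.mem_ofFn.2 h2, a, List.mem_ofFn.2 h1, ha⟩

/-- The neighbourhoods defined by iteration are those defined by distances in the Gaifman graph. -/
theorem mem_ball_iff {r : ℕ} {X : Set A} {b : A} :
    b ∈ S.ball r X ↔ ∃ a ∈ X, S.gaifman.edist a b ≤ r := by
  constructor
  · intro h
    induction r generalizing b with
    | zero => exact ⟨b, h, by simp⟩
    | succ r ih =>
      obtain ⟨c, hc, h⟩ := S.mem_nb_iff.1 h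
      obtain ⟨a, ha, h'⟩ := ih hc
      refine ⟨a, ha, ?_⟩
      rcases h with rfl | h
      · exact h'.trans (by exact_mod_cast Nat.le_succ r)
      · have h1 : S.gaifman.edist c b = 1 := SimpleGraph.edist_eq_one_iff_adj.2 h
        refine SimpleGraph.edist_triangle.trans ((add_le_add h' h1.le).trans ?_)
        push_cast
        exact le_rfl
  · rintro ⟨a, ha, h⟩
    have hne : S.gaifman.edist a b ≠ ⊤ := ne_top_of_le_ne_top (ENat.natCast_ne_top r) h
    obtain ⟨w, hw⟩ := (SimpleGraph.reachable_of_edist_ne_top hne).exists_walk_length_eq_edist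
    rw [← hw] at h
    have hl : w.length ≤ r := by exact_mod_cast h
    refine S.ball_mono_radius hl X ?_
    clear h hw hl hne
    refine S.ball_mono (Set.singleton_subset_iff.2 ha) _ ?_
    clear ha
    induction w with
    | nil => rfl
    | cons h w ih =>
      rw [SimpleGraph.Walk.length_cons, add_comm, ball_add]
      refine S.ball_mono (Set.singleton_subset_iff.2 ?_) _ ih
      exact S.mem_nb_iff.2 ⟨_, rfl, Or.inr h⟩

theorem nbhd_eq_ball (r : ℕ) {n : ℕ} (a : Fin n → A) : S.nbhd r a = S.ball r (Set.range a) := by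
  ext b
  rw [mem_ball_iff]
  simp [nbhd]

theorem ncard_nb_le [Finite A] {d : ℕ} (hd : S.Bounded d) (Y : Set A) :
    (S.nb Y).ncard ≤ Y.ncard * (d + 1) := by
  have h1 : S.nb Y = ⋃ a ∈ Y, insert a (S.gaifman.neighborSet a) := by
    ext b
    rw [mem_nb_iff]
    simp only [Set.mem_iUnion, Set.mem_insert_iff, exists_prop, SimpleGraph.mem_neighborSet]
    refine exists_congr fun a => and_congr_right fun _ => or_congr_left ⟨Eq.symm, Eq.symm⟩
  rw [h1]
  induction Y, Y.toFinite using Set.Finite.induction_on with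
  | empty => simp
  | @insert a Y ha hY ih =>
    rw [Set.biUnion_insert, Set.ncard_insert_of_notMem ha hY, add_mul, one_mul]
    refine (Set.ncard_union_le _ _).trans ?_
    rw [add_comm]
    refine add_le_add (ih ?_) ((Set.ncard_insert_le _ _).trans (Nat.add_le_add_right (hd a) 1))
    ext b
    rw [mem_nb_iff]
    simp only [Set.mem_iUnion, Set.mem_insert_iff, exists_prop, SimpleGraph.mem_neighborSet]
    refine exists_congr fun a => and_congr_right fun _ => or_congr_left ⟨Eq.symm, Eq.symm⟩

/-- In bounded structures the size of neighbourhoods is bounded. -/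
theorem ncard_ball_le [Finite A] {d : ℕ} (hd : S.Bounded d) (r : ℕ) (X : Set A) :
    (S.ball r X).ncard ≤ X.ncard * (d + 1) ^ r := by
  induction r with
  | zero => simp [ball]
  | succ r ih =>
    refine (S.ncard_nb_le hd _).trans ?_
    rw [pow_succ, ← mul_assoc]
    exact Nat.mul_le_mul_right _ ih

end Struc

/-! ### Isomorphisms of neighbourhoods -/

/-- The map `f` restricts to an isomorphism from the substructure of `S` induced on the
`r`-neighbourhood of `X` to the substructure of `T` induced on the `r`-neighbourhood of `f '' X`. -/
structure Match (S : Struc σ A) (T : Struc σ B) (r : ℕ) (X : Set A) (f : A → B) : Prop where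
  inj : Set.InjOn f (S.ball r X)
  rel : ∀ (R : ℕ) (l : List A), (∀ a ∈ l, a ∈ S.ball r X) →
    (S.relList R l ↔ T.relList R (l.map f))
  image : f '' S.ball r X = T.ball r (f '' X)

namespace Match

variable {S : Struc σ A} {T : Struc σ B} {U : Struc σ C} {r : ℕ} {X : Set A} {f : A → B}

theorem exists_list {Y : Set A} {l : List B} (h : ∀ b ∈ l, b ∈ f '' Y) :
    ∃ l' : List A, (∀ a ∈ l', a ∈ Y) ∧ l'.map f = l := by
  induction l with
  | nil => exact ⟨[], by simp, rfl⟩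
  | cons b l ih =>
    obtain ⟨l', h1, h2⟩ := ih fun c hc => h c (List.mem_cons_of_mem _ hc)
    obtain ⟨a, ha, rfl⟩ := h b List.mem_cons_self
    refine ⟨a :: l', ?_, by simp [h2]⟩
    intro c hc
    rcases List.mem_cons.1 hc with rfl | hc
    · exact ha
    · exact h1 c hc

theorem image_ball_subset (h2 : ∀ (R : ℕ) (l : List A), (∀ a ∈ l, a ∈ S.ball r X) →
    (S.relList R l ↔ T.relList R (l.map f))) {s k : ℕ} {Y : Set A} (hY : Y ⊆ S.ball s X)
    (h : s + k ≤ r) : f '' S.ball k Y ⊆ T.ball k (f '' Y) := by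
  induction k with
  | zero => exact subset_rfl
  | succ k ih =>
    rintro _ ⟨c, hc, rfl⟩
    have ih := ih (by omega)
    rcases hc with hc | ⟨R, l, hl, hc, a, ha, haY⟩
    · exact Or.inl (ih ⟨c, hc, rfl⟩)
    · refine Or.inr ⟨R, l.map f, (h2 R l fun b hb => ?_).1 hl, List.mem_map_of_mem hc, f a,
        List.mem_map_of_mem ha, ih ⟨a, haY, rfl⟩⟩
      exact S.ball_subset_ball (k := k + 1) hY h (Or.inr ⟨R, l, hl, hb, a, ha, haY⟩)

/-- A map that is an isomorphism onto its image is an isomorphism onto the whole neighbourhood, if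
no tuple leaves the image from its inner part. -/
theorem of_closed (h1 : Set.InjOn f (S.ball r X))
    (h2 : ∀ (R : ℕ) (l : List A), (∀ a ∈ l, a ∈ S.ball r X) →
      (S.relList R l ↔ T.relList R (l.map f)))
    (h3 : ∀ k, k < r → ∀ (R : ℕ) (l : List B), T.relList R l →
      (∃ b ∈ l, b ∈ f '' S.ball k X) → ∀ b ∈ l, b ∈ f '' S.ball r X) : Match S T r X f := by
  refine ⟨h1, h2, ?_⟩
  have key : ∀ k ≤ r, f '' S.ball k X = T.ball k (f '' X) := by
    intro k hk
    induction k with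
    | zero => rfl
    | succ k ih =>
      have ih := ih (by omega)
      refine (image_ball_subset h2 (s := 0) (Y := X) subset_rfl (by omega)).antisymm ?_
      rintro d (hd | ⟨R, l, hl, hd, b, hb, hbY⟩)
      · rw [← ih] at hd
        exact Set.image_mono (S.subset_nb _) hd
      · rw [← ih] at hbY
        obtain ⟨l', hl', rfl⟩ := exists_list (h3 k hk R l hl ⟨b, hb, hbY⟩)
        obtain ⟨c, hc, rfl⟩ := List.mem_map.1 hd
        obtain ⟨a, ha, rfl⟩ := List.mem_map.1 hb
        obtain ⟨a', ha', e⟩ := hbY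
        have := h1 (S.ball_mono_radius (Nat.le_of_succ_le hk) _ ha') (hl' a ha) e
        subst this
        exact ⟨c, Or.inr ⟨R, l', (h2 R l' hl').2 hl, hc, a', ha, ha'⟩, rfl⟩
  exact key r le_rfl

/-- An isomorphism of neighbourhoods respects the smaller neighbourhoods inside. -/
theorem image_ball (H : Match S T r X f) {s k : ℕ} {Y : Set A} (hY : Y ⊆ S.ball s X)
    (h : s + k ≤ r) : f '' S.ball k Y = T.ball k (f '' Y) := by
  induction k with
  | zero => rfl
  | succ k ih =>
    have ih := ih (by omega)
    refine (image_ball_subset H.rel hY h).antisymm ?_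
    rintro d (hd | ⟨R, l, hl, hd, b, hb, hbY⟩)
    · rw [← ih] at hd
      exact Set.image_mono (S.subset_nb _) hd
    · have h0 : ∀ c ∈ l, c ∈ f '' S.ball r X := by
        intro c hc
        rw [H.image]
        have h4 : c ∈ T.ball (k + 1) (f '' Y) := Or.inr ⟨R, l, hl, hc, b, hb, hbY⟩
        refine T.ball_subset_ball (s := s) ?_ h h4
        exact (Set.image_mono hY).trans (image_ball_subset H.rel (s := 0) subset_rfl (by omega))
      rw [← ih] at hbY
      obtain ⟨l', hl', rfl⟩ := exists_list h0
      obtain ⟨c, hc, rfl⟩ := List.mem_map.1 hd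
      obtain ⟨a, ha, rfl⟩ := List.mem_map.1 hb
      obtain ⟨a', ha', e⟩ := hbY
      have := H.inj (S.ball_subset_ball hY (by omega) ha') (hl' a ha) e
      subst this
      exact ⟨c, Or.inr ⟨R, l', (H.rel R l' hl').2 hl, hc, a', ha, ha'⟩, rfl⟩

theorem restrict (H : Match S T r X f) {s k : ℕ} {Y : Set A} (hY : Y ⊆ S.ball s X)
    (h : s + k ≤ r) : Match S T k Y f where
  inj := H.inj.mono (S.ball_subset_ball hY h)
  rel R l hl := H.rel R l fun a ha => S.ball_subset_ball hY h (hl a ha)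
  image := H.image_ball hY h

theorem congr (H : Match S T r X f) {g : A → B} (h : Set.EqOn f g (S.ball r X)) :
    Match S T r X g where
  inj := H.inj.congr h
  rel R l hl := by
    rw [H.rel R l hl, List.map_congr_left fun a ha => h (hl a ha)]
  image := by
    rw [← h.image_eq, H.image, (h.mono (S.subset_ball r X)).image_eq]

theorem comp {g : B → C} (H' : Match T U r (f '' X) g) (H : Match S T r X f) :
    Match S U r X (g ∘ f) where
  inj := H'.inj.comp H.inj (by rw [← H.image]; exact Set.mapsTo_image _ _)
  rel R l hl := by
    rw [H.rel R l hl, H'.rel R, List.map_map]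
    intro b hb
    obtain ⟨a, ha, rfl⟩ := List.mem_map.1 hb
    rw [← H.image]
    exact ⟨a, hl a ha, rfl⟩
  image := by rw [Set.image_comp, H.image, H'.image, Set.image_comp]

theorem symm [Nonempty A] (H : Match S T r X f) :
    Match T S r (f '' X) (Function.invFunOn f (S.ball r X)) := by
  have hinv : ∀ a ∈ S.ball r X, Function.invFunOn f (S.ball r X) (f a) = a := fun a ha =>
    H.inj.leftInvOn_invFunOn ha
  have himg : ∀ Y ⊆ S.ball r X, Function.invFunOn f (S.ball r X) '' (f '' Y) = Y := fun Y hY => by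
    rw [← Set.image_comp]
    ext a
    constructor
    · rintro ⟨b, hb, rfl⟩; rw [Function.comp_apply, hinv b (hY hb)]; exact hb
    · intro ha; exact ⟨a, ha, hinv a (hY ha)⟩
  refine ⟨?_, ?_, ?_⟩
  · rw [← H.image]
    rintro _ ⟨a, ha, rfl⟩ _ ⟨b, hb, rfl⟩ e
    rw [hinv a ha, hinv b hb] at e
    rw [e]
  · rw [← H.image]
    intro R l hl
    obtain ⟨l', hl', rfl⟩ := exists_list hl
    rw [← H.rel R l' hl', List.map_map]
    have : l'.map (Function.invFunOn f (S.ball r X) ∘ f) = l' := by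
      conv_rhs => rw [← List.map_id l']
      exact List.map_congr_left fun a ha => hinv a (hl' a ha)
    rw [this]
  · rw [← H.image, himg _ subset_rfl, himg _ (S.subset_ball r X)]

theorem symm_apply [Nonempty A] (H : Match S T r X f) {a : A} (ha : a ∈ S.ball r X) :
    Function.invFunOn f (S.ball r X) (f a) = a := H.inj.leftInvOn_invFunOn ha

/-- Isomorphisms of the neighbourhoods of two sets of large distance can be glued together. -/
theorem glue (H : Match S T r X f) {b : A} {g : A → B} (H' : Match S T r {b} g)
    (h1 : b ∉ S.ball (2 * r + 1) X) (h2 : g b ∉ T.ball (2 * r + 1) (f '' X)) :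
    ∃ h : A → B, Match S T r (insert b X) h ∧ Set.EqOn h f X ∧ h b = g b := by
  classical
  -- If the centres have distance greater than `2 * r + 1`, then the neighbourhoods are disjoint and
  -- no tuple meets both.
  have far : ∀ {D : Type} (V : Struc σ D) (Y : Set D) (c : D), c ∉ V.ball (2 * r + 1) Y →
      (∀ x ∈ V.ball r Y, x ∉ V.ball r {c}) ∧ ∀ R l, V.relList R l → (∃ x ∈ l, x ∈ V.ball r Y) →
        ∀ x ∈ l, x ∉ V.ball r {c} := by
    intro D V Y c hc
    have key : ∀ x ∈ V.ball (r + 1) Y, x ∉ V.ball r {c} := fun x hx hx' => hc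
      (V.ball_subset_ball (Set.singleton_subset_iff.2 hx) (by omega) (V.ball_symm hx'))
    refine ⟨fun x hx => key x (Or.inl hx), ?_⟩
    rintro R l hl ⟨y, hy, hyY⟩ x hx
    exact key x (Or.inr ⟨R, l, hl, hx, y, hy, hyY⟩)
  obtain ⟨f1, f2⟩ := far S X b h1
  obtain ⟨g1, g2⟩ := far T (f '' X) (g b) h2
  have H'i : g '' S.ball r {b} = T.ball r {g b} := by rw [H'.image, Set.image_singleton]
  have hfm : ∀ a ∈ S.ball r X, f a ∈ T.ball r (f '' X) := fun a ha => by
    rw [← H.image]; exact ⟨a, ha, rfl⟩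
  have hgm : ∀ a ∈ S.ball r {b}, g a ∈ T.ball r {g b} := fun a ha => by
    rw [← H'i]; exact ⟨a, ha, rfl⟩
  let h : A → B := fun a => if a ∈ S.ball r X then f a else g a
  have hf : ∀ a ∈ S.ball r X, h a = f a := fun a ha => if_pos ha
  have hg : ∀ a ∈ S.ball r {b}, h a = g a := fun a ha => if_neg fun ha' => f1 a ha' ha
  have hb : h b = g b := hg b (S.subset_ball r _ rfl)
  have hX : Set.EqOn h f X := fun a ha => hf a (S.subset_ball r X ha)
  have hun : S.ball r (insert b X) = S.ball r X ∪ S.ball r {b} := by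
    rw [Set.insert_eq, Set.union_comm, S.ball_union]
  refine ⟨h, ⟨?_, ?_, ?_⟩, hX, hb⟩
  · rw [hun]
    rintro x (hx | hx) y (hy | hy) e
    · rw [hf x hx, hf y hy] at e; exact H.inj hx hy e
    · rw [hf x hx, hg y hy] at e
      exact absurd (hgm y hy) (e ▸ g1 _ (hfm x hx))
    · rw [hg x hx, hf y hy] at e
      exact absurd (hgm x hx) (e ▸ g1 _ (hfm y hy))
    · rw [hg x hx, hg y hy] at e; exact H'.inj hx hy e
  · rw [hun]
    intro R l hl
    by_cases c1 : ∀ a ∈ l, a ∈ S.ball r X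
    · rw [H.rel R l c1, List.map_congr_left fun a ha => hf a (c1 a ha)]
    by_cases c2 : ∀ a ∈ l, a ∈ S.ball r {b}
    · rw [H'.rel R l c2, List.map_congr_left fun a ha => hg a (c2 a ha)]
    push Not at c1 c2
    obtain ⟨x, hx, hx'⟩ := c1
    obtain ⟨y, hy, hy'⟩ := c2
    have hxb := (hl x hx).resolve_left hx'
    have hyX := (hl y hy).resolve_right hy'
    refine iff_of_false (fun h3 => f2 R l h3 ⟨y, hy, hyX⟩ x hx hxb) fun h3 => ?_
    refine g2 R _ h3 ⟨h y, List.mem_map_of_mem hy, ?_⟩ (h x) (List.mem_map_of_mem hx) ?_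
    · rw [hf y hyX]; exact hfm y hyX
    · rw [hg x hxb]; exact hgm x hxb
  · have e1 : h '' S.ball r X = f '' S.ball r X := Set.image_congr hf
    have e2 : h '' S.ball r {b} = g '' S.ball r {b} := Set.image_congr hg
    have e3 : h '' X = f '' X := hX.image_eq
    rw [hun, Set.image_union, e1, e2, H.image, H'i, Set.image_insert_eq, hb, e3, Set.insert_eq,
      Set.union_comm, T.ball_union]

end Match

end Neighbourhoods

/-! ### Spheres -/

section Spheres

variable {σ : Signature} {A B : Type} {n : ℕ}

namespace Struc

/-- The sphere of a tuple, in a structure that need not be finite. -/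
def sphereOf (S : Struc σ A) (r : ℕ) (a : Fin n → A) (h : Finite (S.nbhd r a)) : Pointed σ n where
  carrier := S.nbhd r a
  finite := h
  str := S.induce (S.nbhd r a)
  centre := fun i => ⟨a i, S.centre_mem_nbhd r a i⟩

theorem relList_induce (S : Struc σ A) (Y : Set A) (R : ℕ) (l : List Y) :
    (S.induce Y).relList R l ↔ S.relList R (l.map Subtype.val) := by
  constructor
  · rintro ⟨h1, h2, h3⟩
    exact (S.relList_map R l Subtype.val h1 h2).2 h3
  · rintro ⟨h1, h2, h3⟩
    refine ⟨h1, by simpa using h2, ?_⟩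
    exact (S.relList_map R l Subtype.val h1 (by simpa using h2)).1 ⟨h1, h2, h3⟩

/-- The inclusion of a sphere is an isomorphism of neighbourhoods: distances to the centres are the
same in the sphere as in the whole structure. -/
theorem match_induce (S : Struc σ A) (r : ℕ) (a : Fin n → A) :
    Match (S.induce (S.nbhd r a)) S r
      (Set.range fun i => (⟨a i, S.centre_mem_nbhd r a i⟩ : S.nbhd r a)) Subtype.val := by
  have h2 : ∀ (R : ℕ) (l : List (S.nbhd r a)), (∀ x ∈ l, x ∈ (S.induce (S.nbhd r a)).ball r
      (Set.range fun i => (⟨a i, S.centre_mem_nbhd r a i⟩ : S.nbhd r a))) →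
      ((S.induce (S.nbhd r a)).relList R l ↔ S.relList R (l.map Subtype.val)) :=
    fun R l _ => S.relList_induce _ R l
  refine Match.of_closed Subtype.val_injective.injOn h2 ?_
  rintro k hk R l hl ⟨_, hb, b, hb', rfl⟩ c hc
  have h3 : ∀ x ∈ l, x ∈ S.nbhd r a := by
    intro x hx
    rw [nbhd_eq_ball]
    refine S.ball_mono_radius hk _ (Or.inr ⟨R, l, hl, hx, b, hb, ?_⟩)
    have := Match.image_ball_subset h2 (s := 0)
      (Y := Set.range fun i => (⟨a i, S.centre_mem_nbhd r a i⟩ : S.nbhd r a)) subset_rfl (k := k)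
      (by omega) ⟨b, hb', rfl⟩
    rwa [← Set.range_comp] at this
  obtain ⟨l', -, rfl⟩ := Match.exists_list (f := Subtype.val) (Y := Set.univ) (l := l)
    fun x hx => ⟨⟨x, h3 x hx⟩, trivial, rfl⟩
  obtain ⟨c, hc', rfl⟩ := List.mem_map.1 hc
  obtain ⟨b', hb1, e⟩ := List.mem_map.1 hb
  have := Subtype.val_injective e
  subst this
  refine ⟨c, ball_mono_radius _ hk _ (Or.inr ⟨R, l', ?_, hc', b', hb1, hb'⟩), rfl⟩
  exact (S.relList_induce _ R l').2 hl

theorem isType_sphereOf (S : Struc σ A) (r : ℕ) (a : Fin n → A) (h : Finite (S.nbhd r a))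
    (hn : 1 ≤ n) : (S.sphereOf r a h).IsType r := by
  refine ⟨hn, fun b => ?_⟩
  rw [nbhd_eq_ball]
  have h1 := (S.match_induce r a).image
  rw [← Set.range_comp] at h1
  have h2 : b.1 ∈ S.ball r (Set.range a) := by
    rw [← S.nbhd_eq_ball]; exact b.2
  have h3 : b.1 ∈ Subtype.val '' (S.induce (S.nbhd r a)).ball r
      (Set.range fun i => (⟨a i, S.centre_mem_nbhd r a i⟩ : S.nbhd r a)) := by
    rw [h1]; exact h2
  obtain ⟨c, hc, e⟩ := h3
  rw [← Subtype.val_injective e]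
  exact hc

/-- Isomorphisms of spheres in terms of `Match`. -/
theorem iso_sphereOf_iff [Nonempty B] {S : Struc σ A} {T : Struc σ B} {r : ℕ} {a : Fin n → A}
    {c : Fin n → B} (h : Finite (S.nbhd r a)) (h' : Finite (T.nbhd r c)) :
    (S.sphereOf r a h).Iso (T.sphereOf r c h') ↔
      ∃ f : A → B, Match S T r (Set.range a) f ∧ ∀ i, f (a i) = c i := by
  classical
  constructor
  · rintro ⟨e, he, hc⟩
    change S.nbhd r a ≃ T.nbhd r c at e
    have hrel : ∀ (R : ℕ) (l : List (S.nbhd r a)), S.relList R (l.map Subtype.val) ↔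
        T.relList R ((l.map e).map Subtype.val) := by
      intro R l
      rw [← relList_induce, ← relList_induce]
      constructor
      · rintro ⟨h1, h2, h3⟩
        exact ((T.induce _).relList_map R l e h1 h2).2 ((he _ _).1 h3)
      · intro h3
        obtain ⟨h1, h2, -⟩ := id h3
        rw [List.length_map] at h2
        exact ⟨h1, h2, (he _ _).2 (((T.induce _).relList_map R l e h1 h2).1 h3)⟩
    let f : A → B := fun x => if hx : x ∈ S.nbhd r a then (e ⟨x, hx⟩).1 else Classical.arbitrary B
    have hf : ∀ x : S.nbhd r a, f x.1 = (e x).1 := fun x => by simp [f]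
    have hfc : ∀ i, f (a i) = c i := fun i => by
      rw [hf ⟨a i, S.centre_mem_nbhd r a i⟩]
      exact congrArg Subtype.val (hc i)
    refine ⟨f, ⟨?_, ?_, ?_⟩, hfc⟩
    · rw [← nbhd_eq_ball]
      intro x hx y hy hxy
      rw [hf ⟨x, hx⟩, hf ⟨y, hy⟩] at hxy
      exact congrArg Subtype.val (e.injective (Subtype.val_injective hxy))
    · rw [← nbhd_eq_ball]
      intro R l hl
      obtain ⟨l', -, rfl⟩ := Match.exists_list (f := Subtype.val) (Y := Set.univ) (l := l)
        fun x hx => ⟨(⟨x, hl x hx⟩ : S.nbhd r a), trivial, rfl⟩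
      rw [hrel, List.map_map, List.map_map]
      exact iff_of_eq (congrArg _ (List.map_congr_left fun x _ => (hf x).symm))
    · rw [← Set.range_comp, show f ∘ a = c from funext hfc, ← nbhd_eq_ball, ← nbhd_eq_ball]
      ext y
      constructor
      · rintro ⟨x, hx, rfl⟩
        rw [hf ⟨x, hx⟩]
        exact (e ⟨x, hx⟩).2
      · intro hy
        refine ⟨(e.symm ⟨y, hy⟩).1, (e.symm ⟨y, hy⟩).2, ?_⟩
        rw [hf, Equiv.apply_symm_apply]
  · rintro ⟨f, H, hc⟩
    have hc' : f ∘ a = c := funext hc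
    have hb : Set.BijOn f (S.nbhd r a) (T.nbhd r c) := by
      rw [nbhd_eq_ball, nbhd_eq_ball, ← hc', Set.range_comp, ← H.image]
      exact H.inj.bijOn_image
    have h0 : ∀ x, (hb.equiv f x).1 = f x.1 := fun x => rfl
    refine ⟨hb.equiv f, fun R (t : Fin (σ.ar R) → S.nbhd r a) => ?_,
      fun i => Subtype.ext (hc i)⟩
    refine Iff.trans ((S.induce (S.nbhd r a)).relList_ofFn R t).symm
      (Iff.trans ?_ ((T.induce (T.nbhd r c)).relList_ofFn R (hb.equiv f ∘ t)))
    rw [relList_induce, relList_induce, H.rel]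
    · rw [List.map_map, List.map_ofFn, List.map_ofFn]
      rfl
    · intro x hx
      obtain ⟨y, -, rfl⟩ := List.mem_map.1 hx
      rw [← nbhd_eq_ball]
      exact y.2

end Struc

theorem Pointed.Iso.symm {τ ρ : Pointed σ n} (h : τ.Iso ρ) : ρ.Iso τ := by
  obtain ⟨e, h1, h2⟩ := h
  refine ⟨e.symm, fun R t => ?_, fun i => ?_⟩
  · rw [h1, ← Function.comp_assoc, Equiv.self_comp_symm, Function.id_comp]
  · rw [← h2, Equiv.symm_apply_apply]

end Spheres

/-! ### The universal structure -/

section Universal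

/-- The structure on letters that is described by `D`. -/
def compStr (σ : Signature) (D : Diag) : Struc σ ℕ where
  rel R := {t | ((R.val, List.ofFn t), true) ∈ D}

/-- The universal structure: the disjoint union of copies of all structures on letters. -/
def univStr (σ : Signature) : Struc σ Elem where
  rel R := {t | relHolds R.val (List.ofFn t) = true}

variable {σ : Signature} {A : Type}

/-- The number of entries of `l` is the arity of the symbol with index `R`. -/
def FitsArity (σ : Signature) {α : Type} (R : ℕ) (l : List α) : Prop :=
  σ.arities[R]? = some l.length

theorem fitsArity_iff {α : Type} {R : ℕ} {l : List α} : FitsArity σ R l ↔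
    ∃ hR : R < σ.arities.length, l.length = σ.ar ⟨R, hR⟩ := by
  rw [FitsArity, List.getElem?_eq_some_iff]
  exact exists_congr fun h => ⟨fun h' => h'.symm, fun h' => h'.symm⟩

theorem Struc.relList.fitsArity {S : Struc σ A} {R : ℕ} {l : List A} (h : S.relList R l) :
    FitsArity σ R l := by
  obtain ⟨h1, h2, -⟩ := h
  exact fitsArity_iff.2 ⟨h1, h2⟩

theorem FitsArity.map {α β : Type} {R : ℕ} {l : List α} (f : α → β) :
    FitsArity σ R (l.map f) ↔ FitsArity σ R l := by
  rw [FitsArity, List.length_map]; rfl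

theorem FitsArity.ne_nil {α : Type} {R : ℕ} {l : List α} (h : FitsArity σ R l) : l ≠ [] := by
  rintro rfl
  exact absurd (σ.arity_pos _ (List.mem_of_getElem? h)) (by simp)

theorem ofFn_get_cast {α : Type} {l : List α} {n : ℕ} (h : l.length = n) :
    List.ofFn (fun i => l.get (Fin.cast h.symm i)) = l := by
  subst h
  exact List.ofFn_get l

theorem relList_compStr {D : Diag} {R : ℕ} {l : List ℕ} :
    (compStr σ D).relList R l ↔ FitsArity σ R l ∧ ((R, l), true) ∈ D := by
  constructor
  · rintro ⟨h1, h2, h3⟩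
    refine ⟨fitsArity_iff.2 ⟨h1, h2⟩, ?_⟩
    change ((R, List.ofFn _), true) ∈ D at h3
    rwa [ofFn_get_cast h2] at h3
  · rintro ⟨h, h3⟩
    obtain ⟨h1, h2⟩ := fitsArity_iff.1 h
    refine ⟨h1, h2, ?_⟩
    change ((R, List.ofFn _), true) ∈ D
    rwa [ofFn_get_cast h2]

theorem relList_univStr {R : ℕ} {l : List Elem} :
    (univStr σ).relList R l ↔ FitsArity σ R l ∧ relHolds R l = true := by
  constructor
  · rintro ⟨h1, h2, h3⟩
    refine ⟨fitsArity_iff.2 ⟨h1, h2⟩, ?_⟩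
    change relHolds R (List.ofFn _) = true at h3
    rwa [ofFn_get_cast h2] at h3
  · rintro ⟨h, h3⟩
    obtain ⟨h1, h2⟩ := fitsArity_iff.1 h
    refine ⟨h1, h2, ?_⟩
    change relHolds R (List.ofFn _) = true
    rwa [ofFn_get_cast h2]

theorem relHolds_iff {R : ℕ} {us : List Elem} : relHolds R us = true ↔
    (∀ u ∈ us, ∀ v ∈ us, u.2 = v.2) ∧ ∃ u ∈ us, ((R, us.map Prod.fst), true) ∈ u.2.2 := by
  simp [relHolds, Diag.holds]

/-- A copy of a structure on the letters is a union of components of the universal structure. -/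
theorem match_univStr (r : ℕ) (X : Set ℕ) (cD : ℕ × Diag) :
    Match (compStr σ cD.2) (univStr σ) r X (fun i => (i, cD)) := by
  have h2 : ∀ (R : ℕ) (l : List ℕ), (compStr σ cD.2).relList R l ↔
      (univStr σ).relList R (l.map fun i => (i, cD)) := by
    intro R l
    rw [relList_compStr, relList_univStr, relHolds_iff, FitsArity.map]
    refine and_congr_right fun hl => ?_
    have e : (l.map fun i => (i, cD)).map Prod.fst = l := by
      rw [List.map_map]; exact List.map_id l
    rw [e]
    constructor
    · intro h
      refine ⟨fun u hu v hv => ?_, ?_⟩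
      · obtain ⟨i, -, rfl⟩ := List.mem_map.1 hu
        obtain ⟨j, -, rfl⟩ := List.mem_map.1 hv
        rfl
      · obtain ⟨i, hi⟩ := List.exists_mem_of_ne_nil l hl.ne_nil
        exact ⟨_, List.mem_map_of_mem hi, h⟩
    · rintro ⟨-, u, hu, h⟩
      obtain ⟨i, -, rfl⟩ := List.mem_map.1 hu
      exact h
  refine Match.of_closed (fun i _ j _ e => congrArg Prod.fst e) (fun R l _ => h2 R l) ?_
  rintro k hk R l hl ⟨_, hb, b, hb', rfl⟩ u hu
  have h3 := (relHolds_iff.1 (relList_univStr.1 hl).2).1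
  have e : (l.map Prod.fst).map (fun i => ((i, cD) : Elem)) = l := by
    rw [List.map_map]
    conv_rhs => rw [← List.map_id l]
    refine List.map_congr_left fun v hv => ?_
    exact Prod.ext rfl (h3 _ hb v hv)
  rw [← e] at hl
  refine ⟨u.1, (compStr σ cD.2).ball_mono_radius hk _ (Or.inr ⟨R, _, (h2 R _).2 hl,
    List.mem_map_of_mem hu, b, List.mem_map.2 ⟨_, hb, rfl⟩, hb'⟩), Prod.ext rfl (h3 _ hb u hu)⟩

/-- Neighbourhoods in the universal structure are computed within each copy separately. -/
theorem mem_ball_univStr {r : ℕ} {X : Set Elem} {b : Elem} : b ∈ (univStr σ).ball r X ↔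
    b.1 ∈ (compStr σ b.2.2).ball r {i | (i, b.2) ∈ X} := by
  have key : ∀ x : Elem, (univStr σ).ball r {x} =
      (fun i => (i, x.2)) '' (compStr σ x.2.2).ball r {x.1} := fun x => by
    rw [(match_univStr r {x.1} x.2).image, Set.image_singleton]
  rw [Struc.mem_ball_singleton]
  constructor
  · rintro ⟨x, hx, hb⟩
    rw [key] at hb
    obtain ⟨i, hi, rfl⟩ := hb
    exact Struc.ball_mono (compStr σ x.2.2) (Y := {i | (i, x.2) ∈ X})
      (Set.singleton_subset_iff.2 hx) _ hi
  · intro h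
    obtain ⟨i, hi, h⟩ := (Struc.mem_ball_singleton _).1 h
    refine ⟨_, hi, ?_⟩
    rw [key]
    exact ⟨_, h, rfl⟩

end Universal

/-! ### Structures on the letters -/

section Letters

theorem mem_sections_map_const {α β : Type} {L : List α} {ls f : List β} :
    f ∈ (L.map fun _ => ls).sections ↔ f.length = L.length ∧ ∀ j ∈ f, j ∈ ls := by
  rw [List.mem_sections, List.forall₂_map_right_iff]
  induction f generalizing L with
  | nil => cases L <;> simp
  | cons a f ih =>
    cases L with
    | nil => simp
    | cons b L => simp [ih]; tauto

theorem fst_mem_of_mem_signs {α : Type} {l : List α} {D : List (α × Bool)} (hD : D ∈ signs l)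
    {q : α × Bool} (hq : q ∈ D) : q.1 ∈ l := by
  rw [signs, List.mem_sections, List.forall₂_map_right_iff] at hD
  induction hD with
  | nil => cases hq
  | cons h _ ih =>
    rcases List.mem_cons.1 hq with rfl | hq
    · simp only [List.mem_cons, List.not_mem_nil, or_false] at h
      rcases h with rfl | rfl <;> exact List.mem_cons_self
    · exact List.mem_cons_of_mem _ (ih hq)

theorem map_mem_signs {α : Type} (l : List α) (f : α → Bool) :
    l.map (fun a => (a, f a)) ∈ signs l := by
  rw [signs, List.mem_sections, List.forall₂_map_right_iff, List.forall₂_map_left_iff,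
    List.forall₂_same]
  intro a _
  cases f a <;> simp

theorem length_sections {α : Type} (L : List (List α)) :
    L.sections.length = (L.map List.length).prod := by
  induction L with
  | nil => rfl
  | cons l L ih =>
    have : ∀ S : List (List α), (S.flatMap fun s => l.map fun a => a :: s).length =
        l.length * S.length := by
      intro S
      induction S with
      | nil => rfl
      | cons s S ih => simp [ih]; ring
    rw [List.sections, this, ih]; rfl

theorem length_signs {α : Type} (l : List α) : (signs l).length = 2 ^ l.length := by
  rw [signs, length_sections, List.map_map]
  induction l with
  | nil => rfl
  | cons a l ih => rw [List.map_cons, List.prod_cons, ih, List.length_cons, pow_succ, mul_comm]; rfl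

theorem nodup_sections {α : Type} {L : List (List α)} (h : ∀ l ∈ L, l.Nodup) :
    L.sections.Nodup := by
  induction L with
  | nil => simp
  | cons l L ih =>
    rw [List.sections, List.nodup_flatMap]
    refine ⟨fun s _ => (h l List.mem_cons_self).map fun a b e => (List.cons.inj e).1, ?_⟩
    refine (ih fun l' hl' => h l' (List.mem_cons_of_mem _ hl')).imp ?_
    intro s s' hs
    rw [Function.onFun, List.disjoint_left]
    intro x hx hx'
    obtain ⟨a, -, rfl⟩ := List.mem_map.1 hx
    obtain ⟨b, -, e⟩ := List.mem_map.1 hx'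
    exact hs (List.cons.inj e).2.symm

theorem nodup_signs {α : Type} (l : List α) : (signs l).Nodup := by
  refine nodup_sections fun s hs => ?_
  obtain ⟨a, -, rfl⟩ := List.mem_map.1 hs
  simp

/-- Lists of numbers that can serve as letters: the tuples of further variables lie above all
letters. -/
structure IsLetters (ls : List ℕ) : Prop where
  pos : 0 < ls.headD 0
  nodup : ls.Nodup
  lt : ∀ v ∈ ls, v < 2 * ls.headD 0

theorem IsLetters.ne_nil {ls : List ℕ} (h : IsLetters ls) : ls ≠ [] := by
  rintro rfl
  exact absurd h.pos (by simp)

theorem IsLetters.head_mem {ls : List ℕ} (h : IsLetters ls) : ls.headD 0 ∈ ls := by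
  have := h.ne_nil
  cases ls with
  | nil => exact absurd rfl this
  | cons a l => simp

variable {σ : Signature} {ls : List ℕ} {D : Diag}

theorem exists_mem_relsOf {R : ℕ} {a : ℕ} (h : σ.arities[R]? = some a) :
    (R, auxVars (ls.headD 0) a) ∈ relsOf ls σ.arities := by
  rw [relsOf, mem_number, List.getElem?_map, h]; rfl

/-- The atomic statements are all those that respect the arities. -/
theorem mem_tupsOf {t : Tup} : t ∈ (paramsOf ls σ.arities).tups ↔
    FitsArity σ t.1 t.2 ∧ ∀ j ∈ t.2, j ∈ ls := by
  obtain ⟨R, l⟩ := t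
  simp only [paramsOf, tupsOf, List.mem_flatMap, List.mem_map, mem_sections_map_const]
  constructor
  · rintro ⟨R', hR', t, ⟨h1, h2⟩, e⟩
    cases e
    obtain ⟨a, h3, h4⟩ := mem_relsOf hR'
    refine ⟨?_, h2⟩
    rw [FitsArity, h3, h1, h4, length_auxVars]
  · rintro ⟨h1, h2⟩
    refine ⟨_, exists_mem_relsOf h1, l, ⟨?_, h2⟩, rfl⟩
    rw [length_auxVars]

theorem mem_tups_of_mem_diag (hD : D ∈ signs (paramsOf ls σ.arities).tups) {t : Tup} {b : Bool}
    (h : (t, b) ∈ D) : FitsArity σ t.1 t.2 ∧ ∀ j ∈ t.2, j ∈ ls :=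
  mem_tupsOf.1 (fst_mem_of_mem_signs hD h)

theorem mem_U {b : Elem} : b ∈ (paramsOf ls σ.arities).U ↔
    b.1 ∈ ls ∧ b.2.1 ∈ ls ∧ b.2.2 ∈ signs (paramsOf ls σ.arities).tups := by
  obtain ⟨i, c, D⟩ := b
  simp [paramsOf, elems]

theorem nodup_U (h : IsLetters ls) : (paramsOf ls σ.arities).U.Nodup := by
  have : (paramsOf ls σ.arities).U =
      ls ×ˢ (ls ×ˢ signs (tupsOf ls (relsOf ls σ.arities))) := by
    simp only [paramsOf, elems, SProd.sprod, List.product]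
    refine List.flatMap_congr fun i _ => ?_
    rw [List.map_flatMap]
    refine List.flatMap_congr fun c _ => ?_
    rw [List.map_map]
    rfl
  rw [this]
  exact h.nodup.product (h.nodup.product (nodup_signs _))

theorem mem_nbStep (hD : D ∈ signs (paramsOf ls σ.arities).tups) {Y : List ℕ} {v : ℕ} :
    v ∈ nbStep ls D Y ↔ v ∈ ls ∧ v ∈ (compStr σ D).nb {v | v ∈ Y} := by
  simp only [nbStep, List.mem_filter, Bool.or_eq_true, decide_eq_true_eq, List.any_eq_true,
    Bool.and_eq_true, Struc.nb, Set.mem_ofPred_eq, relList_compStr]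
  refine and_congr_right fun _ => or_congr_right ?_
  constructor
  · rintro ⟨⟨⟨R, l⟩, b⟩, h1, h2, h3, j, h4, h5⟩
    dsimp only at h2 h3 h4
    subst h2
    exact ⟨R, l, ⟨(mem_tups_of_mem_diag hD h1).1, h1⟩, h3, j, h4, h5⟩
  · rintro ⟨R, l, ⟨-, h1⟩, h3, j, h4, h5⟩
    exact ⟨((R, l), true), h1, rfl, h3, j, h4, h5⟩

theorem ball_compStr_subset (hD : D ∈ signs (paramsOf ls σ.arities).tups) {X : Set ℕ}
    (hX : ∀ v ∈ X, v ∈ ls) (r : ℕ) : ∀ v ∈ (compStr σ D).ball r X, v ∈ ls := by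
  induction r with
  | zero => exact hX
  | succ r ih =>
    rintro v (hv | ⟨R, l, h1, h2, -⟩)
    · exact ih v hv
    · exact (mem_tups_of_mem_diag hD (relList_compStr.1 h1).2).2 v h2

theorem mem_ballList (hD : D ∈ signs (paramsOf ls σ.arities).tups) {cs : List ℕ}
    (hcs : ∀ v ∈ cs, v ∈ ls) {r : List Unit} {v : ℕ} :
    v ∈ ballList ls D cs r ↔ v ∈ (compStr σ D).ball r.length {v | v ∈ cs} := by
  induction r using List.reverseRecOn generalizing v with
  | nil =>
    simp only [ballList, List.foldl_nil, List.mem_filter, decide_eq_true_eq]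
    exact ⟨fun h => h.2, fun h => ⟨hcs v h, h⟩⟩
  | append_singleton r u ih =>
    have e : {v | v ∈ ballList ls D cs r} = (compStr σ D).ball r.length {v | v ∈ cs} :=
      Set.ext fun v => ih
    have e' : ballList ls D cs (r ++ [u]) = nbStep ls D (ballList ls D cs r) := by
      rw [ballList, List.foldl_append]; rfl
    rw [e', mem_nbStep hD, e, List.length_append]
    refine ⟨fun h => h.2, fun h => ⟨?_, h⟩⟩
    exact ball_compStr_subset hD (X := {v | v ∈ cs}) hcs (r.length + 1) v h

/-! ### Comparison of elements of the universal structure -/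

/-- The elements that occur in an assignment. -/
def Env.values (e : Env) : Set Elem := {u | ∃ x, (x, u) ∈ e}

/-- The test `isNear` is correct. -/
theorem isNear_iff {e : Env} (he : ∀ u ∈ e.values, u ∈ (paramsOf ls σ.arities).U)
    {r : List Unit} {b : Elem} (hb : b ∈ (paramsOf ls σ.arities).U) :
    isNear (paramsOf ls σ.arities) e r b = true ↔ b ∈ (univStr σ).ball r.length e.values := by
  have hD := (mem_U.1 hb).2.2
  have key : ∀ v, v ∈ (e.filter fun q => decide (q.2.2 = b.2)).map (fun q => q.2.1) ↔
      (v, b.2) ∈ e.values := by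
    intro v
    simp only [List.mem_map, List.mem_filter, decide_eq_true_eq, Env.values, Set.mem_ofPred_eq]
    constructor
    · rintro ⟨⟨x, i, cD⟩, ⟨h1, h2⟩, h3⟩
      dsimp only at h2 h3
      subst h2 h3
      exact ⟨x, h1⟩
    · rintro ⟨x, h⟩
      exact ⟨_, ⟨h, rfl⟩, rfl⟩
  rw [isNear, decide_eq_true_eq]
  change b.1 ∈ ballList ls b.2.2 _ r ↔ _
  rw [mem_ballList hD, mem_ball_univStr]
  · simp only [key]
  · intro v hv
    exact (mem_U.1 (he _ ((key v).1 hv))).1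

theorem apply_map {f : ℕ → ℕ} {l : List ℕ} {x : ℕ} (hx : x ∈ l) :
    apply (l.map fun i => (i, f i)) x = f x := by
  induction l with
  | nil => cases hx
  | cons a l ih =>
    by_cases e : a = x
    · subst e; simp [apply]
    · have := ih ((List.mem_cons.1 hx).resolve_left (Ne.symm e))
      simpa [apply, e] using this

theorem map_mem_functions {f : ℕ → ℕ} (hf : ∀ x ∈ ls, f x ∈ ls) :
    ls.map (fun i => (i, f i)) ∈ functions ls := by
  rw [functions, List.mem_sections, List.forall₂_map_right_iff, List.forall₂_map_left_iff,
    List.forall₂_same]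
  intro i hi
  exact List.mem_map.2 ⟨f i, hf i hi, rfl⟩

/-- The test `isoVia` is correct. -/
theorem isoVia_iff {r : List Unit} {b b' : Elem} (hb : b ∈ (paramsOf ls σ.arities).U)
    (hb' : b' ∈ (paramsOf ls σ.arities).U) {π : List (ℕ × ℕ)} :
    isoVia (paramsOf ls σ.arities) r b b' π = true ↔ apply π b.1 = b'.1 ∧
      Match (compStr σ b.2.2) (compStr σ b'.2.2) r.length {b.1} (apply π) := by
  obtain ⟨h1, -, hD⟩ := mem_U.1 hb
  obtain ⟨h1', -, hD'⟩ := mem_U.1 hb'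
  have hN : ∀ v, v ∈ ballList ls b.2.2 [b.1] r ↔ v ∈ (compStr σ b.2.2).ball r.length {b.1} := by
    intro v
    rw [mem_ballList hD (by simpa using h1)]
    simp
  have hN' : ∀ v, v ∈ ballList ls b'.2.2 [b'.1] r ↔
      v ∈ (compStr σ b'.2.2).ball r.length {b'.1} := by
    intro v
    rw [mem_ballList hD' (by simpa using h1')]
    simp
  have hls : ∀ v ∈ (compStr σ b.2.2).ball r.length {b.1}, v ∈ ls :=
    ball_compStr_subset hD (by simpa using h1) _
  have hrel : (∀ t ∈ (paramsOf ls σ.arities).tups, (∀ i ∈ t.2, i ∈ ballList ls b.2.2 [b.1] r) →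
      b.2.2.holds t = b'.2.2.holds (t.1, t.2.map (apply π))) ↔
      ∀ (R : ℕ) (l : List ℕ), (∀ a ∈ l, a ∈ (compStr σ b.2.2).ball r.length {b.1}) →
        ((compStr σ b.2.2).relList R l ↔ (compStr σ b'.2.2).relList R (l.map (apply π))) := by
    constructor
    · intro h R l hl
      rw [relList_compStr, relList_compStr, FitsArity.map]
      refine and_congr_right fun hf => ?_
      have := h (R, l) (mem_tupsOf.2 ⟨hf, fun j hj => hls j (hl j hj)⟩)
        fun i hi => (hN i).2 (hl i hi)
      simpa [Diag.holds] using this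
    · intro h t ht hl
      have := h t.1 t.2 fun a ha => (hN a).1 (hl a ha)
      rw [relList_compStr, relList_compStr, FitsArity.map] at this
      have hf := (mem_tupsOf.1 ht).1
      simpa [Diag.holds, hf] using this
  have e : isoVia (paramsOf ls σ.arities) r b b' π = true ↔ apply π b.1 = b'.1 ∧
      (∀ i ∈ ballList ls b.2.2 [b.1] r, ∀ j ∈ ballList ls b.2.2 [b.1] r, i = j ∨
        apply π i ≠ apply π j) ∧
      (∀ t ∈ (paramsOf ls σ.arities).tups, (∀ i ∈ t.2, i ∈ ballList ls b.2.2 [b.1] r) →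
        b.2.2.holds t = b'.2.2.holds (t.1, t.2.map (apply π))) ∧
      (∀ i ∈ ballList ls b.2.2 [b.1] r, apply π i ∈ ballList ls b'.2.2 [b'.1] r) ∧
      ∀ m ∈ ballList ls b'.2.2 [b'.1] r, ∃ i ∈ ballList ls b.2.2 [b.1] r, apply π i = m := by
    have hpl : (paramsOf ls σ.arities).letters = ls := rfl
    simp only [isoVia, hpl, Bool.and_eq_true, List.all_eq_true, List.any_eq_true,
      Bool.or_eq_true, decide_eq_true_eq, Bool.not_eq_true', decide_eq_false_iff_not]
    refine and_congr_right fun _ => and_congr_right fun _ => and_congr_left fun _ => ?_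
    refine forall₂_congr fun t _ => ?_
    rw [← Bool.not_eq_true, List.all_eq_true]
    simp only [decide_eq_true_eq]
    tauto
  rw [e, hrel]
  simp only [hN, hN']
  refine and_congr_right fun h0 => ?_
  constructor
  · rintro ⟨g1, g2, g3, g4⟩
    refine ⟨fun i hi j hj hij => (g1 i hi j hj).resolve_right fun h => h hij, g2, ?_⟩
    rw [Set.image_singleton, h0]
    ext m
    constructor
    · rintro ⟨i, hi, rfl⟩; exact g3 i hi
    · intro hm; exact g4 m hm
  · intro H
    have him := H.image
    rw [Set.image_singleton, h0] at him
    refine ⟨fun i hi j hj => ?_, H.rel, fun i hi => ?_, fun m hm => ?_⟩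
    · by_cases hij : i = j
      · exact Or.inl hij
      · exact Or.inr fun h => hij (H.inj hi hj h)
    · rw [← him]; exact ⟨i, hi, rfl⟩
    · rw [← him] at hm; exact hm

/-- The `r`-spheres of `a` in `S` and of `b` in `T` are isomorphic. -/
def SameSphere {A B : Type} (S : Struc σ A) (T : Struc σ B) (r : ℕ) (a : A) (b : B) : Prop :=
  ∃ f : A → B, Match S T r {a} f ∧ f a = b

theorem SameSphere.trans {A B C : Type} {S : Struc σ A} {T : Struc σ B} {V : Struc σ C} {r : ℕ}
    {a : A} {b : B} {c : C} (h : SameSphere S T r a b) (h' : SameSphere T V r b c) :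
    SameSphere S V r a c := by
  obtain ⟨f, hf, rfl⟩ := h
  obtain ⟨g, hg, rfl⟩ := h'
  rw [← Set.image_singleton] at hg
  exact ⟨g ∘ f, hg.comp hf, rfl⟩

theorem SameSphere.symm {A B : Type} {S : Struc σ A} {T : Struc σ B} {r : ℕ}
    {a : A} {b : B} (h : SameSphere S T r a b) : SameSphere T S r b a := by
  have : Nonempty A := ⟨a⟩
  obtain ⟨f, hf, rfl⟩ := h
  have := hf.symm
  rw [Set.image_singleton] at this
  exact ⟨_, this, hf.symm_apply (S.subset_ball r _ rfl)⟩

theorem SameSphere.refl {A : Type} (S : Struc σ A) (r : ℕ) (a : A) : SameSphere S S r a a :=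
  ⟨fun x => x, ⟨fun _ _ _ _ h => h, fun R l _ => by simp, by simp⟩, rfl⟩

theorem sameSphere_univStr (r : ℕ) (b : Elem) :
    SameSphere (compStr σ b.2.2) (univStr σ) r b.1 b :=
  ⟨_, match_univStr r {b.1} b.2, rfl⟩

/-- The test `isoTest` is correct: an isomorphism of spheres can be modified outside the sphere to
become a function from letters to letters. -/
theorem isoTest_iff (h : IsLetters ls) {r : List Unit} {b b' : Elem}
    (hb : b ∈ (paramsOf ls σ.arities).U) (hb' : b' ∈ (paramsOf ls σ.arities).U) :
    isoTest (paramsOf ls σ.arities) r b b' = true ↔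
      SameSphere (univStr σ) (univStr σ) r.length b b' := by
  obtain ⟨h1, -, hD⟩ := mem_U.1 hb
  obtain ⟨h1', -, hD'⟩ := mem_U.1 hb'
  have e : SameSphere (univStr σ) (univStr σ) r.length b b' ↔
      SameSphere (compStr σ b.2.2) (compStr σ b'.2.2) r.length b.1 b'.1 :=
    ⟨fun g => ((sameSphere_univStr _ b).trans g).trans (sameSphere_univStr _ b').symm,
      fun g => ((sameSphere_univStr _ b).symm.trans g).trans (sameSphere_univStr _ b')⟩
  rw [e, isoTest, List.any_eq_true]
  constructor
  · rintro ⟨π, -, hπ⟩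
    obtain ⟨g1, g2⟩ := (isoVia_iff hb hb').1 hπ
    exact ⟨_, g2, g1⟩
  · rintro ⟨f, hf, hfb⟩
    classical
    -- Outside the sphere, `f` may have values that are no letters.
    let f' : ℕ → ℕ := fun x => if f x ∈ ls then f x else ls.headD 0
    refine ⟨ls.map fun i => (i, f' i), map_mem_functions fun x _ => ?_, ?_⟩
    · by_cases hx : f x ∈ ls
      · simp [f', hx]
      · simpa only [f', hx, if_false] using h.head_mem
    · have hEq : Set.EqOn f (apply (ls.map fun i => (i, f' i)))
          ((compStr σ b.2.2).ball r.length {b.1}) := by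
        intro x hx
        rw [apply_map (ball_compStr_subset hD (by simpa using h1) _ x hx)]
        have : f x ∈ ls := by
          refine ball_compStr_subset hD' (X := {b'.1}) (by simpa using h1') r.length _ ?_
          rw [← hfb, ← Set.image_singleton, ← hf.image]
          exact ⟨x, hx, rfl⟩
        simp only [f', this, if_true]
      refine (isoVia_iff hb hb').2 ⟨?_, hf.congr hEq⟩
      rw [← hEq (Struc.subset_ball _ _ _ rfl), hfb]

theorem map_inj_of_injOn {α β : Type} {f : α → β} {X : Set α} (hf : Set.InjOn f X) {l l' : List α}
    (hl : ∀ a ∈ l, a ∈ X) (hl' : ∀ a ∈ l', a ∈ X) (e : l.map f = l'.map f) : l = l' := by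
  induction l generalizing l' with
  | nil => exact (List.map_eq_nil_iff.1 e.symm).symm
  | cons a l ih =>
    cases l' with
    | nil => cases e
    | cons b l' =>
      simp only [List.map_cons, List.cons.injEq] at e
      rw [hf (hl a List.mem_cons_self) (hl' b List.mem_cons_self) e.1,
        ih (fun c hc => hl c (List.mem_cons_of_mem _ hc))
          (fun c hc => hl' c (List.mem_cons_of_mem _ hc)) e.2]

/-- Every sphere that is not larger than the number of letters is isomorphic to a sphere in a
structure on the letters. -/
theorem exists_diag {A : Type} [Finite A] (S : Struc σ A) {r : ℕ} {X : Set A}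
    (hX : (S.ball r X).ncard ≤ ls.length) (h : IsLetters ls) :
    ∃ D ∈ signs (paramsOf ls σ.arities).tups, ∃ g : A → ℕ,
      (∀ a ∈ S.ball r X, g a ∈ ls) ∧ Match S (compStr σ D) r X g := by
  classical
  obtain ⟨g, hg1, hg2⟩ : ∃ g : A → ℕ, (∀ a ∈ S.ball r X, g a ∈ ls) ∧
      Set.InjOn g (S.ball r X) := by
    have hle : (S.ball r X).encard ≤ (ls.toFinset : Set ℕ).encard := by
      rw [← (S.ball r X).toFinite.cast_ncard_eq, Set.encard_coe_eq_coe_finsetCard,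
        List.toFinset_card_of_nodup h.nodup]
      exact_mod_cast hX
    obtain ⟨g, h1, h2⟩ := (S.ball r X).toFinite.exists_injOn_of_encard_le hle
    exact ⟨g, fun a ha => by simpa using h1 ha, h2⟩
  -- The relations on the letters are the images of the relations on the sphere, and nothing else.
  let P : Tup → Prop := fun t => ∃ l : List A, (∀ a ∈ l, a ∈ S.ball r X) ∧ l.map g = t.2 ∧
    S.relList t.1 l
  refine ⟨_, map_mem_signs _ fun t => decide (P t), g, hg1, ?_⟩
  have hmem : ∀ t : Tup, (t, true) ∈ (paramsOf ls σ.arities).tups.map (fun t => (t, decide (P t)))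
      ↔ t ∈ (paramsOf ls σ.arities).tups ∧ P t := by
    intro t
    rw [List.mem_map]
    constructor
    · rintro ⟨t', h1, h2⟩
      obtain rfl : t' = t := congrArg Prod.fst h2
      exact ⟨h1, of_decide_eq_true (congrArg Prod.snd h2)⟩
    · rintro ⟨h1, h2⟩
      exact ⟨t, h1, by simp [h2]⟩
  refine Match.of_closed hg2 (fun R l hl => ?_) ?_
  · rw [relList_compStr, hmem]
    constructor
    · intro hR
      refine ⟨(FitsArity.map g).2 hR.fitsArity, mem_tupsOf.2 ⟨(FitsArity.map g).2 hR.fitsArity, ?_⟩,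
        l, hl, rfl, hR⟩
      intro j hj
      obtain ⟨a, ha, rfl⟩ := List.mem_map.1 hj
      exact hg1 a (hl a ha)
    · rintro ⟨-, -, l', hl', e, hR⟩
      exact map_inj_of_injOn hg2 hl' hl e ▸ hR
  · rintro k hk R l hl - b hb
    rw [relList_compStr, hmem] at hl
    obtain ⟨-, -, l', hl', rfl, -⟩ := hl
    obtain ⟨a, ha, rfl⟩ := List.mem_map.1 hb
    exact ⟨a, hl' a ha, rfl⟩

end Letters

/-! ### Sphere-formulas -/

section SphereFormulas

theorem auxVars_spec {v : ℕ} (hv : 0 < v) (a : ℕ) :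
    (auxVars v a).Nodup ∧ ∀ u ∈ auxVars v a, 2 * v ≤ u := by
  have key : ∀ l : List Unit,
      let L := l.foldl (fun vs _ => (2 * vs.headD v) :: vs) ([] : List ℕ)
      L.Nodup ∧ (∀ u ∈ L, 2 * v ≤ u) ∧ v ≤ L.headD v ∧ ∀ u ∈ L, u ≤ L.headD v := by
    intro l
    induction l using List.reverseRecOn with
    | nil => simp
    | append_singleton l a ih =>
      obtain ⟨h1, h2, h3, h4⟩ := ih
      simp only [List.foldl_append, List.foldl_cons, List.foldl_nil]
      refine ⟨List.nodup_cons.2 ⟨fun h => ?_, h1⟩, ?_, ?_, ?_⟩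
      · have := h4 _ h
        omega
      · intro u hu
        rcases List.mem_cons.1 hu with rfl | hu
        · omega
        · exact h2 u hu
      · simp only [List.headD_cons]; omega
      · intro u hu
        simp only [List.headD_cons]
        rcases List.mem_cons.1 hu with rfl | hu
        · omega
        · have := h4 u hu; omega
  exact ⟨(key _).1, (key _).2.1⟩

theorem exists_map_eq {α β : Type} [Nonempty β] {vs : List α} (h : vs.Nodup) {l : List β}
    (hl : vs.length = l.length) : ∃ g : α → β, vs.map g = l := by
  classical
  induction vs generalizing l with
  | nil => exact ⟨fun _ => Classical.arbitrary β, (List.length_eq_zero_iff.1 hl.symm).symm⟩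
  | cons v vs ih =>
    cases l with
    | nil => cases hl
    | cons b l =>
      obtain ⟨hv, hn⟩ := List.nodup_cons.1 h
      obtain ⟨g, rfl⟩ := ih hn (by simpa using hl)
      refine ⟨Function.update g v b, ?_⟩
      rw [List.map_cons, Function.update_self]
      congr 1
      refine List.map_congr_left fun u hu => Function.update_of_ne ?_ _ _
      rintro rfl
      exact hv hu

variable {σ : Signature} {N : Type} [Encodable N] {A : Type} {sem : N → Set ℤ} {S : Struc σ A}
  {β : ℕ → A} {ls : List ℕ} {D : Diag}

/-- The meaning of `closedFormula` in terms of the interpretation of letters as elements of `S`. -/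
theorem holds_closedFormula {y R : ℕ} {vs M' M : List ℕ} (hvs : vs.Nodup)
    (hR : FitsArity σ R vs) (hM' : ∀ i ∈ M', i ∉ vs) (hM : ∀ i ∈ M, i ∉ vs) :
    (closedFormula y M' M (R, vs)).Holds sem S β ↔ ∀ l : List A, S.relList R l →
      (∃ b ∈ l, ∃ i ∈ M', β i = b) → ∀ b ∈ l, ∃ i ∈ M, β i = b := by
  have hne : Nonempty A := ⟨β 0⟩
  simp only [closedFormula, Raw.holds_neg, Raw.holds_exs, Raw.holds_bigAnd, List.mem_cons,
    List.not_mem_nil, or_false, forall_eq_or_imp, forall_eq, Raw.holds_rel, Raw.holds_bigOr,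
    List.mem_flatMap, List.mem_map, exists_exists_and_eq_and]
  have h1 : ∀ g : ℕ → A, vs.map (fun v => if v ∈ vs then g v else β v) = vs.map g := fun g =>
    List.map_congr_left fun v hv => if_pos hv
  constructor
  · intro h l hl ⟨b, hb, i, hi, hib⟩ b' hb'
    by_contra hcon
    push Not at hcon
    have hlen : vs.length = l.length := by
      have := hl.fitsArity
      rw [FitsArity] at this hR
      exact Option.some_injective _ (hR.symm.trans this)
    obtain ⟨g, rfl⟩ := exists_map_eq hvs hlen
    obtain ⟨j, hj, rfl⟩ := List.mem_map.1 hb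
    obtain ⟨j', hj', rfl⟩ := List.mem_map.1 hb'
    refine h ⟨g, by rw [h1]; exact hl, ⟨_, ⟨j, hj, i, hi, rfl⟩, ?_⟩, j', hj', ?_⟩
    · rw [Raw.holds_eq, if_pos hj, if_neg (hM' i hi), hib]
    · rintro _ ⟨i, hi, rfl⟩
      rw [Raw.holds_neg, Raw.holds_eq, if_pos hj', if_neg (hM i hi)]
      exact (hcon i hi).symm
  · rintro h ⟨g, hg, ⟨_, ⟨j, hj, i, hi, rfl⟩, hij⟩, j', hj', hn⟩
    rw [h1] at hg
    rw [Raw.holds_eq, if_pos hj, if_neg (hM' i hi)] at hij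
    obtain ⟨i', hi', e⟩ := h _ hg ⟨g j, List.mem_map_of_mem hj, i, hi, hij.symm⟩ (g j')
      (List.mem_map_of_mem hj')
    refine Raw.holds_neg.1 (hn _ ⟨i', hi', rfl⟩) ?_
    rw [Raw.holds_eq, if_pos hj', if_neg (hM i' hi'), e]

/-- The sphere-formula says that the sphere of the given elements is a copy of the sphere in `D`. The
formula speaks about tuples that contain an element of distance less than `r` from the centres and
an element outside the named ones; excluding them is enough for the named elements to fill the whole
sphere, by `Match.of_closed`. -/
theorem holds_sphereFormula (h : IsLetters ls) (hD : D ∈ signs (paramsOf ls σ.arities).tups)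
    {r : List Unit} {xs : List (ℕ × ℕ)} (hxs : ∀ q ∈ xs, q.1 ∉ ls ∧ q.2 ∈ ls) :
    (sphereFormula (paramsOf ls σ.arities) D r xs).Holds sem S β ↔
      ∃ g : ℕ → A, Match (compStr σ D) S r.length {v | v ∈ xs.map Prod.snd} g ∧
        ∀ q ∈ xs, β q.1 = g q.2 := by
  have hcs : ∀ v ∈ xs.map Prod.snd, v ∈ ls := by
    intro v hv
    obtain ⟨q, hq, rfl⟩ := List.mem_map.1 hv
    exact (hxs q hq).2
  set X : Set ℕ := {v | v ∈ xs.map Prod.snd} with hX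
  set M := ballList ls D (xs.map Prod.snd) r with hMdef
  set M' := if r.isEmpty then [] else ballList ls D (xs.map Prod.snd) r.tail with hM'def
  have hM : ∀ v, v ∈ M ↔ v ∈ (compStr σ D).ball r.length X := fun v => mem_ballList hD hcs
  have hM' : ∀ v, v ∈ M' ↔ ∃ k, k + 1 = r.length ∧ v ∈ (compStr σ D).ball k X := by
    intro v
    cases hr : r with
    | nil => simp [hM'def, hr]
    | cons u r' =>
      rw [hM'def, hr]
      simp only [List.isEmpty_cons, Bool.false_eq_true, if_false, List.tail_cons]
      rw [mem_ballList hD hcs, ← hX]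
      simp
  have hMls : ∀ v ∈ M, v ∈ ls := fun v hv => ball_compStr_subset hD hcs _ v ((hM v).1 hv)
  have hM'ls : ∀ v ∈ M', v ∈ ls := fun v hv => by
    obtain ⟨k, -, hk⟩ := (hM' v).1 hv
    exact ball_compStr_subset hD hcs _ v hk
  have haux : ∀ a, ∀ v ∈ ls, v ∉ auxVars (ls.headD 0) a := fun a v hv hv' => by
    have h1 := h.lt v hv
    have h2 := (auxVars_spec h.pos a).2 v hv'
    omega
  have hXM : ∀ q ∈ xs, q.2 ∈ M := fun q hq => (hM _).2
    (Struc.subset_ball _ _ _ (List.mem_map_of_mem hq))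
  -- The parts of the formula, with the letters interpreted by `g`.
  have hg : ∀ g : ℕ → A,
      ((∀ q ∈ xs, β q.1 = g q.2) ∧
      (∀ i ∈ M, ∀ j ∈ M, i ≠ j → g i ≠ g j) ∧
      (∀ t ∈ (paramsOf ls σ.arities).tups, (∀ i ∈ t.2, i ∈ M) →
        (((t, true) ∈ D) ↔ S.relList t.1 (t.2.map g))) ∧
      ∀ R ∈ relsOf ls σ.arities, ∀ l : List A, S.relList R.1 l →
        (∃ b ∈ l, ∃ i ∈ M', g i = b) → ∀ b ∈ l, ∃ i ∈ M, g i = b) ↔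
      Match (compStr σ D) S r.length X g ∧ ∀ q ∈ xs, β q.1 = g q.2 := by
    intro g
    constructor
    · rintro ⟨g1, g2, g3, g4⟩
      refine ⟨Match.of_closed ?_ ?_ ?_, g1⟩
      · intro i hi j hj hij
        by_contra hne
        exact g2 i ((hM i).2 hi) j ((hM j).2 hj) hne hij
      · intro R l hl
        rw [relList_compStr]
        constructor
        · rintro ⟨-, hR⟩
          refine (g3 (R, l) (fst_mem_of_mem_signs hD hR) ?_).1 hR
          exact fun i hi => (hM i).2 (hl i hi)
        · intro hR
          have hf := (FitsArity.map g).1 hR.fitsArity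
          refine ⟨hf, (g3 (R, l) (mem_tupsOf.2 ⟨hf, fun j hj => ?_⟩) ?_).2 hR⟩
          · exact hMls j ((hM j).2 (hl j hj))
          · exact fun i hi => (hM i).2 (hl i hi)
      · rintro k hk R l hl ⟨_, hb, i, hi, rfl⟩ b hb'
        obtain ⟨i', hi', e⟩ := g4 _ (exists_mem_relsOf hl.fitsArity) l hl ⟨_, hb, i, (hM' i).2
          ⟨r.length - 1, by omega, Struc.ball_mono_radius _ (by omega) _ hi⟩, rfl⟩ b hb'
        exact ⟨i', (hM i').1 hi', e⟩
    · rintro ⟨H, g1⟩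
      refine ⟨g1, ?_, ?_, ?_⟩
      · intro i hi j hj hne hij
        exact hne (H.inj ((hM i).1 hi) ((hM j).1 hj) hij)
      · intro t ht hl
        rw [← H.rel t.1 t.2 fun i hi => (hM i).1 (hl i hi), relList_compStr]
        exact ⟨fun h1 => ⟨(mem_tupsOf.1 ht).1, h1⟩, fun h1 => h1.2⟩
      · rintro R - l hl ⟨b, hb, i, hi, rfl⟩ b' hb'
        obtain ⟨k, hk, hi⟩ := (hM' i).1 hi
        have h1 : g i ∈ S.ball k (g '' X) := by
          rw [← H.image_ball (s := 0) (Y := X) subset_rfl (by omega)]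
          exact ⟨i, hi, rfl⟩
        have h2 : b' ∈ S.ball r.length (g '' X) := by
          rw [← hk]
          exact Or.inr ⟨R.1, l, hl, hb', _, hb, h1⟩
        rw [← H.image] at h2
        obtain ⟨i', hi', e⟩ := h2
        exact ⟨i', (hM i').2 hi', e⟩
  have hsf : sphereFormula (paramsOf ls σ.arities) D r xs = Raw.exs M (Raw.bigAnd (M.headD 0) (
    xs.map (fun q => Raw.eq q.1 q.2) ++
    (M.flatMap (fun i => (M.filter fun j => !decide (i = j)).map fun j =>
      Raw.neg (Raw.eq i j)) ++
    (((paramsOf ls σ.arities).tups.filter fun t => t.2.all fun i => decide (i ∈ M)).map (fun t =>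
      if D.holds t then Raw.rel t.1 t.2 else Raw.neg (Raw.rel t.1 t.2)) ++
    (relsOf ls σ.arities).map (closedFormula (M.headD 0) M' M))))) := rfl
  rw [hsf, Raw.holds_exs]
  simp only [← hg]
  -- The values of the interpretation outside `M` play no role.
  have hval : ∀ g : ℕ → A, Raw.Holds sem S (fun v => if v ∈ M then g v else β v)
      (Raw.bigAnd (M.headD 0) (
    xs.map (fun q => Raw.eq q.1 q.2) ++
    (M.flatMap (fun i => (M.filter fun j => !decide (i = j)).map fun j =>
      Raw.neg (Raw.eq i j)) ++
    (((paramsOf ls σ.arities).tups.filter fun t => t.2.all fun i => decide (i ∈ M)).map (fun t =>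
      if D.holds t then Raw.rel t.1 t.2 else Raw.neg (Raw.rel t.1 t.2)) ++
    (relsOf ls σ.arities).map (closedFormula (M.headD 0) M' M))))) ↔
      ((∀ q ∈ xs, β q.1 = g q.2) ∧
      (∀ i ∈ M, ∀ j ∈ M, i ≠ j → g i ≠ g j) ∧
      (∀ t ∈ (paramsOf ls σ.arities).tups, (∀ i ∈ t.2, i ∈ M) →
        (((t, true) ∈ D) ↔ S.relList t.1 (t.2.map g))) ∧
      ∀ R ∈ relsOf ls σ.arities, ∀ l : List A, S.relList R.1 l →
        (∃ b ∈ l, ∃ i ∈ M', g i = b) → ∀ b ∈ l, ∃ i ∈ M, g i = b) := by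
    intro g
    have hM'M : ∀ i ∈ M', i ∈ M := fun i hi => by
      obtain ⟨k, hk, hi⟩ := (hM' i).1 hi
      exact (hM i).2 (Struc.ball_mono_radius _ (by omega) _ hi)
    rw [Raw.holds_bigAnd]
    simp only [List.mem_append, or_imp, forall_and]
    refine and_congr ?_ (and_congr ?_ (and_congr ?_ ?_))
    · rw [List.forall_mem_map]
      simp only [Raw.holds_eq]
      refine forall₂_congr fun q hq => ?_
      rw [if_pos (hXM q hq), if_neg fun h1 => (hxs q hq).1 (hMls _ h1)]
    · simp only [List.mem_flatMap, List.mem_map, List.mem_filter, Bool.not_eq_true',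
        decide_eq_false_iff_not, forall_exists_index, and_imp]
      constructor
      · intro h1 i hi j hj hij
        have := h1 _ i hi j hj hij rfl
        rwa [Raw.holds_neg, Raw.holds_eq, if_pos hi, if_pos hj] at this
      · rintro h1 _ i hi j hj hij rfl
        rw [Raw.holds_neg, Raw.holds_eq, if_pos hi, if_pos hj]
        exact h1 i hi j hj hij
    · rw [List.forall_mem_map]
      simp only [List.mem_filter, List.all_eq_true, decide_eq_true_eq, and_imp]
      refine forall₃_congr fun t ht hl => ?_
      have e : t.2.map (fun v => if v ∈ M then g v else β v) = t.2.map g :=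
        List.map_congr_left fun v hv => if_pos (hl v hv)
      by_cases hh : (t, true) ∈ D
      · have : D.holds t = true := by simpa [Diag.holds] using hh
        rw [if_pos this, Raw.holds_rel, e]
        simp [hh]
      · have : ¬ D.holds t = true := by simpa [Diag.holds] using hh
        rw [if_neg this, Raw.holds_neg, Raw.holds_rel, e]
        simp [hh]
    · rw [List.forall_mem_map]
      refine forall₂_congr fun R hR => ?_
      obtain ⟨R, vs⟩ := R
      obtain ⟨a, ha, rfl⟩ := mem_relsOf hR
      rw [holds_closedFormula (auxVars_spec h.pos a).1]
      · refine forall₂_congr fun l _ => ?_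
        refine imp_congr (exists_congr fun b => and_congr_right fun _ => exists_congr fun i =>
          and_congr_right fun hi => by rw [if_pos (hM'M i hi)]) ?_
        exact forall₂_congr fun b _ => exists_congr fun i => and_congr_right fun hi => by
          rw [if_pos hi]
      · rw [FitsArity, length_auxVars]; exact ha
      · exact fun i hi => haux a i (hM'ls i hi)
      · exact fun i hi => haux a i (hMls i hi)
  simp only [hval]

end SphereFormulas

section SphereFormulaForm

variable {σ : Signature} {N : Type} [Encodable N] {ls : List ℕ} {D : Diag}

theorem wf_rel {R : ℕ} {l : List ℕ} (h : FitsArity σ R l) : (Raw.rel R l).WF σ N :=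
  fitsArity_iff.1 h

theorem wf_closedFormula {y : ℕ} {M' M : List ℕ} {R : ℕ × List ℕ} (hR : R ∈ relsOf ls σ.arities) :
    (closedFormula y M' M R).WF σ N := by
  refine Raw.wf_exs (Raw.wf_bigAnd ?_)
  obtain ⟨R, vs⟩ := R
  obtain ⟨a, ha, rfl⟩ := mem_relsOf hR
  simp only [List.mem_cons, List.not_mem_nil, or_false, forall_eq_or_imp, forall_eq]
  refine ⟨wf_rel ?_, Raw.wf_bigOr fun r hr => ?_, Raw.wf_bigOr fun r hr => ?_⟩
  · rw [FitsArity, length_auxVars]; exact ha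
  · obtain ⟨j, -, hr⟩ := List.mem_flatMap.1 hr
    obtain ⟨i, -, rfl⟩ := List.mem_map.1 hr
    trivial
  · obtain ⟨j, -, rfl⟩ := List.mem_map.1 hr
    refine Raw.wf_bigAnd fun r hr => ?_
    obtain ⟨i, -, rfl⟩ := List.mem_map.1 hr
    trivial

theorem isFO_closedFormula {y : ℕ} {M' M : List ℕ} {R : ℕ × List ℕ} :
    ((closedFormula y M' M R).lift σ N).IsFO := by
  refine Raw.isFO_exs (Raw.isFO_bigAnd ?_)
  simp only [List.mem_cons, List.not_mem_nil, or_false, forall_eq_or_imp, forall_eq]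
  refine ⟨Raw.isFO_rel _ _, Raw.isFO_bigOr fun r hr => ?_, Raw.isFO_bigOr fun r hr => ?_⟩
  · obtain ⟨j, -, hr⟩ := List.mem_flatMap.1 hr
    obtain ⟨i, -, rfl⟩ := List.mem_map.1 hr
    trivial
  · obtain ⟨j, -, rfl⟩ := List.mem_map.1 hr
    refine Raw.isFO_bigAnd fun r hr => ?_
    obtain ⟨i, -, rfl⟩ := List.mem_map.1 hr
    trivial

theorem free_closedFormula {y : ℕ} {M' M : List ℕ} {R : ℕ × List ℕ}
    (hR : R ∈ relsOf ls σ.arities) {v : ℕ} (hv : v ∈ ((closedFormula y M' M R).lift σ N).free) :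
    v = y ∨ v ∈ M' ∨ v ∈ M := by
  obtain ⟨R, vs⟩ := R
  obtain ⟨a, ha, rfl⟩ := mem_relsOf hR
  obtain ⟨hv, hn⟩ := Raw.mem_free_exs.1 hv
  dsimp only at hv hn
  obtain ⟨h, -⟩ | ⟨r, hr, hv⟩ := Raw.free_bigAnd_subset hv
  · cases h
  simp only [List.mem_cons, List.not_mem_nil, or_false] at hr
  rcases hr with rfl | rfl | rfl
  · refine absurd (Raw.free_lift_rel (wf_rel ?_) hv) hn
    rw [FitsArity, length_auxVars]; exact ha
  · obtain ⟨-, rfl⟩ | ⟨r, hr, hv⟩ := Raw.free_bigOr_subset hv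
    · exact Or.inl rfl
    obtain ⟨j, hj, hr⟩ := List.mem_flatMap.1 hr
    obtain ⟨i, hi, rfl⟩ := List.mem_map.1 hr
    simp only [Raw.lift, Formula.free, Finset.mem_insert, Finset.mem_singleton] at hv
    rcases hv with rfl | rfl
    · exact absurd hj hn
    · exact Or.inr (Or.inl hi)
  · obtain ⟨-, rfl⟩ | ⟨r, hr, hv⟩ := Raw.free_bigOr_subset hv
    · exact Or.inl rfl
    obtain ⟨j, hj, rfl⟩ := List.mem_map.1 hr
    obtain ⟨-, rfl⟩ | ⟨r, hr, hv⟩ := Raw.free_bigAnd_subset hv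
    · exact Or.inl rfl
    obtain ⟨i, hi, rfl⟩ := List.mem_map.1 hr
    simp only [Raw.lift, Formula.free, Finset.mem_insert, Finset.mem_singleton] at hv
    rcases hv with rfl | rfl
    · exact absurd hj hn
    · exact Or.inr (Or.inr hi)

theorem wf_sphereFormula {r : List Unit} {xs : List (ℕ × ℕ)} :
    (sphereFormula (paramsOf ls σ.arities) D r xs).WF σ N := by
  refine Raw.wf_exs (Raw.wf_bigAnd fun s hs => ?_)
  simp only [List.mem_append] at hs
  rcases hs with hs | hs | hs | hs
  · obtain ⟨q, -, rfl⟩ := List.mem_map.1 hs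
    trivial
  · obtain ⟨i, -, hs⟩ := List.mem_flatMap.1 hs
    obtain ⟨j, -, rfl⟩ := List.mem_map.1 hs
    trivial
  · obtain ⟨t, ht, rfl⟩ := List.mem_map.1 hs
    have : (Raw.rel t.1 t.2).WF σ N := wf_rel (mem_tupsOf.1 (List.mem_of_mem_filter ht)).1
    split
    · exact this
    · exact this
  · obtain ⟨R, hR, rfl⟩ := List.mem_map.1 hs
    exact wf_closedFormula hR

theorem isFO_sphereFormula {p : Params} {r : List Unit} {xs : List (ℕ × ℕ)} :
    ((sphereFormula p D r xs).lift σ N).IsFO := by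
  refine Raw.isFO_exs (Raw.isFO_bigAnd fun s hs => ?_)
  simp only [List.mem_append] at hs
  rcases hs with hs | hs | hs | hs
  · obtain ⟨q, -, rfl⟩ := List.mem_map.1 hs
    trivial
  · obtain ⟨i, -, hs⟩ := List.mem_flatMap.1 hs
    obtain ⟨j, -, rfl⟩ := List.mem_map.1 hs
    trivial
  · obtain ⟨t, ht, rfl⟩ := List.mem_map.1 hs
    have : ((Raw.rel t.1 t.2).lift σ N).IsFO := Raw.isFO_rel _ _
    split
    · exact this
    · exact this
  · obtain ⟨R, hR, rfl⟩ := List.mem_map.1 hs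
    exact isFO_closedFormula

theorem mem_free_sphereFormula (hD : D ∈ signs (paramsOf ls σ.arities).tups)
    {r : List Unit} {xs : List (ℕ × ℕ)} (hne : xs ≠ []) (hxs : ∀ q ∈ xs, q.1 ∉ ls ∧ q.2 ∈ ls)
    {v : ℕ} : v ∈ ((sphereFormula (paramsOf ls σ.arities) D r xs).lift σ N).free ↔
      v ∈ xs.map Prod.fst := by
  have hcs : ∀ v ∈ xs.map Prod.snd, v ∈ ls := by
    intro v hv
    obtain ⟨q, hq, rfl⟩ := List.mem_map.1 hv
    exact (hxs q hq).2
  have hcsM : ∀ (r : List Unit), ∀ q ∈ xs, q.2 ∈ ballList ls D (xs.map Prod.snd) r :=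
    fun r q hq => (mem_ballList hD hcs).2 (Struc.subset_ball _ _ _ (List.mem_map_of_mem hq))
  have hMls : ∀ (r : List Unit), ∀ v ∈ ballList ls D (xs.map Prod.snd) r, v ∈ ls := fun r v hv =>
    ball_compStr_subset hD hcs _ v ((mem_ballList hD hcs).1 hv)
  obtain ⟨q0, hq0⟩ := List.exists_mem_of_ne_nil xs hne
  have hhead : ∀ l : List ℕ, l ≠ [] → l.headD 0 ∈ l := by
    intro l hl
    cases l with
    | nil => exact absurd rfl hl
    | cons a l => simp
  rw [sphereFormula, Raw.mem_free_exs]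
  constructor
  · rintro ⟨hv, hn⟩
    obtain ⟨h, -⟩ | ⟨s, hs, hv⟩ := Raw.free_bigAnd_subset hv
    · exact absurd (List.map_eq_nil_iff.1 (List.append_eq_nil_iff.1 h).1) hne
    simp only [List.mem_append] at hs
    rcases hs with hs | hs | hs | hs
    · obtain ⟨q, hq, rfl⟩ := List.mem_map.1 hs
      simp only [Raw.lift, Formula.free, Finset.mem_insert, Finset.mem_singleton] at hv
      rcases hv with rfl | rfl
      · exact List.mem_map_of_mem hq
      · exact absurd (hcsM r q hq) hn
    · obtain ⟨i, hi, hs⟩ := List.mem_flatMap.1 hs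
      obtain ⟨j, hj, rfl⟩ := List.mem_map.1 hs
      simp only [Raw.lift, Formula.free, Finset.mem_insert, Finset.mem_singleton] at hv
      rcases hv with rfl | rfl
      · exact absurd hi hn
      · exact absurd (List.mem_of_mem_filter hj) hn
    · obtain ⟨t, ht, rfl⟩ := List.mem_map.1 hs
      obtain ⟨h1, h2⟩ := List.mem_filter.1 ht
      have hwf : (Raw.rel t.1 t.2).WF σ N := wf_rel (mem_tupsOf.1 h1).1
      have hv : v ∈ ((Raw.rel t.1 t.2).lift σ N).free := by
        split at hv
        · exact hv
        · exact hv
      have h3 := List.all_eq_true.1 h2 v (Raw.free_lift_rel hwf hv)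
      exact absurd (of_decide_eq_true h3) hn
    · obtain ⟨R, hR, rfl⟩ := List.mem_map.1 hs
      refine absurd ?_ hn
      rcases free_closedFormula hR hv with rfl | hv | hv
      · exact hhead _ (List.ne_nil_of_mem (hcsM r q0 hq0))
      · split at hv
        · cases hv
        · cases r with
          | nil => simp at *
          | cons u r =>
            rw [List.tail_cons] at hv
            exact (mem_ballList hD hcs).2 (Struc.ball_mono_radius _ (Nat.le_succ _) _
              ((mem_ballList hD hcs).1 hv))
      · exact hv
  · intro hv
    obtain ⟨q, hq, rfl⟩ := List.mem_map.1 hv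
    refine ⟨Raw.mem_free_bigAnd (r := Raw.eq q.1 q.2) ?_ ?_, fun h => (hxs q hq).1 (hMls r _ h)⟩
    · exact List.mem_append_left _ (List.mem_map.2 ⟨q, hq, rfl⟩)
    · simp [Raw.lift, Formula.free]

theorem finite_nbhd_compStr (hD : D ∈ signs (paramsOf ls σ.arities).tups) {r n : ℕ}
    {c : Fin n → ℕ} (hc : ∀ i, c i ∈ ls) : Finite ((compStr σ D).nbhd r c) := by
  rw [Struc.nbhd_eq_ball]
  refine (ls.finite_toSet.subset fun v hv => ?_).to_subtype
  exact ball_compStr_subset hD (by rintro _ ⟨i, rfl⟩; exact hc i) _ v hv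

/-- The formulas constructed are sphere-formulas in the sense of the definition. -/
theorem isSph_sphereFormula {sem : N → Set ℤ} (h : IsLetters ls)
    (hD : D ∈ signs (paramsOf ls σ.arities).tups) {r : List Unit} {n : ℕ} (hn : 1 ≤ n)
    {x c : Fin n → ℕ} (hx : Function.Injective x) (hxl : ∀ i, x i ∉ ls) (hc : ∀ i, c i ∈ ls) :
    ((sphereFormula (paramsOf ls σ.arities) D r (List.ofFn fun i => (x i, c i))).lift σ N).IsSph
      (withExists sem) r.length
      ((compStr σ D).sphereOf r.length c (finite_nbhd_compStr hD hc)) x := by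
  have hxs : ∀ q ∈ List.ofFn fun i => (x i, c i), q.1 ∉ ls ∧ q.2 ∈ ls := by
    intro q hq
    obtain ⟨i, rfl⟩ := List.mem_ofFn.1 hq
    exact ⟨hxl i, hc i⟩
  refine ⟨Struc.isType_sphereOf _ _ _ _ hn, hx, isFO_sphereFormula, fun v hv => ?_, ?_⟩
  · rw [mem_free_sphereFormula hD _ hxs] at hv
    · obtain ⟨q, hq, rfl⟩ := List.mem_map.1 hv
      obtain ⟨i, rfl⟩ := List.mem_ofFn.1 hq
      exact ⟨i, rfl⟩
    · intro e
      have := congrArg List.length e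
      rw [List.length_ofFn, List.length_nil] at this
      omega
  · intro A _ _ S β
    have e1 : {v | v ∈ (List.ofFn fun i => (x i, c i)).map Prod.snd} = Set.range c := by
      ext v
      simp [List.mem_ofFn]
    have e2 := holds_sphereFormula (sem := sem) (S := S) (β := β) h hD (r := r) hxs
    rw [e1] at e2
    rw [Raw.Holds] at e2
    have e3 : (S.sphere r.length (β ∘ x)) = S.sphereOf r.length (β ∘ x) inferInstance := rfl
    rw [e2, e3]
    have e4 := Struc.iso_sphereOf_iff (S := compStr σ D) (T := S) (r := r.length) (a := c)
      (c := β ∘ x) (finite_nbhd_compStr hD hc) inferInstance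
    refine Iff.trans ?_ (e4.symm.trans ⟨Pointed.Iso.symm, Pointed.Iso.symm⟩)
    refine exists_congr fun g => and_congr_right fun _ => ?_
    simp only [List.forall_mem_ofFn_iff, Function.comp_apply, eq_comm]

end SphereFormulaForm

/-! ### Correctness of the evaluation -/

section Radii

/-- The radius that is relevant for formulas of binding rank `k`, namely `(3 ^ k - 1) / 2`. -/
def rad : ℕ → ℕ
  | 0 => 0
  | k + 1 => 3 * rad k + 1

/-- The radii `rad k, …, rad 0` in unary. -/
def radList : ℕ → List (List Unit)
  | 0 => [[]]
  | k + 1 => List.replicate (rad (k + 1)) () :: radList k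

theorem radList_headD (k : ℕ) : (radList k).headD [] = List.replicate (rad k) () := by
  cases k <;> rfl

theorem radList_ne_nil (k : ℕ) : radList k ≠ [] := by
  cases k <;> simp [radList]

theorem radii_eq {l : List Unit} {k : ℕ} (h : l.length = k + 1) : radii l = radList k := by
  induction k generalizing l with
  | zero =>
    obtain ⟨a, rfl⟩ := List.length_eq_one_iff.1 h
    rfl
  | succ k ih =>
    obtain ⟨l', a, rfl⟩ : ∃ l' a, l = l' ++ [a] :=
      ⟨l.dropLast, l.getLast (by rintro rfl; simp at h), (List.dropLast_append_getLast _).symm⟩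
    have e := ih (l := l') (by simpa using h)
    rw [radii, List.foldl_append]
    change (if (radii l').isEmpty then [[]] else
      ((radii l').headD [] ++ ((radii l').headD [] ++ ((radii l').headD [] ++ [()]))) ::
        radii l') = _
    rw [e, if_neg (by rw [List.isEmpty_iff]; exact radList_ne_nil k), radList, radList_headD]
    congr 1
    rw [List.eq_replicate_iff]
    refine ⟨?_, fun _ _ => rfl⟩
    simp only [List.length_append, List.length_replicate, List.length_singleton, rad]
    omega

theorem rad_mono {k l : ℕ} (h : k ≤ l) : rad k ≤ rad l := by
  induction h with
  | refl => exact le_rfl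
  | step _ ih => exact ih.trans (by rw [rad]; omega)

theorem rad_lt (k : ℕ) : 2 * rad k < 3 ^ k := by
  induction k with
  | zero => simp [rad]
  | succ k ih => rw [rad, pow_succ]; omega

end Radii

section Evaluation

variable {σ : Signature} {N : Type} [Encodable N] {A : Type} {sem : N → Set ℤ} {S : Struc σ A}
  {ls : List ℕ}

theorem length_filter_eq_ncard {α : Type} {l : List α} (h : l.Nodup) (p : α → Bool) :
    (l.filter p).length = {b | b ∈ l ∧ p b = true}.ncard := by
  classical
  rw [← List.toFinset_card_of_nodup (h.filter p), ← Set.ncard_coe_finset]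
  congr 1
  ext b
  simp

theorem eq_map_of_mem_signs {α : Type} {l : List α} {w : List (α × Bool)} (hw : w ∈ signs l)
    (v : α → Raw) (P : Raw → Prop) [DecidablePred P] :
    (∀ q ∈ w.zip (l.map v), (q.1.2 = true ↔ P q.2)) ↔ w = l.map fun a => (a, decide (P (v a))) := by
  rw [signs, List.mem_sections, List.forall₂_map_right_iff] at hw
  induction hw with
  | nil => simp
  | @cons q a w l h _ ih =>
    simp only [List.map_cons, List.zip_cons_cons, List.forall_mem_cons, ih, List.cons.injEq]
    refine and_congr_left fun _ => ?_
    simp only [List.mem_cons, List.not_mem_nil, or_false] at h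
    rcases h with rfl | rfl <;> simp

theorem holds_ofTruthValues {β : ℕ → A} {vals : List Raw} {w : List (Elem × Bool)} {χ : Raw} :
    (ofTruthValues vals w χ).Holds sem S β ↔
      (∀ q ∈ w.zip vals, (q.1.2 = true ↔ q.2.Holds sem S β)) ∧ χ.Holds sem S β := by
  rw [ofTruthValues, Raw.holds_neg, Raw.holds_bigOr]
  push Not
  simp only [List.mem_append, or_imp, forall_and]
  refine and_congr ?_ (by simp [Raw.holds_neg])
  rw [List.forall_mem_map]
  refine forall₂_congr fun q _ => ?_
  cases q.1.2 <;> simp [Raw.holds_neg]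

theorem holds_ofBool {β : ℕ → A} {c : Bool} : (ofBool c).Holds sem S β ↔ c = true := by
  cases c
  · simpa [ofBool] using Raw.holds_bot
  · simpa [ofBool, Raw.holds_neg] using Raw.holds_bot

/-- The list `reps` contains exactly one element for each isomorphism type of spheres. -/
theorem reps_spec (h : IsLetters ls) {r : List Unit} {l : List Elem}
    (hl : ∀ b ∈ l, b ∈ (paramsOf ls σ.arities).U) :
    (∀ b ∈ reps (paramsOf ls σ.arities) r l, b ∈ l) ∧
    (∀ b ∈ l, ∃ b' ∈ reps (paramsOf ls σ.arities) r l,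
      SameSphere (univStr σ) (univStr σ) r.length b b') ∧
    (reps (paramsOf ls σ.arities) r l).Pairwise
      (fun b b' => ¬ SameSphere (univStr σ) (univStr σ) r.length b b') := by
  induction l using List.reverseRecOn with
  | nil => simp [reps]
  | append_singleton l b ih =>
    obtain ⟨h1, h2, h3⟩ := ih fun b hb => hl b (List.mem_append_left _ hb)
    have hbU := hl b (by simp)
    have hU : ∀ b' ∈ reps (paramsOf ls σ.arities) r l, b' ∈ (paramsOf ls σ.arities).U :=
      fun b' hb' => hl b' (List.mem_append_left _ (h1 b' hb'))
    have e : reps (paramsOf ls σ.arities) r (l ++ [b]) =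
        if (reps (paramsOf ls σ.arities) r l).any
          (fun b' => isoTest (paramsOf ls σ.arities) r b b') then
          reps (paramsOf ls σ.arities) r l else b :: reps (paramsOf ls σ.arities) r l := by
      rw [reps, List.foldl_append]; rfl
    rw [e]
    split
    · next hany =>
      obtain ⟨b', hb', hiso⟩ := List.any_eq_true.1 hany
      refine ⟨fun b hb => List.mem_append_left _ (h1 b hb), fun c hc => ?_, h3⟩
      rcases List.mem_append.1 hc with hc | hc
      · exact h2 c hc
      · rw [List.mem_singleton.1 hc]
        exact ⟨b', hb', (isoTest_iff h hbU (hU b' hb')).1 hiso⟩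
    · next hany =>
      refine ⟨fun c hc => ?_, fun c hc => ?_, List.pairwise_cons.2 ⟨fun b' hb' hs => ?_, h3⟩⟩
      · rcases List.mem_cons.1 hc with rfl | hc
        · simp
        · exact List.mem_append_left _ (h1 c hc)
      · rcases List.mem_append.1 hc with hc | hc
        · obtain ⟨b', hb', hs⟩ := h2 c hc
          exact ⟨b', List.mem_cons_of_mem _ hb', hs⟩
        · rw [List.mem_singleton.1 hc]
          exact ⟨b, List.mem_cons_self, SameSphere.refl _ _ _⟩
      · exact hany (List.any_eq_true.2 ⟨b', hb', (isoTest_iff h hbU (hU b' hb')).2 hs⟩)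

theorem ball_univStr_subset {X : Set Elem} (hX : ∀ b ∈ X, b ∈ (paramsOf ls σ.arities).U) (r : ℕ)
    {b : Elem} (hb : b ∈ (univStr σ).ball r X) : b ∈ (paramsOf ls σ.arities).U := by
  rw [mem_ball_univStr] at hb
  obtain ⟨i, hi, -⟩ := (Struc.mem_ball_singleton _).1 hb
  obtain ⟨-, h2, h3⟩ := mem_U.1 (hX _ hi)
  refine mem_U.2 ⟨ball_compStr_subset h3 (fun j hj => (mem_U.1 (hX _ hj)).1) r _ hb, h2, h3⟩

/-- There are more copies of each structure than elements in the assignment, so that some copy is not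
used by the assignment. -/
theorem exists_fresh (h : IsLetters ls) {e : Env} (he : e.length < ls.length) :
    ∃ c ∈ ls, ∀ u ∈ e.values, u.2.1 ≠ c := by
  by_contra hcon
  push Not at hcon
  have hsub : ls ⊆ e.map fun q => q.2.2.1 := by
    intro c hc
    obtain ⟨u, ⟨x, hu⟩, rfl⟩ := hcon c hc
    exact List.mem_map.2 ⟨_, hu, rfl⟩
  have := (h.nodup.subperm hsub).length_le
  rw [List.length_map] at this
  omega

/-- Every sphere in `S` has a copy in the universal structure, with any given name of the copy. -/
theorem exists_sameSphere [Finite A] (h : IsLetters ls) {r : ℕ} {a : A}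
    (ha : (S.ball r {a}).ncard ≤ ls.length) {c : ℕ} (hc : c ∈ ls) :
    ∃ b ∈ (paramsOf ls σ.arities).U, b.2.1 = c ∧ SameSphere (univStr σ) S r b a := by
  obtain ⟨D, hD, g, hg, H⟩ := exists_diag S ha h
  refine ⟨(g a, c, D), mem_U.2 ⟨hg a (S.subset_ball _ _ rfl), hc, hD⟩, rfl, ?_⟩
  exact (SameSphere.trans ⟨g, H, rfl⟩ (sameSphere_univStr r (g a, c, D))).symm

/-- Elements of unused copies are far from the assignment, whatever the distance. -/
theorem not_mem_ball_of_fresh {e : Env} {b : Elem} (h : ∀ u ∈ e.values, u.2.1 ≠ b.2.1) (r : ℕ) :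
    b ∉ (univStr σ).ball r e.values := by
  rw [mem_ball_univStr, Struc.mem_ball_singleton]
  rintro ⟨i, hi, -⟩
  exact h _ hi rfl

theorem holds_sphereFormula_singleton (h : IsLetters ls) {b : Elem}
    (hb : b ∈ (paramsOf ls σ.arities).U) {y : ℕ} (hy : y ∉ ls) {r : List Unit} {β : ℕ → A} :
    (sphereFormula (paramsOf ls σ.arities) b.2.2 r [(y, b.1)]).Holds sem S β ↔
      SameSphere (univStr σ) S r.length b (β y) := by
  obtain ⟨h1, -, hD⟩ := mem_U.1 hb
  rw [holds_sphereFormula h hD (by simpa using ⟨hy, h1⟩)]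
  have e : SameSphere (univStr σ) S r.length b (β y) ↔
      SameSphere (compStr σ b.2.2) S r.length b.1 (β y) :=
    ⟨fun g => (sameSphere_univStr _ b).trans g, fun g => (sameSphere_univStr _ b).symm.trans g⟩
  rw [e]
  simp [SameSphere, eq_comm]

/-- Counting the elements of `S` that satisfy `Q`: the elements near to the assignment correspond
to elements of the universal structure, and for the other elements only their spheres matter. -/
theorem holds_quantifier [Finite A] (h : IsLetters ls) {k : ℕ} {e : Env}
    (he : e.length < ls.length) (heU : ∀ u ∈ e.values, u ∈ (paramsOf ls σ.arities).U) {g : Elem → A}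
    (H : Match (univStr σ) S (rad (k + 1)) e.values g)
    (hS : ∀ a, (S.ball (rad k) {a}).ncard ≤ ls.length) {y : ℕ} (hy : y ∉ ls) {P : ℕ}
    {P' : Option N} (hP : Encodable.encode P' = P) {c : ℤ} {γ : ℕ → A} {Q : A → Prop}
    {vals : Elem → Raw}
    (ih : ∀ b ∈ (paramsOf ls σ.arities).U, ∀ g' : Elem → A,
      Match (univStr σ) S (rad k) (insert b e.values) g' → Set.EqOn g' g e.values →
        (Q (g' b) ↔ (vals b).Holds sem S γ)) :
    (quantifier (paramsOf ls σ.arities) e (List.replicate (rad k) ()) P y c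
      ((paramsOf ls σ.arities).U.map vals)).Holds sem S γ ↔
      ({a | Q a}.ncard : ℤ) - c ∈ withExists sem P' := by
  classical
  set p := paramsOf ls σ.arities with hp
  set r : List Unit := List.replicate (rad k) () with hr
  have hrl : r.length = rad k := by simp [hr]
  set R : List Unit := r ++ (r ++ [()]) with hR
  have hRl : R.length = 2 * rad k + 1 := by
    simp only [hR, List.length_append, hrl, List.length_singleton]; omega
  -- The actual truth values; the corresponding disjunct is the only one that can hold.
  set w0 := p.U.map fun b => (b, decide ((vals b).Holds sem S γ)) with hw0
  have h1 : (quantifier p e r P y c (p.U.map vals)).Holds sem S γ ↔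
      (condition p e r P y c w0).Holds sem S γ := by
    rw [quantifier, Raw.holds_bigOr]
    constructor
    · rintro ⟨_, hs, hh⟩
      obtain ⟨w, hw, rfl⟩ := List.mem_map.1 hs
      obtain ⟨h1, h2⟩ := holds_ofTruthValues.1 hh
      have := (eq_map_of_mem_signs (l := p.U) hw vals fun s => s.Holds sem S γ).1 h1
      rwa [this] at h2
    · intro hh
      refine ⟨_, List.mem_map.2 ⟨w0, map_mem_signs _ _, rfl⟩, holds_ofTruthValues.2 ⟨?_, hh⟩⟩
      exact (eq_map_of_mem_signs (l := p.U) (map_mem_signs _ _) vals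
        fun s => s.Holds sem S γ).2 rfl
  rw [h1]
  -- The elements of the universal structure, near to the assignment or far from it.
  set V := e.values with hV
  have hnear : ∀ b ∈ p.U, (isNear p e R b = true ↔ b ∈ (univStr σ).ball (2 * rad k + 1) V) := by
    intro b hb
    rw [isNear_iff heU hb, hRl]
  set far := (w0.filter fun q => q.2 && !isNear p e R q.1).map Prod.fst with hfar
  have hmemfar : ∀ b, b ∈ far ↔ b ∈ p.U ∧ (vals b).Holds sem S γ ∧
      b ∉ (univStr σ).ball (2 * rad k + 1) V := by
    intro b
    have e1 : far =
        p.U.filter fun b => decide ((vals b).Holds sem S γ) && !isNear p e R b := by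
      rw [hfar, hw0, List.filter_map, List.map_map]
      exact List.map_id _
    rw [e1, List.mem_filter, Bool.and_eq_true, decide_eq_true_eq, Bool.not_eq_true',
      ← Bool.not_eq_true]
    exact and_congr_right fun hb => by rw [hnear b hb]
  set T := reps p r far with hT
  obtain ⟨hT1, hT2, -⟩ := reps_spec (r := r) h (l := far) fun b hb => ((hmemfar b).1 hb).1
  have hTU : ∀ b ∈ T, b ∈ p.U := fun b hb => ((hmemfar b).1 (hT1 b hb)).1
  -- The sets of elements of `S` that are counted.
  set F : Set A := {a | Q a} with hF
  set G : Set A := {a | ∃ b ∈ T, SameSphere (univStr σ) S (rad k) b a} with hG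
  set M : Set A := S.ball (2 * rad k + 1) (g '' V) with hM
  have hMim : g '' (univStr σ).ball (2 * rad k + 1) V = M :=
    H.image_ball (s := 0) subset_rfl (by rw [rad]; omega)
  have hVk : Match (univStr σ) S (rad k) V g := H.restrict (s := 0) subset_rfl (by rw [rad]; omega)
  have hinj : Set.InjOn g ((univStr σ).ball (2 * rad k + 1) V) :=
    H.inj.mono (Struc.ball_mono_radius _ (by rw [rad]; omega) _)
  have hnearMatch : ∀ b ∈ (univStr σ).ball (2 * rad k + 1) V,
      Match (univStr σ) S (rad k) (insert b V) g := fun b hb =>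
    H.restrict (s := 2 * rad k + 1) (Set.insert_subset hb (Struc.subset_ball _ _ _))
      (by rw [rad]; omega)
  have hnearU : ∀ b ∈ (univStr σ).ball (2 * rad k + 1) V, b ∈ p.U := fun b hb =>
    ball_univStr_subset heU _ hb
  -- For elements far from the assignment only the type of the sphere matters, by gluing.
  have hfarQ : ∀ b ∈ p.U, ∀ a, b ∉ (univStr σ).ball (2 * rad k + 1) V → a ∉ M →
      SameSphere (univStr σ) S (rad k) b a → (Q a ↔ (vals b).Holds sem S γ) := by
    rintro b hb a hbV haM ⟨f, hf, rfl⟩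
    obtain ⟨g', H', h2, h3⟩ := hVk.glue hf hbV haM
    rw [← h3]
    exact ih b hb g' H' h2
  -- Far from the assignment, `Q` holds precisely of the elements with a type from `T`. An element
  -- of `S` far from the assignment has a counterpart in an unused copy.
  have hFM : F \ M = G \ M := by
    ext a
    refine and_congr_left fun haM => ?_
    constructor
    · intro hQ
      obtain ⟨c, hc, hfresh⟩ := exists_fresh h he
      obtain ⟨b, hb, rfl, hba⟩ := exists_sameSphere (S := S) h (hS a) hc
      have hbV := not_mem_ball_of_fresh (σ := σ) hfresh (2 * rad k + 1)
      have hbf := (hmemfar b).2 ⟨hb, (hfarQ b hb a hbV haM hba).1 hQ, hbV⟩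
      obtain ⟨b', hb', hs⟩ := hT2 b hbf
      rw [hrl] at hs
      exact ⟨b', hb', hs.symm.trans hba⟩
    · rintro ⟨b, hb, hba⟩
      obtain ⟨hbU, hh, hbV⟩ := (hmemfar b).1 (hT1 b hb)
      exact (hfarQ b hbU a hbV haM hba).2 hh
  -- Near the assignment, `g` is an isomorphism, and the elements are counted on the other side.
  have hFn : (F ∩ M).ncard = (w0.filter fun q => q.2 && isNear p e R q.1).length := by
    have e1 : (w0.filter fun q => q.2 && isNear p e R q.1).length =
        (p.U.filter fun b => decide ((vals b).Holds sem S γ) && isNear p e R b).length := by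
      rw [hw0, List.filter_map, List.length_map]; rfl
    rw [e1, length_filter_eq_ncard (nodup_U h)]
    have e2 : F ∩ M = g '' {b | b ∈ p.U ∧
        (decide ((vals b).Holds sem S γ) && isNear p e R b) = true} := by
      ext a
      constructor
      · rintro ⟨hQ, haM⟩
        rw [← hMim] at haM
        obtain ⟨b, hb, rfl⟩ := haM
        have hbU := hnearU b hb
        refine ⟨b, ⟨hbU, ?_⟩, rfl⟩
        rw [Bool.and_eq_true, decide_eq_true_eq]
        exact ⟨(ih b hbU g (hnearMatch b hb) fun _ _ => rfl).1 hQ, (hnear b hbU).2 hb⟩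
      · rintro ⟨b, ⟨hbU, hb⟩, rfl⟩
        rw [Bool.and_eq_true, decide_eq_true_eq] at hb
        have hbn := (hnear b hbU).1 hb.2
        exact ⟨(ih b hbU g (hnearMatch b hbn) fun _ _ => rfl).2 hb.1, hMim ▸ ⟨b, hbn, rfl⟩⟩
    rw [e2, Set.InjOn.ncard_image]
    refine hinj.mono ?_
    rintro b ⟨hbU, hb⟩
    rw [Bool.and_eq_true] at hb
    exact (hnear b hbU).1 hb.2
  have hGn : (G ∩ M).ncard =
      (p.U.filter fun b => isNear p e R b && T.any fun b' => isoTest p r b b').length := by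
    have hiso : ∀ b ∈ (univStr σ).ball (2 * rad k + 1) V,
        ((T.any fun b' => isoTest p r b b') = true ↔ g b ∈ G) := by
      intro b hb
      have hsb : SameSphere (univStr σ) S (rad k) b (g b) :=
        ⟨g, (hnearMatch b hb).restrict (s := 0) (Set.singleton_subset_iff.2 (Set.mem_insert _ _))
          (by omega), rfl⟩
      rw [List.any_eq_true]
      refine exists_congr fun b' => and_congr_right fun hb' => ?_
      rw [isoTest_iff h (hnearU b hb) (hTU b' hb'), hrl]
      exact ⟨fun hs => hs.symm.trans hsb, fun hs => hsb.trans hs.symm⟩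
    rw [length_filter_eq_ncard (nodup_U h)]
    have e2 : G ∩ M = g '' {b | b ∈ p.U ∧
        (isNear p e R b && T.any fun b' => isoTest p r b b') = true} := by
      ext a
      constructor
      · rintro ⟨hG, haM⟩
        rw [← hMim] at haM
        obtain ⟨b, hb, rfl⟩ := haM
        have hbU := hnearU b hb
        refine ⟨b, ⟨hbU, ?_⟩, rfl⟩
        rw [Bool.and_eq_true]
        exact ⟨(hnear b hbU).2 hb, (hiso b hb).2 hG⟩
      · rintro ⟨b, ⟨hbU, hb⟩, rfl⟩
        rw [Bool.and_eq_true] at hb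
        have hbn := (hnear b hbU).1 hb.1
        exact ⟨(hiso b hbn).1 hb.2, hMim ▸ ⟨b, hbn, rfl⟩⟩
    rw [e2, Set.InjOn.ncard_image]
    refine hinj.mono ?_
    rintro b ⟨hbU, hb⟩
    rw [Bool.and_eq_true] at hb
    exact (hnear b hbU).1 hb.1
  -- `#F = #(F ∩ M) + #(F \ M)`, and `F \ M = G \ M` gives `#(F \ M) = #G - #(G ∩ M)`.
  have hcount : (F.ncard : ℤ) = (w0.filter fun q => q.2 && isNear p e R q.1).length +
      (G.ncard - (p.U.filter fun b => isNear p e R b && T.any fun b' => isoTest p r b b').length) := by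
    rw [← Set.ncard_inter_add_ncard_sdiff_eq_ncard F M, ← Set.ncard_inter_add_ncard_sdiff_eq_ncard G M,
      hFM, hFn, hGn]
    push_cast
    ring
  have hcond : condition p e r P y c w0 =
      Raw.num P y (Raw.bigOr y (T.map fun b => sphereFormula p b.2.2 r [(y, b.1)]))
        (c - (w0.filter fun q => q.2 && isNear p e R q.1).length +
          (p.U.filter fun b => isNear p e R b && T.any fun b' => isoTest p r b b').length) := rfl
  have hsat : ({a | (Raw.bigOr y (T.map fun b => sphereFormula p b.2.2 r [(y, b.1)])).Holds sem S
      (Function.update γ y a)}) = G := by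
    ext a
    change Raw.Holds _ _ _ _ ↔ _
    rw [Raw.holds_bigOr]
    simp only [List.mem_map, exists_exists_and_eq_and]
    refine exists_congr fun b => and_congr_right fun hb => ?_
    rw [holds_sphereFormula_singleton h (hTU b hb) hy, Function.update_self, hrl]
  rw [hcond, Raw.Holds, Raw.lift_num hP, Formula.Sat]
  change (({a | Raw.Holds sem S (Function.update γ y a) _}.ncard : ℤ) - _) ∈ _ ↔ _
  rw [hsat, hcount]
  refine iff_of_eq (congrArg (fun z => z ∈ withExists sem P') ?_)
  ring

end Evaluation

section EvaluationCorrect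

variable {σ : Signature} {N : Type} [Encodable N] {A : Type} {sem : N → Set ℤ} {S : Struc σ A}
  {ls : List ℕ}

theorem Env.lookup_cons (x : ℕ) (u : Elem) (e : Env) (z : ℕ) :
    Env.lookup ((x, u) :: e) z = if x = z then u else e.lookup z := by
  by_cases h : x = z
  · simp [Env.lookup, h]
  · simp [Env.lookup, h]

theorem Env.values_cons (x : ℕ) (u : Elem) (e : Env) :
    Env.values ((x, u) :: e) = insert u e.values := by
  ext v
  simp only [Env.values, List.mem_cons, Set.mem_insert_iff, Set.mem_ofPred_eq, Prod.mk.injEq]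
  constructor
  · rintro ⟨z, ⟨-, h⟩ | h⟩
    · exact Or.inl h
    · exact Or.inr ⟨z, h⟩
  · rintro (rfl | ⟨z, h⟩)
    · exact ⟨x, Or.inl ⟨rfl, rfl⟩⟩
    · exact ⟨z, Or.inr h⟩

/-- The passage to the scope of a quantifier in the proof of `holds_eval`. -/
theorem holds_quantifier_eval [Finite A] (h : IsLetters ls) {φ : Formula σ N} {y : ℕ}
    (hy : y ∉ ls) {k : ℕ} (hk : φ.br + 1 ≤ k)
    (hS : ∀ a, ∀ j < k, (S.ball (rad j) {a}).ncard ≤ ls.length) {e : Env}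
    (he : e.length + (φ.br + 1) ≤ ls.length)
    (heU : ∀ u ∈ e.values, u ∈ (paramsOf ls σ.arities).U)
    {g : Elem → A} (H : Match (univStr σ) S (rad k) e.values g) {β γ : ℕ → A}
    (hβ : ∀ x ∈ φ.free.erase y, e.lookup x ∈ e.values ∧ β x = g (e.lookup x))
    (ih : ∀ {k : ℕ}, φ.br ≤ k → (∀ a, ∀ j < k, (S.ball (rad j) {a}).ncard ≤ ls.length) →
      ∀ {e : Env}, e.length + φ.br ≤ ls.length →
      (∀ u ∈ e.values, u ∈ (paramsOf ls σ.arities).U) → ∀ {g : Elem → A},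
      Match (univStr σ) S (rad k) e.values g → ∀ {β γ : ℕ → A},
      (∀ x ∈ φ.free, e.lookup x ∈ e.values ∧ β x = g (e.lookup x)) →
      (φ.Sat sem S β ↔
        (eval (paramsOf ls σ.arities) φ.erase e (radList k)).Holds sem S γ))
    {P : ℕ} {P' : Option N} (hP : Encodable.encode P' = P) (c : ℤ) :
    (quantifier (paramsOf ls σ.arities) e ((radList k).tail.headD []) P y c
      ((paramsOf ls σ.arities).U.map fun b => eval (paramsOf ls σ.arities) φ.erase
        ((y, b) :: e) (radList k).tail)).Holds sem S γ ↔
      ({a | φ.Sat sem S (Function.update β y a)}.ncard : ℤ) - c ∈ withExists sem P' := by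
  cases k with
  | zero => omega
  | succ k =>
    have e1 : (radList (k + 1)).tail = radList k := rfl
    rw [e1, radList_headD]
    refine holds_quantifier h (by omega) heU H (fun a => hS a k (Nat.lt_succ_self k)) hy hP ?_
    intro b hb g' H' hg'
    rw [← Env.values_cons y] at H'
    refine ih (by omega) (fun a j hj => hS a j (by omega)) (by rw [List.length_cons]; omega)
      ?_ H' ?_
    · rw [Env.values_cons]
      rintro u (rfl | hu)
      · exact hb
      · exact heU u hu
    · intro x hx
      rw [Env.lookup_cons, Env.values_cons]
      by_cases hxy : y = x
      · subst hxy
        simp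
      · have := hβ x (Finset.mem_erase.2 ⟨Ne.symm hxy, hx⟩)
        rw [if_neg hxy, Function.update_of_ne (Ne.symm hxy), hg' this.1]
        exact ⟨Or.inr this.1, this.2⟩

/-- The value of a formula is determined by the isomorphism type of the neighbourhood of its
assignment. -/
theorem holds_eval [Finite A] (h : IsLetters ls) (φ : Formula σ N)
    (hv : ∀ v ∈ φ.erase.vars, v ∉ ls) {k : ℕ} (hk : φ.br ≤ k)
    (hS : ∀ a, ∀ j < k, (S.ball (rad j) {a}).ncard ≤ ls.length) {e : Env}
    (he : e.length + φ.br ≤ ls.length) (heU : ∀ u ∈ e.values, u ∈ (paramsOf ls σ.arities).U)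
    {g : Elem → A} (H : Match (univStr σ) S (rad k) e.values g) {β γ : ℕ → A}
    (hβ : ∀ x ∈ φ.free, e.lookup x ∈ e.values ∧ β x = g (e.lookup x)) :
    φ.Sat sem S β ↔ (eval (paramsOf ls σ.arities) φ.erase e (radList k)).Holds sem S γ := by
  induction φ generalizing k e g β γ with
  | eq x y =>
    rw [Formula.erase, eval, holds_ofBool, decide_eq_true_eq, Formula.Sat]
    obtain ⟨h1, h2⟩ := hβ x (by simp [Formula.free])
    obtain ⟨h3, h4⟩ := hβ y (by simp [Formula.free])
    rw [h2, h4]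
    exact ⟨fun h => H.inj (Struc.subset_ball _ _ _ h1) (Struc.subset_ball _ _ _ h3) h,
      fun h => by rw [h]⟩
  | rel R x =>
    rw [Formula.erase, eval, holds_ofBool, Formula.Sat]
    have h1 : ∀ i, e.lookup (x i) ∈ e.values ∧ β (x i) = g (e.lookup (x i)) := fun i =>
      hβ _ (by simp [Formula.free])
    have e1 : List.ofFn (fun i => β (x i)) = ((List.ofFn x).map e.lookup).map g := by
      rw [List.map_ofFn, List.map_ofFn]
      congr 1
      funext i
      exact (h1 i).2
    rw [← Struc.relList_ofFn, e1, ← H.rel, relList_univStr]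
    · refine and_iff_right ?_
      rw [FitsArity.map]
      exact fitsArity_iff.2 ⟨R.2, by simp⟩
    · intro u hu
      obtain ⟨v, hv, rfl⟩ := List.mem_map.1 hu
      obtain ⟨i, rfl⟩ := List.mem_ofFn.1 hv
      exact Struc.subset_ball _ _ _ (h1 i).1
  | neg φ ih =>
    rw [Formula.erase, eval, Raw.holds_neg, Formula.Sat, ih hv hk hS he heU H hβ]
  | or φ ψ ih ih' =>
    have hb : (Formula.or φ ψ).br = max φ.br ψ.br := rfl
    rw [hb] at hk he
    rw [Formula.erase, eval, Raw.holds_or, Formula.Sat,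
      ih (fun v hv' => hv v (List.mem_append_left _ hv')) (le_trans (le_max_left _ _) hk) hS
        (by omega) heU H (fun x hx => hβ x (Finset.mem_union_left _ hx)),
      ih' (fun v hv' => hv v (List.mem_append_right _ hv')) (le_trans (le_max_right _ _) hk) hS
        (by omega) heU H (fun x hx => hβ x (Finset.mem_union_right _ hx))]
  | ex y φ ih =>
    rw [Formula.erase, eval, holds_quantifier_eval h (hv y List.mem_cons_self) hk hS he heU H hβ
      (ih fun v hv' => hv v (List.mem_cons_of_mem _ hv')) (P := 0) (P' := none) rfl]
    simp only [withExists, Set.mem_ofPred_eq, sub_zero, Formula.Sat]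
    have : (∃ a, φ.Sat sem S (Function.update β y a)) ↔
        0 < {a | φ.Sat sem S (Function.update β y a)}.ncard :=
      (Set.ncard_pos (Set.toFinite _)).symm
    rw [this]
    omega
  | num P y φ c ih =>
    rw [Formula.erase, eval, holds_quantifier_eval h (hv y List.mem_cons_self) hk hS he heU H hβ
      (ih fun v hv' => hv v (List.mem_cons_of_mem _ hv')) (P := Encodable.encode P + 1)
      (P' := some P) rfl]
    rfl

/-! ### The form of the results of the evaluation -/

theorem wf_condition {e : Env} {r : List Unit} {P y : ℕ} {c : ℤ} {w : List (Elem × Bool)}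
    (hP : ∃ P' : Option N, Encodable.encode P' = P) :
    (condition (paramsOf ls σ.arities) e r P y c w).WF σ N := by
  refine ⟨hP, Raw.wf_bigOr fun s hs => ?_⟩
  obtain ⟨b, -, rfl⟩ := List.mem_map.1 hs
  exact wf_sphereFormula

theorem wf_ofTruthValues {vals : List Raw} {w : List (Elem × Bool)} {χ : Raw}
    (h1 : ∀ s ∈ vals, s.WF σ N) (h2 : χ.WF σ N) : (ofTruthValues vals w χ).WF σ N := by
  refine Raw.wf_bigOr (y := 0) fun s hs => ?_
  rcases List.mem_append.1 hs with hs | hs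
  · obtain ⟨q, hq, rfl⟩ := List.mem_map.1 hs
    have := h1 q.2 (List.of_mem_zip hq).2
    split <;> exact this
  · rw [List.mem_singleton.1 hs]
    exact h2

theorem wf_ofBool (c : Bool) : (ofBool c).WF σ N := by
  cases c <;> exact Raw.wf_bot

theorem wf_eval (φ : Formula σ N) (e : Env) (ρ : List (List Unit)) :
    (eval (paramsOf ls σ.arities) φ.erase e ρ).WF σ N := by
  induction φ generalizing e ρ with
  | eq x y => exact wf_ofBool _
  | rel R x => exact wf_ofBool _
  | neg φ ih => exact ih e ρ
  | or φ ψ ih ih' => exact ⟨ih e ρ, ih' e ρ⟩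
  | ex y φ ih =>
    refine Raw.wf_bigOr (y := 0) fun s hs => ?_
    obtain ⟨w, -, rfl⟩ := List.mem_map.1 hs
    refine wf_ofTruthValues (fun s hs => ?_) (wf_condition ⟨none, rfl⟩)
    obtain ⟨b, -, rfl⟩ := List.mem_map.1 hs
    exact ih _ _
  | num P y φ c ih =>
    refine Raw.wf_bigOr (y := 0) fun s hs => ?_
    obtain ⟨w, -, rfl⟩ := List.mem_map.1 hs
    refine wf_ofTruthValues (fun s hs => ?_) (wf_condition ⟨some P, rfl⟩)
    obtain ⟨b, -, rfl⟩ := List.mem_map.1 hs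
    exact ih _ _

/-- The numerical conditions that occur in the result of the evaluation. -/
def evalConds (p : Params) : Raw → Env → List (List Unit) → List Raw
  | .eq _ _, _, _ => [Raw.bot]
  | .rel _ _, _, _ => [Raw.bot]
  | .neg φ, e, ρ => evalConds p φ e ρ
  | .or φ ψ, e, ρ => evalConds p φ e ρ ++ evalConds p ψ e ρ
  | .ex y φ, e, ρ => (p.U.flatMap fun b => evalConds p φ ((y, b) :: e) ρ.tail) ++
      p.W.map (condition p e (ρ.tail.headD []) 0 y 0)
  | .num P y φ k, e, ρ => (p.U.flatMap fun b => evalConds p φ ((y, b) :: e) ρ.tail) ++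
      p.W.map (condition p e (ρ.tail.headD []) (P + 1) y k)

theorem boolComb_bigOr {C : Set (Formula σ (Option N))} {y : ℕ} {l : List Raw} (hl : l ≠ [])
    (h : ∀ s ∈ l, Formula.BoolComb C (s.lift σ N)) :
    Formula.BoolComb C ((Raw.bigOr y l).lift σ N) := by
  induction l with
  | nil => exact absurd rfl hl
  | cons s l ih =>
    cases l with
    | nil => exact h s List.mem_cons_self
    | cons t l =>
      exact .or (h s List.mem_cons_self)
        (ih (by simp) fun u hu => h u (List.mem_cons_of_mem _ hu))

theorem boolComb_quantifier {p : Params} {e : Env} {r : List Unit} {P y : ℕ} {c : ℤ}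
    {vals : List Raw} {C : Set (Formula σ (Option N))} (hW : p.W ≠ [])
    (h1 : ∀ s ∈ vals, Formula.BoolComb C (s.lift σ N))
    (h2 : ∀ w ∈ p.W, (condition p e r P y c w).lift σ N ∈ C) :
    Formula.BoolComb C ((quantifier p e r P y c vals).lift σ N) := by
  refine boolComb_bigOr (by simpa using hW) fun s hs => ?_
  obtain ⟨w, hw, rfl⟩ := List.mem_map.1 hs
  refine .neg (boolComb_bigOr (by simp) fun s hs => ?_)
  rcases List.mem_append.1 hs with hs | hs
  · obtain ⟨q, hq, rfl⟩ := List.mem_map.1 hs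
    have := h1 q.2 (List.of_mem_zip hq).2
    split
    · exact .neg this
    · exact this
  · rw [List.mem_singleton.1 hs]
    exact .neg (.base (h2 w hw))

theorem signs_ne_nil {α : Type} (l : List α) : signs l ≠ [] := by
  intro h
  have := length_signs l
  rw [h] at this
  exact absurd this.symm (pow_pos two_pos _).ne'

/-- The result of the evaluation is a Boolean combination of the conditions listed by `evalConds`. -/
theorem boolComb_eval {C : Set (Formula σ (Option N))} (r : Raw) (e : Env) (ρ : List (List Unit))
    (hC : ∀ s ∈ evalConds (paramsOf ls σ.arities) r e ρ, s.lift σ N ∈ C) :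
    Formula.BoolComb C ((eval (paramsOf ls σ.arities) r e ρ).lift σ N) := by
  have hb : ∀ c : Bool, Raw.bot.lift σ N ∈ C → Formula.BoolComb C ((ofBool c).lift σ N) := by
    intro c h
    cases c
    · exact .base h
    · exact .neg (.base h)
  induction r generalizing e ρ with
  | eq x y => exact hb _ (hC _ (by simp [evalConds]))
  | rel R x => exact hb _ (hC _ (by simp [evalConds]))
  | neg φ ih => exact .neg (ih e ρ hC)
  | or φ ψ ih ih' =>
    exact .or (ih e ρ fun s hs => hC s (List.mem_append_left _ hs))
      (ih' e ρ fun s hs => hC s (List.mem_append_right _ hs))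
  | ex y φ ih =>
    refine boolComb_quantifier (signs_ne_nil _) (fun s hs => ?_) fun w hw =>
      hC _ (List.mem_append_right _ (List.mem_map_of_mem hw))
    obtain ⟨b, hb, rfl⟩ := List.mem_map.1 hs
    exact ih _ _ fun s hs => hC s (List.mem_append_left _ (List.mem_flatMap.2 ⟨b, hb, hs⟩))
  | num P y φ c ih =>
    refine boolComb_quantifier (signs_ne_nil _) (fun s hs => ?_) fun w hw =>
      hC _ (List.mem_append_right _ (List.mem_map_of_mem hw))
    obtain ⟨b, hb, rfl⟩ := List.mem_map.1 hs
    exact ih _ _ fun s hs => hC s (List.mem_append_left _ (List.mem_flatMap.2 ⟨b, hb, hs⟩))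

/-- The types in a condition are pairwise non-isomorphic since they are obtained by `reps`. -/
theorem isWeakCondition_condition (h : IsLetters ls) {e : Env} {r : List Unit} {P y : ℕ} {c : ℤ}
    {w : List (Elem × Bool)} (hw : w ∈ (paramsOf ls σ.arities).W) (hy : y ∉ ls)
    {P' : Option N} (hP : Encodable.encode P' = P) :
    ((condition (paramsOf ls σ.arities) e r P y c w).lift σ N).IsWeakCondition (withExists sem)
      r.length := by
  set T := reps (paramsOf ls σ.arities) r ((w.filter fun q => q.2 &&
    !isNear (paramsOf ls σ.arities) e (r ++ (r ++ [()])) q.1).map Prod.fst) with hT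
  have hU : ∀ b ∈ (w.filter fun q => q.2 &&
      !isNear (paramsOf ls σ.arities) e (r ++ (r ++ [()])) q.1).map Prod.fst,
      b ∈ (paramsOf ls σ.arities).U := by
    intro b hb
    obtain ⟨q, hq, rfl⟩ := List.mem_map.1 hb
    exact fst_mem_of_mem_signs hw (List.mem_of_mem_filter hq)
  obtain ⟨h1, -, h3⟩ := reps_spec (r := r) h hU
  rw [← hT] at h1 h3
  have hTU : ∀ i : Fin T.length, (T.get i).1 ∈ ls ∧ (T.get i).2.1 ∈ ls ∧
      (T.get i).2.2 ∈ signs (paramsOf ls σ.arities).tups := fun i =>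
    mem_U.1 (hU _ (h1 _ (List.get_mem _ _)))
  refine ⟨P', y, (c - (w.filter fun q => q.2 && isNear (paramsOf ls σ.arities) e (r ++ (r ++ [()])) q.1).length +
      ((paramsOf ls σ.arities).U.filter fun b =>
        isNear (paramsOf ls σ.arities) e (r ++ (r ++ [()])) b &&
          T.any fun b' => isoTest (paramsOf ls σ.arities) r b b').length), T.length, fun i => (compStr σ (T.get i).2.2).sphereOf r.length
    (fun _ : Fin 1 => (T.get i).1) (finite_nbhd_compStr (hTU i).2.2 fun _ => (hTU i).1),
    fun i => (sphereFormula (paramsOf ls σ.arities) (T.get i).2.2 r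
      [(y, (T.get i).1)]).lift σ N, ?_, ?_, ?_⟩
  · have key : ∀ i j, (Pointed.Iso ((compStr σ (T.get i).2.2).sphereOf r.length
        (fun _ : Fin 1 => (T.get i).1) (finite_nbhd_compStr (hTU i).2.2 fun _ => (hTU i).1))
        ((compStr σ (T.get j).2.2).sphereOf r.length
        (fun _ : Fin 1 => (T.get j).1) (finite_nbhd_compStr (hTU j).2.2 fun _ => (hTU j).1))) →
        SameSphere (univStr σ) (univStr σ) r.length (T.get i) (T.get j) := by
      intro i j hij
      rw [Struc.iso_sphereOf_iff] at hij
      obtain ⟨f, hf, hc⟩ := hij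
      rw [Set.range_const] at hf
      exact ((sameSphere_univStr _ _).symm.trans ⟨f, hf, hc 0⟩).trans (sameSphere_univStr _ _)
    intro i j hij hiso
    rcases lt_or_gt_of_ne hij with hlt | hlt
    · exact List.pairwise_iff_get.1 h3 i j hlt (key i j hiso)
    · exact List.pairwise_iff_get.1 h3 j i hlt (key i j hiso).symm
  · intro i
    have := isSph_sphereFormula (sem := sem) (r := r) h (hTU i).2.2 (n := 1) le_rfl
      (x := fun _ => y) (c := fun _ => (T.get i).1) (fun a b _ => Subsingleton.elim a b)
      (fun _ => hy) (fun _ => (hTU i).1)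
    simpa using this
  · have e1 : condition (paramsOf ls σ.arities) e r P y c w = Raw.num P y (Raw.bigOr y
        (T.map fun b => sphereFormula (paramsOf ls σ.arities) b.2.2 r [(y, b.1)]))
      (c - (w.filter fun q => q.2 && isNear (paramsOf ls σ.arities) e (r ++ (r ++ [()])) q.1).length +
      ((paramsOf ls σ.arities).U.filter fun b =>
        isNear (paramsOf ls σ.arities) e (r ++ (r ++ [()])) b &&
          T.any fun b' => isoTest (paramsOf ls σ.arities) r b b').length) := rfl
    rw [e1, Raw.lift_num hP, Raw.lift_bigOr, List.map_map]
    refine congrArg (fun l => Formula.num P' y (Formula.bigOr y l) _) ?_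
    apply List.ext_get
    · simp
    · intro n _ _
      simp

theorem isWeakCondition_bot : (Raw.bot.lift σ N).IsWeakCondition (withExists sem) 0 :=
  ⟨none, 0, 0, 0, fun i => i.elim0, fun i => i.elim0, fun i => i.elim0, fun i => i.elim0,
    Raw.lift_num rfl⟩

theorem isWeakCondition_of_mem_quantifier (h : IsLetters ls) {φ : Formula σ N} {y : ℕ}
    (hy : y ∉ ls) {k : ℕ} (hk : φ.br + 1 ≤ k) {e : Env} {s : Raw}
    (ih : ∀ {k : ℕ}, φ.br ≤ k → ∀ {e : Env}, s ∈ evalConds (paramsOf ls σ.arities) φ.erase e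
        (radList k) → ∃ r ≤ rad k, (s.lift σ N).IsWeakCondition (withExists sem) r)
    {P : ℕ} {P' : Option N} (hP : Encodable.encode P' = P) {c : ℤ}
    (hs : s ∈ ((paramsOf ls σ.arities).U.flatMap fun b => evalConds (paramsOf ls σ.arities) φ.erase
        ((y, b) :: e) (radList k).tail) ++ (paramsOf ls σ.arities).W.map
          (condition (paramsOf ls σ.arities) e ((radList k).tail.headD []) P y c)) :
    ∃ r ≤ rad k, (s.lift σ N).IsWeakCondition (withExists sem) r := by
  cases k with
  | zero => omega
  | succ k =>
    have hmono := rad_mono (Nat.le_succ k)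
    have e1 : (radList (k + 1)).tail = radList k := rfl
    rw [e1, radList_headD] at hs
    rcases List.mem_append.1 hs with hs | hs
    · obtain ⟨b, -, hs⟩ := List.mem_flatMap.1 hs
      obtain ⟨r, hr, hs⟩ := ih (by omega) hs
      exact ⟨r, hr.trans hmono, hs⟩
    · obtain ⟨w, hw, rfl⟩ := List.mem_map.1 hs
      refine ⟨_, ?_, isWeakCondition_condition h hw hy hP⟩
      simpa using hmono

theorem isWeakCondition_of_mem_evalConds (h : IsLetters ls) (φ : Formula σ N)
    (hv : ∀ v ∈ φ.erase.vars, v ∉ ls) {k : ℕ} (hk : φ.br ≤ k) {e : Env} {s : Raw}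
    (hs : s ∈ evalConds (paramsOf ls σ.arities) φ.erase e (radList k)) :
    ∃ r ≤ rad k, (s.lift σ N).IsWeakCondition (withExists sem) r := by
  induction φ generalizing k e with
  | eq x y =>
    rw [Formula.erase, evalConds, List.mem_singleton] at hs
    exact ⟨0, Nat.zero_le _, hs ▸ isWeakCondition_bot⟩
  | rel R x =>
    rw [Formula.erase, evalConds, List.mem_singleton] at hs
    exact ⟨0, Nat.zero_le _, hs ▸ isWeakCondition_bot⟩
  | neg φ ih => exact ih hv hk hs
  | or φ ψ ih ih' =>
    rcases List.mem_append.1 hs with hs | hs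
    · exact ih (fun v hv' => hv v (List.mem_append_left _ hv')) (le_trans (le_max_left _ _) hk) hs
    · exact ih' (fun v hv' => hv v (List.mem_append_right _ hv')) (le_trans (le_max_right _ _) hk)
        hs
  | ex y φ ih =>
    exact isWeakCondition_of_mem_quantifier h (hv y List.mem_cons_self) hk
      (ih fun v hv' => hv v (List.mem_cons_of_mem _ hv')) (P := 0) (P' := none) rfl hs
  | num P y φ c ih =>
    exact isWeakCondition_of_mem_quantifier h (hv y List.mem_cons_self) hk
      (ih fun v hv' => hv v (List.mem_cons_of_mem _ hv')) (P := Encodable.encode P + 1)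
      (P' := some P) rfl hs

/-- The conditions are sentences since the variable of the sphere-formulas is bound. -/
theorem free_of_isWeakCondition {M : Type} {sem : M → Set ℤ} {r : ℕ} {χ : Formula σ M}
    (h : χ.IsWeakCondition sem r) : χ.free = ∅ := by
  obtain ⟨P, y, k, m, τ, θ, -, h2, rfl⟩ := h
  have key : ∀ l : List (Formula σ M), (∀ θ ∈ l, ∀ v ∈ θ.free, v = y) →
      ∀ v ∈ (Formula.bigOr y l).free, v = y := by
    intro l
    induction l with
    | nil => intro _ v hv; simpa [Formula.bigOr, Formula.free] using hv
    | cons θ l ih =>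
      intro hl v hv
      cases l with
      | nil => exact hl θ List.mem_cons_self v hv
      | cons θ' l =>
        rcases Finset.mem_union.1 hv with hv | hv
        · exact hl θ List.mem_cons_self v hv
        · exact ih (fun θ hθ => hl θ (List.mem_cons_of_mem _ hθ)) v hv
  refine Finset.eq_empty_of_forall_notMem fun v hv => ?_
  obtain ⟨h3, h4⟩ := Finset.mem_erase.1 hv
  refine h3 (key _ (fun θ' hθ' v hv => ?_) v h4)
  obtain ⟨i, rfl⟩ := List.mem_ofFn.1 hθ'
  obtain ⟨-, -, -, h5, -⟩ := h2 i
  obtain ⟨_, h6⟩ := h5 v hv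
  exact h6.symm

theorem free_of_boolComb {M : Type} {C : Set (Formula σ M)} {ψ : Formula σ M}
    (h : Formula.BoolComb C ψ) (hC : ∀ θ ∈ C, θ.free = ∅) : ψ.free = ∅ := by
  induction h with
  | base h => exact hC _ h
  | neg _ ih => exact ih
  | or _ _ ih ih' => rw [Formula.free, ih, ih']; rfl

theorem free_eval (h : IsLetters ls) (φ : Formula σ N)
    (hv : ∀ v ∈ φ.erase.vars, v ∉ ls) {k : ℕ} (hk : φ.br ≤ k) {e : Env} :
    ((eval (paramsOf ls σ.arities) φ.erase e (radList k)).lift σ N).free = ∅ := by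
  refine free_of_boolComb (boolComb_eval (C := {θ | ∃ s ∈ evalConds (paramsOf ls σ.arities)
    φ.erase e (radList k), s.lift σ N = θ}) _ _ _ fun s hs => ⟨s, hs, rfl⟩) ?_
  rintro _ ⟨s, hs, rfl⟩
  obtain ⟨r, -, hr⟩ := isWeakCondition_of_mem_evalConds (sem := fun _ => ∅) h φ hv hk hs
  exact free_of_isWeakCondition hr

/-- Each quantifier multiplies the number of conditions by the number of elements of the universal
structure and adds one condition for each of its subsets. -/
theorem length_evalConds_le (p : Params) (φ : Formula σ N) (e : Env) (ρ : List (List Unit)) :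
    (evalConds p φ.erase e ρ).length ≤ (p.U.length + p.W.length + 2) ^ φ.size := by
  set B := p.U.length + p.W.length + 2 with hB
  have h1 : ∀ n, 1 ≤ B ^ n := fun n => Nat.one_le_pow _ _ (by omega)
  have quant : ∀ (s n : ℕ) (l : List Elem) (f : Elem → List Raw) (t : List Raw),
      l.length = p.U.length → t.length = p.W.length → (∀ b, (f b).length ≤ B ^ s) → s + 2 ≤ n →
      (l.flatMap f ++ t).length ≤ B ^ n := by
    intro s n l f t hl ht hf hn
    have h2 : (l.flatMap f).length ≤ l.length * B ^ s := by
      clear hl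
      induction l with
      | nil => simp
      | cons b l ih =>
        rw [List.flatMap_cons, List.length_append, List.length_cons, add_mul, one_mul, add_comm]
        exact add_le_add ih (hf b)
    rw [List.length_append]
    calc (l.flatMap f).length + t.length ≤ l.length * B ^ s + p.W.length * B ^ s := by
            rw [ht]; exact add_le_add h2 (Nat.le_mul_of_pos_right _ (h1 s))
      _ = (p.U.length + p.W.length) * B ^ s := by rw [hl, add_mul]
      _ ≤ B * B ^ s := Nat.mul_le_mul_right _ (by omega)
      _ = B ^ (s + 1) := by rw [pow_succ, mul_comm]
      _ ≤ B ^ n := Nat.pow_le_pow_right (by omega) (by omega)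
  induction φ generalizing e ρ with
  | eq x y => exact h1 _
  | rel R x => exact h1 _
  | neg φ ih =>
    exact (ih e ρ).trans (Nat.pow_le_pow_right (by omega) (by rw [Formula.size]; omega))
  | or φ ψ ih ih' =>
    have hs : (Formula.or φ ψ).size = φ.size + ψ.size + 3 := rfl
    rw [Formula.erase, evalConds, List.length_append, hs, pow_add, pow_add]
    have h2 := ih e ρ
    have h3 := ih' e ρ
    have h4 : 2 ≤ B ^ 3 := by
      calc 2 ≤ B := by omega
        _ = B ^ 1 := (pow_one B).symm
        _ ≤ B ^ 3 := Nat.pow_le_pow_right (by omega) (by omega)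
    have h5 : B ^ φ.size + B ^ ψ.size ≤ 2 * (B ^ φ.size * B ^ ψ.size) := by
      have := h1 φ.size
      have := h1 ψ.size
      nlinarith
    have h6 : B ^ φ.size * B ^ ψ.size * 2 ≤ B ^ φ.size * B ^ ψ.size * B ^ 3 :=
      Nat.mul_le_mul_left _ h4
    omega
  | ex y φ ih =>
    exact quant φ.size _ _ _ _ rfl (List.length_map _) (fun b => ih _ _) le_rfl
  | num P y φ c ih =>
    exact quant φ.size _ _ _ _ rfl (List.length_map _) (fun b => ih _ _)
      (by rw [Formula.size]; omega)

end EvaluationCorrect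

/-! ### Correctness of the normal form -/

section LettersOf

theorem flatMap_range' (s n : ℕ) :
    (List.range' s n).flatMap (fun v => [2 * v, 2 * v + 1]) = List.range' (2 * s) (2 * n) := by
  induction n generalizing s with
  | zero => rfl
  | succ n ih =>
    rw [List.range'_succ, List.flatMap_cons, ih]
    change _ = List.range' (2 * s) (2 * n + 1 + 1)
    rw [List.range'_succ, List.range'_succ]
    rfl

/-- The letters form an interval that starts at a multiple of its length, beyond all variables. -/
theorem lettersOf_eq (d : ℕ) (φ : Raw) : lettersOf d φ =
    List.range' (2 ^ (logLetters d φ).length * above φ.vars) (2 ^ (logLetters d φ).length) := by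
  have key : ∀ (l : List Unit) (a : ℕ),
      l.foldl (fun ls _ => ls.flatMap fun v => [2 * v, 2 * v + 1]) [a] =
        List.range' (2 ^ l.length * a) (2 ^ l.length) := by
    intro l a
    induction l using List.reverseRecOn with
    | nil => simp
    | append_singleton l u ih =>
      rw [List.foldl_append, ih, List.foldl_cons, List.foldl_nil, flatMap_range',
        List.length_append, List.length_singleton, pow_succ]
      congr 1 <;> ring
  exact key _ _

theorem length_lettersOf (d : ℕ) (φ : Raw) :
    (lettersOf d φ).length = 2 ^ (logLetters d φ).length := by
  rw [lettersOf_eq, List.length_range']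

theorem above_eq (l : List ℕ) : above l = 2 ^ (l.flatMap Nat.bits).length := by
  have key : ∀ (l : List Bool) (v : ℕ), l.foldl (fun v _ => 2 * v) v = 2 ^ l.length * v := by
    intro l
    induction l with
    | nil => simp
    | cons b l ih => intro v; simp [ih, pow_succ]; ring
  rw [above, key, mul_one]

theorem lt_above {l : List ℕ} {v : ℕ} (hv : v ∈ l) : v < above l := by
  rw [above_eq]
  have h1 : v.bits.length ≤ (l.flatMap Nat.bits).length := by
    induction l with
    | nil => cases hv
    | cons a l ih =>
      rw [List.flatMap_cons, List.length_append]
      rcases List.mem_cons.1 hv with rfl | hv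
      · omega
      · have := ih hv; omega
  rw [Nat.size_eq_bits_len] at h1
  exact (Nat.lt_size_self v).trans_le (Nat.pow_le_pow_right two_pos h1)

theorem isLetters_lettersOf (d : ℕ) (φ : Raw) : IsLetters (lettersOf d φ) := by
  rw [lettersOf_eq]
  set k := 2 ^ (logLetters d φ).length with hk
  have hk0 : 0 < k := pow_pos two_pos _
  have ha : 0 < above φ.vars := by rw [above_eq]; exact pow_pos two_pos _
  have hh : (List.range' (k * above φ.vars) k).headD 0 = k * above φ.vars := by
    obtain ⟨n, hn⟩ := Nat.exists_eq_succ_of_ne_zero hk0.ne'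
    rw [hn, List.range'_succ]
    rfl
  have hle : k ≤ k * above φ.vars := Nat.le_mul_of_pos_right k ha
  refine ⟨?_, List.nodup_range', fun v hv => ?_⟩
  · rw [hh]; omega
  · rw [hh]
    obtain ⟨h1, h2⟩ := List.mem_range'_1.1 hv
    omega

theorem not_mem_lettersOf {d : ℕ} {φ : Raw} {v : ℕ} (hv : v ∈ φ.vars) : v ∉ lettersOf d φ := by
  rw [lettersOf_eq]
  intro h
  obtain ⟨h1, -⟩ := List.mem_range'_1.1 h
  have h2 := lt_above hv
  have h3 := Nat.le_mul_of_pos_left (above φ.vars) (pow_pos two_pos (logLetters d φ).length)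
  omega

end LettersOf

section NormalForm

variable {σ : Signature} {N : Type} [Encodable N]

theorem mem_addNew {l' l : List ℕ} {v : ℕ} : v ∈ addNew l' l ↔ v ∈ l' ∨ v ∈ l := by
  induction l generalizing l' with
  | nil => simp [addNew]
  | cons a l ih =>
    change v ∈ addNew (l'.insert a) l ↔ _
    rw [ih, List.mem_insert_iff, List.mem_cons]
    tauto

theorem mem_free_erase {φ : Formula σ N} {v : ℕ} : v ∈ φ.erase.free ↔ v ∈ φ.free := by
  induction φ with
  | eq x y => simp [Formula.erase, Raw.free, Formula.free, mem_addNew]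
  | rel R x => simp [Formula.erase, Raw.free, Formula.free, mem_addNew, List.mem_ofFn]
  | neg φ ih => exact ih
  | or φ ψ ih ih' => simp [Formula.erase, Raw.free, Formula.free, mem_addNew, ih, ih']
  | ex y φ ih => simp [Formula.erase, Raw.free, Formula.free, ih, and_comm]
  | num P y φ k ih => simp [Formula.erase, Raw.free, Formula.free, ih, and_comm]

theorem mem_vars_of_mem_free {φ : Raw} {v : ℕ} (hv : v ∈ φ.free) : v ∈ φ.vars := by
  induction φ with
  | eq x y => simpa [Raw.free, Raw.vars, mem_addNew] using hv
  | rel R x => simpa [Raw.free, Raw.vars, mem_addNew] using hv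
  | neg φ ih => exact ih hv
  | or φ ψ ih ih' =>
    rcases mem_addNew.1 hv with hv | hv
    · exact List.mem_append_left _ (ih hv)
    · exact List.mem_append_right _ (ih' hv)
  | ex y φ ih => exact List.mem_cons_of_mem _ (ih (List.mem_of_mem_filter hv))
  | num P y φ k ih => exact List.mem_cons_of_mem _ (ih (List.mem_of_mem_filter hv))

theorem nodup_free (φ : Raw) : φ.free.Nodup := by
  have key : ∀ l l' : List ℕ, l'.Nodup → (addNew l' l).Nodup := by
    intro l
    induction l with
    | nil => intro l' h; exact h
    | cons a l ih => intro l' h; exact ih _ (List.Nodup.insert h)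
  induction φ with
  | eq x y => exact key _ _ (List.nodup_singleton _)
  | rel R x => exact key _ _ List.nodup_nil
  | neg φ ih => exact ih
  | or φ ψ ih ih' => exact key _ _ ih
  | ex y φ ih => exact ih.filter _
  | num P y φ k ih => exact ih.filter _

theorem length_br_erase (φ : Formula σ N) : φ.erase.br.length = φ.br := by
  induction φ with
  | eq x y => rfl
  | rel R x => rfl
  | neg φ ih => exact ih
  | or φ ψ ih ih' =>
    rw [Formula.erase, Raw.br, List.length_append, List.length_drop, ih, ih', Formula.br]
    omega
  | ex y φ ih => rw [Formula.erase, Raw.br, List.length_cons, ih]; rfl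
  | num P y φ k ih => rw [Formula.erase, Raw.br, List.length_cons, ih]; rfl

theorem length_logLetters (d : ℕ) (φ : Formula σ N) : (logLetters d φ.erase).length =
    φ.erase.free.length + (φ.br + rad φ.br * d.size) := by
  have h1 : radii (() :: φ.erase.br) = radList φ.br :=
    radii_eq (by rw [List.length_cons, length_br_erase])
  have h2 : ∀ (l : List Unit) (m : List Unit), (l.flatMap fun _ => m).length =
      l.length * m.length := by
    intro l m
    induction l with
    | nil => simp
    | cons a l ih => simp [ih]; ring
  rw [logLetters, List.length_append, List.length_append, List.length_map, length_br_erase, h1,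
    radList_headD, h2, List.length_replicate, List.length_map, Nat.size_eq_bits_len]

/-- There are enough letters for unused copies to be left at each stage of the evaluation. -/
theorem br_lt_length_lettersOf (d : ℕ) (φ : Formula σ N) :
    φ.erase.free.length + φ.br < (lettersOf d φ.erase).length := by
  rw [length_lettersOf, length_logLetters]
  refine Nat.lt_two_pow_self.trans_le (Nat.pow_le_pow_right two_pos ?_)
  omega

/-- The letters suffice to name the elements of the relevant neighbourhoods. -/
theorem ncard_ball_le_length_lettersOf {A : Type} [Finite A] {S : Struc σ A} {d : ℕ}
    (hd : S.Bounded d) (φ : Formula σ N) {X : Set A}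
    (hX : X.ncard ≤ 2 ^ φ.erase.free.length) {r : ℕ} (hr : r ≤ rad φ.br) :
    (S.ball r X).ncard ≤ (lettersOf d φ.erase).length := by
  rw [length_lettersOf, length_logLetters]
  refine (S.ncard_ball_le hd r X).trans ?_
  have h1 : d + 1 ≤ 2 ^ d.size := Nat.lt_size_self d
  calc X.ncard * (d + 1) ^ r ≤ 2 ^ φ.erase.free.length * (2 ^ d.size) ^ rad φ.br :=
        Nat.mul_le_mul hX ((Nat.pow_le_pow_left h1 r).trans
          (Nat.pow_le_pow_right (pow_pos two_pos _) hr))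
    _ = 2 ^ (φ.erase.free.length + rad φ.br * d.size) := by rw [pow_add, ← pow_mul]; ring_nf
    _ ≤ _ := Nat.pow_le_pow_right two_pos (by omega)

theorem mem_sections_pairs {l ls : List ℕ} {xs : List (ℕ × ℕ)}
    (h : xs ∈ (l.map fun x => ls.map fun i => (x, i)).sections) :
    xs.map Prod.fst = l ∧ ∀ q ∈ xs, q.2 ∈ ls := by
  rw [List.mem_sections, List.forall₂_map_right_iff] at h
  induction h with
  | nil => simp
  | @cons q x xs l h _ ih =>
    obtain ⟨i, hi, rfl⟩ := List.mem_map.1 h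
    refine ⟨by rw [List.map_cons, ih.1], fun q hq => ?_⟩
    rcases List.mem_cons.1 hq with rfl | hq
    · exact hi
    · exact ih.2 q hq

theorem map_mem_sections_pairs {l ls : List ℕ} {c : ℕ → ℕ} (hc : ∀ x ∈ l, c x ∈ ls) :
    l.map (fun x => (x, c x)) ∈ (l.map fun x => ls.map fun i => (x, i)).sections := by
  rw [List.mem_sections, List.forall₂_map_right_iff, List.forall₂_map_left_iff, List.forall₂_same]
  intro x hx
  exact List.mem_map.2 ⟨c x, hc x hx, rfl⟩

theorem match_empty {A B : Type} (S : Struc σ A) (T : Struc σ B) (r : ℕ) (f : A → B) :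
    Match S T r ∅ f := by
  have hb : ∀ {C : Type} (V : Struc σ C), V.ball r ∅ = ∅ := by
    intro C V
    refine Set.eq_empty_of_forall_notMem fun c hc => ?_
    obtain ⟨a, ha, -⟩ := V.mem_ball_singleton.1 hc
    exact ha
  refine ⟨?_, fun R l hl => ?_, ?_⟩
  · rw [hb]; exact Set.injOn_empty f
  · have : l = [] := by
      cases l with
      | nil => rfl
      | cons a l =>
        have := hl a List.mem_cons_self
        rw [hb] at this
        exact this.elim
    subst this
    exact iff_of_false (fun h => h.fitsArity.ne_nil rfl) (fun h => h.fitsArity.ne_nil rfl)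
  · rw [hb, Set.image_empty, hb]

/-- The assignment of elements of the universal structure that belongs to an assignment of
letters. -/
def envOf (cD : ℕ × Diag) (xs : List (ℕ × ℕ)) : Env := xs.map fun q => (q.1, q.2, cD)

theorem values_envOf (cD : ℕ × Diag) (xs : List (ℕ × ℕ)) :
    (envOf cD xs).values = (fun i => (i, cD)) '' {v | v ∈ xs.map Prod.snd} := by
  ext u
  simp only [Env.values, envOf, List.mem_map, Set.mem_ofPred_eq, Set.mem_image]
  constructor
  · rintro ⟨x, q, hq, e⟩
    cases e
    exact ⟨q.2, ⟨q, hq, rfl⟩, rfl⟩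
  · rintro ⟨_, ⟨q, hq, rfl⟩, rfl⟩
    exact ⟨q.1, q, hq, rfl⟩

theorem lookup_envOf {cD : ℕ × Diag} {xs : List (ℕ × ℕ)} {x : ℕ} (hx : x ∈ xs.map Prod.fst) :
    ∃ i, (x, i) ∈ xs ∧ (envOf cD xs).lookup x = (i, cD) := by
  induction xs with
  | nil => cases hx
  | cons q xs ih =>
    have e : envOf cD (q :: xs) = (q.1, q.2, cD) :: envOf cD xs := rfl
    rw [e, Env.lookup_cons]
    by_cases hq : q.1 = x
    · subst hq
      exact ⟨q.2, List.mem_cons_self, if_pos rfl⟩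
    · rw [if_neg hq]
      rw [List.map_cons, List.mem_cons] at hx
      obtain ⟨i, hi, e⟩ := ih (hx.resolve_left (Ne.symm hq))
      exact ⟨i, List.mem_cons_of_mem _ hi, e⟩

variable {sem : N → Set ℤ} {d : ℕ} {A : Type} {S : Struc σ A}

/-- If the free variables have the sphere that is described by `D` and `xs`, then the evaluation
yields the value of the formula. -/
theorem holds_eval_envOf [Finite A] (hd : S.Bounded d) (φ : Formula σ N) {D : Diag} {c : ℕ}
    (hc : c ∈ lettersOf d φ.erase)
    (hD : D ∈ signs (paramsOf (lettersOf d φ.erase) σ.arities).tups) {xs : List (ℕ × ℕ)}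
    (hxs : xs.map Prod.fst = φ.erase.free) (hxl : ∀ q ∈ xs, q.2 ∈ lettersOf d φ.erase)
    {g : ℕ → A} (H : Match (compStr σ D) S (rad φ.br) {v | v ∈ xs.map Prod.snd} g)
    {β γ : ℕ → A} (hβ : ∀ q ∈ xs, β q.1 = g q.2) :
    φ.Sat sem S β ↔ (eval (paramsOf (lettersOf d φ.erase) σ.arities) φ.erase (envOf (c, D) xs)
      (radList φ.br)).Holds sem S γ := by
  have h := isLetters_lettersOf d φ.erase
  have hm := match_univStr (σ := σ) (rad φ.br) {v | v ∈ xs.map Prod.snd} (c, D)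
  set ι : ℕ → Elem := fun i => (i, (c, D)) with hι
  set X : Set ℕ := {v | v ∈ xs.map Prod.snd} with hX
  have hinv : ∀ i ∈ X, Function.invFunOn ι ((compStr σ D).ball (rad φ.br) X) (ι i) = i :=
    fun i hi => hm.symm_apply (Struc.subset_ball _ _ _ hi)
  have himg : Function.invFunOn ι ((compStr σ D).ball (rad φ.br) X) '' (ι '' X) = X := by
    rw [← Set.image_comp]
    ext i
    constructor
    · rintro ⟨j, hj, rfl⟩; rw [Function.comp_apply, hinv j hj]; exact hj
    · intro hi; exact ⟨i, hi, hinv i hi⟩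
  have hs := hm.symm
  rw [← himg] at H
  have H' := H.comp hs
  refine holds_eval h φ (fun v hv => not_mem_lettersOf hv) le_rfl ?_ ?_ ?_
    (g := g ∘ Function.invFunOn ι ((compStr σ D).ball (rad φ.br) X)) ?_ ?_
  · intro a j hj
    refine ncard_ball_le_length_lettersOf hd φ ?_ (rad_mono hj.le)
    rw [Set.ncard_singleton]
    exact Nat.one_le_two_pow
  · have h1 := congrArg List.length hxs
    have h2 := br_lt_length_lettersOf d φ
    rw [List.length_map] at h1
    rw [envOf, List.length_map]
    omega
  · rw [values_envOf]
    rintro _ ⟨i, hi, rfl⟩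
    obtain ⟨q, hq, rfl⟩ := List.mem_map.1 hi
    exact mem_U.2 ⟨hxl q hq, hc, hD⟩
  · rw [values_envOf]; exact H'
  · intro x hx
    have hx' : x ∈ xs.map Prod.fst := by rw [hxs]; exact mem_free_erase.2 hx
    obtain ⟨i, hi, e⟩ := lookup_envOf (cD := (c, D)) hx'
    have hiX : i ∈ X := List.mem_map.2 ⟨_, hi, rfl⟩
    rw [e, values_envOf]
    refine ⟨⟨i, hiX, rfl⟩, ?_⟩
    rw [Function.comp_apply]
    change _ = g (Function.invFunOn ι _ (ι i))
    rw [hinv i hiX]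
    exact hβ _ hi

theorem normalForm_eq (d : ℕ) (φ : Formula σ N) : normalForm d σ.arities φ.erase =
    normalFormWith (paramsOf (lettersOf d φ.erase) σ.arities) φ.erase (radList φ.br) := by
  rw [normalForm, radii_eq (k := φ.br)]
  rw [List.length_cons, length_br_erase]

theorem disjunct_eq (d : ℕ) (φ : Formula σ N) (D : Diag) (xs : List (ℕ × ℕ)) :
    disjunct (paramsOf (lettersOf d φ.erase) σ.arities) φ.erase (radList φ.br) D xs =
      Raw.bigAnd 0 [sphereFormula (paramsOf (lettersOf d φ.erase) σ.arities) D
        (List.replicate (rad φ.br) ()) xs,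
        eval (paramsOf (lettersOf d φ.erase) σ.arities) φ.erase
          (envOf ((lettersOf d φ.erase).headD 0, D) xs) (radList φ.br)] := by
  rw [disjunct, radList_headD]; rfl

/-- If `φ` has free variables, then in a given structure the sphere of the assignment is isomorphic to
a sphere in some structure `D` on the letters, and the disjunct for `D` is equivalent to `φ` there,
by `holds_eval_envOf`. -/
theorem dEquiv_normalForm (sem : N → Set ℤ) (d : ℕ) (φ : Formula σ N) :
    DEquiv sem (withExists sem) d φ ((normalForm d σ.arities φ.erase).lift σ N) := by
  intro A _ _ S hd β
  change _ ↔ (normalForm d σ.arities φ.erase).Holds sem S β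
  have h := isLetters_lettersOf d φ.erase
  rw [normalForm_eq, normalFormWith]
  split
  · next hf =>
    have hf : φ.erase.free = [] := List.isEmpty_iff.1 hf
    have h0 : {v : ℕ | v ∈ ([] : List (ℕ × ℕ)).map Prod.snd} = ∅ := by simp
    refine holds_eval_envOf hd φ h.head_mem (map_mem_signs _ fun _ => true) (xs := [])
      hf.symm (by simp) (g := fun _ => β 0) ?_ (by simp)
    rw [h0]
    exact match_empty _ _ _ _
  · next hf =>
    rw [Raw.holds_bigOr]
    have hxl : ∀ xs ∈ (φ.erase.free.map fun x => (lettersOf d φ.erase).map fun i =>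
        (x, i)).sections, xs.map Prod.fst = φ.erase.free ∧ (∀ q ∈ xs, q.2 ∈ lettersOf d φ.erase) ∧
        ∀ q ∈ xs, q.1 ∉ lettersOf d φ.erase ∧ q.2 ∈ lettersOf d φ.erase := by
      intro xs hxs
      obtain ⟨h1, h2⟩ := mem_sections_pairs hxs
      refine ⟨h1, h2, fun q hq => ⟨not_mem_lettersOf (mem_vars_of_mem_free ?_), h2 q hq⟩⟩
      rw [← h1]
      exact List.mem_map_of_mem hq
    constructor
    · intro hφ
      set X : Set A := {a | ∃ x ∈ φ.erase.free, β x = a} with hX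
      have hXc : X.ncard ≤ 2 ^ φ.erase.free.length := by
        have e : X = β '' (φ.erase.free.toFinset : Set ℕ) := by
          ext a; simp [hX]
        rw [e]
        refine (Set.ncard_image_le (Finset.finite_toSet _)).trans ?_
        rw [Set.ncard_coe_finset]
        exact (List.toFinset_card_le _).trans Nat.lt_two_pow_self.le
      obtain ⟨D, hD, f, hf1, H⟩ := exists_diag S (r := rad φ.br)
        (ncard_ball_le_length_lettersOf hd φ hXc le_rfl) h
      have hXb : ∀ x ∈ φ.erase.free, β x ∈ S.ball (rad φ.br) X := fun x hx =>
        S.subset_ball _ _ ⟨x, hx, rfl⟩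
      set xs := φ.erase.free.map fun x => (x, f (β x)) with hxsdef
      have hxs : xs ∈ (φ.erase.free.map fun x => (lettersOf d φ.erase).map fun i =>
        (x, i)).sections := map_mem_sections_pairs (c := fun x => f (β x))
          fun x hx => hf1 _ (hXb x hx)
      have hset : {v | v ∈ xs.map Prod.snd} = f '' X := by
        ext v
        simp [hxsdef, hX]
      have H' := H.symm
      rw [← hset] at H'
      have hβ : ∀ q ∈ xs, β q.1 = Function.invFunOn f (S.ball (rad φ.br) X) q.2 := by
        intro q hq
        obtain ⟨x, hx, rfl⟩ := List.mem_map.1 hq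
        exact (H.symm_apply (hXb x hx)).symm
      refine ⟨_, List.mem_append_left _ (List.mem_flatMap.2 ⟨D, hD, List.mem_map.2
        ⟨xs, hxs, rfl⟩⟩), ?_⟩
      obtain ⟨h1, h2, h3⟩ := hxl xs hxs
      rw [disjunct_eq, Raw.holds_bigAnd]
      simp only [List.mem_cons, List.not_mem_nil, or_false, forall_eq_or_imp, forall_eq]
      refine ⟨(holds_sphereFormula h hD h3).2 ⟨_, ?_, hβ⟩,
        (holds_eval_envOf hd φ h.head_mem hD h1 h2 H' hβ).1 hφ⟩
      rw [List.length_replicate]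
      exact H'
    · rintro ⟨s, hs, hh⟩
      rcases List.mem_append.1 hs with hs | hs
      · obtain ⟨D, hD, hs⟩ := List.mem_flatMap.1 hs
        obtain ⟨xs, hxs, rfl⟩ := List.mem_map.1 hs
        obtain ⟨h1, h2, h3⟩ := hxl xs hxs
        rw [disjunct_eq, Raw.holds_bigAnd] at hh
        simp only [List.mem_cons, List.not_mem_nil, or_false, forall_eq_or_imp, forall_eq] at hh
        obtain ⟨g, H, hβ⟩ := (holds_sphereFormula h hD h3).1 hh.1
        rw [List.length_replicate] at H
        exact (holds_eval_envOf hd φ h.head_mem hD h1 h2 H hβ).2 hh.2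
      · rw [List.mem_singleton.1 hs] at hh
        exact absurd hh Raw.holds_bot

theorem wf_normalForm (d : ℕ) (φ : Formula σ N) :
    (normalForm d σ.arities φ.erase).WF σ N := by
  rw [normalForm_eq, normalFormWith]
  split
  · exact wf_eval _ _ _
  · refine Raw.wf_bigOr fun s hs => ?_
    rcases List.mem_append.1 hs with hs | hs
    · obtain ⟨D, -, hs⟩ := List.mem_flatMap.1 hs
      obtain ⟨xs, -, rfl⟩ := List.mem_map.1 hs
      rw [disjunct_eq]
      refine Raw.wf_bigAnd fun s hs => ?_
      simp only [List.mem_cons, List.not_mem_nil, or_false] at hs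
      rcases hs with rfl | rfl
      · exact wf_sphereFormula
      · exact wf_eval _ _ _
    · rw [List.mem_singleton.1 hs]
      exact Raw.wf_bot

theorem free_normalForm (d : ℕ) (φ : Formula σ N) :
    ((normalForm d σ.arities φ.erase).lift σ N).free = φ.free := by
  have h := isLetters_lettersOf d φ.erase
  have hv : ∀ v ∈ φ.erase.vars, v ∉ lettersOf d φ.erase := fun v hv => not_mem_lettersOf hv
  rw [normalForm_eq, normalFormWith]
  split
  · next hf =>
    rw [free_eval h φ hv le_rfl]
    have hf : φ.erase.free = [] := List.isEmpty_iff.1 hf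
    refine (Finset.eq_empty_of_forall_notMem fun v hv => ?_).symm
    rw [← mem_free_erase, hf] at hv
    cases hv
  · next hf =>
    have hf : φ.erase.free ≠ [] := fun e => hf (List.isEmpty_iff.2 e)
    have hfree : ∀ D ∈ signs (paramsOf (lettersOf d φ.erase) σ.arities).tups, ∀ xs,
        xs ∈ (φ.erase.free.map fun x => (lettersOf d φ.erase).map fun i => (x, i)).sections →
        ∀ v, v ∈ ((disjunct (paramsOf (lettersOf d φ.erase) σ.arities) φ.erase (radList φ.br) D
          xs).lift σ N).free ↔ v ∈ φ.free := by
      intro D hD xs hxs v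
      obtain ⟨h1, h2⟩ := mem_sections_pairs hxs
      have hne : xs ≠ [] := by
        rintro rfl
        exact hf h1.symm
      have h3 : ∀ q ∈ xs, q.1 ∉ lettersOf d φ.erase ∧ q.2 ∈ lettersOf d φ.erase := by
        refine fun q hq => ⟨hv _ (mem_vars_of_mem_free ?_), h2 q hq⟩
        rw [← h1]
        exact List.mem_map_of_mem hq
      rw [disjunct_eq, ← mem_free_erase (φ := φ), ← h1, ← mem_free_sphereFormula (N := N) hD hne h3]
      constructor
      · intro hv'
        obtain ⟨e, -⟩ | ⟨s, hs, hv'⟩ := Raw.free_bigAnd_subset hv'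
        · cases e
        · simp only [List.mem_cons, List.not_mem_nil, or_false] at hs
          rcases hs with rfl | rfl
          · exact hv'
          · rw [free_eval h φ hv le_rfl] at hv'
            cases hv'
      · exact fun hv' => Raw.mem_free_bigAnd List.mem_cons_self hv'
    ext v
    constructor
    · intro hv'
      obtain ⟨e, -⟩ | ⟨s, hs, hv'⟩ := Raw.free_bigOr_subset hv'
      · exact absurd (List.append_eq_nil_iff.1 e).2 (by simp)
      · rcases List.mem_append.1 hs with hs | hs
        · obtain ⟨D, hD, hs⟩ := List.mem_flatMap.1 hs
          obtain ⟨xs, hxs, rfl⟩ := List.mem_map.1 hs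
          exact (hfree D hD xs hxs v).1 hv'
        · rw [List.mem_singleton.1 hs, free_of_isWeakCondition
            (isWeakCondition_bot (sem := fun _ : N => ∅))] at hv'
          cases hv'
    · intro hv'
      have hD := map_mem_signs (paramsOf (lettersOf d φ.erase) σ.arities).tups fun _ => true
      have hxs := map_mem_sections_pairs (l := φ.erase.free) (ls := lettersOf d φ.erase)
        (c := fun _ => (lettersOf d φ.erase).headD 0) fun _ _ => h.head_mem
      exact Raw.mem_free_bigOr (List.mem_append_left _ (List.mem_flatMap.2
        ⟨_, hD, List.mem_map.2 ⟨_, hxs, rfl⟩⟩)) ((hfree _ hD _ hxs v).2 hv')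

/-- The numerical conditions that occur in the normal form. -/
def normalFormConds (p : Params) (φ : Raw) (ρ : List (List Unit)) : List Raw :=
  Raw.bot :: if φ.free.isEmpty then evalConds p φ [] ρ
  else (signs p.tups).flatMap fun D =>
    (φ.free.map fun x => p.letters.map fun i => (x, i)).sections.flatMap fun xs =>
      evalConds p φ (envOf (p.letters.headD 0, D) xs) ρ

theorem bw_pos_of_br_pos (φ : Formula σ N) (h : φ.br ≠ 0) : 1 ≤ φ.bw := by
  induction φ with
  | eq x y => exact absurd rfl h
  | rel R x => exact absurd rfl h
  | neg φ ih => exact ih h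
  | or φ ψ ih ih' =>
    by_cases h1 : φ.br = 0
    · refine (ih' fun h2 => h ?_).trans (le_max_right _ _)
      rw [Formula.br, h1, h2]; rfl
    · exact (ih h1).trans (le_max_left _ _)
  | ex y φ ih => exact le_max_right _ _
  | num P y φ k ih => exact le_max_left _ _

theorem rad_lt_radius (φ : Formula σ N) : rad φ.br < (2 * φ.bw + 1) ^ φ.br := by
  by_cases h : φ.br = 0
  · rw [h]; simp [rad]
  · have h1 := bw_pos_of_br_pos φ h
    have h2 := rad_lt φ.br
    calc rad φ.br < 3 ^ φ.br := by omega
      _ ≤ _ := Nat.pow_le_pow_left (by omega) _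

/-- The normal form is a Boolean combination of sphere-formulas and of the conditions listed by
`normalFormConds`. -/
theorem isWHNF_normalForm (sem : N → Set ℤ) (d : ℕ) (φ : Formula σ N) :
    ((normalForm d σ.arities φ.erase).lift σ N).IsWHNF (withExists sem)
      ((2 * φ.bw + 1) ^ φ.br) (normalFormConds (paramsOf (lettersOf d φ.erase) σ.arities) φ.erase
        (radList φ.br)).length := by
  classical
  have h := isLetters_lettersOf d φ.erase
  have hv : ∀ v ∈ φ.erase.vars, v ∉ lettersOf d φ.erase := fun v hv => not_mem_lettersOf hv
  set L := normalFormConds (paramsOf (lettersOf d φ.erase) σ.arities) φ.erase (radList φ.br) with hL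
  have hLdef : L = Raw.bot :: if φ.erase.free.isEmpty then
      evalConds (paramsOf (lettersOf d φ.erase) σ.arities) φ.erase [] (radList φ.br)
    else (signs (paramsOf (lettersOf d φ.erase) σ.arities).tups).flatMap fun D =>
      (φ.erase.free.map fun x => (lettersOf d φ.erase).map fun i => (x, i)).sections.flatMap fun xs =>
        evalConds (paramsOf (lettersOf d φ.erase) σ.arities) φ.erase
          (envOf ((lettersOf d φ.erase).headD 0, D) xs) (radList φ.br) := rfl
  refine ⟨(L.map (Raw.lift σ N)).toFinset, (List.toFinset_card_le _).trans (by simp), ?_, ?_⟩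
  · intro χ hχ
    obtain ⟨s, hs, rfl⟩ := List.mem_map.1 (List.mem_toFinset.1 hχ)
    have key : ∃ r ≤ rad φ.br, (s.lift σ N).IsWeakCondition (withExists sem) r := by
      rw [hLdef] at hs
      rcases List.mem_cons.1 hs with rfl | hs
      · exact ⟨0, Nat.zero_le _, isWeakCondition_bot⟩
      · split at hs
        · exact isWeakCondition_of_mem_evalConds h φ hv le_rfl hs
        · obtain ⟨D, -, hs⟩ := List.mem_flatMap.1 hs
          obtain ⟨xs, -, hs⟩ := List.mem_flatMap.1 hs
          exact isWeakCondition_of_mem_evalConds h φ hv le_rfl hs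
    obtain ⟨r, hr, hs⟩ := key
    exact ⟨r, hr.trans_lt (rad_lt_radius φ), hs⟩
  · have hmem : ∀ s ∈ L, s.lift σ N ∈ {θ | θ ∈ (L.map (Raw.lift σ N)).toFinset ∨
        ∃ r < (2 * φ.bw + 1) ^ φ.br, θ.IsSphereFormula (withExists sem) r} := fun s hs =>
      Or.inl (List.mem_toFinset.2 (List.mem_map_of_mem hs))
    rw [normalForm_eq, normalFormWith]
    split
    · next hf =>
      refine boolComb_eval _ _ _ fun s hs => hmem s ?_
      rw [hLdef, if_pos hf]
      exact List.mem_cons_of_mem _ hs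
    · next hf =>
      refine boolComb_bigOr (by simp) fun s hs => ?_
      rcases List.mem_append.1 hs with hs | hs
      · obtain ⟨D, hD, hs⟩ := List.mem_flatMap.1 hs
        obtain ⟨xs, hxs, rfl⟩ := List.mem_map.1 hs
        rw [disjunct_eq]
        refine .neg (boolComb_bigOr (by simp) fun s hs => ?_)
        obtain ⟨t, ht, rfl⟩ := List.mem_map.1 hs
        refine .neg ?_
        simp only [List.mem_cons, List.not_mem_nil, or_false] at ht
        rcases ht with rfl | rfl
        · obtain ⟨h1, h2⟩ := mem_sections_pairs hxs
          refine .base (Or.inr ⟨rad φ.br, rad_lt_radius φ, xs.length, ?_⟩)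
          have h3 : ∀ i : Fin xs.length, (xs.get i).1 ∉ lettersOf d φ.erase := by
            refine fun i => hv _ (mem_vars_of_mem_free ?_)
            rw [← h1]
            exact List.mem_map_of_mem (List.get_mem _ _)
          have hne : xs ≠ [] := by
            rintro rfl
            exact hf (List.isEmpty_iff.2 h1.symm)
          have hinj : Function.Injective fun i : Fin xs.length => (xs.get i).1 := by
            have hn : (xs.map Prod.fst).Nodup := by rw [h1]; exact nodup_free _
            intro i j hij
            have := List.nodup_iff_injective_get.1 hn
              (a₁ := Fin.cast (List.length_map _).symm i) (a₂ := Fin.cast (List.length_map _).symm j)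
              (by simpa using hij)
            simpa [Fin.ext_iff] using this
          have := isSph_sphereFormula (sem := sem) (r := List.replicate (rad φ.br) ()) h hD
            (n := xs.length) (List.length_pos_of_ne_nil hne) hinj h3
            (c := fun i => (xs.get i).2) (fun i => h2 _ (List.get_mem _ _))
          have e : (List.ofFn fun i : Fin xs.length => ((xs.get i).1, (xs.get i).2)) = xs :=
            List.ofFn_get xs
          rw [e, List.length_replicate] at this
          exact ⟨_, _, this⟩
        · refine boolComb_eval _ _ _ fun s hs => hmem s ?_
          rw [hLdef, if_neg hf]
          exact List.mem_cons_of_mem _ (List.mem_flatMap.2 ⟨D, hD, List.mem_flatMap.2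
            ⟨xs, hxs, hs⟩⟩)
      · rw [List.mem_singleton.1 hs]
        exact .base (hmem _ (by rw [hLdef]; exact List.mem_cons_self))

end NormalForm

/-! ### Towers of exponentials -/

section Tower

theorem le_expTower (k n : ℕ) : n ≤ expTower k n := by
  induction k with
  | zero => exact le_rfl
  | succ k ih => exact ih.trans Nat.lt_two_pow_self.le

theorem expTower_le_succ (k n : ℕ) : expTower k n ≤ expTower (k + 1) n := Nat.lt_two_pow_self.le

theorem expTower_strictMono (k : ℕ) : StrictMono (expTower k) := by
  induction k with
  | zero => exact strictMono_id
  | succ k ih => exact fun m n h => Nat.pow_lt_pow_right (by norm_num) (ih h)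

/-- From level one on, sums of towers cost an increase of the argument by one only. -/
theorem expTower_add_le_max (k u v : ℕ) :
    expTower (k + 1) u + expTower (k + 1) v ≤ expTower (k + 1) (max u v + 1) := by
  have h1 := (expTower_strictMono (k + 1)).monotone (le_max_left u v)
  have h2 := (expTower_strictMono (k + 1)).monotone (le_max_right u v)
  have h3 : expTower k (max u v) + 1 ≤ expTower k (max u v + 1) :=
    expTower_strictMono k (Nat.lt_succ_self _)
  calc _ ≤ 2 * expTower (k + 1) (max u v) := by omega
    _ = 2 ^ (expTower k (max u v) + 1) := by rw [pow_succ, mul_comm]; rfl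
    _ ≤ _ := Nat.pow_le_pow_right two_pos h3

theorem expTower_add_le (k u v : ℕ) :
    expTower k u + expTower k v ≤ expTower k (u + v + 1) := by
  cases k with
  | zero => exact Nat.le_succ _
  | succ k =>
    exact (expTower_add_le_max k u v).trans ((expTower_strictMono _).monotone (by omega))

variable {I : Type} {a b : I → ℕ} {f g : I → ℕ} {k : ℕ}

/-- `f` is bounded by the `k`-fold exponential of a polynomial in `a`, plus `b`. Only the sum with
`b` is available, no multiple of `b`; therefore, for `k ≤ 1`, products of two such functions need
not have the same property. -/
def TowerBd (a b : I → ℕ) (k : ℕ) (f : I → ℕ) : Prop :=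
  ∃ q : Polynomial ℕ, ∀ i, f i ≤ expTower k (q.eval (a i) + b i)

namespace TowerBd

theorem of_le (h : TowerBd a b k g) (hf : ∀ i, f i ≤ g i) : TowerBd a b k f := by
  obtain ⟨q, hq⟩ := h
  exact ⟨q, fun i => (hf i).trans (hq i)⟩

theorem le_level {j : ℕ} (h : TowerBd a b k f) (hk : k ≤ j) : TowerBd a b j f := by
  induction hk with
  | refl => exact h
  | step _ ih =>
    obtain ⟨q, hq⟩ := ih
    exact ⟨q, fun i => (hq i).trans (expTower_le_succ _ _)⟩

theorem const (c k : ℕ) : TowerBd a b k fun _ => c :=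
  ⟨Polynomial.C c, fun i => by
    rw [Polynomial.eval_C]; exact (Nat.le_add_right _ _).trans (le_expTower _ _)⟩

theorem base (hf : ∀ i, f i ≤ a i) (k : ℕ) : TowerBd a b k f :=
  ⟨Polynomial.X, fun i => by
    rw [Polynomial.eval_X]
    exact (hf i).trans ((Nat.le_add_right _ _).trans (le_expTower _ _))⟩

theorem add_weak (hf : TowerBd a 0 k f) (hg : TowerBd a b k g) :
    TowerBd a b k fun i => f i + g i := by
  obtain ⟨p, hp⟩ := hf
  obtain ⟨q, hq⟩ := hg
  refine ⟨p + q + 1, fun i => (add_le_add (hp i) (hq i)).trans ((expTower_add_le _ _ _).trans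
    ((expTower_strictMono k).monotone ?_))⟩
  simp only [Polynomial.eval_add, Polynomial.eval_one, Pi.zero_apply]
  omega

theorem add (hf : TowerBd a b (k + 1) f) (hg : TowerBd a b (k + 1) g) :
    TowerBd a b (k + 1) fun i => f i + g i := by
  obtain ⟨p, hp⟩ := hf
  obtain ⟨q, hq⟩ := hg
  refine ⟨p + q + 1, fun i => (add_le_add (hp i) (hq i)).trans ((expTower_add_le_max _ _ _).trans
    ((expTower_strictMono _).monotone ?_))⟩
  simp only [Polynomial.eval_add, Polynomial.eval_one]
  omega

theorem two_pow (hf : TowerBd a b k f) : TowerBd a b (k + 1) fun i => 2 ^ f i := by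
  obtain ⟨p, hp⟩ := hf
  exact ⟨p, fun i => Nat.pow_le_pow_right two_pos (hp i)⟩

/-- A function bounded on level `k + 1` is bounded by the exponential of one bounded on level `k`. -/
theorem exists_log (hf : TowerBd a b (k + 1) f) :
    ∃ l, TowerBd a b k l ∧ ∀ i, f i ≤ 2 ^ l i := by
  obtain ⟨p, hp⟩ := hf
  exact ⟨_, ⟨p, fun i => le_rfl⟩, hp⟩

theorem mul_weak (hf : TowerBd a 0 (k + 1) f) (hg : TowerBd a b (k + 1) g) :
    TowerBd a b (k + 1) fun i => f i * g i := by
  obtain ⟨l, hl, hl'⟩ := hf.exists_log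
  obtain ⟨m, hm, hm'⟩ := hg.exists_log
  refine (hl.add_weak hm).two_pow.of_le fun i => ?_
  rw [pow_add]
  exact Nat.mul_le_mul (hl' i) (hm' i)

theorem mul (hf : TowerBd a b (k + 2) f) (hg : TowerBd a b (k + 2) g) :
    TowerBd a b (k + 2) fun i => f i * g i := by
  obtain ⟨l, hl, hl'⟩ := hf.exists_log
  obtain ⟨m, hm, hm'⟩ := hg.exists_log
  refine (hl.add hm).two_pow.of_le fun i => ?_
  rw [pow_add]
  exact Nat.mul_le_mul (hl' i) (hm' i)

theorem pow_weak (hf : TowerBd a b (k + 2) f) (hg : TowerBd a 0 (k + 1) g) :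
    TowerBd a b (k + 2) fun i => f i ^ g i := by
  obtain ⟨l, hl, hl'⟩ := hf.exists_log
  refine (hg.mul_weak hl).two_pow.of_le fun i => ?_
  rw [mul_comm, pow_mul]
  exact Nat.pow_le_pow_left (hl' i) _

theorem pow (hf : TowerBd a b (k + 3) f) (hg : TowerBd a b (k + 2) g) :
    TowerBd a b (k + 3) fun i => f i ^ g i := by
  obtain ⟨l, hl, hl'⟩ := hf.exists_log
  refine (hl.mul hg).two_pow.of_le fun i => ?_
  rw [pow_mul]
  exact Nat.pow_le_pow_left (hl' i) _

end TowerBd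

end Tower

/-! ### Size of the parameters of the normal form -/

section ParamSize

theorem length_flatMap_le {α β : Type} {l : List α} {f : α → List β} {B : ℕ}
    (h : ∀ a ∈ l, (f a).length ≤ B) : (l.flatMap f).length ≤ l.length * B := by
  induction l with
  | nil => simp
  | cons a l ih =>
    rw [List.flatMap_cons, List.length_append, List.length_cons]
    have h1 := h a List.mem_cons_self
    have h2 := ih fun a ha => h a (List.mem_cons_of_mem _ ha)
    linarith

theorem length_sections_map_const {α β : Type} (l : List α) (ls : List β) :
    (l.map fun _ => ls).sections.length = ls.length ^ l.length := by
  rw [length_sections, List.map_map]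
  induction l with
  | nil => rfl
  | cons a l ih => rw [List.map_cons, List.prod_cons, ih, List.length_cons, pow_succ, mul_comm]; rfl

theorem length_relsOf (ls σ : List ℕ) : (relsOf ls σ).length = σ.length := by
  rw [relsOf, number_eq]
  simp

theorem length_tups_le {ls : List ℕ} (hls : 1 ≤ ls.length) (σ : List ℕ) :
    (paramsOf ls σ).tups.length ≤ σ.length * ls.length ^ σ.sum := by
  rw [← length_relsOf ls σ]
  refine length_flatMap_le fun R hR => ?_
  rw [List.length_map, length_sections_map_const]
  exact Nat.pow_le_pow_right hls (length_of_mem_relsOf hR)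

theorem length_U_le (ls σ : List ℕ) :
    (paramsOf ls σ).U.length ≤ ls.length * (ls.length * 2 ^ (paramsOf ls σ).tups.length) := by
  refine length_flatMap_le fun i _ => length_flatMap_le fun c _ => ?_
  rw [List.length_map, length_signs]
  exact le_rfl

theorem length_W (ls σ : List ℕ) : (paramsOf ls σ).W.length = 2 ^ (paramsOf ls σ).U.length :=
  length_signs _

theorem length_normalFormConds_le {σ : Signature} {N : Type} [Encodable N] (p : Params) (φ : Formula σ N)
    (ρ : List (List Unit)) (hp : 1 ≤ p.letters.length) :
    (normalFormConds p φ.erase ρ).length ≤ 1 + 2 ^ p.tups.length *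
      (p.letters.length ^ φ.erase.free.length * (p.U.length + p.W.length + 2) ^ φ.size) := by
  rw [normalFormConds, List.length_cons, add_comm]
  refine Nat.add_le_add_left ?_ _
  split
  · refine (length_evalConds_le _ _ _ _).trans ?_
    rw [← mul_assoc]
    exact Nat.le_mul_of_pos_left _ (Nat.mul_pos (pow_pos two_pos _) (pow_pos hp _))
  · rw [← length_signs]
    refine length_flatMap_le fun D _ => ?_
    have h : (φ.erase.free.map fun x => p.letters.map fun i => (x, i)).sections.length =
        p.letters.length ^ φ.erase.free.length := by
      rw [length_sections, List.map_map]
      generalize φ.erase.free = l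
      induction l with
      | nil => rfl
      | cons a l ih =>
        rw [List.map_cons, List.prod_cons, ih, List.length_cons, pow_succ, mul_comm]; simp
    rw [← h]
    exact length_flatMap_le fun xs _ => length_evalConds_le _ _ _ _

variable {σ : Signature} {N : Type} [Encodable N]

theorem br_le_size (φ : Formula σ N) : φ.br ≤ φ.size := by
  induction φ with
  | eq x y => exact Nat.zero_le _
  | rel R x => exact Nat.zero_le _
  | neg φ ih => exact ih.trans (Nat.le_succ _)
  | or φ ψ ih ih' => simp only [Formula.br, Formula.size]; omega
  | ex y φ ih => simp only [Formula.br, Formula.size]; omega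
  | num P y φ k ih => simp only [Formula.br, Formula.size]; omega

theorem card_free_le_size (φ : Formula σ N) : φ.free.card ≤ φ.size := by
  induction φ with
  | eq x y => exact Finset.card_le_two.trans (Nat.le_succ 2)
  | rel R x =>
    refine Finset.card_image_le.trans ?_
    rw [Finset.card_univ, Fintype.card_fin, Formula.size]
    omega
  | neg φ ih => exact ih.trans (Nat.le_succ _)
  | or φ ψ ih ih' =>
    refine (Finset.card_union_le _ _).trans ?_
    rw [Formula.size]
    omega
  | ex y φ ih => exact Finset.card_erase_le.trans (ih.trans (Nat.le_add_right _ _))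
  | num P y φ k ih =>
    refine Finset.card_erase_le.trans (ih.trans ?_)
    rw [Formula.size]
    omega

theorem length_free_le_size (φ : Formula σ N) : φ.erase.free.length ≤ φ.size := by
  rw [← List.toFinset_card_of_nodup (nodup_free _)]
  refine le_of_eq_of_le (congrArg _ ?_) (card_free_le_size φ)
  ext v
  rw [List.mem_toFinset, mem_free_erase]

theorem length_le_sum {l : List ℕ} (h : ∀ a ∈ l, 0 < a) : l.length ≤ l.sum := by
  induction l with
  | nil => exact le_rfl
  | cons a l ih =>
    have h1 := h a List.mem_cons_self
    have h2 := ih fun a ha => h a (List.mem_cons_of_mem _ ha)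
    rw [List.length_cons, List.sum_cons]
    omega

theorem size_le_two_pow (d : ℕ) : d.size ≤ 2 ^ (Nat.log 2 (Nat.log 2 d) + 1) := by
  refine Nat.size_le.2 ?_
  have h1 : d < 2 ^ (Nat.log 2 d + 1) := Nat.lt_pow_succ_log_self (by norm_num) d
  have h2 : Nat.log 2 d < 2 ^ (Nat.log 2 (Nat.log 2 d) + 1) :=
    Nat.lt_pow_succ_log_self (by norm_num) _
  exact h1.trans_le (Nat.pow_le_pow_right two_pos h2)

end ParamSize

/-! ### The bounds on the normal form -/

section Bounds

variable {N : Type} [Encodable N] {I : Type} {a d : I → ℕ} {σ : I → Signature}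
  {φ : (i : I) → Formula (σ i) N}

/-- The logarithm of the number of letters is a polynomial plus the product of a radius and of the
binary logarithm of `d`, where the latter is the exponential of the double logarithm. -/
theorem towerBd_length_logLetters (h : ∀ i, (φ i).size + (σ i).size ≤ a i) :
    TowerBd a (fun i => Nat.log 2 (Nat.log 2 (d i))) 1
      fun i => (logLetters (d i) (φ i).erase).length := by
  have hs : ∀ i, (φ i).size ≤ a i := fun i => (Nat.le_add_right _ _).trans (h i)
  have hbr : ∀ {b : I → ℕ} (k : ℕ), TowerBd a b k fun i => (φ i).br := fun k =>
    TowerBd.base (fun i => (br_le_size _).trans (hs i)) k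
  have hrad : TowerBd a 0 1 fun i => rad (φ i).br := by
    refine ((hbr 0).add_weak (hbr 0)).two_pow.of_le fun i => ?_
    have h1 := rad_lt (φ i).br
    have h2 : 3 ^ (φ i).br ≤ 2 ^ ((φ i).br + (φ i).br) := by
      rw [← two_mul, pow_mul]
      exact Nat.pow_le_pow_left (by norm_num) _
    omega
  have hd : TowerBd a (fun i => Nat.log 2 (Nat.log 2 (d i))) 1 fun i => (d i).size :=
    ⟨1, fun i => (size_le_two_pow _).trans
      (le_of_eq (by rw [Polynomial.eval_one, add_comm]; rfl))⟩
  refine ((TowerBd.base (fun i => (length_free_le_size _).trans (hs i)) 1).add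
    ((hbr 1).add (hrad.mul_weak hd))).of_le fun i => ?_
  rw [length_logLetters]

theorem towerBd_length_letters (h : ∀ i, (φ i).size + (σ i).size ≤ a i) :
    TowerBd a (fun i => Nat.log 2 (Nat.log 2 (d i))) 2
      fun i => (lettersOf (d i) (φ i).erase).length :=
  (towerBd_length_logLetters h).two_pow.of_le fun i => by rw [length_lettersOf]

theorem one_le_length_lettersOf (d : ℕ) (φ : Raw) : 1 ≤ (lettersOf d φ).length := by
  rw [length_lettersOf]
  exact Nat.one_le_two_pow

theorem towerBd_length_tups (h : ∀ i, (φ i).size + (σ i).size ≤ a i) :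
    TowerBd a (fun i => Nat.log 2 (Nat.log 2 (d i))) 2
      fun i => (paramsOf (lettersOf (d i) (φ i).erase) (σ i).arities).tups.length := by
  have hs : ∀ i, (σ i).size ≤ a i := fun i => (Nat.le_add_left _ _).trans (h i)
  refine ((TowerBd.base hs 2).mul ((towerBd_length_letters h).pow_weak
    (TowerBd.base hs 1))).of_le fun i => ?_
  refine (length_tups_le (one_le_length_lettersOf _ _) _).trans ?_
  exact Nat.mul_le_mul_right _ (length_le_sum (σ i).arity_pos)

theorem towerBd_length_U (h : ∀ i, (φ i).size + (σ i).size ≤ a i) :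
    TowerBd a (fun i => Nat.log 2 (Nat.log 2 (d i))) 3
      fun i => (paramsOf (lettersOf (d i) (φ i).erase) (σ i).arities).U.length := by
  have hl := (towerBd_length_letters (d := d) h).le_level (Nat.le_succ 2)
  exact (hl.mul (hl.mul (towerBd_length_tups h).two_pow)).of_le fun i => length_U_le _ _

theorem towerBd_length_normalFormConds (h : ∀ i, (φ i).size + (σ i).size ≤ a i) :
    TowerBd a (fun i => Nat.log 2 (Nat.log 2 (d i))) 4 fun i => (normalFormConds
      (paramsOf (lettersOf (d i) (φ i).erase) (σ i).arities) (φ i).erase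
        (radList (φ i).br)).length := by
  have hs : ∀ i, (φ i).size ≤ a i := fun i => (Nat.le_add_right _ _).trans (h i)
  have hl := (towerBd_length_letters (d := d) h).le_level (show 2 ≤ 4 by norm_num)
  have hU := towerBd_length_U (d := d) h
  have hW := hU.two_pow
  have hD := (towerBd_length_tups (d := d) h).two_pow.le_level (show 3 ≤ 4 by norm_num)
  refine ((TowerBd.const 1 4).add (hD.mul ((hl.pow_weak
    (TowerBd.base (fun i => (length_free_le_size (φ i)).trans (hs i)) 3)).mul
    ((((hU.le_level (show 3 ≤ 4 by norm_num)).add hW).add (TowerBd.const 2 4)).pow_weak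
      (TowerBd.base hs 3))))).of_le fun i => ?_
  refine (length_normalFormConds_le _ _ _ (one_le_length_lettersOf _ _)).trans ?_
  rw [length_W]
  exact le_rfl

theorem height_erase_le_size {σ : Signature} (φ : Formula σ N) : φ.erase.height ≤ φ.size := by
  induction φ with
  | eq x y => exact Nat.zero_le _
  | rel R x => exact Nat.zero_le _
  | neg φ ih => exact Nat.succ_le_succ ih
  | or φ ψ ih ih' => simp only [Formula.erase, Raw.height, Formula.size]; omega
  | ex y φ ih => simp only [Formula.erase, Raw.height, Formula.size]; omega
  | num P y φ k ih => simp only [Formula.erase, Raw.height, Formula.size]; omega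

theorem towerBd_normalFormHeight (h : ∀ i, (φ i).size + (σ i).size ≤ a i) :
    TowerBd a (fun i => Nat.log 2 (Nat.log 2 (d i))) 3
      fun i => normalFormHeight (d i, (σ i).arities, (φ i).erase) := by
  have hφ : ∀ i, (φ i).size ≤ a i := fun i => (Nat.le_add_right _ _).trans (h i)
  have hσ : ∀ i, (σ i).size ≤ a i := fun i => (Nat.le_add_left _ _).trans (h i)
  have h1 := TowerBd.base (b := fun i => Nat.log 2 (Nat.log 2 (d i)))
    (fun i => (height_erase_le_size (φ i)).trans (hφ i)) 3
  have h2 := TowerBd.base (b := fun i => Nat.log 2 (Nat.log 2 (d i)))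
    (fun i => (le_of_eq (length_br_erase (φ i))).trans ((br_le_size (φ i)).trans (hφ i))) 3
  have h3 := TowerBd.base (b := fun i => Nat.log 2 (Nat.log 2 (d i)))
    (fun i => (length_free_le_size (φ i)).trans (hφ i)) 3
  have h4 := TowerBd.base (b := fun i => Nat.log 2 (Nat.log 2 (d i)))
    (fun i => (length_le_sum (σ i).arity_pos).trans (hσ i)) 3
  have h5 := TowerBd.base (b := fun i => Nat.log 2 (Nat.log 2 (d i))) hσ 3
  exact ((((((((h1.add (h2.add (.const 1 3))).add h3).add h4).add h5).add
    ((towerBd_length_logLetters h).le_level (by norm_num))).add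
    ((towerBd_length_letters h).le_level (by norm_num))).add
    ((towerBd_length_tups h).le_level (by norm_num))).add (towerBd_length_U h))

theorem size_ofNat_le (n : ℕ) : (Data.ofNat n).size ≤ 4 * n.size + 1 := by
  rw [Data.ofNat, ← Nat.size_eq_bits_len]
  induction n.bits with
  | nil => exact le_rfl
  | cons b l ih =>
    rw [List.map_cons, Data.ofList, Data.size, List.length_cons]
    have : (Data.ofBool b).size ≤ 3 := by cases b <;> simp [Data.ofBool, Data.size]
    omega

theorem size_encode_signature_le (σ : Signature) : σ.encode.size ≤ 6 * σ.size + 1 := by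
  obtain ⟨l, hl⟩ := σ
  rw [Signature.encode, Signature.size]
  dsimp only
  induction l with
  | nil => exact le_rfl
  | cons n l ih =>
    have h1 := ih fun a ha => hl a (List.mem_cons_of_mem _ ha)
    have h2 := hl n List.mem_cons_self
    have h3 := size_ofNat_le n
    have h4 : n.size ≤ n := Nat.size_le.2 Nat.lt_two_pow_self
    rw [List.map_cons, Data.ofList, Data.size, List.sum_cons]
    omega

theorem length_le_size_ofList (l : List Data) : 2 * l.length + 1 ≤ (Data.ofList l).size := by
  induction l with
  | nil => exact le_rfl
  | cons a l ih =>
    rw [Data.ofList, Data.size, List.length_cons]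
    have := Data.size_pos a
    omega

theorem size_le_size_encode {σ : Signature} (φ : Formula σ N) : φ.size ≤ φ.encode.size := by
  induction φ with
  | eq x y =>
    have h1 := Data.size_pos (Data.ofNat 0)
    have h2 := Data.size_pos (Data.ofNat x)
    simp only [Formula.encode, Formula.size, Data.ofList, Data.size]
    omega
  | rel R x =>
    have h1 := length_le_size_ofList ((List.ofFn x).map Data.ofNat)
    rw [List.length_map, List.length_ofFn] at h1
    simp only [Formula.encode, Formula.size, Data.ofList, Data.size]
    omega
  | neg φ ih =>
    simp only [Formula.encode, Formula.size, Data.ofList, Data.size]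
    omega
  | or φ ψ ih ih' =>
    simp only [Formula.encode, Formula.size, Data.ofList, Data.size]
    omega
  | ex y φ ih =>
    simp only [Formula.encode, Formula.size, Data.ofList, Data.size]
    omega
  | num P y φ k ih =>
    have h1 : (Data.ofNat 5).size = 11 := by
      simp [Data.ofNat, Data.ofList, Data.size, Data.ofBool, Nat.bits, Nat.binaryRec]
    simp only [Formula.encode, Formula.size, Data.ofList, Data.size]
    split <;> omega

theorem towerBd_size_encodeInput (h : ∀ i, (φ i).encode.size + (σ i).size ≤ a i) :
    TowerBd a (fun i => Nat.log 2 (Nat.log 2 (d i))) 1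
      fun i => (encodeInput (d i) (σ i) (φ i)).size := by
  have hφ : ∀ i, (φ i).encode.size ≤ a i := fun i => (Nat.le_add_right _ _).trans (h i)
  have hσ : ∀ i, (σ i).size ≤ a i := fun i => (Nat.le_add_left _ _).trans (h i)
  have hd : TowerBd a (fun i => Nat.log 2 (Nat.log 2 (d i))) 1 fun i => (d i).size :=
    ⟨1, fun i => (size_le_two_pow _).trans
      (le_of_eq (by rw [Polynomial.eval_one, add_comm]; rfl))⟩
  refine ((((TowerBd.const 4 1).mul_weak hd).add ((TowerBd.const 6 1).mul_weak
    (TowerBd.base hσ 1))).add ((TowerBd.base hφ 1).add (TowerBd.const 6 1))).of_le fun i => ?_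
  have h1 := size_ofNat_le (d i)
  have h2 := size_encode_signature_le (σ i)
  simp only [encodeInput, Data.ofList, Data.size]
  omega

/-- The running time of a program for the normal form, with the encodings used in the definition
of the input and output. -/
theorem exists_prog_normalForm (N : Type) [Encodable N] : ∃ (prog : Prog) (C : ℕ),
    ∀ (d : ℕ) (σ : Signature) (φ : Formula σ N), ∃ t,
      Run prog (encodeInput d σ φ) ((normalForm d σ.arities φ.erase).lift σ N).encode t ∧
      t ≤ ((encodeInput d σ φ).size + 2) ^
        C ^ (normalFormHeight (d, σ.arities, φ.erase) + 1) := by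
  -- an input is a list of length three, that is, a quadruple with a trivial last component
  have h : Fast (fun x : ℕ × List ℕ × Raw × Unit => normalFormHeight (x.1, x.2.1, x.2.2.1))
      fun x => normalForm x.1 x.2.1 x.2.2.1 :=
    Fast.normalForm.comp (f := fun x : ℕ × List ℕ × Raw × Unit => (x.1, x.2.1, x.2.2.1))
      ((Fast.id _).fst.pair ((Fast.id _).snd.fst.pair (Fast.id _).snd.snd.fst)) fun x => le_rfl
  obtain ⟨prog, T, hp, C, hC⟩ := h
  refine ⟨prog, C, fun d σ φ => ?_⟩
  obtain ⟨t, ht, hr⟩ := hp (d, σ.arities, φ.erase, ())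
  have hC' := hC (d, σ.arities, φ.erase, ())
  have e : enc (d, σ.arities, φ.erase, ()) = encodeInput d σ φ := by
    rw [encodeInput, ← Formula.enc_erase]; rfl
  rw [sz, e] at hC'
  rw [e] at hr
  refine ⟨t, ?_, ht.trans hC'⟩
  rw [Raw.encode_lift (wf_normalForm d φ)]
  exact hr

/-- The base of the running time is bounded on level one, the constant `C` and its exponent on the
levels four and three; this gives five levels in total. -/
theorem towerBd_time (C : ℕ) (h : ∀ i, (φ i).encode.size + (σ i).size ≤ a i) :
    TowerBd a (fun i => Nat.log 2 (Nat.log 2 (d i))) 5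
      fun i => ((encodeInput (d i) (σ i) (φ i)).size + 2) ^
        C ^ (normalFormHeight (d i, (σ i).arities, (φ i).erase) + 1) := by
  have h' : ∀ i, (φ i).size + (σ i).size ≤ a i := fun i =>
    (Nat.add_le_add_right (size_le_size_encode _) _).trans (h i)
  exact (((towerBd_size_encodeInput h).add (.const 2 1)).le_level (by norm_num)).pow
    ((TowerBd.const C 4).pow ((towerBd_normalFormHeight h').add (.const 1 3)))

end Bounds

end Hanf
theorem mainTheorem3 {N : Type} [Encodable N] (sem : N → Set ℤ) :
    ∃ p : Polynomial ℕ,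
      (∀ (d : ℕ) (σ : Hanf.Signature) (φ : Hanf.Formula σ N),
        ∃ ψ : Hanf.Formula σ (Option N),
          Hanf.DEquiv sem (Hanf.withExists sem) d φ ψ ∧
          ψ.IsWHNF (Hanf.withExists sem) ((2 * φ.bw + 1) ^ φ.br)
            (Hanf.expTower 4 (p.eval (φ.size + σ.size) + Nat.log 2 (Nat.log 2 d))) ∧
          ψ.free = φ.free) ∧
      ∃ prog : Hanf.Prog,
        ∀ (d : ℕ) (σ : Hanf.Signature) (φ : Hanf.Formula σ N), 2 ≤ d →
          ∃ (ψ : Hanf.Formula σ (Option N)) (t : ℕ),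
            Hanf.Run prog (Hanf.encodeInput d σ φ) ψ.encode t ∧
            t ≤ Hanf.expTower 5
              (p.eval (φ.encode.size + σ.size) + Nat.log 2 (Nat.log 2 d)) ∧
            Hanf.DEquiv sem (Hanf.withExists sem) d φ ψ ∧
            ψ.IsWHNF (Hanf.withExists sem) ((2 * φ.bw + 1) ^ φ.br)
              (Hanf.expTower 4 (p.eval (φ.size + σ.size) + Nat.log 2 (Nat.log 2 d))) ∧
            ψ.free = φ.free := by
  obtain ⟨prog, C, hprog⟩ := Hanf.exists_prog_normalForm N
  -- both bounds are instances of statements about families indexed by all inputs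
  obtain ⟨p, hp⟩ := Hanf.towerBd_length_normalFormConds
    (I := ℕ × (σ : Hanf.Signature) × Hanf.Formula σ N) (d := fun i => i.1) (σ := fun i => i.2.1)
    (φ := fun i => i.2.2) fun _ => le_rfl
  obtain ⟨q, hq⟩ := Hanf.towerBd_time
    (I := ℕ × (σ : Hanf.Signature) × Hanf.Formula σ N) (d := fun i => i.1) (σ := fun i => i.2.1)
    (φ := fun i => i.2.2) C fun _ => le_rfl
  have hmono : ∀ k x y z, Hanf.expTower k (x + z) ≤ Hanf.expTower k (x + y + z) ∧
      Hanf.expTower k (y + z) ≤ Hanf.expTower k (x + y + z) := fun k x y z =>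
    ⟨(Hanf.expTower_strictMono k).monotone (by omega),
      (Hanf.expTower_strictMono k).monotone (by omega)⟩
  have hnf : ∀ (d : ℕ) (σ : Hanf.Signature) (φ : Hanf.Formula σ N),
      ((Hanf.normalForm d σ.arities φ.erase).lift σ N).IsWHNF (Hanf.withExists sem)
        ((2 * φ.bw + 1) ^ φ.br)
        (Hanf.expTower 4 ((p + q).eval (φ.size + σ.size) + Nat.log 2 (Nat.log 2 d))) := by
    intro d σ φ
    obtain ⟨D, hD, h⟩ := Hanf.isWHNF_normalForm sem d φ
    refine ⟨D, hD.trans ((hp (d, ⟨σ, φ⟩)).trans ?_), h⟩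
    rw [Polynomial.eval_add]
    exact (hmono _ _ _ _).1
  refine ⟨p + q, fun d σ φ => ⟨_, Hanf.dEquiv_normalForm sem d φ, hnf d σ φ,
    Hanf.free_normalForm d φ⟩, prog, fun d σ φ _ => ?_⟩
  obtain ⟨t, hr, ht⟩ := hprog d σ φ
  refine ⟨_, t, hr, ht.trans ((hq (d, ⟨σ, φ⟩)).trans ?_), Hanf.dEquiv_normalForm sem d φ,
    hnf d σ φ, Hanf.free_normalForm d φ⟩
  rw [Polynomial.eval_add]
  exact (hmono _ _ _ _).2
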